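/- **Conventions.** Let $\theta\in\mathbb R$. (The noncommutative case is $\theta$ irrational; $\theta=0$ is the classical case.) Let $\mathcal A_\theta$ be the $*$-algebra of series $\sum_{k\in\mathbb Z^3}a_kx^k$ with rapidly decreasing coefficients, $x^k=e^{\pi i\theta k_2k_3}U^{k_1}V^{k_2}W^{k_3}$, where $U,V,W$ are unitaries, $U$ is central and $WV=e^{2\pi i\theta}VW$. For $N=2,3,4,6$ let $h$ generate $\mathbb Z_N$ and act by $h\triangleright x^k=e^{2\pi i k_1/N}x^{(k_1,A(k_2,k_3))}$ with $$A=\begin{pmatrix}-1&0\\0&-1\end{pmatrix},\ \begin{pmatrix}-1&-1\\1&0\end{pmatrix},\ \begin{pmatrix}0&-1\\1&0\end{pmatrix},\ \begin{pmatrix}0&-1\\1&1\end{pmatrix}$$ respectively. The algebra of the noncommutative Bieberbach manifold $\mathrm{B}N_\theta$ is the fixed point algebra. For $\epsilon\in\{0,\frac12\}^3$, $R>0$ and $\tau\in\mathbb C\setminus\mathbb R$, the flat triple of the torus is: $\mathcal H=\ell^2(\mathbb Z^3+\epsilon)\otimes\mathbb C^2$ with basis $e_{\mu,\pm}$; $\pi(x^k)e_{\mu,\pm}=e^{\pi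 i\theta(k_3\mu_2-\mu_3k_2)}e_{\mu+k,\pm}$; $J=\begin{pmatrix}0&-J_0\\J_0&0\end{pmatrix}$ with $J_0$ antilinear, $J_0e_\mu=e_{-\mu}$; $D=\begin{pmatrix}R\delta_1&\delta_2+\tau\delta_3\\\delta_2+\bar\tau\delta_3&-R\delta_1\end{pmatrix}$ with $\delta_ie_\mu=\mu_ie_\mu$, on its maximal domain. A flat real spectral triple over $\mathrm{B}N_\theta$ (with parameters $R,\tau$) is the restriction of such a triple, for some $\epsilon$, to $\mathrm{B}N_\theta$ and to the subspace $\{\psi:\rho(h)\psi=\psi\}$, where $\rho$ is a representation of $\mathbb Z_N$ by bounded operators on $\mathcal H$ with $\rho(g)\pi(a)=\pi(g\triangleright a)\rho(g)$, commuting with $D$ and $J$, and where this subspace is invariant under $\mathrm{B}N_\theta$, $J$ and $D$ (reduces $D$). Unitary equivalence means a unitary intertwining the representations of $\mathrm{B}N_\theta$, the operators $D$ and the real structures $J$. For an operator $D$ with compact resolvent, $\eta(D)$ is the value at $s=0$ of the meromorphic continuation of $\sum_{\lambda\ne0}\operatorname{sgn}(\lambda)|\lambda|^{-s}$ (eigenvalues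 counted with multiplicity). Multisets: $\mathcal Sp^3_\epsilon$ consists of $\pm\sqrt{R^2\mu_1^2+|\mu_2+\tau\mu_3|^2}$, $\mu\in\mathbb Z^3+\epsilon$ (both signs); $\mathcal Sp^1_{\alpha,\beta}$ of $\alpha(k+\beta)$, $k\in\mathbb Z$. **Theorem.** Let $\theta\in\mathbb R$, $R>0$, $\tau\in\mathbb C\setminus\mathbb R$. (0) Every flat triple of the torus is a $U(1)^3$-equivariant real spectral triple ($D=D^*$ with compact resolvent, bounded commutators, $J^2=-1$, $JD=DJ$, zero- and first-order conditions), it has no proper closed subspace invariant under the algebra and $D$, and the spectrum of $D$ is $\mathcal Sp^3_\epsilon$. Fix $N\in\{2,3,4,6\}$. Below, $\sigma,\kappa\in\{\pm1\}$. (1) The equivariant representations $\rho$ are exactly those given by $\rho(h)e_{\mu,\pm}=\omega_\pm(\mu_1)\,e_{(\mu_1,A(\mu_2,\mu_3)),\pm}$ in the following cases (they do not exist otherwise): * $N=2$: $\tau$ arbitrary, $\epsilon_1=\frac12$, $\epsilon_2,\epsilon_3$ arbitrary, $\omega_\pm(x)=\kappa e^{\pi i(x\pm\frac12)}$; * $N=3$: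 $\tau=e^{-\frac{\pi i}{3}\sigma}$, $\epsilon_2=\epsilon_3=0$, $\epsilon_1$ arbitrary, $\omega_\pm(x)=(-1)^{2\epsilon_1}e^{\frac{2\pi i}{3}(x\pm\sigma)}$; * $N=4$: $\tau=e^{\frac{\pi i}{2}\sigma}$, $\epsilon_1=\frac12$, $\epsilon_2=\epsilon_3$, $\omega_\pm(x)=\kappa e^{\frac{\pi i}{2}(x\pm\frac\sigma2)}$; * $N=6$: $\tau=e^{\frac{\pi i}{3}\sigma}$, $\epsilon=(\frac12,0,0)$, $\omega_\pm(x)=\kappa e^{\frac{\pi i}{3}(x\pm\frac\sigma2)}$. (2) A subspace $K\subset\mathcal H$ is the $\rho$-invariant subspace of such a representation if and only if it is closed, nonzero, invariant under $\mathrm{B}N_\theta$, $J$ and $D$, and $U^jK\perp K$ for $0<j<N$. (3) If $\tau$ is not one of the values in (1), there is no flat real spectral triple over $\mathrm{B}N_\theta$ with parameters $R,\tau$. Otherwise they correspond bijectively to the parameters $(\epsilon_2,\epsilon_3,\kappa)$ for $N=2$, $\epsilon_1$ for $N=3$, $(\epsilon_2=\epsilon_3,\kappa)$ for $N=4$, $\kappa$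 for $N=6$ (with $\sigma$ determined by $\tau$ when $N\neq2$), and different parameters give unitarily inequivalent triples: there are exactly $8,2,4,2$ unitary equivalence classes for $N=2,3,4,6$. Each of them is a real spectral triple, without proper closed subspaces invariant under the algebra and $D$. Put $$\beta=-\tfrac\kappa4,\qquad \epsilon_1-\tfrac\sigma3,\qquad \tfrac{1-\kappa}4-\tfrac\sigma8,\qquad \tfrac{1-\kappa}4-\tfrac\sigma{12}$$ for $N=2,3,4,6$. The Hilbert space is the closed span of the vectors $\frac1{\sqrt N}\sum_{p=0}^{N-1}\omega_\pm(\mu_1)^p\,e_{(\mu_1,A^p(\mu_2,\mu_3)),\pm}$ with $\mu\in\mathbb Z^3+\epsilon$, $(\mu_2,\mu_3)\neq(0,0)$, and, if $\epsilon_2=\epsilon_3=0$, of the vectors $e_{\pm N(k+\beta),0,0,\pm}$, $k\in\mathbb Z$. The spectrum of the Dirac operator, with multiplicities, is $\frac1N\mathcal Sp^3_\epsilon$ if $(\epsilon_2,\epsilon_3)\ne(0,0)$, and $$\tfrac1N\bigl(\mathcal Sp^3_\epsilon\setminus2\,\mathcal Sp^1_{R,\epsilon_1}\bigr)\cup2\,\mathcal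 Sp^1_{NR,\beta}$$ if $\epsilon_2=\epsilon_3=0$ (the first part being the eigenvalues with $(\mu_2,\mu_3)\neq(0,0)$). The $\eta$-invariant is $0$ if $(\epsilon_2,\epsilon_3)\neq(0,0)$; if $\epsilon_2=\epsilon_3=0$ it is * $N=2$: $-\kappa$; * $N=3$: $\frac43\sigma$ for $\epsilon_1=\frac12$ and $-\frac23\sigma$ for $\epsilon_1=0$; * $N=4$: $-\frac32\sigma$ for $\kappa=1$ and $\frac12\sigma$ for $\kappa=-1$; * $N=6$: $-\frac53\sigma$ for $\kappa=1$ and $\frac13\sigma$ for $\kappa=-1$. (4) Replacing $D$ by $-D$ turns each flat real spectral triple over $\mathrm{B}N_\theta$ with parameters $R,\tau$ into one that is unitarily equivalent to a flat triple with parameters $R,\bar\tau$. (5) Classical case. Let $\Gamma$ be the group of affine maps of $\mathbb R^3$ generated by $\mathbb Z^3$ and $(x_1,x_2,x_3)\mapsto(x_1+\frac1N,A^T(x_2,x_3))$, and let $c(\xi)=\begin{pmatrix}R\xi_1&\xi_2+\tau\xi_3\\\xi_2+\bar\tau\xi_3&-R\xi_1\end{pmatrix}$. The spin structures of the flat manifold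 $\mathbb R^3/\Gamma$ (with the cometric $c(\xi)^2$) are the homomorphisms $s:\Gamma\to SU(2)$ with $s(\gamma)c(L_\gamma^T\xi)=c(\xi)s(\gamma)$, $L_\gamma$ being the linear part of $\gamma$. For $\theta=0$, there is a bijection between these spin structures and the unitary equivalence classes of flat real spectral triples over $\mathrm{B}N_0$ with parameters $R,\tau$: to $s$ corresponds the class of the triple given by the smooth functions on $\mathbb R^3/\Gamma$, the $L^2$-completion of the smooth spinor fields $\psi:\mathbb R^3\to\mathbb C^2$, $\psi(\gamma x)=s(\gamma)\psi(x)$, charge conjugation $(\psi_+,\psi_-)\mapsto(-\overline{\psi_-},\overline{\psi_+})$, and the closure of the flat Dirac operator $\frac1{2\pi i}\sum_jc(dx_j)\partial_j$. -/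

import Mathlib

open Complex

noncomputable section

namespace FlatBieberbach

/-- Rapidly decreasing families `ℤ³ → ℂ`: all the weighted `ℓ¹` seminorms
`∑ (1 + ‖k‖)^p ‖a k‖` are finite (equivalently, all the weighted sup seminorms). -/
def rapidDecay : Submodule ℂ ((Fin 3 → ℤ) → ℂ) where
  carrier := {a | ∀ p : ℕ, Summable fun k => (1 + ‖k‖) ^ p * ‖a k‖}
  zero_mem' := by intro p; simp
  add_mem' := by
    intro a b ha hb p
    refine Summable.of_nonneg_of_le (fun k => by positivity) (fun k => ?_) ((ha p).add (hb p))
    rw [← mul_add]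
    exact mul_le_mul_of_nonneg_left (norm_add_le _ _) (by positivity)
  smul_mem' := by
    intro c a ha p
    have := (ha p).mul_left ‖c‖
    refine this.congr fun k => ?_
    simp only [Pi.smul_apply, norm_smul]
    ring

/-- The algebra of smooth elements of the noncommutative three-torus: an element is a series
`a = ∑ₖ (coeff a k) x^k` with rapidly decreasing coefficients, where
`x^k = e^{π i θ k₂ k₃} U^{k₁} V^{k₂} W^{k₃}`, `U` is central and `W V = e^{2 π i θ} V W`.
Its multiplication is the twisted convolution defined below. -/
def SmoothTorus (_θ : ℝ) : Type := rapidDecay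

namespace SmoothTorus
variable {θ : ℝ}

instance : AddCommGroup (SmoothTorus θ) := inferInstanceAs (AddCommGroup rapidDecay)
instance : Module ℂ (SmoothTorus θ) := inferInstanceAs (Module ℂ rapidDecay)

/-- The coefficient of `x^k`. -/
def coeff (a : SmoothTorus θ) (k : Fin 3 → ℤ) : ℂ := (show rapidDecay from a).1 k

/-- The element with given coefficients. -/
def mk (a : (Fin 3 → ℤ) → ℂ) (ha : ∀ p : ℕ, Summable fun k => (1 + ‖k‖) ^ p * ‖a k‖) :
    SmoothTorus θ := (⟨a, ha⟩ : rapidDecay)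

@[simp] theorem coeff_mk (a : (Fin 3 → ℤ) → ℂ) (ha) (k) : (mk a ha : SmoothTorus θ).coeff k = a k := rfl
@[simp] theorem coeff_add (a b : SmoothTorus θ) (k) : (a + b).coeff k = a.coeff k + b.coeff k := rfl
@[simp] theorem coeff_smul (c : ℂ) (a : SmoothTorus θ) (k) : (c • a).coeff k = c * a.coeff k := rfl
@[simp] theorem coeff_zero (k) : (0 : SmoothTorus θ).coeff k = 0 := rfl

theorem rapid (a : SmoothTorus θ) (p : ℕ) : Summable fun k => (1 + ‖k‖) ^ p * ‖a.coeff k‖ :=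
  (show rapidDecay from a).2 p

theorem summable_norm (a : SmoothTorus θ) : Summable fun k => ‖a.coeff k‖ := by
  simpa using a.rapid 0

@[ext] theorem ext {a b : SmoothTorus θ} (h : ∀ k, a.coeff k = b.coeff k) : a = b :=
  Subtype.ext (funext h)

/-- The phase in `x^k x^l = cocycle θ k l • x^(k+l)`. -/
def cocycle (θ : ℝ) (k l : Fin 3 → ℤ) : ℂ :=
  exp (Real.pi * I * θ * (k 2 * l 1 - k 1 * l 2))

theorem norm_cocycle (k l) : ‖cocycle θ k l‖ = 1 := by
  have : (Real.pi * I * θ * (k 2 * l 1 - k 1 * l 2) : ℂ)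
      = ((Real.pi * θ * (k 2 * l 1 - k 1 * l 2) : ℝ) : ℂ) * I := by push_cast; ring
  rw [cocycle, this, norm_exp_ofReal_mul_I]

/-- The bijection `(m, k) ↦ (k, m - k)`. -/
def shear : (Fin 3 → ℤ) × (Fin 3 → ℤ) ≃ (Fin 3 → ℤ) × (Fin 3 → ℤ) where
  toFun p := (p.2, p.1 - p.2)
  invFun p := (p.1 + p.2, p.1)
  left_inv p := by ext <;> simp
  right_inv p := by ext <;> simp

theorem summable_conv (a b : SmoothTorus θ) (p : ℕ) :
    Summable fun q : (Fin 3 → ℤ) × (Fin 3 → ℤ) =>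
      (1 + ‖q.1‖) ^ p * ‖a.coeff q.2 * b.coeff (q.1 - q.2) * cocycle θ q.2 (q.1 - q.2)‖ := by
  have h := (a.rapid p).mul_of_nonneg (b.rapid p) (fun k => by positivity) (fun k => by positivity)
  have h2 := (shear.summable_iff (f := fun q : (Fin 3 → ℤ) × (Fin 3 → ℤ) =>
    (1 + ‖q.1‖) ^ p * ‖a.coeff q.1‖ * ((1 + ‖q.2‖) ^ p * ‖b.coeff q.2‖))).2 h
  refine Summable.of_nonneg_of_le (fun q => by positivity) (fun q => ?_) h2
  simp only [Function.comp, shear, Equiv.coe_fn_mk, norm_mul, norm_cocycle, mul_one]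
  have h3 : (1 + ‖q.1‖) ^ p ≤ (1 + ‖q.2‖) ^ p * (1 + ‖q.1 - q.2‖) ^ p := by
    rw [← mul_pow]
    gcongr
    have : ‖q.1‖ ≤ ‖q.2‖ + ‖q.1 - q.2‖ := by
      calc ‖q.1‖ = ‖q.2 + (q.1 - q.2)‖ := by congr 1; abel
        _ ≤ _ := norm_add_le _ _
    nlinarith [norm_nonneg q.2, norm_nonneg (q.1 - q.2)]
  calc _ ≤ (1 + ‖q.2‖) ^ p * (1 + ‖q.1 - q.2‖) ^ p * (‖a.coeff q.2‖ * ‖b.coeff (q.1 - q.2)‖) := by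
        gcongr
    _ = _ := by ring

/-- `x^k x^l = cocycle θ k l • x^(k+l)`, extended bilinearly. -/
instance : Mul (SmoothTorus θ) where
  mul a b := mk (fun m => ∑' k, a.coeff k * b.coeff (m - k) * cocycle θ k (m - k)) (by
    intro p
    have h := summable_conv a b p
    refine Summable.of_nonneg_of_le (fun m => by positivity) (fun m => ?_) h.prod
    have hm := h.prod_factor m
    simp only at hm ⊢
    rw [tsum_mul_left]
    gcongr
    exact norm_tsum_le_tsum_norm ((summable_mul_left_iff (by positivity)).1 hm))

theorem coeff_mul (a b : SmoothTorus θ) (m) :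
    (a * b).coeff m = ∑' k, a.coeff k * b.coeff (m - k) * cocycle θ k (m - k) := rfl

/-- The element `x^k`. -/
def monomial (θ : ℝ) (k : Fin 3 → ℤ) : SmoothTorus θ := mk (Pi.single k 1) (by
  intro p
  refine summable_of_hasFiniteSupport (Set.Finite.subset (Set.finite_singleton k) ?_)
  intro l hl
  by_contra h
  have : l ≠ k := h
  simp [Pi.single_apply, this] at hl)

instance : One (SmoothTorus θ) where one := monomial θ 0

/-- `(x^k)* = x^(-k)`, extended antilinearly. -/
instance : Star (SmoothTorus θ) where
  star a := mk (fun k => starRingEnd ℂ (a.coeff (-k))) (by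
    intro p
    have := ((Equiv.neg (Fin 3 → ℤ)).summable_iff).2 (a.rapid p)
    refine this.congr fun k => ?_
    simp [Function.comp])

@[simp] theorem coeff_star (a : SmoothTorus θ) (k) :
    (star a).coeff k = starRingEnd ℂ (a.coeff (-k)) := rfl

theorem coeff_monomial (k l) : (monomial θ k).coeff l = if l = k then 1 else 0 := by
  simp [monomial, Pi.single_apply]

end SmoothTorus

/-- Families of operators that satisfy the relations of the `x^k`. -/
structure ProjRep (θ : ℝ) {H : Type*} [NormedAddCommGroup H] [InnerProductSpace ℂ H]
    [CompleteSpace H] (X : (Fin 3 → ℤ) → (H →L[ℂ] H)) : Prop where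
  norm_le : ∀ k, ‖X k‖ ≤ 1
  mul : ∀ k l, X k * X l = SmoothTorus.cocycle θ k l • X (k + l)
  one : X 0 = 1
  star : ∀ k, star (X k) = X (-k)

namespace SmoothTorus
variable {θ : ℝ} {H : Type*} [NormedAddCommGroup H] [InnerProductSpace ℂ H] [CompleteSpace H]
  {X : (Fin 3 → ℤ) → (H →L[ℂ] H)}

/-- The operator `∑ aₖ Xₖ`. -/
def op (X : (Fin 3 → ℤ) → (H →L[ℂ] H)) (a : SmoothTorus θ) : H →L[ℂ] H :=
  ∑' k, a.coeff k • X k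

theorem summable_norm_op (hX : ProjRep θ X) (a : SmoothTorus θ) :
    Summable fun k => ‖a.coeff k • X k‖ := by
  refine Summable.of_nonneg_of_le (fun k => norm_nonneg _) (fun k => ?_) a.summable_norm
  rw [norm_smul]
  exact mul_le_of_le_one_right (norm_nonneg _) (hX.norm_le k)

theorem op_add (hX : ProjRep θ X) (a b : SmoothTorus θ) : op X (a + b) = op X a + op X b := by
  simp only [op, coeff_add, add_smul]
  exact (summable_norm_op hX a).of_norm.tsum_add (summable_norm_op hX b).of_norm

theorem op_smul (hX : ProjRep θ X) (c : ℂ) (a : SmoothTorus θ) : op X (c • a) = c • op X a := by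
  simp only [op, coeff_smul, mul_smul]
  exact (summable_norm_op hX a).of_norm.tsum_const_smul c

theorem op_mul (hX : ProjRep θ X) (a b : SmoothTorus θ) : op X (a * b) = op X a * op X b := by
  have hs := summable_mul_of_summable_norm (summable_norm_op hX a) (summable_norm_op hX b)
  rw [op, op, op, tsum_mul_tsum_of_summable_norm (summable_norm_op hX a) (summable_norm_op hX b),
    ← shear.tsum_eq]
  have hs2 := (shear.summable_iff).2 hs
  simp only [Function.comp_def] at hs2
  rw [hs2.tsum_prod]
  refine tsum_congr fun m => ?_
  rw [coeff_mul]
  have h := (summable_conv a b 0).prod_factor m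
  simp only [pow_zero, one_mul] at h
  rw [← h.of_norm.tsum_smul_const]
  refine tsum_congr fun k => ?_
  simp only [shear, Equiv.coe_fn_mk, smul_mul_smul_comm, hX.mul, smul_smul, add_sub_cancel]

theorem op_monomial (k) : op X (monomial θ k) = X k := by
  rw [op, tsum_eq_single k]
  · simp [coeff_monomial]
  · intro l hl; simp [coeff_monomial, hl]

theorem op_one (hX : ProjRep θ X) : op X (1 : SmoothTorus θ) = 1 := by
  rw [← hX.one]; exact op_monomial 0

theorem op_star (hX : ProjRep θ X) (a : SmoothTorus θ) : op X (star a) = star (op X a) := by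
  rw [op, op, tsum_star, ← (Equiv.neg (Fin 3 → ℤ)).tsum_eq]
  refine tsum_congr fun k => ?_
  simp [hX.star, star_smul]

end SmoothTorus

/-- A spin structure `ε = (ε₁, ε₂, ε₃)` of the torus, `εᵢ ∈ {0, 1/2}`, is encoded by three Booleans. -/
def half (b : Bool) : ℝ := if b then 1 / 2 else 0

/-- The points `μ ∈ ℤ³ + ε`. -/
abbrev Weight (ε : Fin 3 → Bool) : Type :=
  {μ : Fin 3 → ℝ // ∀ i, ∃ n : ℤ, μ i = n + half (ε i)}

/-- Two copies of `ℓ²(ℤ³ + ε)`; the second index is `0` for `+` and `1` for `-`. -/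
abbrev Spinor (ε : Fin 3 → Bool) : Type := lp (fun _ : Weight ε × Fin 2 => ℂ) 2

namespace Weight
variable {ε : Fin 3 → Bool}

/-- `-μ`. -/
def neg (μ : Weight ε) : Weight ε :=
  ⟨-μ.1, fun i => by
    obtain ⟨n, hn⟩ := μ.2 i
    cases h : ε i
    · exact ⟨-n, by simp [hn, half, h]⟩
    · exact ⟨-n - 1, by simp [hn, half, h]; ring⟩⟩

/-- `μ + k`. -/
def add (μ : Weight ε) (k : Fin 3 → ℤ) : Weight ε :=
  ⟨fun i => μ.1 i + k i, fun i => by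
    obtain ⟨n, hn⟩ := μ.2 i
    exact ⟨n + k i, by simp [hn]; ring⟩⟩

/-- The weight `0`. -/
def origin : Weight fun _ => false := ⟨0, fun _ => ⟨0, by simp [half]⟩⟩

/-- `μ ↦ -μ`. -/
def negEquiv : Weight ε ≃ Weight ε where
  toFun := neg
  invFun := neg
  left_inv μ := by ext; simp [neg]
  right_inv μ := by ext; simp [neg]

/-- `μ ↦ μ - k`. -/
def subEquiv (k : Fin 3 → ℤ) : Weight ε ≃ Weight ε where
  toFun μ := μ.add (-k)
  invFun μ := μ.add k
  left_inv μ := by ext; simp [add]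
  right_inv μ := by ext; simp [add]

end Weight

/-- The isometry `ψ ↦ (w i * ψ (e i))` of `ℓ²(ι)`, for unimodular weights `w`. -/
def weightedPerm {ι : Type*} (e : ι ≃ ι) (w : ι → ℂ) (hw : ∀ i, ‖w i‖ = 1) :
    lp (fun _ : ι => ℂ) 2 ≃ₗᵢ[ℂ] lp (fun _ : ι => ℂ) 2 :=
  have mem : ∀ (e : ι ≃ ι) (w : ι → ℂ), (∀ i, ‖w i‖ = 1) → ∀ ψ : lp (fun _ : ι => ℂ) 2,
      Memℓp (fun i => w i * ψ (e i)) 2 := by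
    intro e w hw ψ
    refine memℓp_gen ?_
    have := (lp.memℓp ψ).summable (by norm_num)
    refine ((e.summable_iff).2 this).congr fun i => ?_
    simp [hw]
  { toFun := fun ψ => ⟨fun i => w i * ψ (e i), mem e w hw ψ⟩
    invFun := fun ψ => ⟨fun i => starRingEnd ℂ (w (e.symm i)) * ψ (e.symm i),
      mem e.symm (fun i => starRingEnd ℂ (w (e.symm i))) (fun i => by simp [hw]) ψ⟩
    map_add' := fun ψ φ => by ext i; exact mul_add _ _ _
    map_smul' := fun c ψ => by ext i; exact mul_left_comm _ _ _
    left_inv := fun ψ => by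
      ext i
      simp only [Equiv.apply_symm_apply]
      rw [← mul_assoc, ← Complex.normSq_eq_conj_mul_self, Complex.normSq_eq_norm_sq, hw]
      simp
    right_inv := fun ψ => by
      ext i
      simp only [Equiv.symm_apply_apply]
      rw [← mul_assoc, Complex.mul_conj, Complex.normSq_eq_norm_sq, hw]
      simp
    norm_map' := fun ψ => by
      have h2 : (0 : ℝ) < (2 : ENNReal).toReal := by norm_num
      rw [lp.norm_eq_tsum_rpow h2, lp.norm_eq_tsum_rpow h2]
      congr 1
      refine Eq.trans (tsum_congr fun i => ?_)
        (e.tsum_eq fun i => ‖ψ i‖ ^ (2 : ENNReal).toReal)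
      simp [hw] }

theorem weightedPerm_apply {ι : Type*} (e : ι ≃ ι) (w : ι → ℂ) (hw : ∀ i, ‖w i‖ = 1)
    (ψ : lp (fun _ : ι => ℂ) 2) (i : ι) : weightedPerm e w hw ψ i = w i * ψ (e i) := rfl

/-- The phase `e^{π i θ (k₃ μ₂ - μ₃ k₂)}`. -/
def phase (θ : ℝ) (k : Fin 3 → ℤ) (μ : Fin 3 → ℝ) : ℂ :=
  exp (Real.pi * I * θ * (k 2 * μ 1 - μ 2 * k 1))

theorem norm_phase (θ k μ) : ‖phase θ k μ‖ = 1 := by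
  have : (Real.pi * I * θ * (k 2 * μ 1 - μ 2 * k 1) : ℂ)
      = ((Real.pi * θ * (k 2 * μ 1 - μ 2 * k 1) : ℝ) : ℂ) * I := by push_cast; ring
  rw [phase, this, norm_exp_ofReal_mul_I]

/-- The operator `π(x^k)`, that is `π(x^k) e_{μ,±} = e^{π i θ (k₃ μ₂ - μ₃ k₂)} e_{μ+k,±}`; on
functions, `(π(x^k) ψ)(μ, ±) = e^{π i θ (k₃ μ₂ - μ₃ k₂)} ψ(μ - k, ±)`. -/
def shift (θ : ℝ) (ε : Fin 3 → Bool) (k : Fin 3 → ℤ) : Spinor ε →L[ℂ] Spinor ε :=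
  (weightedPerm ((Weight.subEquiv k).prodCongr (Equiv.refl (Fin 2)))
    (fun i => phase θ k i.1.1) (fun i => norm_phase θ k i.1.1)).toContinuousLinearEquiv.toContinuousLinearMap

theorem shift_apply (θ ε k) (ψ : Spinor ε) (μ : Weight ε) (s : Fin 2) :
    shift θ ε k ψ (μ, s) = phase θ k μ.1 * ψ (μ.add (-k), s) := rfl

theorem projRep_shift (θ : ℝ) (ε : Fin 3 → Bool) : ProjRep θ (shift θ ε) where
  norm_le k := ContinuousLinearMap.opNorm_le_bound _ zero_le_one fun ψ => by
    rw [one_mul]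
    exact (LinearIsometryEquiv.norm_map _ ψ).le
  mul k l := by
    ext ψ ⟨μ, s⟩
    have h1 : (μ.add (-k)).add (-l) = μ.add (-(k + l)) := by
      ext i; simp [Weight.add]; ring
    change phase θ k μ.1 * (phase θ l (μ.add (-k)).1 * ψ ((μ.add (-k)).add (-l), s)) =
      SmoothTorus.cocycle θ k l * (phase θ (k + l) μ.1 * ψ (μ.add (-(k + l)), s))
    rw [h1, ← mul_assoc, ← mul_assoc]
    congr 1
    simp only [phase, SmoothTorus.cocycle, ← Complex.exp_add, Weight.add]
    congr 1
    push_cast [Pi.add_apply, Pi.neg_apply]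
    ring
  one := by
    ext ψ ⟨μ, s⟩
    have h1 : μ.add (-0) = μ := by ext i; simp [Weight.add]
    change phase θ 0 μ.1 * ψ (μ.add (-0), s) = ψ (μ, s)
    rw [h1]; simp [phase]
  star k := by
    rw [ContinuousLinearMap.star_eq_adjoint, eq_comm, ContinuousLinearMap.eq_adjoint_iff]
    intro ψ φ
    have key : shift θ ε (-k) ψ = (weightedPerm ((Weight.subEquiv k).prodCongr (Equiv.refl (Fin 2)))
      (fun i => phase θ k i.1.1) (fun i => norm_phase θ k i.1.1)).symm ψ := by
      ext ⟨μ, s⟩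
      change phase θ (-k) μ.1 * ψ (μ.add (- -k), s) =
        starRingEnd ℂ (phase θ k (μ.add k).1) * ψ (μ.add k, s)
      rw [neg_neg]
      congr 1
      simp only [phase, ← Complex.exp_conj, Weight.add]
      congr 1
      simp
      ring
    rw [key]
    generalize hW : weightedPerm ((Weight.subEquiv k).prodCongr (Equiv.refl (Fin 2)))
      (fun i : Weight ε × Fin 2 => phase θ k i.1.1) (fun i => norm_phase θ k i.1.1) = W
    have hs : shift θ ε k φ = W φ := by rw [← hW]; rfl
    rw [hs, ← W.inner_map_map (W.symm ψ) φ, W.apply_symm_apply]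

namespace SmoothTorus
variable {θ : ℝ}

theorem op_apply {ε : Fin 3 → Bool} (a : SmoothTorus θ) (ψ : Spinor ε) (i : Weight ε × Fin 2) :
    op (shift θ ε) a ψ i = ∑' k, a.coeff k * shift θ ε k ψ i := by
  let L : (Spinor ε →L[ℂ] Spinor ε) →L[ℂ] ℂ :=
    (lp.evalCLM (𝕜 := ℂ) (E := fun _ : Weight ε × Fin 2 => ℂ) (p := 2) i).comp
      (ContinuousLinearMap.apply ℂ (Spinor ε) ψ)
  have h := L.map_tsum (summable_norm_op (projRep_shift θ ε) a).of_norm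
  exact h

theorem op_injective {a b : SmoothTorus θ}
    (h : op (shift θ fun _ => false) a = op (shift θ fun _ => false) b) : a = b := by
  classical
  have key : ∀ (a : SmoothTorus θ) (k : Fin 3 → ℤ),
      op (shift θ fun _ => false) a
        (lp.single 2 (Weight.origin, (0 : Fin 2)) 1)
        (Weight.origin.add k, 0) =
      a.coeff k * phase θ k (Weight.origin.add k).1 := by
    intro a k
    rw [op_apply, tsum_eq_single k]
    · rw [shift_apply, lp.single_apply, Pi.single_apply, if_pos]
      · simp
      · ext i <;> simp [Weight.add]
    · intro l hl
      rw [shift_apply, lp.single_apply, Pi.single_apply, if_neg]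
      · simp
      · intro h
        apply hl
        ext i
        have := congrArg (fun q : (Weight fun _ => false) × Fin 2 => q.1.1 i) h
        simp only [Weight.add, Weight.origin, Pi.zero_apply, zero_add, Pi.neg_apply] at this
        have h2 : (k i : ℝ) - l i = 0 := by push_cast at this; linarith
        have h3 : ((l i : ℤ) : ℝ) = k i := by linarith
        exact_mod_cast h3
  ext k
  have h1 := key a k
  rw [h, key b k] at h1
  have h2 : phase θ k (Weight.origin.add k).1 ≠ 0 :=
    exp_ne_zero _
  exact (mul_right_cancel₀ h2 h1).symm

instance : Ring (SmoothTorus θ) where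
  __ := (inferInstance : AddCommGroup (SmoothTorus θ))
  left_distrib a b c := op_injective (by
    simp only [op_mul (projRep_shift θ _), op_add (projRep_shift θ _), mul_add])
  right_distrib a b c := op_injective (by
    simp only [op_mul (projRep_shift θ _), op_add (projRep_shift θ _), add_mul])
  zero_mul a := by ext k; simp [coeff_mul]
  mul_zero a := by ext k; simp [coeff_mul]
  mul_assoc a b c := op_injective (by simp only [op_mul (projRep_shift θ _), mul_assoc])
  one_mul a := op_injective (by
    simp only [op_mul (projRep_shift θ _), op_one (projRep_shift θ _), one_mul])
  mul_one a := op_injective (by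
    simp only [op_mul (projRep_shift θ _), op_one (projRep_shift θ _), mul_one])

instance : Algebra ℂ (SmoothTorus θ) := Algebra.ofModule
  (fun c a b => op_injective (by
    simp only [op_mul (projRep_shift θ _), op_smul (projRep_shift θ _), smul_mul_assoc]))
  (fun c a b => op_injective (by
    simp only [op_mul (projRep_shift θ _), op_smul (projRep_shift θ _), mul_smul_comm]))

instance : StarRing (SmoothTorus θ) where
  star_involutive a := by ext k; simp
  star_mul a b := op_injective (by
    simp only [op_mul (projRep_shift θ _), op_star (projRep_shift θ _), star_mul])
  star_add a b := by ext k; simp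

instance : StarModule ℂ (SmoothTorus θ) where
  star_smul c a := by ext k; simp

/-- The representation of the torus algebra on the spinors with spin structure `ε`. -/
def rep (θ : ℝ) (ε : Fin 3 → Bool) : SmoothTorus θ →⋆ₐ[ℂ] (Spinor ε →L[ℂ] Spinor ε) where
  toFun := op (shift θ ε)
  map_one' := op_one (projRep_shift θ ε)
  map_mul' := op_mul (projRep_shift θ ε)
  map_zero' := by simp [op]
  map_add' := op_add (projRep_shift θ ε)
  commutes' c := by
    rw [Algebra.algebraMap_eq_smul_one, Algebra.algebraMap_eq_smul_one,
      op_smul (projRep_shift θ ε), op_one (projRep_shift θ ε)]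
  map_star' := op_star (projRep_shift θ ε)

end SmoothTorus

/-- The four types of orientable noncommutative Bieberbach manifolds. -/
inductive Bieb | B2 | B3 | B4 | B6

namespace Bieb

/-- The order `N` of the holonomy group. -/
def order : Bieb → ℕ
  | B2 => 2
  | B3 => 3
  | B4 => 4
  | B6 => 6

/-- The matrix `A` through which the generator of `ℤ_N` acts on the exponents of `V`, `W`. -/
def matrix : Bieb → Matrix (Fin 2) (Fin 2) ℤ
  | B2 => !![-1, 0; 0, -1]
  | B3 => !![-1, -1; 1, 0]
  | B4 => !![0, -1; 1, 0]
  | B6 => !![0, -1; 1, 1]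

theorem matrix_det (b : Bieb) :
    b.matrix 0 0 * b.matrix 1 1 - b.matrix 0 1 * b.matrix 1 0 = 1 := by
  cases b <;> simp [matrix]

/-- The map `(x₁, x₂, x₃) ↦ (x₁, A (x₂, x₃))`. -/
def lin {R : Type*} [Ring R] (b : Bieb) (x : Fin 3 → R) : Fin 3 → R :=
  ![x 0, b.matrix 0 0 * x 1 + b.matrix 0 1 * x 2, b.matrix 1 0 * x 1 + b.matrix 1 1 * x 2]

/-- The inverse of `lin`. -/
def linInv {R : Type*} [Ring R] (b : Bieb) (x : Fin 3 → R) : Fin 3 → R :=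
  ![x 0, b.matrix 1 1 * x 1 - b.matrix 0 1 * x 2, -b.matrix 1 0 * x 1 + b.matrix 0 0 * x 2]

/-- `lin` on `ℤ³`, as a bijection. -/
def linEquiv (b : Bieb) : (Fin 3 → ℤ) ≃ (Fin 3 → ℤ) where
  toFun := b.lin
  invFun := b.linInv
  left_inv x := by ext i; fin_cases i <;> cases b <;> simp [lin, linInv, matrix]
  right_inv x := by ext i; fin_cases i <;> cases b <;> simp [lin, linInv, matrix]

theorem norm_lin_le (b : Bieb) (k : Fin 3 → ℤ) : ‖b.lin k‖ ≤ 2 * ‖k‖ := by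
  have h0 := norm_le_pi_norm k 0
  have h1 := norm_le_pi_norm k 1
  have h2 := norm_le_pi_norm k 2
  have h3 := norm_nonneg k
  refine (pi_norm_le_iff_of_nonneg (by positivity)).2 fun i => ?_
  have key : ∀ c d : ℤ, |c| ≤ 1 → |d| ≤ 1 → ‖c * k 1 + d * k 2‖ ≤ 2 * ‖k‖ := by
    intro c d hc hd
    have hc' : ‖c‖ ≤ 1 := by rw [Int.norm_eq_abs]; exact_mod_cast hc
    have hd' : ‖d‖ ≤ 1 := by rw [Int.norm_eq_abs]; exact_mod_cast hd
    calc ‖c * k 1 + d * k 2‖ ≤ ‖c * k 1‖ + ‖d * k 2‖ := norm_add_le _ _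
      _ ≤ ‖c‖ * ‖k 1‖ + ‖d‖ * ‖k 2‖ := add_le_add (norm_mul_le _ _) (norm_mul_le _ _)
      _ ≤ 1 * ‖k‖ + 1 * ‖k‖ := by gcongr
      _ = 2 * ‖k‖ := by ring
  fin_cases i
  · change ‖k 0‖ ≤ _; linarith
  · exact key _ _ (by cases b <;> simp [matrix]) (by cases b <;> simp [matrix])
  · exact key _ _ (by cases b <;> simp [matrix]) (by cases b <;> simp [matrix])

/-- The root of unity `e^{2 π i m₁ / N}`. -/
def twist (b : Bieb) (m : Fin 3 → ℤ) : ℂ := exp (2 * Real.pi * I * m 0 / b.order)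

theorem norm_twist (b : Bieb) (m) : ‖b.twist m‖ = 1 := by
  have : (2 * Real.pi * I * m 0 / b.order : ℂ)
      = ((2 * Real.pi * m 0 / b.order : ℝ) : ℂ) * I := by push_cast; ring
  rw [twist, this, norm_exp_ofReal_mul_I]

theorem twist_add (b : Bieb) (m l) : b.twist (m + l) = b.twist m * b.twist l := by
  rw [twist, twist, twist, ← Complex.exp_add]
  congr 1
  push_cast [Pi.add_apply]
  ring

theorem cocycle_lin (b : Bieb) (θ : ℝ) (k l) :
    SmoothTorus.cocycle θ (b.lin k) (b.lin l) = SmoothTorus.cocycle θ k l := by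
  cases b <;> simp [SmoothTorus.cocycle, lin, matrix] <;> congr 1 <;> ring

/-- The map underlying `act`. -/
def actFun (θ : ℝ) (b : Bieb) (a : SmoothTorus θ) : SmoothTorus θ :=
  SmoothTorus.mk (fun m => b.twist m * a.coeff (b.linEquiv.symm m)) (by
    intro p
    rw [← b.linEquiv.summable_iff]
    refine Summable.of_nonneg_of_le (fun k => ?_) (fun k => ?_) ((a.rapid p).mul_left (2 ^ p))
    · simp only [Function.comp]; positivity
    · simp only [Function.comp, Equiv.symm_apply_apply, norm_mul, norm_twist, one_mul]
      rw [← mul_assoc, ← mul_pow]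
      gcongr
      have := b.norm_lin_le k
      change 1 + ‖b.lin k‖ ≤ _
      linarith [norm_nonneg k])

theorem coeff_actFun (θ : ℝ) (b : Bieb) (a : SmoothTorus θ) (m) :
    (b.actFun θ a).coeff m = b.twist m * a.coeff (b.linEquiv.symm m) := rfl

theorem lin_sub (b : Bieb) (k l : Fin 3 → ℤ) : b.lin (k - l) = b.lin k - b.lin l := by
  ext i; fin_cases i <;> simp [lin] <;> ring

theorem linEquiv_symm_sub (b : Bieb) (k l : Fin 3 → ℤ) :
    b.linEquiv.symm (k - l) = b.linEquiv.symm k - b.linEquiv.symm l := by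
  rw [Equiv.symm_apply_eq]
  change _ = b.lin _
  rw [lin_sub]
  exact congrArg₂ _ (b.linEquiv.apply_symm_apply k).symm (b.linEquiv.apply_symm_apply l).symm

/-- The generator `h` of `ℤ_N` acting on the torus algebra by
`h ▷ x^k = e^{2 π i k₁ / N} x^(k₁, A (k₂, k₃))`, that is
* `B2`: `U ↦ -U`, `V ↦ V*`, `W ↦ W*`;
* `B3`: `U ↦ e^{2 π i/3} U`, `V ↦ e^{-π i θ} V* W`, `W ↦ V*`;
* `B4`: `U ↦ i U`, `V ↦ W`, `W ↦ V*`;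
* `B6`: `U ↦ e^{π i/3} U`, `V ↦ W`, `W ↦ e^{-π i θ} V* W`. -/
def act (θ : ℝ) (b : Bieb) : SmoothTorus θ →⋆ₐ[ℂ] SmoothTorus θ where
  toFun := b.actFun θ
  map_one' := by
    ext m
    rw [coeff_actFun]
    change _ * (SmoothTorus.monomial θ 0).coeff _ = (SmoothTorus.monomial θ 0).coeff _
    have h0 : b.linEquiv.symm m = 0 ↔ m = 0 := by
      rw [Equiv.symm_apply_eq]
      have : b.linEquiv 0 = 0 := by
        change b.lin 0 = 0
        ext i; fin_cases i <;> simp [lin]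
      rw [this]
    simp only [SmoothTorus.coeff_monomial, h0]
    split_ifs with h
    · subst h; simp [twist]
    · simp
  map_zero' := by ext m; simp [coeff_actFun]
  map_add' a c := by ext m; simp [coeff_actFun, mul_add]
  map_mul' a c := by
    ext m
    rw [coeff_actFun, SmoothTorus.coeff_mul, SmoothTorus.coeff_mul, ← tsum_mul_left]
    refine Eq.trans (tsum_congr fun k => ?_) (b.linEquiv.tsum_eq _)
    simp only [coeff_actFun, linEquiv_symm_sub, Equiv.symm_apply_apply]
    have h1 : b.twist m = b.twist (b.linEquiv k) * b.twist (m - b.linEquiv k) := by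
      rw [← twist_add, add_sub_cancel]
    have h2 : SmoothTorus.cocycle θ (b.linEquiv k) (m - b.linEquiv k) =
        SmoothTorus.cocycle θ k (b.linEquiv.symm m - k) := by
      rw [← b.cocycle_lin θ k, lin_sub]
      congr 2
      exact (b.linEquiv.apply_symm_apply m).symm
    rw [h1, h2]
    ring
  commutes' c := by
    ext m
    rw [Algebra.algebraMap_eq_smul_one, coeff_actFun]
    change _ * (c * (SmoothTorus.monomial θ 0).coeff _) = c * (SmoothTorus.monomial θ 0).coeff _
    have h0 : b.linEquiv.symm m = 0 ↔ m = 0 := by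
      rw [Equiv.symm_apply_eq]
      have : b.linEquiv 0 = 0 := by
        change b.lin 0 = 0
        ext i; fin_cases i <;> simp [lin]
      rw [this]
    simp only [SmoothTorus.coeff_monomial, h0]
    split_ifs with h
    · subst h; simp [twist]
    · simp
  map_star' a := by
    ext m
    simp only [coeff_actFun, SmoothTorus.coeff_star, map_mul]
    have h1 : b.linEquiv.symm (-m) = - b.linEquiv.symm m := by
      have := b.linEquiv_symm_sub 0 m
      have h2 : b.linEquiv.symm 0 = 0 := by
        have := b.linEquiv_symm_sub 0 0
        simpa using this
      simpa [h2] using this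
    rw [h1]
    congr 1
    simp only [twist, ← Complex.exp_conj]
    congr 1
    simp [map_ofNat]

theorem act_monomial (θ : ℝ) (b : Bieb) (k : Fin 3 → ℤ) :
    b.act θ (SmoothTorus.monomial θ k) = b.twist k • SmoothTorus.monomial θ (b.lin k) := by
  ext m
  change b.twist m * (SmoothTorus.monomial θ k).coeff _ =
    b.twist k * (SmoothTorus.monomial θ (b.lin k)).coeff m
  have h0 : b.linEquiv.symm m = k ↔ m = b.lin k := by
    rw [Equiv.symm_apply_eq]; rfl
  simp only [SmoothTorus.coeff_monomial, h0]
  split_ifs with h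
  · subst h; simp [twist, lin]
  · simp

/-- The algebra of the noncommutative Bieberbach manifold: the fixed points of `h`. -/
def algebra (θ : ℝ) (b : Bieb) : StarSubalgebra ℂ (SmoothTorus θ) :=
  StarAlgHom.equalizer (b.act θ) (StarAlgHom.id ℂ (SmoothTorus θ))

end Bieb

section Triples

variable {𝒜 : Type*} [Ring 𝒜] [StarRing 𝒜] [Algebra ℂ 𝒜] [StarModule ℂ 𝒜]
  {H : Type*} [NormedAddCommGroup H] [InnerProductSpace ℂ H] [CompleteSpace H]
  {H' : Type*} [NormedAddCommGroup H'] [InnerProductSpace ℂ H'] [CompleteSpace H']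
  {H'' : Type*} [NormedAddCommGroup H''] [InnerProductSpace ℂ H''] [CompleteSpace H'']

/-- The data of a real (ungraded) spectral triple over the `*`-algebra `𝒜`: a `*`-representation,
an unbounded operator and an antiunitary. The axioms are in `IsRealSpectralTriple`. -/
structure RealTriple (𝒜 : Type*) [Ring 𝒜] [StarRing 𝒜] [Algebra ℂ 𝒜]
    (H : Type*) [NormedAddCommGroup H] [InnerProductSpace ℂ H] [CompleteSpace H] where
  rep : 𝒜 →⋆ₐ[ℂ] (H →L[ℂ] H)
  dirac : H →ₗ.[ℂ] H
  conj : H ≃ₗᵢ⋆[ℂ] H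

/-- The unbounded operator `D` is reduced by `K`: it is invariant under `D` together with the
orthogonal complement, the components of a vector of the domain being in the domain. -/
def ReducesOperator (D : H →ₗ.[ℂ] H) (K : Submodule ℂ H) : Prop :=
  ∀ ψ ∈ K, ∀ φ ∈ Kᗮ, ψ + φ ∈ D.domain →
    (∃ χ ∈ K, (ψ, χ) ∈ D.graph) ∧ ∃ χ ∈ Kᗮ, (φ, χ) ∈ D.graph

/-- The eigenspace of `D` for the real number `l`. -/
def diracEigenspace (D : H →ₗ.[ℂ] H) (l : ℝ) : Submodule ℂ H :=
  D.graph.comap (LinearMap.id.prod ((l : ℂ) • LinearMap.id))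

theorem mem_diracEigenspace (D : H →ₗ.[ℂ] H) (l : ℝ) (ψ : H) :
    ψ ∈ diracEigenspace D l ↔ (ψ, (l : ℂ) • ψ) ∈ D.graph := Iff.rfl

/-- The `η`-function `∑_{l ≠ 0} mult(l) sgn(l) |l|^{-s}` of `D` converges absolutely for `Re s`
large, and has a meromorphic continuation to the plane which is regular at `0`, with value `η`. -/
def HasEtaInvariant (D : H →ₗ.[ℂ] H) (η : ℂ) : Prop :=
  ∃ F : ℂ → ℂ, MeromorphicOn F Set.univ ∧ AnalyticAt ℂ F 0 ∧ F 0 = η ∧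
    ∃ x : ℝ, ∀ s : ℂ, x < s.re →
      HasSum (fun l : ℝ => (Module.finrank ℂ (diracEigenspace D l) : ℂ) *
        ((SignType.sign l : ℝ) : ℂ) * ((|l| : ℝ) : ℂ) ^ (-s)) (F s)

namespace RealTriple

/-- The axioms of a real spectral triple of `KO`-dimension `3`: `D` is self-adjoint with compact
resolvent (`r` is `(D - i)⁻¹`), `J² = -1`, `J D = D J`, the commutators `[D, a]` are bounded (`C`),
and the zero-order and first-order conditions hold. -/
structure IsRealSpectralTriple (T : RealTriple 𝒜 H) : Prop where
  selfAdjoint : IsSelfAdjoint T.dirac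
  compactResolvent : ∃ r : H →L[ℂ] H, IsCompactOperator r ∧
    (∀ ψ, (r ψ, ψ + I • r ψ) ∈ T.dirac.graph) ∧
    ∀ ψ φ, (ψ, φ) ∈ T.dirac.graph → r (φ - I • ψ) = ψ
  conj_conj : ∀ ψ, T.conj (T.conj ψ) = -ψ
  conj_dirac : ∀ ψ φ, (ψ, φ) ∈ T.dirac.graph → (T.conj ψ, T.conj φ) ∈ T.dirac.graph
  order_zero : ∀ a b ψ, T.rep a (T.conj (T.rep b (T.conj.symm ψ))) =
    T.conj (T.rep b (T.conj.symm (T.rep a ψ)))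
  order_one : ∀ a, ∃ C : H →L[ℂ] H,
    (∀ ψ φ, (ψ, φ) ∈ T.dirac.graph → (T.rep a ψ, T.rep a φ + C ψ) ∈ T.dirac.graph) ∧
    ∀ b ψ, C (T.conj (T.rep b (T.conj.symm ψ))) = T.conj (T.rep b (T.conj.symm (C ψ)))

/-- No proper closed subspace is invariant under the algebra and `D`. In particular none is
invariant under the algebra, `D` and `J`. -/
def IsDiracIrreducible (T : RealTriple 𝒜 H) : Prop :=
  Nontrivial H ∧ ∀ L : Submodule ℂ H, IsClosed (L : Set H) →
    (∀ a, ∀ ψ ∈ L, T.rep a ψ ∈ L) → ReducesOperator T.dirac L → L = ⊥ ∨ L = ⊤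

/-- The same triple with `-D` in place of `D`. -/
def neg (T : RealTriple 𝒜 H) : RealTriple 𝒜 H := { T with dirac := -T.dirac }

/-- A unitary that intertwines the representations, the real structures and the Dirac operators. -/
def UnitarilyEquivalent (T : RealTriple 𝒜 H) (T' : RealTriple 𝒜 H') : Prop :=
  ∃ W : H ≃ₗᵢ[ℂ] H', (∀ a ψ, W (T.rep a ψ) = T'.rep a (W ψ)) ∧
    (∀ ψ, W (T.conj ψ) = T'.conj (W ψ)) ∧
    ∀ ψ φ, (ψ, φ) ∈ T.dirac.graph ↔ (W ψ, W φ) ∈ T'.dirac.graph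

theorem UnitarilyEquivalent.refl (T : RealTriple 𝒜 H) : T.UnitarilyEquivalent T :=
  ⟨LinearIsometryEquiv.refl ℂ H, fun _ _ => rfl, fun _ => rfl, fun _ _ => Iff.rfl⟩

theorem UnitarilyEquivalent.symm {T : RealTriple 𝒜 H} {T' : RealTriple 𝒜 H'}
    (h : T.UnitarilyEquivalent T') : T'.UnitarilyEquivalent T := by
  obtain ⟨W, h1, h2, h3⟩ := h
  refine ⟨W.symm, fun a ψ => ?_, fun ψ => ?_, fun ψ φ => ?_⟩
  · rw [W.symm_apply_eq, h1, W.apply_symm_apply]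
  · rw [W.symm_apply_eq, h2, W.apply_symm_apply]
  · rw [h3, W.apply_symm_apply, W.apply_symm_apply]

theorem UnitarilyEquivalent.trans {T : RealTriple 𝒜 H} {T' : RealTriple 𝒜 H'}
    {T'' : RealTriple 𝒜 H''} (h : T.UnitarilyEquivalent T') (h' : T'.UnitarilyEquivalent T'') :
    T.UnitarilyEquivalent T'' := by
  obtain ⟨W, h1, h2, h3⟩ := h
  obtain ⟨W', h1', h2', h3'⟩ := h'
  refine ⟨W.trans W', fun a ψ => ?_, fun ψ => ?_, fun ψ φ => ?_⟩
  · simp [h1, h1']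
  · simp [h2, h2']
  · simp [h3, h3']

/-- The subspace `K` is invariant under the subalgebra `B`, under `J` and under `D`. -/
structure Reduces (T : RealTriple 𝒜 H) (B : StarSubalgebra ℂ 𝒜) (K : Submodule ℂ H) : Prop where
  rep_mem : ∀ b ∈ B, ∀ ψ ∈ K, T.rep b ψ ∈ K
  conj_mem : ∀ ψ, T.conj ψ ∈ K ↔ ψ ∈ K
  dirac_mem : ReducesOperator T.dirac K

theorem Reduces.dirac_apply_mem {T : RealTriple 𝒜 H} {B : StarSubalgebra ℂ 𝒜}
    {K : Submodule ℂ H} (h : T.Reduces B K) (ψ : T.dirac.domain) (hψ : (ψ : H) ∈ K) :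
    T.dirac ψ ∈ K := by
  obtain ⟨⟨χ, hχ, h1⟩, -⟩ := h.dirac_mem ψ hψ 0 (Submodule.zero_mem _) (by simp)
  obtain ⟨y, hy, hy'⟩ := T.dirac.mem_graph_iff.1 h1
  have : y = ψ := Subtype.ext hy
  subst this
  rw [hy']
  exact hχ

/-- The restriction of a real spectral triple to a subalgebra and an invariant subspace. -/
def restrict (T : RealTriple 𝒜 H) (B : StarSubalgebra ℂ 𝒜) (K : Submodule ℂ H) [CompleteSpace K]
    (h : T.Reduces B K) : RealTriple B K where
  rep :=
    { toFun := fun b => ((T.rep b).comp K.subtypeL).codRestrict K fun ψ => h.rep_mem b b.2 ψ ψ.2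
      map_one' := by ext ψ; simp
      map_mul' := fun a b => by ext ψ; simp; rfl
      map_zero' := by ext ψ; simp
      map_add' := fun a b => by ext ψ; simp; rfl
      commutes' := fun c => by
        ext ψ
        simp [Algebra.algebraMap_eq_smul_one]
      map_star' := fun b => by
        rw [ContinuousLinearMap.star_eq_adjoint, ContinuousLinearMap.eq_adjoint_iff]
        intro ψ φ
        have : inner ℂ (T.rep (star (b : 𝒜)) ψ) (φ : H) = inner ℂ (ψ : H) (T.rep b φ) := by
          rw [map_star, ContinuousLinearMap.star_eq_adjoint,
            ContinuousLinearMap.adjoint_inner_left]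
        exact this }
  dirac :=
    { domain := T.dirac.domain.comap K.subtype
      toFun :=
        { toFun := fun ψ => ⟨T.dirac ⟨ψ.1, ψ.2⟩, h.dirac_apply_mem _ ψ.1.2⟩
          map_add' := fun ψ φ => Subtype.ext (T.dirac.map_add ⟨ψ.1, ψ.2⟩ ⟨φ.1, φ.2⟩)
          map_smul' := fun c ψ => Subtype.ext (T.dirac.map_smul c ⟨ψ.1, ψ.2⟩) } }
  conj :=
    { toFun := fun ψ => ⟨T.conj ψ, (h.conj_mem _).2 ψ.2⟩
      invFun := fun ψ => ⟨T.conj.symm ψ, (h.conj_mem _).1 (by simp)⟩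
      map_add' := fun ψ φ => Subtype.ext (map_add T.conj _ _)
      map_smul' := fun c ψ => Subtype.ext (LinearIsometryEquiv.map_smulₛₗ T.conj c (ψ : H))
      left_inv := fun ψ => Subtype.ext (T.conj.symm_apply_apply _)
      right_inv := fun ψ => Subtype.ext (T.conj.apply_symm_apply _)
      norm_map' := fun ψ => T.conj.norm_map _ }

/-- The powers of `S` are a representation of `ℤ_N` on the Hilbert space which implements the
action of `ℤ_N` on the algebra with generator `α`, and which commutes with `D` and with `J`. -/
structure IsEquivariantAction (T : RealTriple 𝒜 H) (α : 𝒜 →⋆ₐ[ℂ] 𝒜) (N : ℕ) (S : H →L[ℂ] H) :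
    Prop where
  pow : S ^ N = 1
  rep : ∀ a, S * T.rep a = T.rep (α a) * S
  dirac : ∀ ψ φ, (ψ, φ) ∈ T.dirac.graph → (S ψ, S φ) ∈ T.dirac.graph
  conj : ∀ ψ, S (T.conj ψ) = T.conj (S ψ)

end RealTriple
end Triples

/-- The matrix `[[R ξ₁, ξ₂ + τ ξ₃], [ξ₂ + τ* ξ₃, -R ξ₁]]`. -/
def symbol (R : ℝ) (τ : ℂ) (ξ : Fin 3 → ℝ) : Matrix (Fin 2) (Fin 2) ℂ :=
  !![(R * ξ 0 : ℂ), ξ 1 + τ * ξ 2; ξ 1 + starRingEnd ℂ τ * ξ 2, -(R * ξ 0 : ℂ)]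

/-- `[[R δ₁, δ₂ + τ δ₃], [δ₂ + τ* δ₃, -R δ₁]] ψ`, where `δᵢ e_μ = μᵢ e_μ`. -/
def diracFun (R : ℝ) (τ : ℂ) {ε : Fin 3 → Bool} (ψ : Weight ε × Fin 2 → ℂ) :
    Weight ε × Fin 2 → ℂ :=
  fun i => ∑ t, symbol R τ i.1.1 i.2 t * ψ (i.1, t)

theorem diracFun_add (R : ℝ) (τ : ℂ) {ε : Fin 3 → Bool} (ψ φ : Weight ε × Fin 2 → ℂ) :
    diracFun R τ (ψ + φ) = diracFun R τ ψ + diracFun R τ φ := by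
  ext i; simp [diracFun, mul_add]; ring

theorem diracFun_smul (R : ℝ) (τ : ℂ) {ε : Fin 3 → Bool} (c : ℂ) (ψ : Weight ε × Fin 2 → ℂ) :
    diracFun R τ (c • ψ) = c • diracFun R τ ψ := by
  ext i; simp [diracFun]; ring

/-- The flat Dirac operator `D` of the torus, on its maximal domain. -/
def torusDirac (R : ℝ) (τ : ℂ) (ε : Fin 3 → Bool) : Spinor ε →ₗ.[ℂ] Spinor ε where
  domain :=
    { carrier := {ψ | Memℓp (diracFun R τ ψ) 2}
      zero_mem' := by
        have : diracFun R τ ((0 : Spinor ε) : Weight ε × Fin 2 → ℂ) = 0 := by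
          ext i; simp [diracFun]
        simp only [Set.mem_ofPred_eq, this]
        exact zero_memℓp
      add_mem' := fun {ψ φ} hψ hφ => by
        have := Memℓp.add hψ hφ
        rwa [← diracFun_add] at this
      smul_mem' := fun c ψ hψ => by
        have := Memℓp.const_smul (𝕜 := ℂ) hψ c
        rwa [← diracFun_smul] at this }
  toFun :=
    { toFun := fun ψ => ⟨diracFun R τ ψ.1, ψ.2⟩
      map_add' := fun ψ φ => Subtype.ext (diracFun_add R τ ψ.1 φ.1)
      map_smul' := fun c ψ => Subtype.ext (diracFun_smul R τ c ψ.1) }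

/-- The real structure `J (ψ₊, ψ₋) = (-J₀ ψ₋, J₀ ψ₊)`, with `J₀` antilinear, `J₀ e_μ = e_{-μ}`. -/
def torusConj (ε : Fin 3 → Bool) : Spinor ε ≃ₗᵢ⋆[ℂ] Spinor ε :=
  (starₗᵢ ℂ : Spinor ε ≃ₗᵢ⋆[ℂ] Spinor ε).trans
    (weightedPerm (Weight.negEquiv.prodCongr (Equiv.swap (0 : Fin 2) 1))
      (fun i => if i.2 = 0 then -1 else 1) (fun i => by split_ifs <;> simp))

theorem torusConj_zero (ε : Fin 3 → Bool) (ψ : Spinor ε) (μ : Weight ε) :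
    torusConj ε ψ (μ, 0) = -starRingEnd ℂ (ψ (μ.neg, 1)) := by
  change (if (0 : Fin 2) = 0 then (-1 : ℂ) else 1) * _ = _
  simp; rfl

theorem torusConj_one (ε : Fin 3 → Bool) (ψ : Spinor ε) (μ : Weight ε) :
    torusConj ε ψ (μ, 1) = starRingEnd ℂ (ψ (μ.neg, 0)) := by
  change (if (1 : Fin 2) = 0 then (-1 : ℂ) else 1) * _ = _
  simp; rfl

/-- The flat real spectral triple of the torus with parameters `R`, `τ` and spin structure `ε`. -/
def flatTorus (θ R : ℝ) (τ : ℂ) (ε : Fin 3 → Bool) : RealTriple (SmoothTorus θ) (Spinor ε) where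
  rep := SmoothTorus.rep θ ε
  dirac := torusDirac R τ ε
  conj := torusConj ε

/-- The action of `U(1)³` on the torus algebra, `x^k ↦ e^{2 π i t·k} x^k`. -/
def torusGauge (θ : ℝ) (t : Fin 3 → ℝ) (a : SmoothTorus θ) : SmoothTorus θ :=
  SmoothTorus.mk (fun k => exp (((2 * Real.pi * ∑ i, t i * k i : ℝ) : ℂ) * I) * a.coeff k) (by
    intro p
    refine (a.rapid p).congr fun k => ?_
    rw [norm_mul, norm_exp_ofReal_mul_I, one_mul])

/-- `U(1)³`-equivariance: a strongly continuous unitary representation (of `U(1)³`, or of its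
covering `ℝ³ / (2ℤ)³`) implements the action of `U(1)³` on the algebra, commuting with `D`, `J`. -/
def IsTorusEquivariant {θ : ℝ} {H : Type*} [NormedAddCommGroup H] [InnerProductSpace ℂ H]
    [CompleteSpace H] (T : RealTriple (SmoothTorus θ) H) : Prop :=
  ∃ u : Multiplicative (Fin 3 → ℝ) →* (H ≃ₗᵢ[ℂ] H),
    (∀ ψ, Continuous fun t : Fin 3 → ℝ => u (Multiplicative.ofAdd t) ψ) ∧
    (∀ n : Fin 3 → ℤ, u (Multiplicative.ofAdd fun i => 2 * (n i : ℝ)) = 1) ∧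
    (∀ t a ψ, u (Multiplicative.ofAdd t) (T.rep a ψ) =
      T.rep (torusGauge θ t a) (u (Multiplicative.ofAdd t) ψ)) ∧
    (∀ t ψ φ, (ψ, φ) ∈ T.dirac.graph → (u t ψ, u t φ) ∈ T.dirac.graph) ∧
    ∀ t ψ, u t (T.conj ψ) = T.conj (u t ψ)

/-- The flat real spectral triples over a noncommutative Bieberbach manifold, for given parameters
`R`, `τ` of the Dirac operator: the restrictions of the flat triples of the torus (for some spin
structure) to the fixed point algebra of `ℤ_N` and to the `ℤ_N`-invariant subspace of a
representation of `ℤ_N` which is equivariant with respect to the algebra, `D` and `J`. -/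
structure FlatRestriction (θ : ℝ) (b : Bieb) (R : ℝ) (τ : ℂ) where
  spin : Fin 3 → Bool
  space : Submodule ℂ (Spinor spin)
  complete : CompleteSpace space
  reduces : (flatTorus θ R τ spin).Reduces (b.algebra θ) space
  fixed : ∃ S : Spinor spin →L[ℂ] Spinor spin,
    (flatTorus θ R τ spin).IsEquivariantAction (b.act θ) b.order S ∧ ∀ ψ, ψ ∈ space ↔ S ψ = ψ

namespace FlatRestriction
variable {θ : ℝ} {b : Bieb} {R : ℝ} {τ : ℂ}

instance (X : FlatRestriction θ b R τ) : CompleteSpace X.space := X.complete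

/-- The restricted triple. -/
def triple (X : FlatRestriction θ b R τ) : RealTriple (b.algebra θ) X.space :=
  (flatTorus θ R τ X.spin).restrict (b.algebra θ) X.space X.reduces

/-- Unitary equivalence of flat triples. -/
def setoid (θ : ℝ) (b : Bieb) (R : ℝ) (τ : ℂ) : Setoid (FlatRestriction θ b R τ) where
  r X Y := X.triple.UnitarilyEquivalent Y.triple
  iseqv := ⟨fun _ => .refl _, fun h => h.symm, fun h h' => h.trans h'⟩

end FlatRestriction

/-- The basis vector `e_{μ,s}` (and `0` if `μ` is not in `ℤ³ + ε`). -/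
def basisVec (ε : Fin 3 → Bool) (μ : Fin 3 → ℝ) (s : Fin 2) : Spinor ε :=
  open Classical in
  if h : ∀ i, ∃ n : ℤ, μ i = n + half (ε i) then lp.single 2 ((⟨μ, h⟩ : Weight ε), s) 1 else 0

/-- The sign `±1` of the spinor index. -/
def sgn (s : Fin 2) : ℝ := if s = 0 then 1 else -1

namespace Bieb

/-- The parameters of the classification: `ε₂, ε₃, κ` for `B2`; `ε₁` for `B3`; `ε₂ = ε₃ = e` and
`κ` for `B4`; `κ` for `B6`. -/
inductive Label : Bieb → Type
  | b2 (e₂ e₃ : Bool) (κ : ℤˣ) : Label B2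
  | b3 (e₁ : Bool) : Label B3
  | b4 (e : Bool) (κ : ℤˣ) : Label B4
  | b6 (κ : ℤˣ) : Label B6

/-- The number of classes. -/
def numSpin : Bieb → ℕ
  | B2 => 8
  | B3 => 2
  | B4 => 4
  | B6 => 2

/-- The values of `τ` that are compatible with the holonomy; `σ` is a sign. -/
def Admissible (b : Bieb) (σ : ℤˣ) (τ : ℂ) : Prop :=
  match b with
  | B2 => True
  | B3 => τ = exp (-(Real.pi * I * (σ : ℤ) / 3))
  | B4 => τ = exp (Real.pi * I * (σ : ℤ) / 2)
  | B6 => τ = exp (Real.pi * I * (σ : ℤ) / 3)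

/-- The spin structure of the torus. -/
def Label.spin : {b : Bieb} → b.Label → Fin 3 → Bool
  | _, .b2 e₂ e₃ _ => ![true, e₂, e₃]
  | _, .b3 e₁ => ![e₁, false, false]
  | _, .b4 e _ => ![true, e, e]
  | _, .b6 _ => ![true, false, false]

/-- The phase in `ρ(h) e_{μ,s} = phase (μ₁, s) e_{(μ₁, A(μ₂,μ₃)),s}`. -/
def Label.phase (σ : ℤˣ) : {b : Bieb} → b.Label → ℝ → Fin 2 → ℂ
  | _, .b2 _ _ κ, x, s => (κ : ℤ) * exp (Real.pi * I * (x + sgn s / 2))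
  | _, .b3 e₁, x, s =>
    (if e₁ then -1 else 1) * exp (2 * Real.pi * I / 3 * (x + sgn s * (σ : ℤ)))
  | _, .b4 _ κ, x, s => (κ : ℤ) * exp (Real.pi * I / 2 * (x + sgn s * (σ : ℤ) / 2))
  | _, .b6 κ, x, s => (κ : ℤ) * exp (Real.pi * I / 3 * (x + sgn s * (σ : ℤ) / 2))

/-- The number `β` such that `e_{μ₁,0,0,±}` is invariant exactly for `±μ₁ ∈ N (ℤ + β)`. -/
def Label.offset (σ : ℤˣ) : {b : Bieb} → b.Label → ℝ
  | _, .b2 _ _ κ => -(κ : ℤ) / 4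
  | _, .b3 e₁ => half e₁ - (σ : ℤ) / 3
  | _, .b4 _ κ => (1 - (κ : ℤ)) / 4 - (σ : ℤ) / 8
  | _, .b6 κ => (1 - (κ : ℤ)) / 4 - (σ : ℤ) / 12

/-- The value of the `η`-invariant. -/
def Label.eta (σ : ℤˣ) : {b : Bieb} → b.Label → ℝ
  | _, .b2 e₂ e₃ κ => if e₂ || e₃ then 0 else -(κ : ℤ)
  | _, .b3 e₁ => if e₁ then 4 / 3 * (σ : ℤ) else -(2 / 3) * (σ : ℤ)
  | _, .b4 e κ => if e then 0 else if κ = 1 then -(3 / 2) * (σ : ℤ) else 1 / 2 * (σ : ℤ)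
  | _, .b6 κ => if κ = 1 then -(5 / 3) * (σ : ℤ) else 1 / 3 * (σ : ℤ)

/-- The closed span of the vectors `N^{-1/2} ∑_{0 ≤ p < N} ρ(h)^p e_{μ,s}`, where `μ ∈ ℤ³ + ε` and
`(μ₂, μ₃) ≠ (0, 0)`, and of the vectors `e_{±N(k + β),0,0,±}`, `k ∈ ℤ`. -/
def Label.invariantSpace {b : Bieb} (σ : ℤˣ) (l : b.Label) (ε : Fin 3 → Bool) : Submodule ℂ (Spinor ε) :=
  (Submodule.span ℂ
    ({v | ∃ (μ : Weight ε) (s : Fin 2), ¬(μ.1 1 = 0 ∧ μ.1 2 = 0) ∧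
        v = ((1 / Real.sqrt b.order : ℝ) : ℂ) •
          ∑ p ∈ Finset.range b.order, l.phase σ (μ.1 0) s ^ p • basisVec ε (b.lin^[p] μ.1) s} ∪
     {v | ∃ (k : ℤ) (s : Fin 2),
        v = basisVec ε ![sgn s * (b.order * (k + l.offset σ)), 0, 0] s})).topologicalClosure

end Bieb

/-- The eigenvalues `± √(R² μ₁² + |μ₂ + τ μ₃|²)`. -/
def torusEigenvalue (R : ℝ) (τ : ℂ) (μ : Fin 3 → ℝ) (s : Fin 2) : ℝ :=
  sgn s * Real.sqrt (R ^ 2 * μ 0 ^ 2 + ‖(μ 1 : ℂ) + τ * μ 2‖ ^ 2)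


namespace Bieb

/-- The screw motion `(x₁, x₂, x₃) ↦ (x₁ + 1/N, Aᵀ (x₂, x₃))` of `ℝ³`, dual to `h`. -/
def screw (b : Bieb) : Equiv.Perm (Fin 3 → ℝ) where
  toFun x := ![x 0 + 1 / b.order, b.matrix 0 0 * x 1 + b.matrix 1 0 * x 2,
    b.matrix 0 1 * x 1 + b.matrix 1 1 * x 2]
  invFun x := ![x 0 - 1 / b.order, b.matrix 1 1 * x 1 - b.matrix 1 0 * x 2,
    -b.matrix 0 1 * x 1 + b.matrix 0 0 * x 2]
  left_inv x := by ext i; fin_cases i <;> cases b <;> simp [matrix]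
  right_inv x := by ext i; fin_cases i <;> cases b <;> simp [matrix]

/-- The Bieberbach group: it is generated by the translations of `ℤ³` and the screw motion. -/
def group (b : Bieb) : Subgroup (Equiv.Perm (Fin 3 → ℝ)) :=
  Subgroup.closure ({b.screw} ∪ Set.range fun i : Fin 3 => Equiv.addRight (Pi.single i (1 : ℝ)))

end Bieb

/-- The spin structures of the flat manifold `ℝ³ / Γ`, where the covector `ξ` has square length
`R² ξ₁² + |ξ₂ + τ ξ₃|²` and acts on spinors by `symbol R τ ξ`: the lifts of the holonomy
(linear part) homomorphism of `Γ` to `SU(2) = Spin(3)`. -/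
structure SpinStructure (b : Bieb) (R : ℝ) (τ : ℂ) where
  lift : b.group →* Matrix.specialUnitaryGroup (Fin 2) ℂ
  covers : ∀ (g : b.group) (ξ : Fin 3 → ℝ),
    (lift g : Matrix (Fin 2) (Fin 2) ℂ) *
        symbol R τ (fun j => ξ ⬝ᵥ ((g : Equiv.Perm (Fin 3 → ℝ)) (Pi.single j 1) -
          (g : Equiv.Perm (Fin 3 → ℝ)) 0)) =
      symbol R τ ξ * (lift g : Matrix (Fin 2) (Fin 2) ℂ)

/-- The smooth spinor fields on `ℝ³ / Γ` for the spin structure `s`: the smooth `ψ : ℝ³ → ℂ²` with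
`ψ(g x) = s(g) ψ(x)` for `g ∈ Γ`. -/
def SpinStructure.smoothSpinors {b : Bieb} {R : ℝ} {τ : ℂ} (s : SpinStructure b R τ) :
    Submodule ℂ ((Fin 3 → ℝ) → Fin 2 → ℂ) where
  carrier := {ψ | ContDiff ℝ (⊤ : ℕ∞) ψ ∧ ∀ (g : b.group) (x : Fin 3 → ℝ),
    ψ ((g : Equiv.Perm (Fin 3 → ℝ)) x) =
      (s.lift g : Matrix (Fin 2) (Fin 2) ℂ).mulVec (ψ x)}
  zero_mem' := ⟨contDiff_const, fun g x => by simp⟩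
  add_mem' := fun hψ hφ => ⟨hψ.1.add hφ.1, fun g x => by
    simp [hψ.2 g x, hφ.2 g x, Matrix.mulVec_add]⟩
  smul_mem' := fun c ψ hψ => ⟨hψ.1.const_smul c, fun g x => by
    simp [hψ.2 g x, Matrix.mulVec_smul]⟩

/-- The Dirac operator of the flat metric, `(2 π i)⁻¹ ∑ⱼ symbol(dxⱼ) ∂ⱼ`. -/
def classicalDirac (R : ℝ) (τ : ℂ) (ψ : (Fin 3 → ℝ) → Fin 2 → ℂ) (x : Fin 3 → ℝ) : Fin 2 → ℂ :=
  (1 / (2 * Real.pi * I)) • ∑ j : Fin 3,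
    (symbol R τ (Pi.single j 1)).mulVec (fderiv ℝ ψ x (Pi.single j 1))

/-- Charge conjugation. -/
def classicalConj (ψ : (Fin 3 → ℝ) → Fin 2 → ℂ) (x : Fin 3 → ℝ) : Fin 2 → ℂ :=
  ![-starRingEnd ℂ (ψ x 1), starRingEnd ℂ (ψ x 0)]

/-- The smooth function on the torus `ℝ³ / ℤ³` given by an element of the algebra for `θ = 0`. -/
def classicalFunction (a : SmoothTorus 0) (x : Fin 3 → ℝ) : ℂ :=
  ∑' k, a.coeff k * exp (((2 * Real.pi * ∑ i, k i * x i : ℝ) : ℂ) * I)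

/-- The triple `T` over the classical algebra is the completion of the smooth spinor fields with the
`L²` norm (over a fundamental domain of `ℤ³`), where functions act by multiplication, the real
structure is charge conjugation, and `D` is the closure of the Dirac operator of the flat metric. -/
def IsClassicalDiracTriple {b : Bieb} {R : ℝ} {τ : ℂ} (s : SpinStructure b R τ)
    {H : Type*} [NormedAddCommGroup H] [InnerProductSpace ℂ H] [CompleteSpace H]
    (T : RealTriple (b.algebra 0) H) : Prop :=
  ∃ Φ : s.smoothSpinors →ₗ[ℂ] H, DenseRange Φ ∧
    (∀ ψ, ‖Φ ψ‖ ^ 2 = ∫ x in Set.Icc (0 : Fin 3 → ℝ) 1, (‖ψ.1 x 0‖ ^ 2 + ‖ψ.1 x 1‖ ^ 2)) ∧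
    (∀ (a : b.algebra 0) ψ, ∃ φ : s.smoothSpinors,
      (∀ x, φ.1 x = classicalFunction a x • ψ.1 x) ∧ T.rep a (Φ ψ) = Φ φ) ∧
    (∀ ψ, ∃ φ : s.smoothSpinors, (∀ x, φ.1 x = classicalConj ψ.1 x) ∧ T.conj (Φ ψ) = Φ φ) ∧
    (∀ ψ, ∃ φ : s.smoothSpinors, (∀ x, φ.1 x = classicalDirac R τ ψ.1 x) ∧
      (Φ ψ, Φ φ) ∈ T.dirac.graph) ∧
    (T.dirac.graph : Set (H × H)) ⊆ closure {q | ∃ ψ φ : s.smoothSpinors,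
      (∀ x, φ.1 x = classicalDirac R τ ψ.1 x) ∧ q = (Φ ψ, Φ φ)}


end FlatBieberbach

end

open FlatBieberbach

noncomputable section
namespace FlatBieberbach

section DiagonalOperators
variable {ι : Type*}

/-- The basis vectors of `ℓ²(ι)`. -/
def ket (i : ι) : lp (fun _ : ι => ℂ) 2 := open Classical in lp.single 2 i 1

theorem ket_apply_self (i : ι) : (ket i) i = 1 := by
  classical
  simp [ket]

theorem ket_apply_ne {i j : ι} (h : j ≠ i) : (ket i) j = 0 := by
  classical
  simp [ket, h]

theorem ket_apply [DecidableEq ι] (i j : ι) : (ket i) j = if j = i then 1 else 0 := by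
  split_ifs with h
  · rw [h, ket_apply_self]
  · exact ket_apply_ne h

theorem ket_ne_zero (i : ι) : ket i ≠ 0 := by
  intro h
  have := ket_apply_self i
  rw [h] at this
  simp at this

theorem hasSum_ket (ψ : lp (fun _ : ι => ℂ) 2) : HasSum (fun i => ψ i • ket i) ψ := by
  classical
  have := lp.hasSum_single (p := 2) (by norm_num) ψ
  refine this.congr_fun fun i => ?_
  ext j
  simp [ket, Pi.single_apply]

theorem dense_span_ket : (Submodule.span ℂ (Set.range (ket (ι := ι)))).topologicalClosure = ⊤ := by
  rw [eq_top_iff]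
  intro ψ _
  have h := hasSum_ket ψ
  refine mem_closure_of_tendsto h (Filter.Eventually.of_forall fun s => ?_)
  exact Submodule.sum_mem _ fun i _ => Submodule.smul_mem _ _ (Submodule.subset_span ⟨i, rfl⟩)

theorem ext_ket {H : Type*} [NormedAddCommGroup H] [NormedSpace ℂ H]
    {S T : lp (fun _ : ι => ℂ) 2 →L[ℂ] H} (h : ∀ i, S (ket i) = T (ket i)) : S = T := by
  ext ψ
  have h1 := (hasSum_ket ψ).mapL S
  have h2 := (hasSum_ket ψ).mapL T
  simp only [map_smul, h] at h1 h2
  exact h1.unique h2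

theorem norm_mul_rpow_le {w : ι → ℂ} {C : ℝ} (hw : ∀ i, ‖w i‖ ≤ C)
    (ψ : lp (fun _ : ι => ℂ) 2) (i : ι) :
    ‖w i * ψ i‖ ^ (2 : ENNReal).toReal ≤ C ^ 2 * ‖ψ i‖ ^ (2 : ENNReal).toReal := by
  have h0 : ‖w i * ψ i‖ ≤ C * ‖ψ i‖ := by
    rw [norm_mul]; exact mul_le_mul_of_nonneg_right (hw i) (norm_nonneg _)
  have := pow_le_pow_left₀ (norm_nonneg _) h0 2
  simpa [mul_pow] using this

theorem memℓp_mul {w : ι → ℂ} {C : ℝ} (hw : ∀ i, ‖w i‖ ≤ C) (ψ : lp (fun _ : ι => ℂ) 2) :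
    Memℓp (fun i => w i * ψ i) 2 := by
  refine memℓp_gen ?_
  have := (lp.memℓp ψ).summable (by norm_num)
  exact Summable.of_nonneg_of_le (fun i => by positivity) (norm_mul_rpow_le hw ψ)
    (this.mul_left (C ^ 2))

theorem norm_mul_le {w : ι → ℂ} {C : ℝ} (hw : ∀ i, ‖w i‖ ≤ C) (ψ : lp (fun _ : ι => ℂ) 2) :
    ‖(⟨fun i => w i * ψ i, memℓp_mul hw ψ⟩ : lp (fun _ : ι => ℂ) 2)‖ ≤ |C| * ‖ψ‖ := by
  have h2 : (0 : ℝ) < (2 : ENNReal).toReal := by norm_num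
  have h3 := (lp.memℓp ψ).summable (by norm_num)
  refine lp.norm_le_of_tsum_le h2 (by positivity) ?_
  refine ((memℓp_mul hw ψ).summable h2).tsum_le_tsum (norm_mul_rpow_le hw ψ)
    (h3.mul_left (C ^ 2)) |>.trans ?_
  rw [tsum_mul_left, ← lp.norm_rpow_eq_tsum h2]
  simp [mul_pow]

/-- Multiplication by a bounded function. -/
def diagOp (w : ι → ℂ) (C : ℝ) (hw : ∀ i, ‖w i‖ ≤ C) :
    lp (fun _ : ι => ℂ) 2 →L[ℂ] lp (fun _ : ι => ℂ) 2 :=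
  LinearMap.mkContinuous
    { toFun := fun ψ => ⟨fun i => w i * ψ i, memℓp_mul hw ψ⟩
      map_add' := fun ψ φ => by ext i; exact mul_add _ _ _
      map_smul' := fun c ψ => by ext i; exact mul_left_comm _ _ _ } |C| (norm_mul_le hw)

theorem diagOp_apply (w : ι → ℂ) (C : ℝ) (hw : ∀ i, ‖w i‖ ≤ C) (ψ : lp (fun _ : ι => ℂ) 2)
    (i : ι) : diagOp w C hw ψ i = w i * ψ i := rfl

theorem norm_diagOp_le (w : ι → ℂ) (C : ℝ) (hC : 0 ≤ C) (hw : ∀ i, ‖w i‖ ≤ C) :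
    ‖diagOp w C hw‖ ≤ C :=
  (LinearMap.mkContinuous_norm_le _ (abs_nonneg C) (norm_mul_le hw)).trans (abs_of_nonneg hC).le

theorem isCompactOperator_sum {H H' α : Type*} [NormedAddCommGroup H] [NormedSpace ℂ H]
    [NormedAddCommGroup H'] [NormedSpace ℂ H'] (s : Finset α) (T : α → H →L[ℂ] H')
    (h : ∀ i ∈ s, IsCompactOperator (T i)) : IsCompactOperator (∑ i ∈ s, T i : H →L[ℂ] H') := by
  classical
  induction s using Finset.induction_on with
  | empty => simpa using isCompactOperator_zero (M₁ := H) (M₂ := H')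
  | insert a s ha ih =>
    rw [Finset.sum_insert ha]
    exact (h a (by simp)).add (ih fun i hi => h i (by simp [hi]))

/-- The coordinates on `ℓ²(ι)`. -/
def coordCLM (i : ι) : lp (fun _ : ι => ℂ) 2 →L[ℂ] ℂ :=
  lp.evalCLM (𝕜 := ℂ) (E := fun _ : ι => ℂ) (p := 2) i

theorem coordCLM_apply (i : ι) (ψ : lp (fun _ : ι => ℂ) 2) : coordCLM i ψ = ψ i := rfl

/-- A multiplication operator whose coefficients tend to `0` is compact. -/
theorem isCompactOperator_diagOp (w : ι → ℂ) (C : ℝ) (hw : ∀ i, ‖w i‖ ≤ C)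
    (h0 : ∀ δ > 0, {i | δ ≤ ‖w i‖}.Finite) : IsCompactOperator (diagOp w C hw) := by
  classical
  have hδ : ∀ n : ℕ, (0 : ℝ) < 1 / (n + 1) := fun n => by positivity
  let F : ℕ → Finset ι := fun n => (h0 _ (hδ n)).toFinset
  let T : ℕ → lp (fun _ : ι => ℂ) 2 →L[ℂ] lp (fun _ : ι => ℂ) 2 := fun n =>
    ∑ i ∈ F n, (ContinuousLinearMap.toSpanSingleton ℂ (w i • ket i)).comp (coordCLM i)
  have hT : ∀ n ψ j, T n ψ j = if j ∈ F n then w j * ψ j else 0 := by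
    intro n ψ j
    have : T n ψ = ∑ i ∈ F n, ψ i • w i • ket i := by
      simp [T, coordCLM_apply]
    rw [this, lp.coeFn_sum, Finset.sum_apply]
    simp only [lp.coeFn_smul, Pi.smul_apply, ket_apply, smul_eq_mul, mul_ite, mul_one, mul_zero,
      Finset.sum_ite_eq]
    split_ifs <;> ring
  refine isCompactOperator_of_tendsto (l := Filter.atTop) (F := T) ?_ (Filter.Eventually.of_forall fun n => ?_)
  · rw [tendsto_iff_norm_sub_tendsto_zero]
    refine squeeze_zero (fun n => norm_nonneg _) (fun n => ?_) tendsto_one_div_add_atTop_nhds_zero_nat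
    have h1 : ∀ i, ‖(if i ∈ F n then 0 else - w i)‖ ≤ 1 / ((n : ℝ) + 1) := by
      intro i
      split_ifs with h
      · simpa using (hδ n).le
      · rw [norm_neg]
        simp only [F, Set.Finite.mem_toFinset, Set.mem_ofPred_eq, not_le] at h
        exact h.le
    have h2 : T n - diagOp w C hw = diagOp _ _ h1 := by
      ext ψ j
      change T n ψ j - w j * ψ j = (if j ∈ F n then 0 else - w j) * ψ j
      rw [hT]
      split_ifs <;> ring
    rw [h2]
    exact norm_diagOp_le _ _ (hδ n).le _
  · refine isCompactOperator_sum _ _ fun i _ => ?_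
    have h : IsCompactOperator (coordCLM i) := isCompactOperator_of_locallyCompactSpace_dom (coordCLM i)
    exact h.clm_comp (ContinuousLinearMap.toSpanSingleton ℂ (w i • ket i))

end DiagonalOperators

variable {ε : Fin 3 → Bool}

theorem basisVec_coe (μ : Weight ε) (s : Fin 2) : basisVec ε μ.1 s = ket (μ, s) := by
  rw [basisVec, dif_pos μ.2, ket]
  congr!

theorem basisVec_of_not {μ : Fin 3 → ℝ} (h : ¬ ∀ i, ∃ n : ℤ, μ i = n + half (ε i)) (s : Fin 2) :
    basisVec ε μ s = 0 := by
  rw [basisVec, dif_neg h]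

theorem diracFun_zero' (R : ℝ) (τ : ℂ) (ψ : Weight ε × Fin 2 → ℂ) (μ : Weight ε) :
    diracFun R τ ψ (μ, 0) = R * μ.1 0 * ψ (μ, 0) + (μ.1 1 + τ * μ.1 2) * ψ (μ, 1) := by
  simp [diracFun, symbol]

theorem diracFun_one' (R : ℝ) (τ : ℂ) (ψ : Weight ε × Fin 2 → ℂ) (μ : Weight ε) :
    diracFun R τ ψ (μ, 1) =
      (μ.1 1 + starRingEnd ℂ τ * μ.1 2) * ψ (μ, 0) - R * μ.1 0 * ψ (μ, 1) := by
  simp [diracFun, symbol]; ring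

theorem mem_graph_torusDirac {R : ℝ} {τ : ℂ} {ψ φ : Spinor ε} :
    (ψ, φ) ∈ (torusDirac R τ ε).graph ↔ ∀ i, φ i = diracFun R τ ψ i := by
  rw [LinearPMap.mem_graph_iff]
  constructor
  · rintro ⟨y, rfl, rfl⟩ i
    rfl
  · intro h
    have h1 : (φ : Weight ε × Fin 2 → ℂ) = diracFun R τ ψ := funext h
    refine ⟨⟨ψ, ?_⟩, rfl, ?_⟩
    · change Memℓp (diracFun R τ ψ) 2
      rw [← h1]; exact lp.memℓp φ
    · exact Subtype.ext h1.symm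

/-- `x₂ + τ x₃`. -/
def slope (τ : ℂ) (x : Fin 3 → ℝ) : ℂ := x 1 + τ * x 2

/-- `R² x₁² + |x₂ + τ x₃|²`. -/
def energy (R : ℝ) (τ : ℂ) (x : Fin 3 → ℝ) : ℝ := R ^ 2 * x 0 ^ 2 + ‖slope τ x‖ ^ 2

theorem energy_nonneg (R : ℝ) (τ : ℂ) (x : Fin 3 → ℝ) : 0 ≤ energy R τ x := by
  unfold energy; positivity

theorem slope_eq_zero {τ : ℂ} (hτ : τ.im ≠ 0) {x : Fin 3 → ℝ} :
    slope τ x = 0 ↔ x 1 = 0 ∧ x 2 = 0 := by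
  constructor
  · intro h
    have h1 := congrArg Complex.im h
    have h2 := congrArg Complex.re h
    simp [slope] at h1 h2
    have h3 : x 2 = 0 := by rcases h1 with h | h; exact absurd h hτ; exact h
    simp [h3] at h2
    exact ⟨h2, h3⟩
  · rintro ⟨h1, h2⟩; simp [slope, h1, h2]

theorem energy_eq_zero {R : ℝ} (hR : 0 < R) {τ : ℂ} (hτ : τ.im ≠ 0) {x : Fin 3 → ℝ}
    (h : energy R τ x = 0) : x = 0 := by
  have h1 : R ^ 2 * x 0 ^ 2 = 0 := by
    unfold energy at h; nlinarith [sq_nonneg (R * x 0), sq_nonneg ‖slope τ x‖]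
  have h2 : ‖slope τ x‖ ^ 2 = 0 := by unfold energy at h; linarith
  have h3 := (slope_eq_zero hτ).1 (by simpa using h2)
  have h4 : x 0 = 0 := by
    rcases mul_eq_zero.1 h1 with h | h
    · exact absurd h (by positivity)
    · simpa using h
  ext i; fin_cases i
  · exact h4
  · exact h3.1
  · exact h3.2

theorem conj_slope (τ : ℂ) (x : Fin 3 → ℝ) :
    starRingEnd ℂ (slope τ x) = x 1 + starRingEnd ℂ τ * x 2 := by
  simp [slope]

theorem slope_mul_conj (R : ℝ) (τ : ℂ) (x : Fin 3 → ℝ) :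
    slope τ x * starRingEnd ℂ (slope τ x) = energy R τ x - (R * x 0 : ℂ) ^ 2 := by
  rw [Complex.mul_conj, Complex.normSq_eq_norm_sq, energy]; push_cast; ring

theorem exists_energy_ge {R : ℝ} (hR : 0 < R) {τ : ℂ} (hτ : τ.im ≠ 0) :
    ∃ c > 0, ∀ x : Fin 3 → ℝ, c * ‖x‖ ≤ Real.sqrt (energy R τ x) := by
  have hi : 0 < |τ.im| := abs_pos.2 hτ
  set B : ℝ := 1 / R + 1 / |τ.im| + (1 + ‖τ‖ / |τ.im|) with hB
  have hB0 : 0 < B := by positivity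
  refine ⟨B⁻¹, by positivity, fun x => ?_⟩
  rw [inv_mul_le_iff₀ hB0]
  set m := Real.sqrt (energy R τ x) with hm
  have hm0 : 0 ≤ m := Real.sqrt_nonneg _
  have h0 : R * |x 0| ≤ m := by
    apply Real.le_sqrt_of_sq_le
    rw [mul_pow, sq_abs, energy]
    nlinarith [sq_nonneg ‖slope τ x‖]
  have hz : ‖slope τ x‖ ≤ m := by
    apply Real.le_sqrt_of_sq_le
    rw [energy]
    nlinarith [sq_nonneg (R * x 0)]
  have h2 : |τ.im| * |x 2| ≤ m := by
    have : (slope τ x).im = τ.im * x 2 := by simp [slope]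
    rw [← abs_mul, ← this]
    exact (Complex.abs_im_le_norm _).trans hz
  have h0' : |x 0| ≤ 1 / R * m := by
    rw [div_mul_eq_mul_div, one_mul, le_div_iff₀ hR]; linarith
  have h2' : |x 2| ≤ 1 / |τ.im| * m := by
    rw [div_mul_eq_mul_div, one_mul, le_div_iff₀ hi]; linarith
  have h1 : |x 1| ≤ (1 + ‖τ‖ / |τ.im|) * m := by
    have e : (x 1 : ℂ) = slope τ x - τ * x 2 := by simp [slope]
    have : |x 1| ≤ ‖slope τ x‖ + ‖τ‖ * |x 2| := by
      calc |x 1| = ‖(x 1 : ℂ)‖ := by simp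
        _ ≤ _ := by rw [e]; refine (norm_sub_le _ _).trans ?_; simp
    have h3 : ‖τ‖ * |x 2| ≤ ‖τ‖ * (1 / |τ.im| * m) := by gcongr
    calc _ ≤ _ := this
      _ ≤ m + ‖τ‖ * (1 / |τ.im| * m) := by linarith
      _ = _ := by ring
  have e1 : 0 ≤ 1 / R * m := by positivity
  have e2 : 0 ≤ 1 / |τ.im| * m := by positivity
  have e3 : 0 ≤ (1 + ‖τ‖ / |τ.im|) * m := by positivity
  refine (pi_norm_le_iff_of_nonneg (by positivity)).2 fun i => ?_
  rw [Real.norm_eq_abs, hB, add_mul, add_mul]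
  fin_cases i <;> simp only [Fin.zero_eta, Fin.mk_one, Fin.reduceFinMk] <;> linarith

/-- The bijection `n ↦ n + ε` of `ℤ³` with `ℤ³ + ε`. -/
def Weight.ofInt (ε : Fin 3 → Bool) : (Fin 3 → ℤ) ≃ Weight ε where
  toFun n := ⟨fun i => n i + half (ε i), fun i => ⟨n i, rfl⟩⟩
  invFun μ := fun i => ⌊μ.1 i - half (ε i)⌋
  left_inv n := by ext i; simp
  right_inv μ := by
    ext i
    obtain ⟨n, hn⟩ := μ.2 i
    simp [hn]

theorem Weight.ofInt_apply (n : Fin 3 → ℤ) (i : Fin 3) :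
    (Weight.ofInt ε n).1 i = n i + half (ε i) := rfl

theorem half_mem (b : Bool) : |half b| ≤ 1 := by
  cases b <;> norm_num [half]

theorem Weight.norm_ofInt_ge (n : Fin 3 → ℤ) : ‖n‖ - 1 ≤ ‖(Weight.ofInt ε n).1‖ := by
  rw [sub_le_iff_le_add]
  refine (pi_norm_le_iff_of_nonneg (by positivity)).2 fun i => ?_
  have h1 := norm_le_pi_norm (Weight.ofInt ε n).1 i
  rw [Weight.ofInt_apply, Real.norm_eq_abs] at h1
  rw [Int.norm_eq_abs]
  have h2 := abs_sub_abs_le_abs_sub (n i : ℝ) (-half (ε i))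
  rw [sub_neg_eq_add, abs_neg] at h2
  linarith [half_mem (ε i)]

theorem finite_norm_le (C : ℝ) : {n : Fin 3 → ℤ | ‖n‖ ≤ C}.Finite := by
  have := (isCompact_closedBall (0 : Fin 3 → ℤ) C).finite_of_discrete
  refine this.subset fun n hn => ?_
  simpa using hn

/-- The sublevel sets of the energy are finite. -/
theorem finite_energy_le {R : ℝ} (hR : 0 < R) {τ : ℂ} (hτ : τ.im ≠ 0) (ε : Fin 3 → Bool) (C : ℝ) :
    {μ : Weight ε | Real.sqrt (energy R τ μ.1) ≤ C}.Finite := by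
  obtain ⟨c, hc, h⟩ := exists_energy_ge hR hτ
  refine ((finite_norm_le (C / c + 1)).image (Weight.ofInt ε)).subset fun μ hμ => ?_
  refine ⟨(Weight.ofInt ε).symm μ, ?_, by simp⟩
  have h1 := Weight.norm_ofInt_ge (ε := ε) ((Weight.ofInt ε).symm μ)
  rw [Equiv.apply_symm_apply] at h1
  have h2 : ‖μ.1‖ ≤ C / c := by
    rw [le_div_iff₀ hc, mul_comm]
    exact (h μ.1).trans hμ
  change ‖_‖ ≤ _
  linarith

theorem torusEigenvalue_eq (R : ℝ) (τ : ℂ) (x : Fin 3 → ℝ) (s : Fin 2) :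
    torusEigenvalue R τ x s = sgn s * Real.sqrt (energy R τ x) := rfl

section FiberOperators
variable {α : Type*}

/-- The exchange of the two components. -/
def swapOp (α : Type*) : lp (fun _ : α × Fin 2 => ℂ) 2 →L[ℂ] lp (fun _ : α × Fin 2 => ℂ) 2 :=
  (weightedPerm ((Equiv.refl α).prodCongr (Equiv.swap (0 : Fin 2) 1)) (fun _ => 1)
    (fun _ => by simp)).toContinuousLinearEquiv.toContinuousLinearMap

theorem norm_swapOp_le : ‖swapOp α‖ ≤ 1 :=
  ContinuousLinearMap.opNorm_le_bound _ zero_le_one fun ψ => by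
    rw [one_mul]; exact (LinearIsometryEquiv.norm_map _ ψ).le

/-- The operator given by a bounded family of `2 × 2` matrices. -/
def fiberOp (T : α → Matrix (Fin 2) (Fin 2) ℂ) (C : ℝ) (hT : ∀ a s t, ‖T a s t‖ ≤ C) :
    lp (fun _ : α × Fin 2 => ℂ) 2 →L[ℂ] lp (fun _ : α × Fin 2 => ℂ) 2 :=
  diagOp (fun i => T i.1 i.2 i.2) C (fun _ => hT _ _ _) +
    (diagOp (fun i => T i.1 i.2 (Equiv.swap 0 1 i.2)) C (fun _ => hT _ _ _)).comp (swapOp α)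

theorem fiberOp_apply (T : α → Matrix (Fin 2) (Fin 2) ℂ) (C : ℝ) (hT : ∀ a s t, ‖T a s t‖ ≤ C)
    (ψ : lp (fun _ : α × Fin 2 => ℂ) 2) (a : α) (s : Fin 2) :
    fiberOp T C hT ψ (a, s) = ∑ t, T a s t * ψ (a, t) := by
  change T a s s * ψ (a, s) + T a s (Equiv.swap 0 1 s) * (1 * ψ (a, Equiv.swap 0 1 s)) = _
  fin_cases s <;> simp [Fin.sum_univ_two, add_comm]

theorem norm_fiberOp_le (T : α → Matrix (Fin 2) (Fin 2) ℂ) (C : ℝ) (hC : 0 ≤ C)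
    (hT : ∀ a s t, ‖T a s t‖ ≤ C) : ‖fiberOp T C hT‖ ≤ 2 * C := by
  refine (norm_add_le _ _).trans ?_
  have h1 := norm_diagOp_le (fun i : α × Fin 2 => T i.1 i.2 i.2) C hC (fun _ => hT _ _ _)
  have h2 := norm_diagOp_le (fun i : α × Fin 2 => T i.1 i.2 (Equiv.swap 0 1 i.2)) C hC
    (fun _ => hT _ _ _)
  have h3 := ContinuousLinearMap.opNorm_comp_le
    (diagOp (fun i : α × Fin 2 => T i.1 i.2 (Equiv.swap 0 1 i.2)) C (fun _ => hT _ _ _)) (swapOp α)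
  have h4 : ‖diagOp (fun i : α × Fin 2 => T i.1 i.2 (Equiv.swap 0 1 i.2)) C (fun _ => hT _ _ _)‖ *
      ‖swapOp α‖ ≤ C * 1 := by gcongr; exact norm_swapOp_le
  linarith

theorem isCompactOperator_fiberOp (T : α → Matrix (Fin 2) (Fin 2) ℂ) (C : ℝ)
    (hT : ∀ a s t, ‖T a s t‖ ≤ C) (h0 : ∀ δ > 0, {a | ∃ s t, δ ≤ ‖T a s t‖}.Finite) :
    IsCompactOperator (fiberOp T C hT) := by
  have key : ∀ f : Fin 2 → Fin 2, ∀ δ > 0, {i : α × Fin 2 | δ ≤ ‖T i.1 i.2 (f i.2)‖}.Finite := by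
    intro f δ hδ
    refine ((h0 δ hδ).prod (Set.finite_univ (α := Fin 2))).subset ?_
    rintro ⟨a, s⟩ h
    exact ⟨⟨s, _, h⟩, trivial⟩
  exact (isCompactOperator_diagOp _ C (fun _ => hT _ _ _) (key id)).add
    ((isCompactOperator_diagOp _ C (fun _ => hT _ _ _) (key (Equiv.swap 0 1))).comp_clm (swapOp α))

theorem inner_eq_tsum (ψ φ : lp (fun _ : α × Fin 2 => ℂ) 2) :
    inner ℂ ψ φ = ∑' a, (starRingEnd ℂ (ψ (a, 0)) * φ (a, 0) +
      starRingEnd ℂ (ψ (a, 1)) * φ (a, 1)) := by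
  have h : Summable (fun i : α × Fin 2 => inner ℂ (ψ i) (φ i)) := lp.summable_inner ψ φ
  have e : inner ℂ ψ φ = ∑' i : α × Fin 2, inner ℂ (ψ i) (φ i) := lp.inner_eq_tsum ψ φ
  rw [e, h.tsum_prod]
  refine tsum_congr fun a => ?_
  rw [tsum_fintype, Fin.sum_univ_two]
  simp [mul_comm]

end FiberOperators

section Criteria
variable {H : Type*} [NormedAddCommGroup H] [InnerProductSpace ℂ H] [CompleteSpace H]

/-- A symmetric operator such that `D ± i` are surjective is self-adjoint. -/
theorem isSelfAdjoint_of_resolvents (D : H →ₗ.[ℂ] H)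
    (hD : ∀ ψ φ ψ' φ', (ψ, φ) ∈ D.graph → (ψ', φ') ∈ D.graph → inner ℂ φ ψ' = inner ℂ ψ φ')
    (hp : ∀ χ, ∃ ψ, (ψ, χ + I • ψ) ∈ D.graph) (hm : ∀ χ, ∃ ψ, (ψ, χ - I • ψ) ∈ D.graph) :
    IsSelfAdjoint D := by
  have key : ∀ χ : H, (∀ ψ φ, (ψ, φ) ∈ D.graph → inner ℂ χ (φ - I • ψ) = 0) → χ = 0 := by
    intro χ h
    obtain ⟨ψ, hψ⟩ := hp χ
    have := h _ _ hψ
    rw [add_sub_cancel_right] at this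
    exact inner_self_eq_zero.1 this
  have hdense : Dense (D.domain : Set H) := by
    rw [Submodule.dense_iff_topologicalClosure_eq_top, Submodule.topologicalClosure_eq_top_iff,
      Submodule.eq_bot_iff]
    intro φ hφ
    obtain ⟨χ, hχ⟩ := hm φ
    have h1 : χ = 0 := by
      apply key
      intro ψ ψ' hψ
      have h2 := hD _ _ _ _ hχ hψ
      have h3 : inner ℂ φ ψ = 0 := by
        rw [Submodule.mem_orthogonal'] at hφ
        exact hφ ψ (LinearPMap.mem_domain_of_mem_graph hψ)
      rw [inner_sub_left, h3, inner_smul_left] at h2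
      rw [inner_sub_right, ← h2, inner_smul_right]
      simp
    have h2 := LinearPMap.graph_fst_eq_zero_snd _ hχ h1
    simpa [h1] using h2
  rw [LinearPMap.isSelfAdjoint_def]
  symm
  refine LinearPMap.eq_of_le_of_domain_eq ?_ ?_
  · refine LinearPMap.IsFormalAdjoint.le_adjoint hdense fun x y => ?_
    exact hD _ _ _ _ (D.mem_graph x) (D.mem_graph y)
  · refine le_antisymm ?_ fun y hy => ?_
    · exact (LinearPMap.IsFormalAdjoint.le_adjoint hdense fun x y =>
        hD _ _ _ _ (D.mem_graph x) (D.mem_graph y)).1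
    · obtain ⟨x, hx⟩ := hm (D.adjoint ⟨y, hy⟩ + I • y)
      have h1 : y - x = 0 := by
        apply key
        intro ψ φ hψ
        have h2 := hD _ _ _ _ hx hψ
        obtain ⟨u, rfl, rfl⟩ := (LinearPMap.mem_graph_iff D).1 hψ
        have h3 := LinearPMap.adjoint_isFormalAdjoint hdense ⟨y, hy⟩ u
        have h4 : inner ℂ y (D u) = inner ℂ (D.adjoint ⟨y, hy⟩) (u : H) := h3.symm
        rw [inner_sub_left, inner_add_left, inner_smul_left, inner_smul_left] at h2
        rw [inner_sub_left, inner_sub_right, inner_sub_right, inner_smul_right, inner_smul_right,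
          h4, ← h2]
        simp only [Complex.conj_I]
        ring
      rw [sub_eq_zero.1 h1]
      exact LinearPMap.mem_domain_of_mem_graph hx

/-- Self-adjoint operators with their inner products, on the graph. -/
theorem IsSelfAdjoint.inner_graph {D : H →ₗ.[ℂ] H} (hD : IsSelfAdjoint D) {ψ φ ψ' φ' : H}
    (h : (ψ, φ) ∈ D.graph) (h' : (ψ', φ') ∈ D.graph) : inner ℂ φ ψ' = inner ℂ ψ φ' := by
  obtain ⟨x, rfl, rfl⟩ := (LinearPMap.mem_graph_iff D).1 h
  obtain ⟨y, rfl, rfl⟩ := (LinearPMap.mem_graph_iff D).1 h'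
  have h1 := LinearPMap.adjoint_isFormalAdjoint hD.dense_domain
  rw [LinearPMap.isSelfAdjoint_def.1 hD] at h1
  exact h1 x y

end Criteria
section Torus
variable {θ R : ℝ} {τ : ℂ} {ε : Fin 3 → Bool}

theorem hasSum_rep (a : SmoothTorus θ) (ψ : Spinor ε) :
    HasSum (fun k => a.coeff k • shift θ ε k ψ) (SmoothTorus.rep θ ε a ψ) := by
  have h := (SmoothTorus.summable_norm_op (projRep_shift θ ε) a).of_norm.hasSum
  exact h.mapL (ContinuousLinearMap.apply ℂ (Spinor ε) ψ)

theorem rep_monomial (k : Fin 3 → ℤ) :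
    SmoothTorus.rep θ ε (SmoothTorus.monomial θ k) = shift θ ε k := SmoothTorus.op_monomial k

theorem torusConj_torusConj (ψ : Spinor ε) : torusConj ε (torusConj ε ψ) = -ψ := by
  have hneg : ∀ μ : Weight ε, μ.neg.neg = μ := Weight.negEquiv.left_inv
  ext ⟨μ, s⟩
  fin_cases s
  · change torusConj ε (torusConj ε ψ) (μ, 0) = -ψ (μ, 0)
    rw [torusConj_zero, torusConj_one, hneg, Complex.conj_conj]
  · change torusConj ε (torusConj ε ψ) (μ, 1) = -ψ (μ, 1)
    rw [torusConj_one, torusConj_zero, hneg, map_neg, Complex.conj_conj]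

theorem torusConj_symm (ψ : Spinor ε) : (torusConj ε).symm ψ = -torusConj ε ψ := by
  rw [LinearIsometryEquiv.symm_apply_eq, map_neg, torusConj_torusConj, neg_neg]

/-- The operators `J π(x^k) J⁻¹`. -/
theorem conj_shift_apply (k : Fin 3 → ℤ) (ψ : Spinor ε) (μ : Weight ε) (s : Fin 2) :
    torusConj ε (shift θ ε k ((torusConj ε).symm ψ)) (μ, s) = phase θ k μ.1 * ψ (μ.add k, s) := by
  have h1 : (μ.neg.add (-k)).neg = μ.add k := by ext i; simp [Weight.neg, Weight.add]; ring
  have h2 : starRingEnd ℂ (phase θ k μ.neg.1) = phase θ k μ.1 := by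
    simp only [phase, ← Complex.exp_conj, Weight.neg]
    congr 1
    simp
    ring
  rw [torusConj_symm]
  fin_cases s
  · change torusConj ε (shift θ ε k (-torusConj ε ψ)) (μ, 0) = _ * ψ (μ.add k, 0)
    rw [torusConj_zero, shift_apply, lp.coeFn_neg, Pi.neg_apply, torusConj_one, h1]
    simp [h2]
  · change torusConj ε (shift θ ε k (-torusConj ε ψ)) (μ, 1) = _ * ψ (μ.add k, 1)
    rw [torusConj_one, shift_apply, lp.coeFn_neg, Pi.neg_apply, torusConj_zero, h1]
    simp [h2]

/-- An operator which commutes with `J π(x^k) J⁻¹` for all `k` commutes with `J π(b) J⁻¹`. -/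
theorem commute_opposite (T : Spinor ε →L[ℂ] Spinor ε)
    (hT : ∀ k ψ, T (torusConj ε (shift θ ε k ((torusConj ε).symm ψ))) =
      torusConj ε (shift θ ε k ((torusConj ε).symm (T ψ)))) (b : SmoothTorus θ) (ψ : Spinor ε) :
    T (torusConj ε (SmoothTorus.rep θ ε b ((torusConj ε).symm ψ))) =
      torusConj ε (SmoothTorus.rep θ ε b ((torusConj ε).symm (T ψ))) := by
  have h1 := (hasSum_rep b ((torusConj ε).symm ψ)).map (T.toLinearMap.toAddMonoidHom.comp
    (torusConj ε).toLinearEquiv.toLinearMap.toAddMonoidHom)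
    (T.continuous.comp (torusConj ε).continuous)
  have h2 := (hasSum_rep b ((torusConj ε).symm (T ψ))).map
    (torusConj ε).toLinearEquiv.toLinearMap.toAddMonoidHom (torusConj ε).continuous
  refine h1.unique (h2.congr_fun fun k => ?_)
  change T (torusConj ε (_ • _)) = torusConj ε (_ • _)
  rw [LinearIsometryEquiv.map_smulₛₗ, LinearIsometryEquiv.map_smulₛₗ, map_smul, hT]

theorem shift_commute_opposite (k l : Fin 3 → ℤ) (ψ : Spinor ε) :
    shift θ ε k (torusConj ε (shift θ ε l ((torusConj ε).symm ψ))) =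
      torusConj ε (shift θ ε l ((torusConj ε).symm (shift θ ε k ψ))) := by
  ext ⟨μ, s⟩
  have h1 : (μ.add (-k)).add l = (μ.add l).add (-k) := by ext i; simp [Weight.add]; ring
  rw [shift_apply, conj_shift_apply, conj_shift_apply, shift_apply, h1, ← mul_assoc, ← mul_assoc]
  congr 1
  simp only [phase, ← Complex.exp_add, Weight.add]
  congr 1
  push_cast [Pi.neg_apply]
  ring

/-- The bound for the entries of the symbol. -/
theorem norm_symbol_le (x : Fin 3 → ℝ) (s t : Fin 2) :
    ‖symbol R τ x s t‖ ≤ (|R| + 1 + ‖τ‖) * ‖x‖ := by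
  have h0 := norm_le_pi_norm x 0
  have h1 := norm_le_pi_norm x 1
  have h2 := norm_le_pi_norm x 2
  simp only [Real.norm_eq_abs] at h0 h1 h2
  have hx := norm_nonneg x
  have e0 : ‖(R * x 0 : ℂ)‖ ≤ (|R| + 1 + ‖τ‖) * ‖x‖ := by
    rw [norm_mul]; simp only [Complex.norm_real, Real.norm_eq_abs]
    nlinarith [mul_le_mul_of_nonneg_left h0 (abs_nonneg R), mul_nonneg (norm_nonneg τ) hx]
  have e1 : ∀ w : ℂ, ‖w‖ = ‖τ‖ → ‖(x 1 + w * x 2 : ℂ)‖ ≤ (|R| + 1 + ‖τ‖) * ‖x‖ := by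
    intro w hw
    refine (norm_add_le _ _).trans ?_
    rw [norm_mul, hw]; simp only [Complex.norm_real, Real.norm_eq_abs]
    nlinarith [mul_le_mul_of_nonneg_left h2 (norm_nonneg τ), mul_nonneg (abs_nonneg R) hx]
  fin_cases s <;> fin_cases t <;> simp only [symbol, Fin.zero_eta, Fin.mk_one, Matrix.of_apply,
    Matrix.cons_val', Matrix.cons_val_zero, Matrix.cons_val_one, Matrix.cons_val_fin_one]
  · exact e0
  · exact e1 _ rfl
  · exact e1 _ (RCLike.norm_conj τ)
  · rw [norm_neg]; exact e0

/-- A constant matrix, acting on the spinor index. -/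
def constOp (ε : Fin 3 → Bool) (M : Matrix (Fin 2) (Fin 2) ℂ) : Spinor ε →L[ℂ] Spinor ε :=
  fiberOp (fun _ => M) (∑ s, ∑ t, ‖M s t‖) (fun _ s t =>
    (Finset.single_le_sum (f := fun t => ‖M s t‖) (fun _ _ => norm_nonneg _) (Finset.mem_univ t)).trans
    (Finset.single_le_sum (f := fun s => ∑ t, ‖M s t‖) (fun _ _ => by positivity)
      (Finset.mem_univ s)))

theorem constOp_apply (M : Matrix (Fin 2) (Fin 2) ℂ) (ψ : Spinor ε) (μ : Weight ε) (s : Fin 2) :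
    constOp ε M ψ (μ, s) = ∑ t, M s t * ψ (μ, t) := fiberOp_apply _ _ _ _ _ _

theorem norm_constOp_le {M : Matrix (Fin 2) (Fin 2) ℂ} {C : ℝ} (hM : ∀ s t, ‖M s t‖ ≤ C) :
    ‖constOp ε M‖ ≤ 8 * C := by
  refine (norm_fiberOp_le _ _ (by positivity) _).trans ?_
  simp only [Fin.sum_univ_two]
  linarith [hM 0 0, hM 0 1, hM 1 0, hM 1 1]

/-- The closure of the commutator `[D, π(a)]`. -/
def diracCommutator (θ R : ℝ) (τ : ℂ) (ε : Fin 3 → Bool) (a : SmoothTorus θ) :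
    Spinor ε →L[ℂ] Spinor ε :=
  ∑' k, a.coeff k • (constOp ε (symbol R τ fun i => k i)).comp (shift θ ε k)

theorem summable_diracCommutator (a : SmoothTorus θ) :
    Summable fun k => a.coeff k • (constOp ε (symbol R τ fun i => k i)).comp (shift θ ε k) := by
  refine Summable.of_norm (Summable.of_nonneg_of_le (fun k => norm_nonneg _) (fun k => ?_)
    ((a.rapid 1).mul_left (8 * (|R| + 1 + ‖τ‖))))
  have h1 : ‖(fun i => (k i : ℝ))‖ ≤ 1 + ‖k‖ := by
    have : ‖(fun i => (k i : ℝ))‖ ≤ ‖k‖ := by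
      refine (pi_norm_le_iff_of_nonneg (norm_nonneg _)).2 fun i => ?_
      exact (norm_le_pi_norm k i : _)
    linarith
  have h2 : ‖constOp ε (symbol R τ fun i => (k i : ℝ))‖ ≤ 8 * ((|R| + 1 + ‖τ‖) * (1 + ‖k‖)) :=
    norm_constOp_le fun s t => (norm_symbol_le _ s t).trans (by gcongr)
  rw [norm_smul, pow_one]
  have h3 := ContinuousLinearMap.opNorm_comp_le (constOp ε (symbol R τ fun i => (k i : ℝ)))
    (shift θ ε k)
  have h4 : ‖constOp ε (symbol R τ fun i => (k i : ℝ))‖ * ‖shift θ ε k‖ ≤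
      8 * ((|R| + 1 + ‖τ‖) * (1 + ‖k‖)) * 1 :=
    mul_le_mul h2 ((projRep_shift θ ε).norm_le k) (norm_nonneg _) (by positivity)
  calc _ ≤ ‖a.coeff k‖ * (8 * ((|R| + 1 + ‖τ‖) * (1 + ‖k‖)) * 1) := by gcongr; linarith
    _ = _ := by ring

theorem hasSum_diracCommutator (a : SmoothTorus θ) (ψ : Spinor ε) :
    HasSum (fun k => a.coeff k • constOp ε (symbol R τ fun i => k i) (shift θ ε k ψ))
      (diracCommutator θ R τ ε a ψ) :=
  (summable_diracCommutator a).hasSum.mapL (ContinuousLinearMap.apply ℂ (Spinor ε) ψ)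

theorem diracFun_shift (k : Fin 3 → ℤ) (ψ : Spinor ε) (μ : Weight ε) (s : Fin 2) :
    diracFun R τ (shift θ ε k ψ) (μ, s) = phase θ k μ.1 * diracFun R τ ψ (μ.add (-k), s) +
      constOp ε (symbol R τ fun i => k i) (shift θ ε k ψ) (μ, s) := by
  rw [constOp_apply, diracFun, diracFun, Finset.mul_sum, ← Finset.sum_add_distrib]
  refine Finset.sum_congr rfl fun t _ => ?_
  simp only [shift_apply]
  have : symbol R τ μ.1 s t =
      symbol R τ (μ.add (-k)).1 s t + symbol R τ (fun i => (k i : ℝ)) s t := by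
    fin_cases s <;> fin_cases t <;> simp [symbol, Weight.add] <;> ring
  rw [this]
  ring

theorem commutator_mem_graph (a : SmoothTorus θ) {ψ φ : Spinor ε}
    (h : (ψ, φ) ∈ (torusDirac R τ ε).graph) :
    (SmoothTorus.rep θ ε a ψ, SmoothTorus.rep θ ε a φ + diracCommutator θ R τ ε a ψ) ∈
      (torusDirac R τ ε).graph := by
  rw [mem_graph_torusDirac] at h ⊢
  rintro ⟨μ, s⟩
  have h1 := ((hasSum_rep a φ).add (hasSum_diracCommutator (R := R) (τ := τ) a ψ)).mapL
    (coordCLM (μ, s))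
  have h2 : HasSum (fun k => ∑ t, symbol R τ μ.1 s t * (a.coeff k * shift θ ε k ψ (μ, t)))
      (diracFun R τ (SmoothTorus.rep θ ε a ψ) (μ, s)) := by
    refine hasSum_sum fun t _ => HasSum.mul_left _ ?_
    exact (hasSum_rep a ψ).mapL (coordCLM (μ, t))
  refine h1.unique (h2.congr_fun fun k => ?_)
  have h3 : coordCLM (μ, s) (a.coeff k • shift θ ε k φ +
      a.coeff k • constOp ε (symbol R τ fun i => k i) (shift θ ε k ψ)) =
      a.coeff k * (shift θ ε k φ (μ, s) +
        constOp ε (symbol R τ fun i => k i) (shift θ ε k ψ) (μ, s)) := by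
    rw [← smul_add]; rfl
  rw [h3, shift_apply, h, ← diracFun_shift, diracFun, Finset.mul_sum]
  refine Finset.sum_congr rfl fun t _ => ?_
  ring

theorem constOp_commute_opposite (M : Matrix (Fin 2) (Fin 2) ℂ) (l : Fin 3 → ℤ) (ψ : Spinor ε) :
    constOp ε M (torusConj ε (shift θ ε l ((torusConj ε).symm ψ))) =
      torusConj ε (shift θ ε l ((torusConj ε).symm (constOp ε M ψ))) := by
  ext ⟨μ, s⟩
  simp only [constOp_apply, conj_shift_apply, Finset.mul_sum]
  exact Finset.sum_congr rfl fun t _ => by ring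

theorem rep_commute_opposite (a b : SmoothTorus θ) (ψ : Spinor ε) :
    SmoothTorus.rep θ ε a (torusConj ε (SmoothTorus.rep θ ε b ((torusConj ε).symm ψ))) =
      torusConj ε (SmoothTorus.rep θ ε b ((torusConj ε).symm (SmoothTorus.rep θ ε a ψ))) := by
  refine commute_opposite _ (fun l ψ => ?_) b ψ
  have h1 := hasSum_rep a (torusConj ε (shift θ ε l ((torusConj ε).symm ψ)))
  have h2 := (hasSum_rep a ψ).map
    ((torusConj ε).toLinearEquiv.toLinearMap.toAddMonoidHom.comp
      ((shift θ ε l).toLinearMap.toAddMonoidHom.comp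
        (torusConj ε).symm.toLinearEquiv.toLinearMap.toAddMonoidHom))
    ((torusConj ε).continuous.comp ((shift θ ε l).continuous.comp (torusConj ε).symm.continuous))
  refine h1.unique (h2.congr_fun fun k => ?_)
  change _ = torusConj ε (shift θ ε l ((torusConj ε).symm (_ • _)))
  rw [LinearIsometryEquiv.map_smulₛₗ, map_smul, LinearIsometryEquiv.map_smulₛₗ, Complex.conj_conj,
    shift_commute_opposite]

theorem diracCommutator_commute_opposite (a b : SmoothTorus θ) (ψ : Spinor ε) :
    diracCommutator θ R τ ε a (torusConj ε (SmoothTorus.rep θ ε b ((torusConj ε).symm ψ))) =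
      torusConj ε (SmoothTorus.rep θ ε b ((torusConj ε).symm (diracCommutator θ R τ ε a ψ))) := by
  refine commute_opposite _ (fun l ψ => ?_) b ψ
  have h1 := hasSum_diracCommutator (R := R) (τ := τ) a
    (torusConj ε (shift θ ε l ((torusConj ε).symm ψ)))
  have h2 := (hasSum_diracCommutator (R := R) (τ := τ) a ψ).map
    ((torusConj ε).toLinearEquiv.toLinearMap.toAddMonoidHom.comp
      ((shift θ ε l).toLinearMap.toAddMonoidHom.comp
        (torusConj ε).symm.toLinearEquiv.toLinearMap.toAddMonoidHom))
    ((torusConj ε).continuous.comp ((shift θ ε l).continuous.comp (torusConj ε).symm.continuous))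
  refine h1.unique (h2.congr_fun fun k => ?_)
  change _ = torusConj ε (shift θ ε l ((torusConj ε).symm (_ • _)))
  rw [LinearIsometryEquiv.map_smulₛₗ, map_smul, LinearIsometryEquiv.map_smulₛₗ, Complex.conj_conj,
    shift_commute_opposite, constOp_commute_opposite]

theorem conj_mem_graph {ψ φ : Spinor ε} (h : (ψ, φ) ∈ (torusDirac R τ ε).graph) :
    (torusConj ε ψ, torusConj ε φ) ∈ (torusDirac R τ ε).graph := by
  rw [mem_graph_torusDirac] at h ⊢
  rintro ⟨μ, s⟩
  fin_cases s
  · change torusConj ε φ (μ, 0) = diracFun R τ (torusConj ε ψ) (μ, 0)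
    rw [diracFun_zero', torusConj_zero, torusConj_zero, torusConj_one, h, diracFun_one']
    simp [Weight.neg]; ring
  · change torusConj ε φ (μ, 1) = diracFun R τ (torusConj ε ψ) (μ, 1)
    rw [diracFun_one', torusConj_one, torusConj_zero, torusConj_one, h, diracFun_zero']
    simp [Weight.neg]; ring

/-- The matrix `(c - i)⁻¹`. -/
def resolventMatrix (R : ℝ) (τ : ℂ) (x : Fin 3 → ℝ) : Matrix (Fin 2) (Fin 2) ℂ :=
  ((energy R τ x + 1 : ℝ) : ℂ)⁻¹ • (symbol R τ x + I • 1)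

theorem norm_resolventMatrix_le (x : Fin 3 → ℝ) (s t : Fin 2) :
    ‖resolventMatrix R τ x s t‖ ≤ 1 / Real.sqrt (energy R τ x + 1) := by
  have hq := energy_nonneg R τ x
  have hq1 : 0 < energy R τ x + 1 := by linarith
  have hs : 0 < Real.sqrt (energy R τ x + 1) := Real.sqrt_pos.2 hq1
  have e : 1 / Real.sqrt (energy R τ x + 1) =
      (energy R τ x + 1)⁻¹ * Real.sqrt (energy R τ x + 1) := by
    nth_rewrite 2 [← Real.mul_self_sqrt hq1.le]
    field_simp
  rw [e, resolventMatrix, Matrix.smul_apply, norm_smul, norm_inv, Complex.norm_real,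
    Real.norm_of_nonneg hq1.le]
  refine mul_le_mul_of_nonneg_left ?_ (by positivity)
  apply Real.le_sqrt_of_sq_le
  have hx : 0 ≤ R ^ 2 * x 0 ^ 2 := by positivity
  have hz : 0 ≤ ‖slope τ x‖ ^ 2 := by positivity
  fin_cases s <;> fin_cases t <;> simp [symbol, Matrix.add_apply]
  · rw [← Complex.normSq_eq_norm_sq]
    simp [Complex.normSq_apply, energy]; nlinarith
  · change ‖slope τ x‖ ^ 2 ≤ _
    rw [energy]; nlinarith
  · rw [← conj_slope, RCLike.norm_conj, energy]; nlinarith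
  · rw [← Complex.normSq_eq_norm_sq]
    simp [Complex.normSq_apply, energy]; nlinarith

/-- The resolvent `(D - i)⁻¹`. -/
def torusResolvent (R : ℝ) (τ : ℂ) (ε : Fin 3 → Bool) : Spinor ε →L[ℂ] Spinor ε :=
  fiberOp (fun μ => resolventMatrix R τ μ.1) 1 (fun μ s t =>
    (norm_resolventMatrix_le μ.1 s t).trans (by
      rw [div_le_one (Real.sqrt_pos.2 (by linarith [energy_nonneg R τ μ.1]))]
      rw [Real.one_le_sqrt]; linarith [energy_nonneg R τ μ.1]))

theorem torusResolvent_zero (ψ : Spinor ε) (μ : Weight ε) : torusResolvent R τ ε ψ (μ, 0) =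
    ((energy R τ μ.1 + 1 : ℝ) : ℂ)⁻¹ *
      ((R * μ.1 0 + I) * ψ (μ, 0) + slope τ μ.1 * ψ (μ, 1)) := by
  rw [torusResolvent, fiberOp_apply]
  simp [resolventMatrix, symbol, slope]; ring

theorem torusResolvent_one (ψ : Spinor ε) (μ : Weight ε) : torusResolvent R τ ε ψ (μ, 1) =
    ((energy R τ μ.1 + 1 : ℝ) : ℂ)⁻¹ *
      (starRingEnd ℂ (slope τ μ.1) * ψ (μ, 0) + (-(R * μ.1 0) + I) * ψ (μ, 1)) := by
  rw [torusResolvent, fiberOp_apply]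
  simp [resolventMatrix, symbol, slope]; ring

theorem isCompactOperator_torusResolvent (hR : 0 < R) (hτ : τ.im ≠ 0) :
    IsCompactOperator (torusResolvent R τ ε) := by
  refine isCompactOperator_fiberOp _ _ _ fun δ hδ => ?_
  refine (finite_energy_le hR hτ ε (1 / δ)).subset ?_
  rintro μ ⟨s, t, h⟩
  have h1 := h.trans (norm_resolventMatrix_le μ.1 s t)
  have hs : 0 < Real.sqrt (energy R τ μ.1 + 1) :=
    Real.sqrt_pos.2 (by linarith [energy_nonneg R τ μ.1])
  change Real.sqrt _ ≤ _
  calc _ ≤ Real.sqrt (energy R τ μ.1 + 1) := Real.sqrt_le_sqrt (by linarith)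
    _ ≤ 1 / δ := by rw [le_div_iff₀ hδ]; rw [le_div_iff₀ hs] at h1; linarith

theorem energy_add_one_ne (x : Fin 3 → ℝ) : ((energy R τ x + 1 : ℝ) : ℂ) ≠ 0 := by
  have := energy_nonneg R τ x
  exact_mod_cast (by linarith : energy R τ x + 1 ≠ 0)

theorem torusResolvent_mem_graph (ψ : Spinor ε) :
    (torusResolvent R τ ε ψ, ψ + I • torusResolvent R τ ε ψ) ∈ (torusDirac R τ ε).graph := by
  rw [mem_graph_torusDirac]
  rintro ⟨μ, s⟩
  have h0 := energy_add_one_ne (R := R) (τ := τ) μ.1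
  have h1 := slope_mul_conj R τ μ.1
  have e : ((energy R τ μ.1 + 1 : ℝ) : ℂ) = energy R τ μ.1 + 1 := by push_cast; ring
  fin_cases s
  · change ψ (μ, 0) + I * torusResolvent R τ ε ψ (μ, 0) = diracFun R τ _ (μ, 0)
    rw [diracFun_zero', torusResolvent_zero, torusResolvent_one]
    change _ = _ + slope τ μ.1 * _
    field_simp
    rw [e]
    linear_combination (-ψ (μ, 0)) * h1 + ψ (μ, 0) * Complex.I_sq
  · change ψ (μ, 1) + I * torusResolvent R τ ε ψ (μ, 1) = diracFun R τ _ (μ, 1)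
    rw [diracFun_one', torusResolvent_zero, torusResolvent_one, ← conj_slope]
    field_simp
    rw [e]
    linear_combination (-ψ (μ, 1)) * h1 + ψ (μ, 1) * Complex.I_sq

theorem torusDirac_symm {ψ φ ψ' φ' : Spinor ε} (h : (ψ, φ) ∈ (torusDirac R τ ε).graph)
    (h' : (ψ', φ') ∈ (torusDirac R τ ε).graph) : inner ℂ φ ψ' = inner ℂ ψ φ' := by
  rw [mem_graph_torusDirac] at h h'
  rw [inner_eq_tsum, inner_eq_tsum]
  refine tsum_congr fun μ => ?_
  rw [h, h, h', h', diracFun_zero', diracFun_zero', diracFun_one', diracFun_one']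
  simp
  ring

theorem torusResolvent_left_inv {ψ φ : Spinor ε} (h : (ψ, φ) ∈ (torusDirac R τ ε).graph) :
    torusResolvent R τ ε (φ - I • ψ) = ψ := by
  have h1 := torusResolvent_mem_graph (R := R) (τ := τ) (φ - I • ψ)
  have h2 := Submodule.sub_mem _ h1 h
  rw [Prod.mk_sub_mk] at h2
  set χ := torusResolvent R τ ε (φ - I • ψ) - ψ with hχ
  have h3 : φ - I • ψ + I • torusResolvent R τ ε (φ - I • ψ) - φ = I • χ := by
    rw [hχ, smul_sub]; abel
  rw [h3] at h2
  have h4 := torusDirac_symm h2 h2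
  rw [inner_smul_left, inner_smul_right] at h4
  have h5 : inner ℂ χ χ = (0 : ℂ) := by
    have : (2 * I) * inner ℂ χ χ = (0 : ℂ) := by
      simp only [Complex.conj_I] at h4
      linear_combination -h4
    rcases mul_eq_zero.1 this with h | h
    · simp at h
    · exact h
  exact sub_eq_zero.1 (inner_self_eq_zero.1 h5)

theorem isSelfAdjoint_torusDirac (R : ℝ) (τ : ℂ) (ε : Fin 3 → Bool) :
    IsSelfAdjoint (torusDirac R τ ε) := by
  refine isSelfAdjoint_of_resolvents _ (fun _ _ _ _ => torusDirac_symm)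
    (fun χ => ⟨_, torusResolvent_mem_graph χ⟩) fun χ => ?_
  have := conj_mem_graph (torusResolvent_mem_graph (R := R) (τ := τ) ((torusConj ε).symm χ))
  rw [map_add, LinearIsometryEquiv.map_smulₛₗ, LinearIsometryEquiv.apply_symm_apply,
    Complex.conj_I, neg_smul, ← sub_eq_add_neg] at this
  exact ⟨_, this⟩

/-- The flat triples of the torus are real spectral triples. -/
theorem isRealSpectralTriple_flatTorus (θ : ℝ) (hR : 0 < R) (hτ : τ.im ≠ 0) (ε : Fin 3 → Bool) :
    (flatTorus θ R τ ε).IsRealSpectralTriple where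
  selfAdjoint := isSelfAdjoint_torusDirac R τ ε
  compactResolvent := ⟨torusResolvent R τ ε, isCompactOperator_torusResolvent hR hτ,
    torusResolvent_mem_graph, fun _ _ => torusResolvent_left_inv⟩
  conj_conj := torusConj_torusConj
  conj_dirac _ _ := conj_mem_graph
  order_zero := rep_commute_opposite
  order_one a := ⟨diracCommutator θ R τ ε a, fun _ _ => commutator_mem_graph a,
    diracCommutator_commute_opposite a⟩

end Torus

section LinearAlgebra
variable {V : Type*} [AddCommGroup V] [Module ℂ V]

theorem sum_pow_eq_zero_of_primitive {ζ : ℂ} {N : ℕ} (hζ : IsPrimitiveRoot ζ N) {j : ℤ}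
    (hj : ¬ (N : ℤ) ∣ j) : ∑ p ∈ Finset.range N, (ζ ^ j) ^ p = 0 := by
  have h1 : ζ ^ j ≠ 1 := fun h => hj ((hζ.zpow_eq_one_iff_dvd j).1 h)
  have h2 := geom_sum_mul (ζ ^ j) N
  have h3 : (ζ ^ j) ^ N = 1 := by
    rw [← zpow_natCast, ← zpow_mul, mul_comm, zpow_mul, zpow_natCast, hζ.pow_eq_one, one_zpow]
  rw [h3, sub_self] at h2
  exact (mul_eq_zero.1 h2).resolve_right (sub_ne_zero.2 h1)

/-- If `S` has order `N` and an invertible operator multiplies its eigenvalues by a primitive root of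
unity, then the multiplicity of the eigenvalue `1` is the `N`-th part of the dimension. -/
theorem mul_finrank_fixed [FiniteDimensional ℂ V] (S M : V →ₗ[ℂ] V) {ζ : ℂ} {N : ℕ} (hN : 0 < N)
    (hζ : IsPrimitiveRoot ζ N) (hS : S ^ N = 1) (hM : Function.Injective M)
    (hSM : ∀ v, S (M v) = ζ • M (S v)) :
    N * Module.finrank ℂ (LinearMap.ker (S - 1)) = Module.finrank ℂ V := by
  have hN' : (N : ℂ) ≠ 0 := by exact_mod_cast hN.ne'
  let e : V ≃ₗ[ℂ] V := LinearEquiv.ofInjectiveEndo M hM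
  have he : ∀ v, e v = M v := fun v => rfl
  have hpow : ∀ p : ℕ, ∀ v, (S ^ p) (M v) = ζ ^ p • M ((S ^ p) v) := by
    intro p
    induction p with
    | zero => intro v; simp
    | succ p ih => intro v; rw [pow_succ', Module.End.mul_apply, ih, map_smul, hSM, smul_smul]; rfl
  have htr : ∀ p ∈ Finset.range N, p ≠ 0 → LinearMap.trace ℂ V (S ^ p) = 0 := by
    intro p hp hp0
    have h1 : S ^ p = ζ ^ p • e.conj (S ^ p) := by
      ext v
      obtain ⟨w, rfl⟩ := e.surjective v
      simp only [LinearMap.smul_apply, LinearEquiv.conj_apply_apply, LinearEquiv.symm_apply_apply]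
      exact hpow p w
    have h2 := congrArg (LinearMap.trace ℂ V) h1
    rw [map_smul, LinearMap.trace_conj', smul_eq_mul] at h2
    have h3 : ζ ^ p ≠ 1 := hζ.pow_ne_one_of_pos_of_lt hp0 (Finset.mem_range.1 hp)
    have h4 : (ζ ^ p - 1) * LinearMap.trace ℂ V (S ^ p) = 0 := by linear_combination -h2
    exact (mul_eq_zero.1 h4).resolve_left (sub_ne_zero.2 h3)
  let P : V →ₗ[ℂ] V := (N : ℂ)⁻¹ • ∑ p ∈ Finset.range N, S ^ p
  have hSP : ∀ v, S (P v) = P v := by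
    intro v
    have h1 : S * ∑ p ∈ Finset.range N, S ^ p = ∑ p ∈ Finset.range N, S ^ p := by
      have := mul_geom_sum S N
      rw [hS, sub_self, sub_mul, one_mul, sub_eq_zero] at this
      exact this
    change S ((N : ℂ)⁻¹ • (∑ p ∈ Finset.range N, S ^ p) v) = _
    rw [map_smul, ← Module.End.mul_apply, h1]; rfl
  have hP : LinearMap.IsProj (LinearMap.ker (S - 1)) P := by
    constructor
    · intro v
      rw [LinearMap.mem_ker, LinearMap.sub_apply, Module.End.one_apply, hSP, sub_self]
    · intro v hv
      rw [LinearMap.mem_ker, LinearMap.sub_apply, Module.End.one_apply, sub_eq_zero] at hv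
      have h1 : ∀ p : ℕ, (S ^ p) v = v := by
        intro p
        induction p with
        | zero => simp
        | succ p ih => rw [pow_succ, Module.End.mul_apply, hv, ih]
      change (N : ℂ)⁻¹ • (∑ p ∈ Finset.range N, S ^ p) v = v
      rw [LinearMap.sum_apply, Finset.sum_congr rfl (fun p _ => h1 p), Finset.sum_const,
        Finset.card_range, ← Nat.cast_smul_eq_nsmul ℂ, smul_smul, inv_mul_cancel₀ hN', one_smul]
  have h1 := hP.trace
  have h2 : LinearMap.trace ℂ V P = (N : ℂ)⁻¹ * Module.finrank ℂ V := by
    rw [map_smul, map_sum, Finset.sum_eq_single 0 htr (by simp [hN.ne']), pow_zero,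
      LinearMap.trace_one, smul_eq_mul]
  rw [h2] at h1
  have h3 : (N : ℂ) * Module.finrank ℂ (LinearMap.ker (S - 1)) = Module.finrank ℂ V := by
    rw [← h1, mul_inv_cancel_left₀ hN']
  exact_mod_cast h3

end LinearAlgebra

section Eigenspaces
variable {R : ℝ} {τ : ℂ} {ε : Fin 3 → Bool}

/-- The kernel of `c(x) - l`. -/
def symbolEigen (R : ℝ) (τ : ℂ) (x : Fin 3 → ℝ) (l : ℝ) : Submodule ℂ (Fin 2 → ℂ) :=
  LinearMap.ker ((symbol R τ x).mulVecLin - (l : ℂ) • 1)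

theorem mem_symbolEigen {x : Fin 3 → ℝ} {l : ℝ} {v : Fin 2 → ℂ} :
    v ∈ symbolEigen R τ x l ↔ ∀ s, ∑ t, symbol R τ x s t * v t = l * v s := by
  rw [symbolEigen, LinearMap.mem_ker, LinearMap.sub_apply, sub_eq_zero, funext_iff]
  rfl

theorem symbol_mulVec_mulVec (x : Fin 3 → ℝ) (v : Fin 2 → ℂ) :
    (symbol R τ x).mulVec ((symbol R τ x).mulVec v) = (energy R τ x : ℂ) • v := by
  have h1 := slope_mul_conj R τ x
  rw [conj_slope] at h1
  unfold slope at h1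
  ext s
  fin_cases s <;> simp [symbol, Matrix.mulVec, dotProduct, Fin.sum_univ_two]
  · linear_combination (v 0) * h1
  · linear_combination (v 1) * h1

theorem energy_of_mem_symbolEigen {x : Fin 3 → ℝ} {l : ℝ} {v : Fin 2 → ℂ}
    (hv : v ∈ symbolEigen R τ x l) (h0 : v ≠ 0) : Real.sqrt (energy R τ x) = |l| := by
  have h1 : (symbol R τ x).mulVec v = (l : ℂ) • v := funext (mem_symbolEigen.1 hv)
  have h2 := symbol_mulVec_mulVec (R := R) (τ := τ) x v
  rw [h1, Matrix.mulVec_smul, h1, smul_smul] at h2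
  have h3 := smul_left_injective ℂ h0 h2
  have h4 : l * l = energy R τ x := by exact_mod_cast h3
  rw [← h4, Real.sqrt_mul_self_eq_abs]

theorem encard_sign (l : ℝ) :
    Set.encard {s : Fin 2 | sgn s * |l| = l} = if l = 0 then 2 else 1 := by
  split_ifs with h
  · have : {s : Fin 2 | sgn s * |l| = l} = Set.univ := by ext s; simp [h]
    rw [this, Set.encard_univ]; simp
  · rcases lt_or_gt_of_ne h with h | h
    · have : {s : Fin 2 | sgn s * |l| = l} = {1} := by
        ext s; fin_cases s <;> simp [sgn, abs_of_neg h]; linarith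
      rw [this, Set.encard_singleton]
    · have : {s : Fin 2 | sgn s * |l| = l} = {0} := by
        ext s; fin_cases s <;> simp [sgn, abs_of_pos h]; linarith
      rw [this, Set.encard_singleton]

theorem finrank_symbolEigen (hR : 0 < R) (hτ : τ.im ≠ 0) {x : Fin 3 → ℝ} {l : ℝ}
    (h : Real.sqrt (energy R τ x) = |l|) :
    Module.finrank ℂ (symbolEigen R τ x l) = if l = 0 then 2 else 1 := by
  have hsq : (l : ℂ) * l = energy R τ x := by
    have : energy R τ x = l * l := by
      rw [← Real.mul_self_sqrt (energy_nonneg R τ x), h, abs_mul_abs_self]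
    rw [this]; push_cast; ring
  split_ifs with hl
  · subst hl
    have hx : x = 0 := energy_eq_zero hR hτ (by simpa using hsq.symm)
    have : symbolEigen R τ x 0 = ⊤ := by
      rw [eq_top_iff]
      intro v _
      rw [mem_symbolEigen, hx]
      intro s
      fin_cases s <;> simp [symbol]
    rw [this, finrank_top]; simp
  · have hl' : (l : ℂ) ≠ 0 := by exact_mod_cast hl
    have h2 : Module.finrank ℂ (symbolEigen R τ x l) ≤ 2 := by
      simpa using Submodule.finrank_le (symbolEigen R τ x l)
    have h3 : Module.finrank ℂ (symbolEigen R τ x l) ≠ 2 := by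
      intro h3
      have htop : symbolEigen R τ x l = ⊤ :=
        Submodule.eq_top_of_finrank_eq (by rw [h3]; simp)
      have e0 := mem_symbolEigen.1 (htop ▸ Submodule.mem_top : ![1, 0] ∈ symbolEigen R τ x l) 0
      have e1 := mem_symbolEigen.1 (htop ▸ Submodule.mem_top : ![0, 1] ∈ symbolEigen R τ x l) 1
      simp [symbol] at e0 e1
      apply hl'
      linear_combination (-1 / 2) * e0 - (1 / 2) * e1
    have h4 : Module.finrank ℂ (symbolEigen R τ x l) ≠ 0 := by
      intro h4
      have hbot : symbolEigen R τ x l = ⊥ := Submodule.finrank_eq_zero.1 h4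
      have key : ∀ v, (symbol R τ x).mulVec v + (l : ℂ) • v = 0 := by
        intro v
        have : (symbol R τ x).mulVec v + (l : ℂ) • v ∈ symbolEigen R τ x l := by
          rw [mem_symbolEigen]
          have := symbol_mulVec_mulVec (R := R) (τ := τ) x v
          intro s
          change (symbol R τ x).mulVec _ s = _
          rw [Matrix.mulVec_add, Matrix.mulVec_smul, this, ← hsq]
          change l * l * v s + l * (symbol R τ x).mulVec v s =
            l * ((symbol R τ x).mulVec v s + l * v s)
          ring
        rwa [hbot, Submodule.mem_bot] at this
      have e0 := congrFun (key ![1, 0]) 0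
      have e1 := congrFun (key ![0, 1]) 1
      simp [symbol] at e0 e1
      apply hl'
      linear_combination (1 / 2) * e0 + (1 / 2) * e1
    omega

/-- The vectors of the eigenspace of `l` which are supported in the set `P` of weights. -/
def eigenPart (R : ℝ) (τ : ℂ) (ε : Fin 3 → Bool) (P : Weight ε → Prop) (l : ℝ) :
    Submodule ℂ (Spinor ε) where
  carrier := {ψ | ψ ∈ diracEigenspace (torusDirac R τ ε) l ∧ ∀ μ s, ¬ P μ → ψ (μ, s) = 0}
  zero_mem' := ⟨Submodule.zero_mem _, fun _ _ _ => rfl⟩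
  add_mem' := fun {ψ φ} hψ hφ => ⟨Submodule.add_mem _ hψ.1 hφ.1, fun μ s h => by
    rw [lp.coeFn_add, Pi.add_apply, hψ.2 μ s h, hφ.2 μ s h, add_zero]⟩
  smul_mem' := fun c ψ hψ => ⟨Submodule.smul_mem _ _ hψ.1, fun μ s h => by
    rw [lp.coeFn_smul, Pi.smul_apply, hψ.2 μ s h, smul_zero]⟩

theorem mem_eigenPart {P : Weight ε → Prop} {l : ℝ} {ψ : Spinor ε} :
    ψ ∈ eigenPart R τ ε P l ↔
      ψ ∈ diracEigenspace (torusDirac R τ ε) l ∧ ∀ μ s, ¬ P μ → ψ (μ, s) = 0 := Iff.rfl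

theorem mem_diracEigenspace_torus {l : ℝ} {ψ : Spinor ε} :
    ψ ∈ diracEigenspace (torusDirac R τ ε) l ↔
      ∀ μ, (fun s => ψ (μ, s)) ∈ symbolEigen R τ μ.1 l := by
  rw [mem_diracEigenspace, mem_graph_torusDirac]
  simp only [mem_symbolEigen]
  exact ⟨fun h μ s => (h (μ, s)).symm, fun h i => (h i.1 i.2).symm⟩

theorem memℓp_of_finite {ι : Type*} {f : ι → ℂ} (h : f.support.Finite) : Memℓp f 2 :=
  (memℓp_zero h).of_exponent_ge (by norm_num)

/-- An eigenspace is the direct sum of the eigenspaces of the symbol. -/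
def eigenPartEquiv (R : ℝ) (τ : ℂ) (ε : Fin 3 → Bool) (P : Weight ε → Prop) (l : ℝ)
    (hF : {μ : Weight ε | P μ ∧ Real.sqrt (energy R τ μ.1) = |l|}.Finite) :
    eigenPart R τ ε P l ≃ₗ[ℂ]
      ((μ : {μ : Weight ε | P μ ∧ Real.sqrt (energy R τ μ.1) = |l|}) → symbolEigen R τ μ.1.1 l) :=
  LinearEquiv.ofBijective
    { toFun := fun ψ μ => ⟨fun s => ψ.1 (μ.1, s), mem_diracEigenspace_torus.1 ψ.2.1 μ.1⟩
      map_add' := fun ψ φ => rfl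
      map_smul' := fun c ψ => rfl }
    ⟨by
      rw [← LinearMap.ker_eq_bot, LinearMap.ker_eq_bot']
      intro ψ h
      ext ⟨μ, s⟩
      by_contra h0
      have hP : P μ := by
        by_contra hP
        exact h0 (ψ.2.2 μ s hP)
      have h1 := mem_diracEigenspace_torus.1 ψ.2.1 μ
      have h2 := energy_of_mem_symbolEigen h1 (fun h => h0 (congrFun h s))
      have h3 := congrArg (fun f => (f ⟨μ, hP, h2⟩).1 s) h
      exact h0 h3, by
      intro f
      classical
      let g : Weight ε × Fin 2 → ℂ := fun i =>
        if h : P i.1 ∧ Real.sqrt (energy R τ i.1.1) = |l| then (f ⟨i.1, h⟩).1 i.2 else 0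
      have hg : Memℓp g 2 := by
        refine memℓp_of_finite ((hF.prod (Set.finite_univ (α := Fin 2))).subset ?_)
        intro i hi
        refine ⟨?_, trivial⟩
        by_contra h
        exact hi (dif_neg h)
      refine ⟨⟨⟨g, hg⟩, mem_diracEigenspace_torus.2 fun μ => ?_, fun μ s h => ?_⟩, ?_⟩
      · by_cases h : P μ ∧ Real.sqrt (energy R τ μ.1) = |l|
        · have : (fun s => g (μ, s)) = (f ⟨μ, h⟩).1 := funext fun s => dif_pos h
          change (fun s => g (μ, s)) ∈ _
          rw [this]; exact (f ⟨μ, h⟩).2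
        · have : (fun s => g (μ, s)) = 0 := funext fun s => dif_neg h
          change (fun s => g (μ, s)) ∈ _
          rw [this]; exact Submodule.zero_mem _
      · exact dif_neg fun h' => h h'.1
      · ext ⟨μ, h⟩ s
        exact dif_pos h⟩

theorem finite_energy_eq (hR : 0 < R) (hτ : τ.im ≠ 0) (P : Weight ε → Prop) (l : ℝ) :
    {μ : Weight ε | P μ ∧ Real.sqrt (energy R τ μ.1) = |l|}.Finite :=
  (finite_energy_le hR hτ ε |l|).subset fun _ h => h.2.le

theorem finiteDimensional_eigenPart (hR : 0 < R) (hτ : τ.im ≠ 0) (P : Weight ε → Prop) (l : ℝ) :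
    FiniteDimensional ℂ (eigenPart R τ ε P l) := by
  have hF := finite_energy_eq hR hτ P l
  have := hF.fintype
  exact (eigenPartEquiv R τ ε P l hF).symm.finiteDimensional

theorem finrank_eigenPart (hR : 0 < R) (hτ : τ.im ≠ 0) (P : Weight ε → Prop) (l : ℝ) :
    ((Module.finrank ℂ (eigenPart R τ ε P l) : ℕ) : ℕ∞) =
      Set.encard {i : Weight ε × Fin 2 | P i.1 ∧ torusEigenvalue R τ i.1.1 i.2 = l} := by
  have hF := finite_energy_eq hR hτ P l
  have := hF.fintype
  rw [(eigenPartEquiv R τ ε P l hF).finrank_eq, Module.finrank_pi_fintype,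
    Finset.sum_congr rfl fun μ _ => finrank_symbolEigen hR hτ μ.2.2, Finset.sum_const]
  have h1 : {i : Weight ε × Fin 2 | P i.1 ∧ torusEigenvalue R τ i.1.1 i.2 = l} =
      {μ : Weight ε | P μ ∧ Real.sqrt (energy R τ μ.1) = |l|} ×ˢ {s : Fin 2 | sgn s * |l| = l} := by
    ext ⟨μ, s⟩
    simp only [Set.mem_ofPred_eq, Set.mem_prod, torusEigenvalue_eq]
    constructor
    · rintro ⟨h, h'⟩
      have : Real.sqrt (energy R τ μ.1) = |l| := by
        rw [← h', abs_mul, abs_of_nonneg (Real.sqrt_nonneg _)]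
        fin_cases s <;> simp [sgn]
      exact ⟨⟨h, this⟩, by rw [← this]; exact h'⟩
    · rintro ⟨⟨h, h'⟩, h2⟩
      exact ⟨h, by rw [h', h2]⟩
  rw [h1, Set.encard_prod, encard_sign, ← Set.coe_fintypeCard, Finset.card_univ]
  split_ifs <;> simp

theorem eigenPart_true (l : ℝ) :
    eigenPart R τ ε (fun _ => True) l = diracEigenspace (torusDirac R τ ε) l := by
  ext ψ; simp [mem_eigenPart]

theorem finrank_eigenspace_flatTorus (hR : 0 < R) (hτ : τ.im ≠ 0) (l : ℝ) :
    FiniteDimensional ℂ (diracEigenspace (torusDirac R τ ε) l) ∧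
      ((Module.finrank ℂ (diracEigenspace (torusDirac R τ ε) l) : ℕ) : ℕ∞) =
        Set.encard {i : Weight ε × Fin 2 | torusEigenvalue R τ i.1.1 i.2 = l} := by
  rw [← eigenPart_true]
  exact ⟨finiteDimensional_eigenPart hR hτ _ l, by
    rw [finrank_eigenPart hR hτ]; simp⟩

end Eigenspaces

section SymbolAlgebra
variable {R : ℝ} {τ : ℂ}

theorem symbol_add (x y : Fin 3 → ℝ) : symbol R τ (x + y) = symbol R τ x + symbol R τ y := by
  ext s t
  fin_cases s <;> fin_cases t <;> simp [symbol] <;> ring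

theorem symbol_smul (r : ℝ) (x : Fin 3 → ℝ) : symbol R τ (r • x) = r • symbol R τ x := by
  ext s t
  fin_cases s <;> fin_cases t <;> simp [symbol] <;> ring

/-- The symbol as a linear map. -/
def symbolLin (R : ℝ) (τ : ℂ) : (Fin 3 → ℝ) →ₗ[ℝ] Matrix (Fin 2) (Fin 2) ℂ where
  toFun := symbol R τ
  map_add' := symbol_add
  map_smul' := symbol_smul

theorem symbol_sub (x y : Fin 3 → ℝ) : symbol R τ (x - y) = symbol R τ x - symbol R τ y :=
  (symbolLin R τ).map_sub x y

theorem symbol_mul_self (x : Fin 3 → ℝ) :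
    symbol R τ x * symbol R τ x = (energy R τ x : ℂ) • 1 := by
  refine Matrix.ext_of_mulVec_single fun j => ?_
  rw [← Matrix.mulVec_mulVec, symbol_mulVec_mulVec, Matrix.smul_mulVec, Matrix.one_mulVec]

/-- Matrices which commute with the symbols are scalar. -/
theorem scalar_of_commute_symbol (hR : 0 < R) {M : Matrix (Fin 2) (Fin 2) ℂ}
    (h : ∀ x, M * symbol R τ x = symbol R τ x * M) : M = M 0 0 • 1 := by
  have hR' : (R : ℂ) ≠ 0 := by exact_mod_cast hR.ne'
  have h0 := h ![1, 0, 0]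
  have h1 := h ![0, 1, 0]
  have a := congrFun (congrFun h0 0) 1
  have b := congrFun (congrFun h0 1) 0
  have c := congrFun (congrFun h1 0) 1
  simp [symbol, Matrix.mul_apply, Fin.sum_univ_two] at a b c
  have a' : M 0 1 = 0 := by
    have : (2 * R) * M 0 1 = 0 := by linear_combination -a
    simpa [hR'] using this
  have b' : M 1 0 = 0 := by
    have : (2 * R) * M 1 0 = 0 := by linear_combination b
    simpa [hR'] using this
  ext s t
  fin_cases s <;> fin_cases t <;> simp [a', b', c]

end SymbolAlgebra

section Intertwiners
variable {θ R : ℝ} {τ : ℂ} {ε ε' : Fin 3 → Bool}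

theorem Weight.ext' {μ ν : Weight ε} (h : ∀ i, μ.1 i = ν.1 i) : μ = ν := Subtype.ext (funext h)

theorem shift_ket (k : Fin 3 → ℤ) (μ : Weight ε) (s : Fin 2) :
    shift θ ε k (ket (μ, s)) = phase θ k (μ.add k).1 • ket (μ.add k, s) := by
  classical
  ext ⟨ν, t⟩
  have h1 : (ν.add (-k), t) = (μ, s) ↔ (ν, t) = (μ.add k, s) := by
    constructor
    · intro h
      have e1 : ν.add (-k) = μ := congrArg Prod.fst h
      have e2 : t = s := congrArg Prod.snd h
      rw [← e1, e2]; congr 1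
      exact Weight.ext' fun i => by simp [Weight.add]
    · intro h
      have e1 : ν = μ.add k := congrArg Prod.fst h
      have e2 : t = s := congrArg Prod.snd h
      rw [e1, e2]; congr 1
      exact Weight.ext' fun i => by simp [Weight.add]
  rw [shift_apply, lp.coeFn_smul, Pi.smul_apply, ket_apply, ket_apply, smul_eq_mul]
  simp only [h1]
  split_ifs with h
  · have : ν = μ.add k := congrArg Prod.fst h
    rw [this]
  · simp

theorem dirac_ket_mem (μ : Weight ε) (t : Fin 2) :
    (ket (μ, t), ∑ u, symbol R τ μ.1 u t • ket (μ, u)) ∈ (torusDirac R τ ε).graph := by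
  classical
  rw [mem_graph_torusDirac]
  rintro ⟨ν, s⟩
  rw [lp.coeFn_sum, Finset.sum_apply, diracFun]
  simp only [lp.coeFn_smul, Pi.smul_apply, ket_apply, smul_eq_mul, Prod.mk.injEq]
  by_cases h : ν = μ
  · subst h; simp
  · simp [h]

/-- The `2 × 2` blocks of an operator. -/
def block (T : Spinor ε →L[ℂ] Spinor ε') (ν : Weight ε') (μ : Weight ε) :
    Matrix (Fin 2) (Fin 2) ℂ := Matrix.of fun s t => T (ket (μ, t)) (ν, s)

theorem block_apply (T : Spinor ε →L[ℂ] Spinor ε') (ν : Weight ε') (μ : Weight ε) (s t : Fin 2) :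
    block T ν μ s t = T (ket (μ, t)) (ν, s) := rfl

/-- The operators which intertwine the Dirac operators. -/
def IntertwinesDirac (R : ℝ) (τ : ℂ) (T : Spinor ε →L[ℂ] Spinor ε') : Prop :=
  ∀ ψ φ, (ψ, φ) ∈ (torusDirac R τ ε).graph → (T ψ, T φ) ∈ (torusDirac R τ ε').graph

theorem IntertwinesDirac.block {T : Spinor ε →L[ℂ] Spinor ε'} (h : IntertwinesDirac R τ T)
    (ν : Weight ε') (μ : Weight ε) :
    block T ν μ * symbol R τ μ.1 = symbol R τ ν.1 * block T ν μ := by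
  ext s t
  have h1 := mem_graph_torusDirac.1 (h _ _ (dirac_ket_mem μ t)) (ν, s)
  rw [map_sum, lp.coeFn_sum, Finset.sum_apply] at h1
  simp only [map_smul, lp.coeFn_smul, Pi.smul_apply, smul_eq_mul] at h1
  rw [Matrix.mul_apply, Matrix.mul_apply]
  simp only [block_apply]
  change _ = diracFun R τ (T (ket (μ, t))) (ν, s)
  rw [← h1]
  exact Finset.sum_congr rfl fun u _ => mul_comm _ _

/-- Operators that commute with the shifts up to a linear substitution. -/
structure IntertwinesShift (θ : ℝ) (L : (Fin 3 → ℝ) →ₗ[ℝ] (Fin 3 → ℝ))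
    (α : (Fin 3 → ℤ) → (Fin 3 → ℤ)) (χ : (Fin 3 → ℤ) → ℂ)
    (T : Spinor ε →L[ℂ] Spinor ε') : Prop where
  lin : ∀ k i, ((α k i : ℤ) : ℝ) = L (fun j => (k j : ℝ)) i
  shift : ∀ k ψ, T (shift θ ε k ψ) = χ k • shift θ ε' (α k) (T ψ)
  ne_zero : ∀ k, χ k ≠ 0

variable {L : (Fin 3 → ℝ) →ₗ[ℝ] (Fin 3 → ℝ)} {α : (Fin 3 → ℤ) → (Fin 3 → ℤ)}
  {χ : (Fin 3 → ℤ) → ℂ}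

theorem IntertwinesShift.block_add {T : Spinor ε →L[ℂ] Spinor ε'}
    (h : IntertwinesShift θ L α χ T) (k : Fin 3 → ℤ) (ν : Weight ε') (μ : Weight ε) :
    phase θ k (μ.add k).1 • block T (ν.add (α k)) (μ.add k) =
      (χ k * phase θ (α k) (ν.add (α k)).1) • block T ν μ := by
  ext s t
  have h1 := congrArg (fun ψ : Spinor ε' => ψ (ν.add (α k), s)) (h.shift k (ket (μ, t)))
  simp only [shift_ket, map_smul, lp.coeFn_smul, Pi.smul_apply, smul_eq_mul, shift_apply] at h1
  have h2 : (ν.add (α k)).add (-(α k)) = ν := Weight.ext' fun i => by simp [Weight.add]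
  rw [h2] at h1
  simp only [Matrix.smul_apply, block_apply, smul_eq_mul]
  rw [h1, mul_assoc]

theorem IntertwinesShift.block_mul {T : Spinor ε →L[ℂ] Spinor ε'}
    (h : IntertwinesShift θ L α χ T) (hD : IntertwinesDirac R τ T) (ν : Weight ε') (μ : Weight ε)
    (x : Fin 3 → ℝ) : block T ν μ * symbol R τ x = symbol R τ (L x) * block T ν μ := by
  have key : ∀ k : Fin 3 → ℤ, block T ν μ * symbol R τ (fun i => (k i : ℝ)) =
      symbol R τ (L fun i => (k i : ℝ)) * block T ν μ := by
    intro k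
    have h1 := congrArg (fun M => phase θ k (μ.add k).1 • M) (hD.block (ν.add (α k)) (μ.add k))
    rw [← Matrix.smul_mul, ← Matrix.mul_smul, h.block_add, Matrix.smul_mul, Matrix.mul_smul] at h1
    have hne : χ k * phase θ (α k) (ν.add (α k)).1 ≠ 0 :=
      mul_ne_zero (h.ne_zero k) (exp_ne_zero _)
    have h2 := smul_right_injective _ hne h1
    have e1 : (μ.add k).1 = μ.1 + fun i => (k i : ℝ) := rfl
    have e2 : (ν.add (α k)).1 = ν.1 + L fun i => (k i : ℝ) := by
      ext i
      change ν.1 i + (α k i : ℝ) = _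
      rw [h.lin]; rfl
    rw [e1, e2, symbol_add, symbol_add, Matrix.mul_add, Matrix.add_mul, hD.block] at h2
    exact add_left_cancel h2
  let f : (Fin 3 → ℝ) →ₗ[ℝ] Matrix (Fin 2) (Fin 2) ℂ :=
    (LinearMap.mulLeft ℝ (block T ν μ)).comp (symbolLin R τ) -
      (LinearMap.mulRight ℝ (block T ν μ)).comp ((symbolLin R τ).comp L)
  have hf : f = 0 := by
    refine LinearMap.pi_ext' fun i => LinearMap.ext_ring ?_
    have e : (Pi.single i (1 : ℝ) : Fin 3 → ℝ) = fun j => (((Pi.single i 1 : Fin 3 → ℤ) j : ℤ) : ℝ) := by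
      ext j; by_cases h : j = i
      · subst h; simp
      · simp [h]
    change block T ν μ * symbol R τ (Pi.single i 1) - symbol R τ (L (Pi.single i 1)) * block T ν μ = 0
    rw [e, key, sub_self]
  have := LinearMap.congr_fun hf x
  exact sub_eq_zero.1 this

theorem IntertwinesShift.block_eq_zero {T : Spinor ε →L[ℂ] Spinor ε'}
    (h : IntertwinesShift θ L α χ T) (hD : IntertwinesDirac R τ T) (hR : 0 < R) (hτ : τ.im ≠ 0)
    {ν : Weight ε'} {μ : Weight ε} (hne : ν.1 ≠ L μ.1) : block T ν μ = 0 := by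
  have h1 : symbol R τ (ν.1 - L μ.1) * block T ν μ = 0 := by
    rw [symbol_sub, Matrix.sub_mul, ← hD.block, h.block_mul hD, sub_self]
  have h2 := congrArg (fun M => symbol R τ (ν.1 - L μ.1) * M) h1
  simp only [← Matrix.mul_assoc, symbol_mul_self, Matrix.smul_mul, Matrix.one_mul,
    Matrix.mul_zero] at h2
  refine (smul_eq_zero.1 h2).resolve_left fun h3 => hne ?_
  exact sub_eq_zero.1 (energy_eq_zero hR hτ (by exact_mod_cast h3))

/-- The operators that commute with the algebra of the torus and with the Dirac operator. -/
structure Intertwines (θ R : ℝ) (τ : ℂ) (T : Spinor ε →L[ℂ] Spinor ε') : Prop where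
  shift : ∀ k ψ, T (shift θ ε k ψ) = shift θ ε' k (T ψ)
  dirac : IntertwinesDirac R τ T

theorem Intertwines.intertwinesShift {T : Spinor ε →L[ℂ] Spinor ε'} (h : Intertwines θ R τ T) :
    IntertwinesShift θ LinearMap.id id (fun _ => 1) T where
  lin _ _ := rfl
  shift k ψ := by rw [one_smul]; exact h.shift k ψ
  ne_zero _ := one_ne_zero

theorem Weight.spin_eq {μ : Weight ε} {ν : Weight ε'} (h : ν.1 = μ.1) : ε = ε' := by
  ext1 i
  obtain ⟨m, hm⟩ := μ.2 i
  obtain ⟨n, hn⟩ := ν.2 i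
  rw [h, hm] at hn
  cases h1 : ε i <;> cases h2 : ε' i <;> simp [h1, h2, half] at hn ⊢
  · have h3 : ((2 * m : ℤ) : ℝ) = ((2 * n + 1 : ℤ) : ℝ) := by push_cast; linarith
    have := Int.cast_injective h3
    omega
  · have h3 : ((2 * m + 1 : ℤ) : ℝ) = ((2 * n : ℤ) : ℝ) := by push_cast; linarith
    have := Int.cast_injective h3
    omega

theorem Intertwines.eq_zero {T : Spinor ε →L[ℂ] Spinor ε'} (h : Intertwines θ R τ T)
    (hR : 0 < R) (hτ : τ.im ≠ 0) (hε : ε ≠ ε') : T = 0 := by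
  refine ext_ket fun ⟨μ, t⟩ => ?_
  ext ⟨ν, s⟩
  have := h.intertwinesShift.block_eq_zero h.dirac hR hτ (ν := ν) (μ := μ)
    fun h => hε (Weight.spin_eq h)
  exact congrFun (congrFun this s) t

theorem Intertwines.eq_smul {T : Spinor ε →L[ℂ] Spinor ε} (h : Intertwines θ R τ T)
    (hR : 0 < R) (hτ : τ.im ≠ 0) : ∃ c : ℂ, T = c • 1 := by
  classical
  let μ₀ : Weight ε := Weight.ofInt ε 0
  refine ⟨block T μ₀ μ₀ 0 0, ext_ket fun ⟨μ, t⟩ => ?_⟩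
  ext ⟨ν, s⟩
  rw [smul_apply, one_apply_eq_self, lp.coeFn_smul, Pi.smul_apply,
    ket_apply, smul_eq_mul, ← block_apply]
  by_cases hν : ν = μ
  · subst hν
    have h1 := scalar_of_commute_symbol hR (h.intertwinesShift.block_mul h.dirac μ₀ μ₀)
    have h2 : ν = μ₀.add ((Weight.ofInt ε).symm ν) := by
      obtain ⟨n, rfl⟩ := (Weight.ofInt ε).surjective ν
      refine Weight.ext' fun i => ?_
      rw [Equiv.symm_apply_apply]
      simp [Weight.ofInt_apply, Weight.add, μ₀]; ring
    have h3 := h.intertwinesShift.block_add ((Weight.ofInt ε).symm ν) μ₀ μ₀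
    simp only [id, ← h2, one_mul] at h3
    have h4 := smul_right_injective _ (show phase θ ((Weight.ofInt ε).symm ν) ν.1 ≠ 0 from
      exp_ne_zero _) h3
    rw [h4, h1]
    by_cases hs : s = t
    · subst hs; simp
    · simp [hs]
  · rw [h.intertwinesShift.block_eq_zero h.dirac hR hτ (fun h => hν (Subtype.ext h))]
    simp [hν]

end Intertwiners

section Projections
variable {H : Type*} [NormedAddCommGroup H] [InnerProductSpace ℂ H] [CompleteSpace H]

theorem starProjection_commute (K : Submodule ℂ H) [K.HasOrthogonalProjection] (T : H →L[ℂ] H)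
    (h : ∀ ψ ∈ K, T ψ ∈ K) (h' : ∀ ψ ∈ K, star T ψ ∈ K) (ψ : H) :
    K.starProjection (T ψ) = T (K.starProjection ψ) := by
  refine Submodule.eq_starProjection_of_mem_of_inner_eq_zero (h _ (Submodule.starProjection_apply_mem K ψ)) fun χ hχ => ?_
  rw [← map_sub, ← ContinuousLinearMap.adjoint_inner_right]
  exact Submodule.starProjection_inner_eq_zero ψ _ (h' χ hχ)

theorem ReducesOperator.starProjection {D : H →ₗ.[ℂ] H} {K : Submodule ℂ H}
    [K.HasOrthogonalProjection] (h : ReducesOperator D K) {ψ φ : H} (hψ : (ψ, φ) ∈ D.graph) :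
    (K.starProjection ψ, K.starProjection φ) ∈ D.graph := by
  obtain ⟨⟨χ, hχ, h1⟩, χ', hχ', h2⟩ := h (K.starProjection ψ)
    (Submodule.starProjection_apply_mem K ψ) (ψ - K.starProjection ψ)
    (Submodule.sub_starProjection_mem_orthogonal ψ) (by
      rw [add_sub_cancel]; exact LinearPMap.mem_domain_of_mem_graph hψ)
  have h3 := Submodule.add_mem _ h1 h2
  rw [Prod.mk_add_mk, add_sub_cancel] at h3
  have h4 : φ = χ + χ' := LinearPMap.mem_graph_snd_inj _ hψ h3 rfl
  have h5 : K.starProjection φ = χ := by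
    rw [h4, map_add, (Submodule.starProjection_eq_self_iff).2 hχ,
      (Submodule.starProjection_apply_eq_zero_iff K).2 hχ', add_zero]
  rw [h5]; exact h1

theorem reducesOperator_of_starProjection {D : H →ₗ.[ℂ] H} {K : Submodule ℂ H}
    [K.HasOrthogonalProjection]
    (h : ∀ ψ φ, (ψ, φ) ∈ D.graph → (K.starProjection ψ, K.starProjection φ) ∈ D.graph) :
    ReducesOperator D K := by
  intro ψ hψ φ hφ hd
  have h1 := D.mem_graph ⟨ψ + φ, hd⟩
  have h2 := h _ _ h1
  have h3 : K.starProjection (ψ + φ) = ψ := by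
    rw [map_add, (Submodule.starProjection_eq_self_iff).2 hψ,
      (Submodule.starProjection_apply_eq_zero_iff K).2 hφ, add_zero]
  have h4 := Submodule.sub_mem _ h1 h2
  simp only [h3] at h2
  simp only [Prod.mk_sub_mk, h3, add_sub_cancel_left] at h4
  exact ⟨⟨_, Submodule.starProjection_apply_mem K _, h2⟩,
    _, Submodule.sub_starProjection_mem_orthogonal _, h4⟩

end Projections

section Torus
variable {θ R : ℝ} {τ : ℂ} {ε : Fin 3 → Bool}

theorem intertwines_of_rep {ε' : Fin 3 → Bool} {T : Spinor ε →L[ℂ] Spinor ε'}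
    (h : ∀ a ψ, T (SmoothTorus.rep θ ε a ψ) = SmoothTorus.rep θ ε' a (T ψ))
    (hD : IntertwinesDirac R τ T) : Intertwines θ R τ T where
  shift k ψ := by
    have := h (SmoothTorus.monomial θ k) ψ
    rwa [rep_monomial, rep_monomial] at this
  dirac := hD

/-- The flat triples of the torus have no proper subspaces invariant under the algebra and `D`. -/
theorem isDiracIrreducible_flatTorus (θ : ℝ) (hR : 0 < R) (hτ : τ.im ≠ 0) (ε : Fin 3 → Bool) :
    (flatTorus θ R τ ε).IsDiracIrreducible := by
  refine ⟨⟨ket (Weight.ofInt ε 0, 0), 0, ket_ne_zero _⟩, fun L hL hrep hD => ?_⟩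
  have : CompleteSpace L := hL.completeSpace_coe
  have h1 : Intertwines θ R τ L.starProjection := by
    refine intertwines_of_rep (fun a ψ => ?_) fun ψ φ h => hD.starProjection h
    refine starProjection_commute L _ (hrep a) (fun ψ hψ => ?_) ψ
    rw [← map_star]
    exact hrep (star a) ψ hψ
  obtain ⟨c, hc⟩ := h1.eq_smul hR hτ
  by_cases hc0 : c = 0
  · left
    rw [Submodule.eq_bot_iff]
    intro ψ hψ
    rw [← (Submodule.starProjection_eq_self_iff).2 hψ, hc, hc0]
    simp
  · right
    rw [eq_top_iff]
    intro ψ _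
    have h2 := Submodule.starProjection_apply_mem L ψ
    rw [hc] at h2
    exact (Submodule.smul_mem_iff L hc0).1 h2

/-- The implementation of the action of `U(1)³` on the spinors. -/
def gaugeUnitary (ε : Fin 3 → Bool) (t : Fin 3 → ℝ) : Spinor ε ≃ₗᵢ[ℂ] Spinor ε :=
  weightedPerm (Equiv.refl _) (fun i => exp (((2 * Real.pi * ∑ j, t j * i.1.1 j : ℝ) : ℂ) * I))
    (fun _ => norm_exp_ofReal_mul_I _)

theorem gaugeUnitary_apply (t : Fin 3 → ℝ) (ψ : Spinor ε) (i : Weight ε × Fin 2) :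
    gaugeUnitary ε t ψ i = exp (((2 * Real.pi * ∑ j, t j * i.1.1 j : ℝ) : ℂ) * I) * ψ i := rfl

theorem continuous_gaugeUnitary (ψ : Spinor ε) : Continuous fun t => gaugeUnitary ε t ψ := by
  refine continuous_of_uniform_approx_of_continuous fun u hu => ?_
  obtain ⟨δ, hδ, hδu⟩ := Metric.mem_uniformity_dist.1 hu
  have h1 := hasSum_ket ψ
  obtain ⟨s, hs⟩ := ((Metric.tendsto_nhds.1 h1) δ hδ).exists
  refine ⟨fun t => ∑ i ∈ s, ψ i • exp (((2 * Real.pi * ∑ j, t j * i.1.1 j : ℝ) : ℂ) * I) • ket i,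
    ?_, fun t => hδu ?_⟩
  · fun_prop
  · have h2 : ∑ i ∈ s, ψ i • exp (((2 * Real.pi * ∑ j, t j * i.1.1 j : ℝ) : ℂ) * I) • ket i =
        gaugeUnitary ε t (∑ i ∈ s, ψ i • ket i) := by
      classical
      rw [map_sum]
      refine Finset.sum_congr rfl fun i _ => ?_
      rw [map_smul]
      congr 1
      ext j
      rw [gaugeUnitary_apply, lp.coeFn_smul, Pi.smul_apply, ket_apply]
      split_ifs with h
      · rw [h]; rfl
      · simp
    change dist _ (∑ i ∈ s, ψ i • exp (((2 * Real.pi * ∑ j, t j * i.1.1 j : ℝ) : ℂ) * I) • ket i) < δ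
    rw [h2, LinearIsometryEquiv.dist_map, dist_comm]
    exact hs

theorem isTorusEquivariant_flatTorus (θ R : ℝ) (τ : ℂ) (ε : Fin 3 → Bool) :
    IsTorusEquivariant (flatTorus θ R τ ε) := by
  refine ⟨{ toFun := fun t => gaugeUnitary ε (Multiplicative.toAdd t), map_one' := ?_,
            map_mul' := ?_ }, continuous_gaugeUnitary, ?_, ?_, ?_, ?_⟩
  · ext ψ i
    change gaugeUnitary ε 0 ψ i = ψ i
    simp [gaugeUnitary_apply]
  · intro t u
    ext ψ i
    change gaugeUnitary ε (Multiplicative.toAdd t + Multiplicative.toAdd u) ψ i =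
      gaugeUnitary ε (Multiplicative.toAdd t) (gaugeUnitary ε (Multiplicative.toAdd u) ψ) i
    rw [gaugeUnitary_apply, gaugeUnitary_apply, gaugeUnitary_apply, ← mul_assoc, ← exp_add]
    congr 2
    simp only [Fin.sum_univ_three, Pi.add_apply]
    push_cast; ring
  · intro n
    ext ψ i
    change gaugeUnitary ε (fun i => 2 * (n i : ℝ)) ψ i = ψ i
    choose m hm using i.1.2
    rw [gaugeUnitary_apply]
    have h1 : ∀ b : Bool, ∃ p : ℤ, 2 * half b = p := by
      intro b; cases b
      · exact ⟨0, by simp [half]⟩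
      · exact ⟨1, by simp [half]⟩
    choose p hp using h1
    have h2 : (((2 * Real.pi * ∑ j, 2 * (n j : ℝ) * i.1.1 j : ℝ) : ℂ) * I) =
        ((∑ j, n j * (2 * m j + p (ε j)) : ℤ) : ℂ) * (2 * Real.pi * I) := by
      have : ∑ j, 2 * (n j : ℝ) * i.1.1 j = ((∑ j, n j * (2 * m j + p (ε j)) : ℤ) : ℝ) := by
        push_cast
        refine Finset.sum_congr rfl fun j _ => ?_
        rw [hm, ← hp]; ring
      rw [this]; push_cast; ring
    rw [h2, exp_int_mul_two_pi_mul_I, one_mul]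
  · intro t a ψ
    ext ⟨μ, s⟩
    have h1 := ((hasSum_rep a ψ).mapL (coordCLM (μ, s))).mul_left
      (exp (((2 * Real.pi * ∑ j, t j * μ.1 j : ℝ) : ℂ) * I))
    have h2 := (hasSum_rep (torusGauge θ t a) (gaugeUnitary ε t ψ)).mapL (coordCLM (μ, s))
    refine h1.unique (h2.congr_fun fun k => ?_)
    change _ * (a.coeff k * (phase θ k μ.1 * ψ (μ.add (-k), s))) = (exp _ * a.coeff k) *
      (phase θ k μ.1 * (exp (((2 * Real.pi * ∑ j, t j * (μ.add (-k)).1 j : ℝ) : ℂ) * I) *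
        ψ (μ.add (-k), s)))
    have e : exp (((2 * Real.pi * ∑ j, t j * μ.1 j : ℝ) : ℂ) * I) =
        exp (((2 * Real.pi * ∑ j, t j * k j : ℝ) : ℂ) * I) *
        exp (((2 * Real.pi * ∑ j, t j * (μ.add (-k)).1 j : ℝ) : ℂ) * I) := by
      rw [← exp_add]
      congr 1
      simp only [Fin.sum_univ_three, Weight.add, Pi.neg_apply]
      push_cast; ring
    rw [e]; ring
  · intro t ψ φ h
    change (ψ, φ) ∈ (torusDirac R τ ε).graph at h
    change _ ∈ (torusDirac R τ ε).graph
    rw [mem_graph_torusDirac] at h ⊢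
    rintro ⟨μ, s⟩
    change gaugeUnitary ε (Multiplicative.toAdd t) φ (μ, s) =
      diracFun R τ (gaugeUnitary ε (Multiplicative.toAdd t) ψ) (μ, s)
    rw [gaugeUnitary_apply, h, diracFun, diracFun, Finset.mul_sum]
    refine Finset.sum_congr rfl fun u _ => ?_
    rw [gaugeUnitary_apply]; ring
  · intro t ψ
    ext ⟨μ, s⟩
    have e : starRingEnd ℂ (exp (((2 * Real.pi *
        ∑ j, Multiplicative.toAdd t j * -μ.1 j : ℝ) : ℂ) * I)) =
        exp (((2 * Real.pi * ∑ j, Multiplicative.toAdd t j * μ.1 j : ℝ) : ℂ) * I) := by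
      rw [← Complex.exp_conj]
      congr 1
      simp [map_ofNat]
    change gaugeUnitary ε (Multiplicative.toAdd t) (torusConj ε ψ) (μ, s) =
      torusConj ε (gaugeUnitary ε (Multiplicative.toAdd t) ψ) (μ, s)
    fin_cases s
    · change _ = torusConj ε (gaugeUnitary ε (Multiplicative.toAdd t) ψ) (μ, 0)
      rw [torusConj_zero, gaugeUnitary_apply, gaugeUnitary_apply, map_mul]
      change _ * torusConj ε ψ (μ, 0) = -(starRingEnd ℂ (exp (((2 * Real.pi *
        ∑ j, Multiplicative.toAdd t j * -μ.1 j : ℝ) : ℂ) * I)) * _)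
      rw [torusConj_zero, e]; ring
    · change _ = torusConj ε (gaugeUnitary ε (Multiplicative.toAdd t) ψ) (μ, 1)
      rw [torusConj_one, gaugeUnitary_apply, gaugeUnitary_apply, map_mul]
      change _ * torusConj ε ψ (μ, 1) = starRingEnd ℂ (exp (((2 * Real.pi *
        ∑ j, Multiplicative.toAdd t j * -μ.1 j : ℝ) : ℂ) * I)) * _
      rw [torusConj_one, e]

end Torus

theorem clm_mul_apply {H : Type*} [NormedAddCommGroup H] [NormedSpace ℂ H] (S T : H →L[ℂ] H) (ψ : H) :
    (S * T) ψ = S (T ψ) := rfl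

namespace Bieb

theorem order_pos (b : Bieb) : 0 < b.order := by cases b <;> simp [order]

theorem order_cast_ne (b : Bieb) : (b.order : ℂ) ≠ 0 := by exact_mod_cast b.order_pos.ne'

theorem lin_iterate_order {A : Type*} [CommRing A] (b : Bieb) (x : Fin 3 → A) :
    b.lin^[b.order] x = x := by
  cases b
  · have h : ∀ y : Fin 3 → A, B2.lin y = ![y 0, -y 1, -y 2] := fun y => by simp [lin, matrix]
    change B2.lin (B2.lin x) = x
    ext i
    fin_cases i <;> simp [h]
  · have h : ∀ y : Fin 3 → A, B3.lin y = ![y 0, -y 1 - y 2, y 1] := fun y => by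
      simp [lin, matrix, sub_eq_add_neg]
    change B3.lin (B3.lin (B3.lin x)) = x
    ext i
    fin_cases i <;> simp [h] <;> ring
  · have h : ∀ y : Fin 3 → A, B4.lin (B4.lin y) = ![y 0, -y 1, -y 2] := fun y => by simp [lin, matrix]
    change B4.lin (B4.lin (B4.lin (B4.lin x))) = x
    rw [h, h]
    ext i
    fin_cases i <;> simp
  · have h : ∀ y : Fin 3 → A, B6.lin (B6.lin (B6.lin y)) = ![y 0, -y 1, -y 2] := fun y => by
      ext i
      fin_cases i <;> simp [lin, matrix]
    change B6.lin (B6.lin (B6.lin (B6.lin (B6.lin (B6.lin x))))) = x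
    rw [h, h]
    ext i
    fin_cases i <;> simp

@[simp] theorem lin_zero' {A : Type*} [Ring A] (b : Bieb) (x : Fin 3 → A) : b.lin x 0 = x 0 := rfl

/-- `lin` as a linear map. -/
def linMap (b : Bieb) : (Fin 3 → ℝ) →ₗ[ℝ] (Fin 3 → ℝ) where
  toFun := b.lin
  map_add' x y := by ext i; fin_cases i <;> simp [lin] <;> ring
  map_smul' r x := by ext i; fin_cases i <;> simp [lin] <;> ring

theorem lin_intCast (b : Bieb) (k : Fin 3 → ℤ) (i : Fin 3) :
    ((b.lin k i : ℤ) : ℝ) = b.lin (fun j => (k j : ℝ)) i := by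
  fin_cases i <;> simp [lin]

theorem phase_lin (θ : ℝ) (b : Bieb) (k : Fin 3 → ℤ) (x : Fin 3 → ℝ) :
    phase θ (b.lin k) (b.lin x) = phase θ k x := by
  have h := b.matrix_det
  have h' : (b.matrix 0 0 * b.matrix 1 1 - b.matrix 0 1 * b.matrix 1 0 : ℂ) = 1 := by exact_mod_cast h
  simp only [phase, lin]
  congr 1
  simp
  left
  linear_combination (k 2 * x 1 - x 2 * k 1) * h'

end Bieb

/-- The conditions for `e_{μ,±} ↦ e^{2 π i μ₁ / N} c_± e_{Aμ,±}`, with `c₊ = c`, `c₋ = c̄`, to be an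
equivariant action. -/
structure Holonomy (b : Bieb) (τ : ℂ) (ε : Fin 3 → Bool) (c : ℂ) : Prop where
  norm_eq : ‖c‖ = 1
  pow_eq : c ^ b.order = if ε 0 then -1 else 1
  slope_eq : ∀ x : Fin 3 → ℝ, slope τ (b.lin x) = c ^ 2 * slope τ x
  maps : ∀ μ : Weight ε, ∀ i, ∃ n : ℤ, b.lin μ.1 i = n + half (ε i)

/-- `c₊ = c`, `c₋ = c̄`. -/
def conjIf (c : ℂ) (s : Fin 2) : ℂ := if s = 0 then c else starRingEnd ℂ c

@[simp] theorem conjIf_zero (c : ℂ) : conjIf c 0 = c := rfl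
@[simp] theorem conjIf_one (c : ℂ) : conjIf c 1 = starRingEnd ℂ c := rfl

theorem norm_conjIf (c : ℂ) (s : Fin 2) : ‖conjIf c s‖ = ‖c‖ := by
  fin_cases s
  · rfl
  · exact RCLike.norm_conj c

/-- The character `e^{2 π i x / N}`. -/
def charN (b : Bieb) (x : ℝ) : ℂ := exp (2 * Real.pi * I * x / b.order)

theorem norm_charN (b : Bieb) (x : ℝ) : ‖charN b x‖ = 1 := by
  have : (2 * Real.pi * I * x / b.order : ℂ) = ((2 * Real.pi * x / b.order : ℝ) : ℂ) * I := by
    push_cast; ring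
  rw [charN, this, norm_exp_ofReal_mul_I]

theorem charN_add (b : Bieb) (x y : ℝ) : charN b (x + y) = charN b x * charN b y := by
  rw [charN, charN, charN, ← exp_add]; congr 1; push_cast; ring

theorem charN_ne_zero (b : Bieb) (x : ℝ) : charN b x ≠ 0 := exp_ne_zero _

theorem charN_intCast (b : Bieb) (k : Fin 3 → ℤ) : charN b (k 0) = b.twist k := by
  simp [charN, Bieb.twist]

theorem conj_charN (b : Bieb) (x : ℝ) : starRingEnd ℂ (charN b x) = charN b (-x) := by
  rw [charN, charN, ← exp_conj]; congr 1; simp [map_ofNat]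

theorem charN_pow (b : Bieb) (x : ℝ) : charN b x ^ b.order = exp (2 * Real.pi * I * x) := by
  rw [charN, ← exp_nat_mul, mul_div_cancel₀ _ b.order_cast_ne]

theorem exp_weight {ε : Fin 3 → Bool} (μ : Weight ε) (i : Fin 3) :
    exp (2 * Real.pi * I * (μ.1 i : ℝ)) = if ε i then -1 else 1 := by
  obtain ⟨n, hn⟩ := μ.2 i
  have h1 : (2 * Real.pi * I * (μ.1 i : ℝ) : ℂ) =
      n * (2 * Real.pi * I) + 2 * Real.pi * I * half (ε i) := by rw [hn]; push_cast; ring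
  rw [h1, exp_add, exp_int_mul_two_pi_mul_I, one_mul]
  cases ε i
  · simp [half]
  · have : (2 * Real.pi * I * half true : ℂ) = Real.pi * I := by simp [half]; ring
    rw [this, exp_pi_mul_I]; simp

section Action
variable {b : Bieb} {τ : ℂ} {ε : Fin 3 → Bool} {c : ℂ} {θ R : ℝ}

/-- The substitution `μ ↦ Aμ`. -/
def Weight.lin (b : Bieb) (h : ∀ μ : Weight ε, ∀ i, ∃ n : ℤ, b.lin μ.1 i = n + half (ε i)) :
    Weight ε ≃ Weight ε :=
  let f : Weight ε → Weight ε := fun μ => ⟨b.lin μ.1, h μ⟩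
  have hf : ∀ n μ, (f^[n] μ).1 = b.lin^[n] μ.1 := fun n => by
    induction n with
    | zero => intro μ; rfl
    | succ n ih => intro μ; rw [Function.iterate_succ_apply, ih, Function.iterate_succ_apply]
  have hN : b.order = (b.order - 1) + 1 := (Nat.succ_pred_eq_of_pos b.order_pos).symm
  { toFun := f
    invFun := f^[b.order - 1]
    left_inv := fun μ => by
      rw [← Function.iterate_succ_apply]
      exact Subtype.ext ((hf _ _).trans (by
        rw [Nat.succ_eq_add_one, ← hN]; exact b.lin_iterate_order _))
    right_inv := fun μ => by
      rw [← Function.iterate_succ_apply' f]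
      exact Subtype.ext ((hf _ _).trans (by
        rw [Nat.succ_eq_add_one, ← hN]; exact b.lin_iterate_order _)) }

theorem Weight.lin_coe (h : ∀ μ : Weight ε, ∀ i, ∃ n : ℤ, b.lin μ.1 i = n + half (ε i))
    (μ : Weight ε) : (Weight.lin b h μ).1 = b.lin μ.1 := rfl

/-- The phase `e^{2 π i μ₁ / N} c_s`. -/
def holPhase (b : Bieb) (c : ℂ) (x : ℝ) (s : Fin 2) : ℂ := charN b x * conjIf c s

theorem norm_holPhase (h : ‖c‖ = 1) (x : ℝ) (s : Fin 2) : ‖holPhase b c x s‖ = 1 := by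
  rw [holPhase, norm_mul, norm_charN, norm_conjIf, h, one_mul]

theorem Holonomy.mul_conj (h : Holonomy b τ ε c) : c * starRingEnd ℂ c = 1 := by
  rw [Complex.mul_conj, Complex.normSq_eq_norm_sq, h.norm_eq]; simp

theorem Holonomy.ne_zero (h : Holonomy b τ ε c) : c ≠ 0 := by
  intro h0
  have := h.norm_eq
  rw [h0] at this; simp at this

theorem Holonomy.holPhase_pow (h : Holonomy b τ ε c) (μ : Weight ε) (s : Fin 2) :
    holPhase b c (μ.1 0) s ^ b.order = 1 := by
  have h1 : conjIf c s ^ b.order = if ε 0 then -1 else 1 := by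
    fin_cases s
    · exact h.pow_eq
    · change (starRingEnd ℂ c) ^ _ = _
      rw [← map_pow, h.pow_eq]; split_ifs <;> simp
  rw [holPhase, mul_pow, charN_pow, exp_weight, h1]
  split_ifs <;> norm_num

/-- The action with given holonomy. -/
def Holonomy.iso (h : Holonomy b τ ε c) : Spinor ε ≃ₗᵢ[ℂ] Spinor ε :=
  weightedPerm ((Weight.lin b h.maps).symm.prodCongr (Equiv.refl (Fin 2)))
    (fun i => holPhase b c (i.1.1 0) i.2) (fun _ => norm_holPhase h.norm_eq _ _)

/-- The action with given holonomy, as an operator. -/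
def Holonomy.op (h : Holonomy b τ ε c) : Spinor ε →L[ℂ] Spinor ε :=
  h.iso.toContinuousLinearEquiv.toContinuousLinearMap

theorem Holonomy.op_apply (h : Holonomy b τ ε c) (ψ : Spinor ε) (μ : Weight ε) (s : Fin 2) :
    h.op ψ (μ, s) = holPhase b c (μ.1 0) s * ψ ((Weight.lin b h.maps).symm μ, s) := rfl

theorem Holonomy.op_lin (h : Holonomy b τ ε c) (ψ : Spinor ε) (μ : Weight ε) (s : Fin 2) :
    h.op ψ (Weight.lin b h.maps μ, s) = holPhase b c (μ.1 0) s * ψ (μ, s) := by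
  rw [h.op_apply, Equiv.symm_apply_apply]; rfl

theorem Holonomy.op_ket (h : Holonomy b τ ε c) (μ : Weight ε) (s : Fin 2) :
    h.op (ket (μ, s)) = holPhase b c (μ.1 0) s • ket (Weight.lin b h.maps μ, s) := by
  classical
  ext ⟨ν, t⟩
  obtain ⟨ν, rfl⟩ := (Weight.lin b h.maps).surjective ν
  rw [h.op_lin, lp.coeFn_smul, Pi.smul_apply, ket_apply, ket_apply, smul_eq_mul]
  simp only [Prod.mk.injEq, EmbeddingLike.apply_eq_iff_eq]
  split_ifs with hν
  · rw [hν.1, hν.2]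
  · simp

theorem Holonomy.op_inner (h : Holonomy b τ ε c) (ψ φ : Spinor ε) :
    inner ℂ (h.op ψ) (h.op φ) = inner ℂ ψ φ := h.iso.inner_map_map ψ φ

theorem Holonomy.op_pow_ket (h : Holonomy b τ ε c) (p : ℕ) (μ : Weight ε) (s : Fin 2) :
    (h.op ^ p) (ket (μ, s)) =
      holPhase b c (μ.1 0) s ^ p • ket ((Weight.lin b h.maps)^[p] μ, s) := by
  induction p generalizing μ with
  | zero => simp
  | succ p ih =>
    rw [pow_succ, clm_mul_apply, h.op_ket, map_smul, ih,
      Function.iterate_succ_apply, smul_smul, pow_succ']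
    rfl

theorem Weight.lin_iterate_coe (h : ∀ μ : Weight ε, ∀ i, ∃ n : ℤ, b.lin μ.1 i = n + half (ε i))
    (p : ℕ) (μ : Weight ε) : ((Weight.lin b h)^[p] μ).1 = b.lin^[p] μ.1 := by
  induction p generalizing μ with
  | zero => rfl
  | succ p ih => rw [Function.iterate_succ_apply, ih, Function.iterate_succ_apply]; rfl

theorem Weight.lin_iterate_order (h : ∀ μ : Weight ε, ∀ i, ∃ n : ℤ, b.lin μ.1 i = n + half (ε i))
    (μ : Weight ε) : (Weight.lin b h)^[b.order] μ = μ :=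
  Subtype.ext ((Weight.lin_iterate_coe h _ μ).trans (b.lin_iterate_order _))

theorem Holonomy.op_pow (h : Holonomy b τ ε c) : h.op ^ b.order = 1 := by
  refine ext_ket fun ⟨μ, s⟩ => ?_
  rw [h.op_pow_ket, h.holPhase_pow, Weight.lin_iterate_order, one_smul, one_apply_eq_self]

theorem Weight.lin_add (h : ∀ μ : Weight ε, ∀ i, ∃ n : ℤ, b.lin μ.1 i = n + half (ε i))
    (μ : Weight ε) (k : Fin 3 → ℤ) :
    Weight.lin b h (μ.add k) = (Weight.lin b h μ).add (b.lin k) := by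
  refine Weight.ext' fun i => ?_
  change b.linMap (μ.1 + fun j => (k j : ℝ)) i = b.lin μ.1 i + ((b.lin k i : ℤ) : ℝ)
  rw [map_add, b.lin_intCast]; rfl

theorem Holonomy.op_shift (h : Holonomy b τ ε c) (k : Fin 3 → ℤ) (ψ : Spinor ε) :
    h.op (shift θ ε k ψ) = b.twist k • shift θ ε (b.lin k) (h.op ψ) := by
  have : h.op.comp (shift θ ε k) = b.twist k • (shift θ ε (b.lin k)).comp h.op := by
    refine ext_ket fun ⟨μ, s⟩ => ?_
    change h.op (shift θ ε k (ket (μ, s))) = b.twist k • shift θ ε (b.lin k) (h.op (ket (μ, s)))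
    rw [shift_ket, map_smul, h.op_ket, h.op_ket, map_smul, shift_ket, ← Weight.lin_add,
      Weight.lin_coe, Bieb.phase_lin, smul_smul, smul_smul, smul_smul]
    congr 1
    have : holPhase b c ((μ.add k).1 0) s = b.twist k * holPhase b c (μ.1 0) s := by
      rw [holPhase, holPhase, ← charN_intCast]
      change charN b (μ.1 0 + k 0) * _ = _
      rw [charN_add]; ring
    rw [this]; ring
  exact congrArg (fun T : Spinor ε →L[ℂ] Spinor ε => T ψ) this

/-- Equivariance with respect to the algebra is a statement about the `x^k`. -/
theorem rep_act_of_shift (S : Spinor ε →L[ℂ] Spinor ε)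
    (h : ∀ k ψ, S (shift θ ε k ψ) = b.twist k • shift θ ε (b.lin k) (S ψ)) (a : SmoothTorus θ) :
    S * SmoothTorus.rep θ ε a = SmoothTorus.rep θ ε (b.act θ a) * S := by
  ext1 ψ
  change S (SmoothTorus.rep θ ε a ψ) = SmoothTorus.rep θ ε (b.act θ a) (S ψ)
  have h1 := (hasSum_rep a ψ).mapL S
  have h2 := b.linEquiv.hasSum_iff.2 (hasSum_rep (b.act θ a) (S ψ))
  refine h1.unique (h2.congr_fun fun k => ?_)
  change S (a.coeff k • shift θ ε k ψ) = (b.twist (b.linEquiv k) *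
    a.coeff (b.linEquiv.symm (b.linEquiv k))) • shift θ ε (b.lin k) (S ψ)
  rw [map_smul, h, Equiv.symm_apply_apply, smul_smul, mul_comm]
  rfl

theorem Holonomy.op_dirac (h : Holonomy b τ ε c) : IntertwinesDirac R τ h.op := by
  intro ψ φ hψ
  rw [mem_graph_torusDirac] at hψ ⊢
  rintro ⟨μ, s⟩
  obtain ⟨ν, rfl⟩ := (Weight.lin b h.maps).surjective μ
  have hz : ((b.lin ν.1 1 : ℝ) : ℂ) + τ * ((b.lin ν.1 2 : ℝ) : ℂ) =
      c ^ 2 * (ν.1 1 + τ * ν.1 2) := h.slope_eq ν.1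
  have hz' : ((b.lin ν.1 1 : ℝ) : ℂ) + starRingEnd ℂ τ * ((b.lin ν.1 2 : ℝ) : ℂ) =
      starRingEnd ℂ c ^ 2 * (ν.1 1 + starRingEnd ℂ τ * ν.1 2) := by
    have := congrArg (starRingEnd ℂ) hz
    simpa using this
  have hc := h.mul_conj
  rw [h.op_lin, hψ]
  fin_cases s
  · change _ = diracFun R τ (h.op ψ) (Weight.lin b h.maps ν, 0)
    rw [diracFun_zero', h.op_lin, h.op_lin, Weight.lin_coe, hz]
    change _ * diracFun R τ ψ (ν, 0) = _
    rw [diracFun_zero']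
    simp only [holPhase, conjIf, Bieb.lin_zero']
    simp
    linear_combination (-charN b (ν.1 0) * c * (ν.1 1 + τ * ν.1 2) * ψ (ν, 1)) * hc
  · change _ = diracFun R τ (h.op ψ) (Weight.lin b h.maps ν, 1)
    rw [diracFun_one', h.op_lin, h.op_lin, Weight.lin_coe, hz']
    change _ * diracFun R τ ψ (ν, 1) = _
    rw [diracFun_one']
    simp only [holPhase, conjIf, Bieb.lin_zero']
    simp
    linear_combination (-charN b (ν.1 0) * starRingEnd ℂ c * (ν.1 1 + starRingEnd ℂ τ * ν.1 2) *
      ψ (ν, 0)) * hc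

theorem Weight.lin_neg (h : ∀ μ : Weight ε, ∀ i, ∃ n : ℤ, b.lin μ.1 i = n + half (ε i))
    (μ : Weight ε) : Weight.lin b h μ.neg = (Weight.lin b h μ).neg := by
  refine Weight.ext' fun i => ?_
  change b.linMap (-μ.1) i = -b.linMap μ.1 i
  rw [map_neg]; rfl

theorem Holonomy.op_conj (h : Holonomy b τ ε c) (ψ : Spinor ε) :
    h.op (torusConj ε ψ) = torusConj ε (h.op ψ) := by
  ext ⟨μ, s⟩
  obtain ⟨ν, rfl⟩ := (Weight.lin b h.maps).surjective μ
  rw [h.op_lin]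
  fin_cases s
  · change _ * torusConj ε ψ (ν, 0) = torusConj ε (h.op ψ) (Weight.lin b h.maps ν, 0)
    rw [torusConj_zero, torusConj_zero, ← Weight.lin_neg, h.op_lin]
    simp [holPhase, conj_charN, Weight.neg]
  · change _ * torusConj ε ψ (ν, 1) = torusConj ε (h.op ψ) (Weight.lin b h.maps ν, 1)
    rw [torusConj_one, torusConj_one, ← Weight.lin_neg, h.op_lin]
    simp [holPhase, conj_charN, Weight.neg]

theorem Holonomy.isEquivariantAction (h : Holonomy b τ ε c) (θ R : ℝ) :
    (flatTorus θ R τ ε).IsEquivariantAction (b.act θ) b.order h.op where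
  pow := h.op_pow
  rep := rep_act_of_shift _ h.op_shift
  dirac := h.op_dirac
  conj := h.op_conj

theorem shift_of_equivariant {S : Spinor ε →L[ℂ] Spinor ε}
    (hS : (flatTorus θ R τ ε).IsEquivariantAction (b.act θ) b.order S) (k : Fin 3 → ℤ)
    (ψ : Spinor ε) : S (shift θ ε k ψ) = b.twist k • shift θ ε (b.lin k) (S ψ) := by
  have h1 := hS.rep (SmoothTorus.monomial θ k)
  change S * SmoothTorus.rep θ ε _ = SmoothTorus.rep θ ε _ * S at h1
  rw [Bieb.act_monomial, map_smul, rep_monomial, rep_monomial] at h1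
  exact congrArg (fun T : Spinor ε →L[ℂ] Spinor ε => T ψ) h1

/-- Every equivariant action is given by its holonomy. -/
theorem exists_holonomy (hR : 0 < R) (hτ : τ.im ≠ 0) {S : Spinor ε →L[ℂ] Spinor ε}
    (hS : (flatTorus θ R τ ε).IsEquivariantAction (b.act θ) b.order S) :
    ∃ (c : ℂ) (h : Holonomy b τ ε c), S = h.op := by
  classical
  have hR' : (R : ℂ) ≠ 0 := by exact_mod_cast hR.ne'
  have hI : IntertwinesShift θ b.linMap b.lin b.twist S :=
    ⟨fun k i => b.lin_intCast k i, shift_of_equivariant hS, fun k => exp_ne_zero _⟩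
  have hD : IntertwinesDirac R τ S := hS.dirac
  have hinj : ∀ ψ, S ψ = 0 → ψ = 0 := by
    intro ψ h
    have h1 := congrArg (fun T : Spinor ε →L[ℂ] Spinor ε => T ψ) hS.pow
    have hN : b.order = (b.order - 1) + 1 := (Nat.succ_pred_eq_of_pos b.order_pos).symm
    simp only [one_apply_eq_self] at h1
    rw [hN, pow_succ, clm_mul_apply, h, map_zero] at h1
    exact h1.symm
  have hex : ∀ (μ : Weight ε) (t : Fin 2), ∃ (ν : Weight ε) (s : Fin 2), block S ν μ s t ≠ 0 := by
    intro μ t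
    by_contra! h0
    refine ket_ne_zero (μ, t) (hinj _ ?_)
    ext ⟨ν, s⟩
    exact h0 ν s
  have hmaps : ∀ μ : Weight ε, ∀ i, ∃ n : ℤ, b.lin μ.1 i = n + half (ε i) := by
    intro μ
    obtain ⟨ν, s, hs⟩ := hex μ 0
    have : ν.1 = b.lin μ.1 := by
      by_contra hne
      exact hs (by rw [hI.block_eq_zero hD hR hτ hne]; rfl)
    rw [← this]; exact ν.2
  have hoff : ∀ {ν μ : Weight ε}, ν ≠ Weight.lin b hmaps μ → block S ν μ = 0 := fun hne =>
    hI.block_eq_zero hD hR hτ fun h => hne (Subtype.ext h)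
  set M : Weight ε → Matrix (Fin 2) (Fin 2) ℂ := fun μ => block S (Weight.lin b hmaps μ) μ with hM
  have hMc : ∀ μ x, M μ * symbol R τ x = symbol R τ (b.lin x) * M μ := fun μ x =>
    hI.block_mul hD _ μ x
  have hdiag : ∀ μ, M μ 0 1 = 0 ∧ M μ 1 0 = 0 := by
    intro μ
    have h0 := hMc μ ![1, 0, 0]
    have a := congrFun (congrFun h0 0) 1
    have b' := congrFun (congrFun h0 1) 0
    simp [symbol, Matrix.mul_apply, Fin.sum_univ_two, Bieb.lin] at a b'
    constructor
    · have : (2 * R) * M μ 0 1 = 0 := by linear_combination -a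
      simpa [hR'] using this
    · have : (2 * R) * M μ 1 0 = 0 := by linear_combination b'
      simpa [hR'] using this
  have hSket : ∀ μ s, S (ket (μ, s)) = M μ s s • ket (Weight.lin b hmaps μ, s) := by
    intro μ s
    ext ⟨ν, t⟩
    rw [← block_apply, lp.coeFn_smul, Pi.smul_apply, ket_apply, smul_eq_mul]
    by_cases hν : ν = Weight.lin b hmaps μ
    · subst hν
      change M μ t s = _
      by_cases hs : t = s
      · subst hs; simp
      · fin_cases s <;> fin_cases t <;> simp [hdiag μ] at hs ⊢
    · rw [hoff hν]; simp [hν]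
  have hM0 : ∀ μ s, M μ s s ≠ 0 := by
    intro μ s h0
    have := hSket μ s
    rw [h0, zero_smul] at this
    exact ket_ne_zero _ (hinj _ this)
  have hslope : ∀ μ x, slope τ (b.lin x) * M μ 1 1 = M μ 0 0 * slope τ x := by
    intro μ x
    have h1 := congrFun (congrFun (hMc μ x) 0) 1
    simp [symbol, Matrix.mul_apply, Fin.sum_univ_two, hdiag μ] at h1
    exact h1.symm
  have hconj : ∀ μ, M μ.neg 1 1 = starRingEnd ℂ (M μ 0 0) := by
    intro μ
    have h1 := congrArg (fun ψ : Spinor ε => ψ (Weight.lin b hmaps μ.neg, 1)) (hS.conj (ket (μ, 0)))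
    have e : torusConj ε (ket (μ, 0)) = ket (μ.neg, 1) := by
      have hnn : ∀ ν : Weight ε, ν.neg = μ ↔ ν = μ.neg := fun ν =>
        ⟨fun h => by rw [← h]; exact (Weight.negEquiv.left_inv ν).symm,
          fun h => by rw [h]; exact Weight.negEquiv.left_inv μ⟩
      ext ⟨ν, t⟩
      fin_cases t
      · change torusConj ε _ (ν, 0) = _
        rw [torusConj_zero, ket_apply, ket_apply]; simp
      · change torusConj ε _ (ν, 1) = (ket (μ.neg, 1)) (ν, 1)
        rw [torusConj_one, ket_apply, ket_apply]; simp [hnn]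
    change S (torusConj ε _) _ = torusConj ε _ _ at h1
    rw [e, hSket, hSket, torusConj_one, ← Weight.lin_neg] at h1
    have hnn : μ.neg.neg = μ := Weight.negEquiv.left_inv μ
    simpa [ket_apply_self, hnn] using h1
  have hadd : ∀ μ k, M (μ.add k) = b.twist k • M μ := by
    intro μ k
    have h1 := hI.block_add k (Weight.lin b hmaps μ) μ
    rw [← Weight.lin_add, Weight.lin_coe, Bieb.phase_lin, mul_comm, mul_smul] at h1
    exact smul_right_injective _ (exp_ne_zero _) h1
  let μ₀ : Weight ε := Weight.ofInt ε 0
  set d : Fin 2 → ℂ := fun s => charN b (-μ₀.1 0) * M μ₀ s s with hd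
  have hMd : ∀ μ s, M μ s s = charN b (μ.1 0) * d s := by
    intro μ s
    obtain ⟨n, rfl⟩ := (Weight.ofInt ε).surjective μ
    have e : Weight.ofInt ε n = μ₀.add n := Weight.ext' fun i => by
      simp [Weight.ofInt_apply, Weight.add, μ₀]; ring
    rw [e, hadd, ← charN_intCast, hd]
    change _ = charN b (μ₀.1 0 + n 0) * (charN b (-μ₀.1 0) * M μ₀ s s)
    rw [← mul_assoc, ← charN_add, Matrix.smul_apply, smul_eq_mul]
    congr 2; ring
  have hd1 : d 1 = starRingEnd ℂ (d 0) := by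
    have h1 := hconj μ₀
    rw [hMd, hMd, map_mul, conj_charN] at h1
    exact mul_left_cancel₀ (charN_ne_zero _ _) h1
  have hds : ∀ s, d s = conjIf (d 0) s := fun s => by fin_cases s; rfl; exact hd1
  have hpow : d 0 ^ b.order = if ε 0 then -1 else 1 := by
    have h1 : ∀ p : ℕ, (S ^ p) (ket (μ₀, 0)) =
        (charN b (μ₀.1 0) * d 0) ^ p • ket ((Weight.lin b hmaps)^[p] μ₀, 0) := by
      intro p
      induction p with
      | zero => simp
      | succ p ih =>
        have e : ((Weight.lin b hmaps)^[p] μ₀).1 0 = μ₀.1 0 := by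
          clear ih
          induction p with
          | zero => rfl
          | succ p ih => rw [Function.iterate_succ_apply', Weight.lin_coe, Bieb.lin_zero', ih]
        rw [pow_succ', clm_mul_apply, ih, map_smul, hSket, hMd, smul_smul,
          Function.iterate_succ_apply', e, pow_succ]
    have h2 := h1 b.order
    rw [hS.pow, Weight.lin_iterate_order, one_apply_eq_self] at h2
    have h3 := congrArg (fun ψ : Spinor ε => ψ (μ₀, 0)) h2
    simp only [lp.coeFn_smul, Pi.smul_apply, ket_apply_self, smul_eq_mul, mul_one] at h3
    rw [mul_pow, charN_pow, exp_weight] at h3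
    split_ifs at h3 ⊢
    · linear_combination h3
    · linear_combination -h3
  have hnorm : ‖d 0‖ = 1 := by
    have h1 : ‖d 0‖ ^ b.order = 1 := by rw [← norm_pow, hpow]; split_ifs <;> simp
    exact (pow_eq_one_iff_of_nonneg (norm_nonneg _) b.order_pos.ne').1 h1
  have hmc : d 0 * starRingEnd ℂ (d 0) = 1 := by
    rw [Complex.mul_conj, Complex.normSq_eq_norm_sq, hnorm]; simp
  refine ⟨d 0, ⟨hnorm, hpow, fun x => ?_, hmaps⟩, ext_ket fun ⟨μ, s⟩ => ?_⟩
  · have h1 := hslope μ₀ x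
    rw [hMd, hMd, hd1] at h1
    have h2 : charN b (μ₀.1 0) * (slope τ (b.lin x) * starRingEnd ℂ (d 0)) =
        charN b (μ₀.1 0) * (d 0 * slope τ x) := by linear_combination h1
    have h3 := mul_left_cancel₀ (charN_ne_zero _ _) h2
    linear_combination d 0 * h3 - slope τ (b.lin x) * hmc
  · rw [Holonomy.op_ket, hSket, hMd, hds]; rfl

end Action

section Labels
variable {b : Bieb} {τ : ℂ} {ε : Fin 3 → Bool} {c : ℂ}

theorem units_int_sq (σ : ℤˣ) : (((σ : ℤ) : ℂ)) ^ 2 = 1 := by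
  rcases Int.units_eq_one_or σ with h | h <;> simp [h]

/-- The constant `c` of the action with given label. -/
def Bieb.Label.const (σ : ℤˣ) {b : Bieb} (l : b.Label) : ℂ := l.phase σ 0 0

theorem Bieb.Label.phase_eq (σ : ℤˣ) {b : Bieb} (l : b.Label) (x : ℝ) (s : Fin 2) :
    l.phase σ x s = holPhase b (l.const σ) x s := by
  cases l with
  | b2 e₂ e₃ κ =>
    fin_cases s <;> simp [Bieb.Label.const, Bieb.Label.phase, holPhase, charN, Bieb.order, sgn,
      ← exp_conj, map_ofNat] <;> rw [mul_left_comm, ← exp_add] <;> congr 2 <;> ring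
  | b3 e₁ =>
    have h : starRingEnd ℂ (if e₁ then -1 else 1 : ℂ) = if e₁ then -1 else 1 := by
      split_ifs <;> simp
    fin_cases s <;> simp only [Bieb.Label.const, Bieb.Label.phase, holPhase, charN, Bieb.order, sgn,
      Fin.zero_eta, Fin.mk_one, conjIf_zero, conjIf_one, map_mul, h, ← exp_conj] <;>
      rw [mul_left_comm, ← exp_add] <;> congr 2 <;> simp [map_ofNat] <;> ring
  | b4 e κ =>
    fin_cases s <;> simp [Bieb.Label.const, Bieb.Label.phase, holPhase, charN, Bieb.order, sgn,
      ← exp_conj, map_ofNat] <;> rw [mul_left_comm, ← exp_add] <;> congr 2 <;> ring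
  | b6 κ =>
    fin_cases s <;> simp [Bieb.Label.const, Bieb.Label.phase, holPhase, charN, Bieb.order, sgn,
      ← exp_conj, map_ofNat] <;> rw [mul_left_comm, ← exp_add] <;> congr 2 <;> ring

theorem exp_pi_third (σ : ℤˣ) :
    exp (Real.pi * I * (σ : ℤ) / 3) ^ 2 - exp (Real.pi * I * (σ : ℤ) / 3) + 1 = 0 := by
  set w := exp (Real.pi * I * (σ : ℤ) / 3) with hw
  have h1 : w ^ 3 = -1 := by
    rw [hw, ← exp_nat_mul]
    have : ((3 : ℕ) * (Real.pi * I * (σ : ℤ) / 3) : ℂ) = (Real.pi * I) * (σ : ℤ) := by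
      push_cast; ring
    rw [this]
    rcases Int.units_eq_one_or σ with h | h
    · simp [h]
    · simp [h, exp_neg]
  have h2 : w + 1 ≠ 0 := by
    intro h
    have h3 : w.re = 1 / 2 := by
      have : (Real.pi * I * (σ : ℤ) / 3 : ℂ) = ((Real.pi / 3 * (σ : ℤ) : ℝ) : ℂ) * I := by
        push_cast; ring
      rw [hw, this, exp_ofReal_mul_I_re]
      rcases Int.units_eq_one_or σ with h | h <;> simp [h]
    have h4 := congrArg re h
    simp [h3] at h4
    norm_num at h4
  have h5 : (w + 1) * (w ^ 2 - w + 1) = 0 := by linear_combination h1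
  exact (mul_eq_zero.1 h5).resolve_left h2

theorem exp_pi_fourth (σ : ℤˣ) : exp (Real.pi * I * (σ : ℤ) / 2) ^ 2 = -1 := by
  rw [← exp_nat_mul]
  have : ((2 : ℕ) * (Real.pi * I * (σ : ℤ) / 2) : ℂ) = (Real.pi * I) * (σ : ℤ) := by
    push_cast; ring
  rw [this]
  rcases Int.units_eq_one_or σ with h | h
  · simp [h]
  · simp [h, exp_neg]

/-- The roots of `x² - x + 1`. -/
theorem eq_exp_pi_third {x : ℂ} (h : x ^ 2 - x + 1 = 0) :
    ∃ σ : ℤˣ, x = exp (Real.pi * I * (σ : ℤ) / 3) := by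
  have h1 := exp_pi_third 1
  set w := exp (Real.pi * I * ((1 : ℤˣ) : ℤ) / 3) with hw
  have h2 : exp (Real.pi * I * ((-1 : ℤˣ) : ℤ) / 3) = w⁻¹ := by
    rw [hw, ← exp_neg]; congr 1; push_cast; ring
  have hw0 : w ≠ 0 := exp_ne_zero _
  have h3 : w⁻¹ = 1 - w := by field_simp; linear_combination h1
  have h4 : (x - w) * (x - (1 - w)) = 0 := by
    linear_combination h - h1
  rcases mul_eq_zero.1 h4 with h | h
  · exact ⟨1, sub_eq_zero.1 h⟩
  · exact ⟨-1, by rw [h2, h3]; exact sub_eq_zero.1 h⟩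

theorem Holonomy.slope_one (h : Holonomy b τ ε c) :
    (b.matrix 0 0 : ℂ) + τ * b.matrix 1 0 = c ^ 2 := by
  have := h.slope_eq ![0, 1, 0]
  simpa [slope, Bieb.lin] using this

theorem Holonomy.slope_two (h : Holonomy b τ ε c) :
    (b.matrix 0 1 : ℂ) + τ * b.matrix 1 1 = c ^ 2 * τ := by
  have := h.slope_eq ![0, 0, 1]
  simpa [slope, Bieb.lin] using this

theorem slope_lin_of (h1 : (b.matrix 0 0 : ℂ) + τ * b.matrix 1 0 = c ^ 2)
    (h2 : (b.matrix 0 1 : ℂ) + τ * b.matrix 1 1 = c ^ 2 * τ) (x : Fin 3 → ℝ) :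
    slope τ (b.lin x) = c ^ 2 * slope τ x := by
  simp [slope, Bieb.lin]
  linear_combination (x 1) * h1 + (x 2) * h2

/-- Existence of an action forces `τ` to be admissible. -/
theorem Holonomy.exists_admissible (h : Holonomy b τ ε c) : ∃ σ, b.Admissible σ τ := by
  have h1 := h.slope_one
  have h2 := h.slope_two
  cases b
  · exact ⟨1, trivial⟩
  · simp [Bieb.matrix] at h1 h2
    obtain ⟨σ, hσ⟩ := eq_exp_pi_third (x := τ) (by linear_combination τ * h1 - h2)
    refine ⟨-σ, ?_⟩
    rw [Bieb.Admissible, hσ]; congr 1; push_cast; ring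
  · simp [Bieb.matrix] at h1 h2
    have h3 : (τ - exp (Real.pi * I * ((1 : ℤˣ) : ℤ) / 2)) *
        (τ + exp (Real.pi * I * ((1 : ℤˣ) : ℤ) / 2)) = 0 := by
      linear_combination τ * h1 - h2 - exp_pi_fourth 1
    rcases mul_eq_zero.1 h3 with h | h
    · exact ⟨1, sub_eq_zero.1 h⟩
    · refine ⟨-1, ?_⟩
      rw [Bieb.Admissible, eq_neg_of_add_eq_zero_left h]
      have e1 := exp_pi_fourth 1
      have e2 : exp (Real.pi * I * ((-1 : ℤˣ) : ℤ) / 2) *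
          exp (Real.pi * I * ((1 : ℤˣ) : ℤ) / 2) = 1 := by
        rw [← exp_add, ← exp_zero]; congr 1; push_cast; ring
      have e3 := exp_ne_zero (Real.pi * I * ((1 : ℤˣ) : ℤ) / 2)
      refine mul_right_cancel₀ e3 ?_
      rw [e2]; linear_combination -e1
  · simp [Bieb.matrix] at h1 h2
    obtain ⟨σ, hσ⟩ := eq_exp_pi_third (x := τ) (by linear_combination τ * h1 - h2)
    exact ⟨σ, hσ⟩

/-- `2 ε` as an integer. -/
def halfInt (b : Bool) : ℤ := if b then 1 else 0

theorem half_eq (b : Bool) : half b = (halfInt b : ℝ) / 2 := by cases b <;> simp [half, halfInt]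

theorem maps_iff : (∀ μ : Weight ε, ∀ i, ∃ n : ℤ, b.lin μ.1 i = n + half (ε i)) ↔
    ∃ m n : ℤ, b.matrix 0 0 * halfInt (ε 1) + b.matrix 0 1 * halfInt (ε 2) =
      2 * m + halfInt (ε 1) ∧
    b.matrix 1 0 * halfInt (ε 1) + b.matrix 1 1 * halfInt (ε 2) = 2 * n + halfInt (ε 2) := by
  constructor
  · intro h
    obtain ⟨m, hm⟩ := h (Weight.ofInt ε 0) 1
    obtain ⟨n, hn⟩ := h (Weight.ofInt ε 0) 2
    simp [Bieb.lin, Weight.ofInt_apply, half_eq] at hm hn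
    refine ⟨m, n, ?_, ?_⟩
    · have : (b.matrix 0 0 * halfInt (ε 1) + b.matrix 0 1 * halfInt (ε 2) : ℝ) =
        2 * m + halfInt (ε 1) := by linarith
      exact_mod_cast this
    · have : (b.matrix 1 0 * halfInt (ε 1) + b.matrix 1 1 * halfInt (ε 2) : ℝ) =
        2 * n + halfInt (ε 2) := by linarith
      exact_mod_cast this
  · rintro ⟨m, n, hm, hn⟩ μ i
    obtain ⟨k, rfl⟩ := (Weight.ofInt ε).surjective μ
    have hm' : (b.matrix 0 0 * halfInt (ε 1) + b.matrix 0 1 * halfInt (ε 2) : ℝ) =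
        2 * m + halfInt (ε 1) := by exact_mod_cast hm
    have hn' : (b.matrix 1 0 * halfInt (ε 1) + b.matrix 1 1 * halfInt (ε 2) : ℝ) =
        2 * n + halfInt (ε 2) := by exact_mod_cast hn
    fin_cases i
    · exact ⟨k 0, rfl⟩
    · refine ⟨b.matrix 0 0 * k 1 + b.matrix 0 1 * k 2 + m, ?_⟩
      simp [Bieb.lin, Weight.ofInt_apply, half_eq]; linarith
    · refine ⟨b.matrix 1 0 * k 1 + b.matrix 1 1 * k 2 + n, ?_⟩
      simp [Bieb.lin, Weight.ofInt_apply, half_eq]; linarith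

theorem const_b3 (σ : ℤˣ) (e : Bool) : (Bieb.Label.b3 e).const σ =
    (if e then -1 else 1) * exp (Real.pi * I * (σ : ℤ) / 3) ^ 2 := by
  rw [Bieb.Label.const, Bieb.Label.phase, ← exp_nat_mul]
  congr 2; simp [sgn]; ring

theorem const_b4 (σ : ℤˣ) (e : Bool) (κ : ℤˣ) : (Bieb.Label.b4 e κ).const σ =
    (κ : ℤ) * exp (Real.pi * I * (σ : ℤ) / 4) := by
  rw [Bieb.Label.const, Bieb.Label.phase]
  congr 2; simp [sgn]; ring

theorem const_b6 (σ : ℤˣ) (κ : ℤˣ) : (Bieb.Label.b6 κ).const σ =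
    (κ : ℤ) * exp (Real.pi * I * (σ : ℤ) / 6) := by
  rw [Bieb.Label.const, Bieb.Label.phase]
  congr 2; simp [sgn]; ring

theorem const_b2 (σ : ℤˣ) (e₂ e₃ : Bool) (κ : ℤˣ) : (Bieb.Label.b2 e₂ e₃ κ).const σ = (κ : ℤ) * I := by
  rw [Bieb.Label.const, Bieb.Label.phase]
  have : (Real.pi * I * ((0 : ℝ) + sgn 0 / 2) : ℂ) = Real.pi / 2 * I := by simp [sgn]; ring
  rw [this, exp_pi_div_two_mul_I]

theorem admissible_b3 {σ : ℤˣ} (h : Bieb.B3.Admissible σ τ) :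
    τ = 1 - exp (Real.pi * I * (σ : ℤ) / 3) := by
  have h1 := exp_pi_third σ
  rw [Bieb.Admissible] at h
  rw [h, exp_neg]
  have := exp_ne_zero (Real.pi * I * (σ : ℤ) / 3)
  field_simp
  linear_combination h1

theorem admissible_b4 {σ : ℤˣ} (h : Bieb.B4.Admissible σ τ) :
    τ = exp (Real.pi * I * (σ : ℤ) / 4) ^ 2 := by
  rw [Bieb.Admissible] at h
  rw [h, ← exp_nat_mul]; congr 1; push_cast; ring

theorem admissible_b6 {σ : ℤˣ} (h : Bieb.B6.Admissible σ τ) :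
    τ = exp (Real.pi * I * (σ : ℤ) / 6) ^ 2 := by
  rw [Bieb.Admissible] at h
  rw [h, ← exp_nat_mul]; congr 1; push_cast; ring

theorem norm_const (σ : ℤˣ) (l : b.Label) : ‖l.const σ‖ = 1 := by
  have key : ∀ (κ : ℤˣ) (r : ℝ), ‖((κ : ℤ) : ℂ) * exp (r * I)‖ = 1 := by
    intro κ r
    rw [norm_mul, norm_exp_ofReal_mul_I]
    rcases Int.units_eq_one_or κ with h | h <;> simp [h]
  cases l with
  | b2 e₂ e₃ κ =>
    rw [const_b2, norm_mul]
    rcases Int.units_eq_one_or κ with h | h <;> simp [h]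
  | b3 e =>
    rw [const_b3, ← exp_nat_mul]
    have : ((2 : ℕ) * (Real.pi * I * (σ : ℤ) / 3) : ℂ) = ((2 * (Real.pi * (σ : ℤ) / 3) : ℝ) : ℂ) * I := by
      push_cast; ring
    rw [this, norm_mul, norm_exp_ofReal_mul_I]
    cases e <;> simp
  | b4 e κ =>
    rw [const_b4]
    have : (Real.pi * I * (σ : ℤ) / 4 : ℂ) = ((Real.pi * (σ : ℤ) / 4 : ℝ) : ℂ) * I := by
      push_cast; ring
    rw [this, key]
  | b6 κ =>
    rw [const_b6]
    have : (Real.pi * I * (σ : ℤ) / 6 : ℂ) = ((Real.pi * (σ : ℤ) / 6 : ℝ) : ℂ) * I := by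
      push_cast; ring
    rw [this, key]

/-- Each label gives an action. -/
theorem holonomy_label {σ : ℤˣ} (hσ : b.Admissible σ τ) (l : b.Label) :
    Holonomy b τ l.spin (l.const σ) := by
  have key : ∀ {d : ℂ}, l.const σ = d → d ^ b.order = (if l.spin 0 then -1 else 1) →
      (b.matrix 0 0 : ℂ) + τ * b.matrix 1 0 = d ^ 2 →
      (b.matrix 0 1 : ℂ) + τ * b.matrix 1 1 = d ^ 2 * τ →
      (∃ m n : ℤ, b.matrix 0 0 * halfInt (l.spin 1) + b.matrix 0 1 * halfInt (l.spin 2) =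
        2 * m + halfInt (l.spin 1) ∧ b.matrix 1 0 * halfInt (l.spin 1) +
        b.matrix 1 1 * halfInt (l.spin 2) = 2 * n + halfInt (l.spin 2)) →
      Holonomy b τ l.spin (l.const σ) := fun hd h1 h2 h3 h4 =>
    ⟨norm_const σ l, by rw [hd, h1], by rw [hd]; exact slope_lin_of h2 h3, maps_iff.2 h4⟩
  cases l with
  | b2 e₂ e₃ κ =>
    have hκ := units_int_sq κ
    refine key (const_b2 σ e₂ e₃ κ) ?_ ?_ ?_ ⟨-halfInt e₂, -halfInt e₃, ?_⟩
    · simp [Bieb.order, Bieb.Label.spin, mul_pow, hκ]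
    · simp [Bieb.matrix, mul_pow, hκ]
    · simp [Bieb.matrix, mul_pow, hκ]
    · simp [Bieb.matrix, Bieb.Label.spin]; constructor <;> ring
  | b3 e =>
    have h1 := exp_pi_third σ
    have h2 := admissible_b3 hσ
    have he : (if e then -1 else 1 : ℂ) ^ 2 = 1 := by split_ifs <;> simp
    have he3 : (if e then -1 else 1 : ℂ) ^ 3 = if e then -1 else 1 := by split_ifs <;> norm_num
    refine key (const_b3 σ e) ?_ ?_ ?_ ⟨0, 0, ?_⟩
    · rw [mul_pow, Bieb.order, he3]
      have : (exp (Real.pi * I * (σ : ℤ) / 3) ^ 2) ^ 3 = 1 := by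
        generalize exp (Real.pi * I * (σ : ℤ) / 3) = w at h1
        linear_combination (w ^ 4 + w ^ 3 - w - 1) * h1
      rw [this, mul_one]; rfl
    · rw [mul_pow, he, one_mul, h2]
      generalize exp (Real.pi * I * (σ : ℤ) / 3) = w at h1
      simp [Bieb.matrix]
      linear_combination -(w ^ 2 + w) * h1
    · rw [mul_pow, he, one_mul, h2]
      generalize exp (Real.pi * I * (σ : ℤ) / 3) = w at h1
      simp [Bieb.matrix]
      linear_combination (w ^ 3 - w - 1) * h1
    · simp [Bieb.matrix, Bieb.Label.spin, halfInt]
  | b4 e κ =>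
    have hκ := units_int_sq κ
    have hκ4 : ((κ : ℤ) : ℂ) ^ 4 = 1 := by linear_combination (((κ : ℤ) : ℂ) ^ 2 + 1) * hκ
    have h2 := admissible_b4 hσ
    have h1 : exp (Real.pi * I * (σ : ℤ) / 4) ^ 4 = -1 := by
      have := exp_pi_fourth σ
      rw [← (show τ = _ from hσ), h2] at this
      linear_combination this
    refine key (const_b4 σ e κ) ?_ ?_ ?_ ⟨-halfInt e, 0, ?_⟩
    · simp [Bieb.order, Bieb.Label.spin, mul_pow, hκ4, h1]
    · simp [Bieb.matrix, mul_pow, hκ, h2]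
    · simp only [Bieb.matrix, mul_pow, hκ, h2]
      simp
      linear_combination -h1
    · simp [Bieb.matrix, Bieb.Label.spin]; ring
  | b6 κ =>
    have hκ := units_int_sq κ
    have hκ6 : ((κ : ℤ) : ℂ) ^ 6 = 1 := by
      linear_combination (((κ : ℤ) : ℂ) ^ 4 + ((κ : ℤ) : ℂ) ^ 2 + 1) * hκ
    have h2 := admissible_b6 hσ
    have h1 := exp_pi_third σ
    rw [← (show τ = _ from hσ), h2] at h1
    refine key (const_b6 σ κ) ?_ ?_ ?_ ⟨0, 0, ?_⟩
    · have : exp (Real.pi * I * (σ : ℤ) / 6) ^ 6 = -1 := by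
        linear_combination (exp (Real.pi * I * (σ : ℤ) / 6) ^ 2 + 1) * h1
      simp [Bieb.order, Bieb.Label.spin, mul_pow, hκ6, this]
    · simp [Bieb.matrix, mul_pow, hκ, h2]
    · simp only [Bieb.matrix, mul_pow, hκ, h2]
      simp
      linear_combination -h1
    · simp [Bieb.matrix, Bieb.Label.spin, halfInt]

theorem exists_unit_mul {c d : ℂ} (h : c ^ 2 = d ^ 2) : ∃ κ : ℤˣ, ((κ : ℤ) : ℂ) * d = c := by
  rcases sq_eq_sq_iff_eq_or_eq_neg.1 h with h | h
  · exact ⟨1, by simp [h]⟩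
  · exact ⟨-1, by simp [h]⟩

/-- Every action has a label. -/
theorem Holonomy.exists_label {σ : ℤˣ} (hσ : b.Admissible σ τ) (h : Holonomy b τ ε c) :
    ∃ l : b.Label, l.spin = ε ∧ l.const σ = c := by
  have h1 := h.slope_one
  have h2 := h.slope_two
  have h3 := h.pow_eq
  obtain ⟨m, n, hm, hn⟩ := maps_iff.1 h.maps
  have spin_eq : ∀ {x y z : Bool}, ε 0 = x → ε 1 = y → ε 2 = z → ![x, y, z] = ε := by
    rintro x y z rfl rfl rfl
    ext i; fin_cases i <;> rfl
  have ε0 : c ^ b.order = -1 → ε 0 = true := by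
    intro h4
    rw [h3] at h4
    by_contra h5
    rw [if_neg h5] at h4
    norm_num at h4
  cases b
  · simp [Bieb.matrix] at h1
    obtain ⟨κ, hκ⟩ := exists_unit_mul (c := c) (d := I) (by rw [← h1]; simp)
    exact ⟨.b2 (ε 1) (ε 2) κ, spin_eq (ε0 h1.symm) rfl rfl, by rw [const_b2, hκ]⟩
  · simp [Bieb.matrix] at h1 h2 hm hn
    have e : ε 1 = false ∧ ε 2 = false := by
      cases h1 : ε 1 <;> cases h2 : ε 2 <;> simp [halfInt, h1, h2] at hm hn ⊢ <;> omega
    refine ⟨.b3 (ε 0), spin_eq rfl e.1 e.2, ?_⟩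
    rw [const_b3, ← h3, Bieb.order]
    rw [admissible_b3 hσ] at h1
    have h4 := exp_pi_third σ
    generalize exp (Real.pi * I * (σ : ℤ) / 3) = w at h1 h4
    have h5 : c ^ 2 = -w := by linear_combination -h1
    have h6 : w ^ 3 = -1 := by linear_combination (w + 1) * h4
    linear_combination (c * w ^ 2) * h5 - c * h6
  · simp [Bieb.matrix] at h1 h2 hm hn
    have e : ε 1 = ε 2 := by
      cases h1 : ε 1 <;> cases h2 : ε 2 <;> simp [halfInt, h1, h2] at hm hn ⊢ <;> omega
    have h4 : c ^ 4 = -1 := by rw [h1] at h2; linear_combination -h2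
    obtain ⟨κ, hκ⟩ := exists_unit_mul (c := c) (d := exp (Real.pi * I * (σ : ℤ) / 4))
      (by rw [← admissible_b4 hσ, h1])
    exact ⟨.b4 (ε 1) κ, spin_eq (ε0 h4) rfl e.symm, by rw [const_b4, hκ]⟩
  · simp [Bieb.matrix] at h1 h2 hm hn
    have e : ε 1 = false ∧ ε 2 = false := by
      cases h1 : ε 1 <;> cases h2 : ε 2 <;> simp [halfInt, h1, h2] at hm hn ⊢ <;> omega
    have h4 : c ^ 6 = -1 := by rw [h1] at h2; linear_combination -(c ^ 2 + 1) * h2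
    obtain ⟨κ, hκ⟩ := exists_unit_mul (c := c) (d := exp (Real.pi * I * (σ : ℤ) / 6))
      (by rw [← admissible_b6 hσ, h1])
    exact ⟨.b6 κ, spin_eq (ε0 h4) e.1 e.2, by rw [const_b6, hκ]⟩

/-- The label is determined by the action. -/
theorem label_injective (σ : ℤˣ) {l l' : b.Label} (h : l.spin = l'.spin)
    (h' : l.const σ = l'.const σ) : l = l' := by
  have hu : ∀ {κ κ' : ℤˣ} {d : ℂ}, d ≠ 0 → ((κ : ℤ) : ℂ) * d = ((κ' : ℤ) : ℂ) * d → κ = κ' := by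
    intro κ κ' d hd h
    exact Units.ext (by exact_mod_cast mul_right_cancel₀ hd h)
  cases l with
  | b2 e₂ e₃ κ =>
    cases l' with
    | b2 e₂' e₃' κ' =>
      rw [const_b2, const_b2] at h'
      have h1 := congrFun h 1
      have h2 := congrFun h 2
      have h3 := hu I_ne_zero h'
      simp_all [Bieb.Label.spin]
  | b3 e =>
    cases l' with
    | b3 e' =>
      have := congrFun h 0
      simp_all [Bieb.Label.spin]
  | b4 e κ =>
    cases l' with
    | b4 e' κ' =>
      rw [const_b4, const_b4] at h'
      have h1 := congrFun h 1
      have h2 := hu (exp_ne_zero _) h'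
      simp_all [Bieb.Label.spin]
  | b6 κ =>
    cases l' with
    | b6 κ' =>
      rw [const_b6, const_b6] at h'
      rw [hu (exp_ne_zero _) h']

/-- The square of the constant is a primitive root of unity. -/
theorem Holonomy.isPrimitiveRoot (h : Holonomy b τ ε c) : IsPrimitiveRoot (c ^ 2) b.order := by
  have h1 := h.slope_one
  have h2 := h.slope_two
  rw [IsPrimitiveRoot.iff b.order_pos]
  cases b
  · simp [Bieb.matrix] at h1
    refine ⟨by rw [← h1]; simp [Bieb.order], fun l hl hl' => ?_⟩
    simp only [Bieb.order] at hl'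
    interval_cases l
    rw [← h1]; norm_num
  · simp [Bieb.matrix] at h1 h2
    rw [← h1] at h2 ⊢
    have h3 : τ ^ 2 - τ + 1 = 0 := by linear_combination -h2
    refine ⟨by rw [Bieb.order]; linear_combination (τ - 2) * h3, fun l hl hl' h4 => ?_⟩
    simp only [Bieb.order] at hl'
    interval_cases l
    · have : (3 : ℂ) = 0 := by linear_combination h3 - (τ + 1) * h4
      norm_num at this
    · have h5 : τ = -1 := by linear_combination h3 - h4
      rw [h5] at h3; norm_num at h3
  · simp [Bieb.matrix] at h1 h2
    rw [← h1] at h2 ⊢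
    refine ⟨by rw [Bieb.order]; linear_combination (1 - τ ^ 2) * h2, fun l hl hl' h4 => ?_⟩
    simp only [Bieb.order] at hl'
    interval_cases l
    · have : (2 : ℂ) = 0 := by linear_combination -h2 - (τ + 1) * h4
      norm_num at this
    · have : (2 : ℂ) = 0 := by linear_combination -h2 - h4
      norm_num at this
    · have h5 : τ = -1 := by linear_combination -h4 - τ * h2
      rw [h5] at h2; norm_num at h2
  · simp [Bieb.matrix] at h1 h2
    rw [← h1] at h2 ⊢
    have h3 : τ ^ 2 - τ + 1 = 0 := by linear_combination -h2
    have h6 : τ ^ 3 = -1 := by linear_combination (τ + 1) * h3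
    refine ⟨by rw [Bieb.order]; linear_combination (τ ^ 3 - 1) * h6, fun l hl hl' h4 => ?_⟩
    simp only [Bieb.order] at hl'
    interval_cases l
    · rw [pow_one] at h4; rw [h4] at h3; norm_num at h3
    · have h5 : τ = 2 := by linear_combination h4 - h3
      rw [h5] at h3; norm_num at h3
    · rw [h6] at h4; norm_num at h4
    · have h5 : τ = -1 := by linear_combination h4 * (-1) + τ * h6
      rw [h5] at h3; norm_num at h3
    · have h5 : τ ^ 2 = -1 := by linear_combination -h4 + τ ^ 2 * h6
      have h7 : τ = 0 := by linear_combination h5 - h3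
      rw [h7] at h3; norm_num at h3

/-- Classification of the equivariant actions. -/
theorem isEquivariantAction_iff {θ R : ℝ} (hR : 0 < R) (hτ : τ.im ≠ 0) (b : Bieb)
    (S : Spinor ε →L[ℂ] Spinor ε) :
    (flatTorus θ R τ ε).IsEquivariantAction (b.act θ) b.order S ↔
      ∃ (σ : ℤˣ) (l : b.Label), b.Admissible σ τ ∧ l.spin = ε ∧
        ∀ (μ : Weight ε) (s : Fin 2),
          S (basisVec ε μ.1 s) = l.phase σ (μ.1 0) s • basisVec ε (b.lin μ.1) s := by
  have hket : ∀ (h : ∀ μ : Weight ε, ∀ i, ∃ n : ℤ, b.lin μ.1 i = n + half (ε i)) (μ : Weight ε)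
      (s : Fin 2), basisVec ε (b.lin μ.1) s = ket (Weight.lin b h μ, s) := fun h μ s =>
    basisVec_coe (Weight.lin b h μ) s
  constructor
  · intro hS
    obtain ⟨c, h, rfl⟩ := exists_holonomy hR hτ hS
    obtain ⟨σ, hσ⟩ := h.exists_admissible
    obtain ⟨l, hl, hl'⟩ := h.exists_label hσ
    refine ⟨σ, l, hσ, hl, fun μ s => ?_⟩
    rw [basisVec_coe, hket h.maps, h.op_ket, l.phase_eq, hl']
  · rintro ⟨σ, l, hσ, rfl, hS⟩
    have h := holonomy_label hσ l
    have : S = h.op := ext_ket fun ⟨μ, s⟩ => by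
      rw [← basisVec_coe, hS, basisVec_coe, hket h.maps, h.op_ket, l.phase_eq]
    rw [this]
    exact h.isEquivariantAction θ R

end Labels

section Axis
variable {θ R : ℝ} {τ : ℂ} {ε ε' : Fin 3 → Bool} {b : Bieb}

/-- The exponent of the central unitary `U^j`. -/
def axis (j : ℤ) : Fin 3 → ℤ := ![j, 0, 0]

theorem axis_add (i j : ℤ) : axis (i + j) = axis i + axis j := by
  ext t; fin_cases t <;> simp [axis]

theorem axis_neg (j : ℤ) : axis (-j) = -axis j := by
  ext t; fin_cases t <;> simp [axis]

theorem axis_zero : axis 0 = 0 := by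
  ext t; fin_cases t <;> simp [axis]

theorem lin_axis (b : Bieb) (j : ℤ) : b.lin (axis j) = axis j := by
  ext t; fin_cases t <;> simp [axis, Bieb.lin]

theorem phase_axis (j : ℤ) (x : Fin 3 → ℝ) : phase θ (axis j) x = 1 := by simp [phase, axis]

theorem shift_axis_apply (j : ℤ) (ψ : Spinor ε) (μ : Weight ε) (s : Fin 2) :
    shift θ ε (axis j) ψ (μ, s) = ψ (μ.add (-axis j), s) := by
  rw [shift_apply, phase_axis, one_mul]

theorem shift_shift (k l : Fin 3 → ℤ) (ψ : Spinor ε) :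
    shift θ ε k (shift θ ε l ψ) = SmoothTorus.cocycle θ k l • shift θ ε (k + l) ψ :=
  congrArg (fun T : Spinor ε →L[ℂ] Spinor ε => T ψ) ((projRep_shift θ ε).mul k l)

theorem shift_axis_left (k : Fin 3 → ℤ) (j : ℤ) (ψ : Spinor ε) :
    shift θ ε (axis j) (shift θ ε k ψ) = shift θ ε (axis j + k) ψ := by
  rw [shift_shift]; simp [SmoothTorus.cocycle, axis]

theorem shift_axis_right (k : Fin 3 → ℤ) (j : ℤ) (ψ : Spinor ε) :
    shift θ ε k (shift θ ε (axis j) ψ) = shift θ ε (axis j) (shift θ ε k ψ) := by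
  rw [shift_axis_left, shift_shift, add_comm]; simp [SmoothTorus.cocycle, axis]

theorem shift_axis_axis (i j : ℤ) (ψ : Spinor ε) :
    shift θ ε (axis i) (shift θ ε (axis j) ψ) = shift θ ε (axis (i + j)) ψ := by
  rw [shift_axis_left, axis_add]

theorem shift_axis_zero (ψ : Spinor ε) : shift θ ε (axis 0) ψ = ψ := by
  rw [axis_zero, (projRep_shift θ ε).one]; rfl

theorem rep_shift_axis (a : SmoothTorus θ) (j : ℤ) (ψ : Spinor ε) :
    SmoothTorus.rep θ ε a (shift θ ε (axis j) ψ) =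
      shift θ ε (axis j) (SmoothTorus.rep θ ε a ψ) := by
  refine (hasSum_rep a _).unique (((hasSum_rep a ψ).mapL (shift θ ε (axis j))).congr_fun fun k => ?_)
  rw [map_smul, shift_axis_right]

theorem inner_shift_axis (j : ℤ) (ψ φ : Spinor ε) :
    inner ℂ (shift θ ε (axis j) ψ) φ = inner ℂ ψ (shift θ ε (axis (-j)) φ) := by
  rw [axis_neg, ← (projRep_shift θ ε).star, ContinuousLinearMap.star_eq_adjoint,
    ContinuousLinearMap.adjoint_inner_right]

/-- The root of unity `e^{2 π i / N}`. -/
def Bieb.root (b : Bieb) : ℂ := exp (2 * Real.pi * I / b.order)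

theorem Bieb.isPrimitiveRoot_root (b : Bieb) : IsPrimitiveRoot b.root b.order :=
  Complex.isPrimitiveRoot_exp _ b.order_pos.ne'

theorem Bieb.root_ne_zero (b : Bieb) : b.root ≠ 0 := exp_ne_zero _

theorem Bieb.twist_eq (b : Bieb) (k : Fin 3 → ℤ) : b.twist k = b.root ^ k 0 := by
  rw [Bieb.twist, Bieb.root, ← exp_int_mul]; congr 1; ring

theorem Bieb.twist_axis (b : Bieb) (j : ℤ) : b.twist (axis j) = b.root ^ j := b.twist_eq _

theorem Bieb.twist_pow (b : Bieb) (k : Fin 3 → ℤ) : b.twist k ^ b.order = 1 := by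
  rw [b.twist_eq, ← zpow_natCast, ← zpow_mul, mul_comm, zpow_mul, zpow_natCast,
    b.isPrimitiveRoot_root.pow_eq_one, one_zpow]

theorem Bieb.mem_algebra {a : SmoothTorus θ} : a ∈ b.algebra θ ↔ b.act θ a = a := Iff.rfl

theorem monomial_axis_order_mem (b : Bieb) (θ : ℝ) :
    SmoothTorus.monomial θ (axis b.order) ∈ b.algebra θ := by
  rw [Bieb.mem_algebra, Bieb.act_monomial, lin_axis, b.twist_axis, zpow_natCast,
    b.isPrimitiveRoot_root.pow_eq_one, one_smul]

/-- The spectral components of `x^k`. -/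
theorem exists_components (b : Bieb) (θ : ℝ) (k : Fin 3 → ℤ) :
    ∃ a : ℕ → SmoothTorus θ, (∀ j, a j ∈ b.algebra θ) ∧ SmoothTorus.monomial θ k =
      ∑ j ∈ Finset.range b.order, a j * SmoothTorus.monomial θ (axis j) := by
  set v : ℕ → SmoothTorus θ := fun p => b.twist k ^ p • SmoothTorus.monomial θ (b.lin^[p] k) with hv
  have hact : ∀ p, b.act θ (v p) = v (p + 1) := by
    intro p
    have : b.twist (b.lin^[p] k) = b.twist k := by
      have h0 : b.lin^[p] k 0 = k 0 := by
        induction p with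
        | zero => rfl
        | succ p ih => rw [Function.iterate_succ_apply', Bieb.lin_zero', ih]
      rw [b.twist_eq, b.twist_eq, h0]
    rw [hv]
    simp only [map_smul, Bieb.act_monomial, smul_smul, this, pow_succ, Function.iterate_succ_apply']
  have hN : v b.order = v 0 := by
    simp [hv, b.twist_pow, b.lin_iterate_order]
  have hmul : ∀ j : ℤ, SmoothTorus.monomial θ (axis (-j)) * SmoothTorus.monomial θ (axis j) = 1 := by
    intro j
    refine SmoothTorus.op_injective ?_
    rw [SmoothTorus.op_mul (projRep_shift θ _), SmoothTorus.op_monomial, SmoothTorus.op_monomial,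
      SmoothTorus.op_one (projRep_shift θ _)]
    ext1 ψ
    rw [clm_mul_apply, shift_axis_axis, neg_add_cancel, shift_axis_zero]; rfl
  have hr := b.root_ne_zero
  let w : ℕ → SmoothTorus θ := fun j =>
    (b.order : ℂ)⁻¹ • ∑ p ∈ Finset.range b.order, (b.root ^ (-(j : ℤ))) ^ p • v p
  refine ⟨fun j => w j * SmoothTorus.monomial θ (axis (-j)), fun j => ?_, ?_⟩
  · have h1 : b.act θ (w j) = b.root ^ (j : ℤ) • w j := by
      have h2 : ∑ p ∈ Finset.range b.order, (b.root ^ (-(j : ℤ))) ^ p • v p =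
          ∑ p ∈ Finset.range b.order, (b.root ^ (-(j : ℤ))) ^ (p + 1) • v (p + 1) := by
        have e1 := Finset.sum_range_succ (fun p => (b.root ^ (-(j : ℤ))) ^ p • v p) b.order
        have e2 := Finset.sum_range_succ' (fun p => (b.root ^ (-(j : ℤ))) ^ p • v p) b.order
        have e3 : (b.root ^ (-(j : ℤ))) ^ b.order = 1 := by
          rw [← zpow_natCast, ← zpow_mul, mul_comm, zpow_mul, zpow_natCast,
            b.isPrimitiveRoot_root.pow_eq_one, one_zpow]
        simp only [hN, e3, pow_zero] at e1 e2
        exact add_right_cancel (e1.symm.trans e2)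
      simp only [w, map_smul, map_sum, hact]
      rw [h2, smul_comm (b.root ^ (j : ℤ)), Finset.smul_sum (r := b.root ^ (j : ℤ))]
      congr 1
      refine Finset.sum_congr rfl fun p _ => ?_
      have e : b.root ^ (j : ℤ) * (b.root ^ (-(j : ℤ))) ^ (p + 1) = (b.root ^ (-(j : ℤ))) ^ p := by
        rw [pow_succ', ← mul_assoc, ← zpow_add₀ hr, add_neg_cancel, zpow_zero, one_mul]
      rw [smul_smul (b.root ^ (j : ℤ)), e]
    rw [Bieb.mem_algebra, map_mul, h1, Bieb.act_monomial, lin_axis, b.twist_axis, smul_mul_smul_comm,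
      ← zpow_add₀ hr, add_neg_cancel, zpow_zero, one_smul]
  · simp only [mul_assoc, hmul, mul_one, w]
    rw [← Finset.smul_sum, Finset.sum_comm, Finset.sum_eq_single 0]
    · simp only [pow_zero, one_smul, Finset.sum_const, Finset.card_range]
      rw [← Nat.cast_smul_eq_nsmul ℂ, smul_smul, inv_mul_cancel₀ b.order_cast_ne, one_smul]
      simp [hv]
    · intro p hp hp0
      rw [← Finset.sum_smul]
      have : ∑ j ∈ Finset.range b.order, (b.root ^ (-(j : ℤ))) ^ p =
          ∑ j ∈ Finset.range b.order, (b.root ^ (-(p : ℤ))) ^ j :=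
        Finset.sum_congr rfl fun j _ => by
          rw [← zpow_natCast, ← zpow_natCast, ← zpow_mul, ← zpow_mul]; congr 1; ring
      rw [this, sum_pow_eq_zero_of_primitive b.isPrimitiveRoot_root, zero_smul]
      rw [Int.dvd_neg, Int.natCast_dvd_natCast]
      exact Nat.not_dvd_of_pos_of_lt (Nat.pos_of_ne_zero hp0) (Finset.mem_range.1 hp)
    · intro h; exact absurd (Finset.mem_range.2 b.order_pos) h

theorem shift_eq_components {a : ℕ → SmoothTorus θ} {k : Fin 3 → ℤ}
    (h : SmoothTorus.monomial θ k =
      ∑ j ∈ Finset.range b.order, a j * SmoothTorus.monomial θ (axis j)) (ψ : Spinor ε) :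
    shift θ ε k ψ =
      ∑ j ∈ Finset.range b.order, SmoothTorus.rep θ ε (a j) (shift θ ε (axis j) ψ) := by
  have h1 := congrArg (fun a => SmoothTorus.rep θ ε a ψ) h
  simp only [map_sum, map_mul, rep_monomial, sum_apply] at h1
  exact h1

/-- The operators which intertwine the actions of the fixed point algebra. -/
def IntertwinesFixed (θ : ℝ) (b : Bieb) (T : Spinor ε →L[ℂ] Spinor ε') : Prop :=
  ∀ a ∈ b.algebra θ, ∀ ψ, T (SmoothTorus.rep θ ε a ψ) = SmoothTorus.rep θ ε' a (T ψ)

theorem IntertwinesFixed.shift {T : Spinor ε →L[ℂ] Spinor ε'} (hT : IntertwinesFixed θ b T) {z : ℂ}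
    (hU : ∀ ψ, T (shift θ ε (axis 1) ψ) = z • shift θ ε' (axis 1) (T ψ))
    {a : ℕ → SmoothTorus θ} {k : Fin 3 → ℤ} (ha : ∀ j, a j ∈ b.algebra θ)
    (h : SmoothTorus.monomial θ k =
      ∑ j ∈ Finset.range b.order, a j * SmoothTorus.monomial θ (axis j)) (ψ : Spinor ε) :
    T (shift θ ε k ψ) = ∑ j ∈ Finset.range b.order,
      z ^ j • SmoothTorus.rep θ ε' (a j) (FlatBieberbach.shift θ ε' (axis j) (T ψ)) := by
  have hj : ∀ (j : ℕ) ψ, T (FlatBieberbach.shift θ ε (axis j) ψ) =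
      z ^ j • FlatBieberbach.shift θ ε' (axis j) (T ψ) := by
    intro j
    induction j with
    | zero => intro ψ; simp only [Nat.cast_zero, shift_axis_zero, pow_zero, one_smul]
    | succ j ih =>
      intro ψ
      rw [Nat.cast_succ, ← shift_axis_axis, ih, hU, map_smul, shift_axis_axis, smul_smul, pow_succ]
  rw [shift_eq_components h, map_sum]
  refine Finset.sum_congr rfl fun j _ => ?_
  rw [hT _ (ha j), hj, map_smul]

theorem IntertwinesFixed.shift_eq {T : Spinor ε →L[ℂ] Spinor ε'} (hT : IntertwinesFixed θ b T)
    (hU : ∀ ψ, T (FlatBieberbach.shift θ ε (axis 1) ψ) = FlatBieberbach.shift θ ε' (axis 1) (T ψ))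
    (k : Fin 3 → ℤ) (ψ : Spinor ε) :
    T (FlatBieberbach.shift θ ε k ψ) = FlatBieberbach.shift θ ε' k (T ψ) := by
  obtain ⟨a, ha, h⟩ := exists_components b θ k
  rw [hT.shift (z := 1) (by simpa using hU) ha h, shift_eq_components h]
  simp

theorem IntertwinesFixed.shift_twist {T : Spinor ε →L[ℂ] Spinor ε'} (hT : IntertwinesFixed θ b T)
    (hU : ∀ ψ, T (FlatBieberbach.shift θ ε (axis 1) ψ) =
      b.root • FlatBieberbach.shift θ ε' (axis 1) (T ψ))
    (k : Fin 3 → ℤ) (ψ : Spinor ε) :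
    T (FlatBieberbach.shift θ ε k ψ) = b.twist k • FlatBieberbach.shift θ ε' (b.lin k) (T ψ) := by
  obtain ⟨a, ha, h⟩ := exists_components b θ k
  rw [hT.shift hU ha h]
  have h1 := congrArg (fun a => SmoothTorus.rep θ ε' (b.act θ a) (T ψ)) h
  simp only [Bieb.act_monomial, map_sum, map_mul, map_smul, rep_monomial, sum_apply, lin_axis,
    b.twist_axis, zpow_natCast, Bieb.mem_algebra.1 (ha _)] at h1
  refine Eq.trans (Finset.sum_congr rfl fun j _ => ?_) h1.symm
  rw [mul_smul_comm]; rfl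

/-- The grading operator `diag(1, -1)`. -/
def gradingOp (ε : Fin 3 → Bool) : Spinor ε →L[ℂ] Spinor ε := constOp ε !![1, 0; 0, -1]

theorem gradingOp_apply (ψ : Spinor ε) (μ : Weight ε) (s : Fin 2) :
    gradingOp ε ψ (μ, s) = (sgn s : ℂ) * ψ (μ, s) := by
  rw [gradingOp, constOp_apply]
  fin_cases s <;> simp [sgn]

theorem gradingOp_shift_axis (j : ℤ) (ψ : Spinor ε) :
    gradingOp ε (shift θ ε (axis j) ψ) = shift θ ε (axis j) (gradingOp ε ψ) := by
  ext ⟨μ, s⟩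
  rw [gradingOp_apply, shift_axis_apply, shift_axis_apply, gradingOp_apply]

theorem shift_axis_mem_graph (j : ℤ) {ψ φ : Spinor ε} (h : (ψ, φ) ∈ (torusDirac R τ ε).graph) :
    (shift θ ε (axis j) ψ,
      shift θ ε (axis j) φ + (j * R : ℂ) • gradingOp ε (shift θ ε (axis j) ψ)) ∈
      (torusDirac R τ ε).graph := by
  rw [mem_graph_torusDirac] at h ⊢
  rintro ⟨μ, s⟩
  rw [lp.coeFn_add, Pi.add_apply, lp.coeFn_smul, Pi.smul_apply, gradingOp_apply, shift_axis_apply, h,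
    smul_eq_mul]
  fin_cases s
  · change diracFun R τ ψ (_, 0) + _ * (_ * (shift θ ε (axis j) ψ) (μ, 0)) = diracFun R τ _ (μ, 0)
    rw [diracFun_zero', diracFun_zero', shift_axis_apply, shift_axis_apply]
    simp [Weight.add, axis, sgn]; ring
  · change diracFun R τ ψ (_, 1) + _ * (_ * (shift θ ε (axis j) ψ) (μ, 1)) = diracFun R τ _ (μ, 1)
    rw [diracFun_one', diracFun_one', shift_axis_apply, shift_axis_apply]
    simp [Weight.add, axis, sgn]; ring

/-- An operator which intertwines the fixed point algebras and the Dirac operators preserves the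
grading. -/
theorem IntertwinesFixed.grading {Q : Spinor ε →L[ℂ] Spinor ε'} (hQ : IntertwinesFixed θ b Q)
    (hD : IntertwinesDirac R τ Q) (hR : 0 < R) (ψ : Spinor ε) :
    Q (gradingOp ε ψ) = gradingOp ε' (Q ψ) := by
  have hN := hQ _ (monomial_axis_order_mem b θ)
  simp only [rep_monomial] at hN
  have hR' : ((b.order : ℤ) * R : ℂ) ≠ 0 :=
    mul_ne_zero (by exact_mod_cast b.order_pos.ne') (by exact_mod_cast hR.ne')
  suffices Q.comp (gradingOp ε) = (gradingOp ε').comp Q from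
    congrArg (fun T : Spinor ε →L[ℂ] Spinor ε' => T ψ) this
  refine ext_ket fun ⟨μ, s⟩ => ?_
  change Q (gradingOp ε (ket (μ, s))) = gradingOp ε' (Q (ket (μ, s)))
  have hμ : ket (μ, s) = FlatBieberbach.shift θ ε (axis b.order) (ket (μ.add (axis (-b.order)), s)) := by
    rw [shift_ket, phase_axis, one_smul]
    congr 2
    exact Weight.ext' fun i => by simp [Weight.add, axis_neg]
  have h1 := dirac_ket_mem (R := R) (τ := τ) (μ.add (axis (-b.order))) s
  have h2 := hD _ _ (shift_axis_mem_graph (θ := θ) b.order h1)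
  have h3 := shift_axis_mem_graph (θ := θ) b.order (hD _ _ h1)
  rw [← hN, ← hN] at h3
  have h4 := LinearPMap.mem_graph_snd_inj _ h2 h3 rfl
  rw [← hμ, map_add, map_smul] at h4
  exact smul_right_injective _ hR' (add_left_cancel h4)

/-- The operator `U^j Q U^{-j}`. -/
def axisConj (θ : ℝ) (Q : Spinor ε →L[ℂ] Spinor ε') (j : ℤ) : Spinor ε →L[ℂ] Spinor ε' :=
  (shift θ ε' (axis j)).comp (Q.comp (shift θ ε (axis (-j))))

theorem axisConj_apply (Q : Spinor ε →L[ℂ] Spinor ε') (j : ℤ) (ψ : Spinor ε) :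
    axisConj θ Q j ψ = shift θ ε' (axis j) (Q (shift θ ε (axis (-j)) ψ)) := rfl

theorem axisConj_zero (Q : Spinor ε →L[ℂ] Spinor ε') : axisConj θ Q 0 = Q := by
  ext1 ψ
  rw [axisConj_apply, neg_zero, shift_axis_zero, shift_axis_zero]

theorem axisConj_shift_axis (Q : Spinor ε →L[ℂ] Spinor ε') (j : ℤ) (ψ : Spinor ε) :
    axisConj θ Q (j + 1) (shift θ ε (axis 1) ψ) = shift θ ε' (axis 1) (axisConj θ Q j ψ) := by
  rw [axisConj_apply, axisConj_apply, shift_axis_axis, shift_axis_axis, add_comm 1 j]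
  ring_nf

theorem IntertwinesFixed.axisConj {Q : Spinor ε →L[ℂ] Spinor ε'} (hQ : IntertwinesFixed θ b Q)
    (j : ℤ) : IntertwinesFixed θ b (axisConj θ Q j) := by
  intro a ha ψ
  rw [axisConj_apply, axisConj_apply, ← rep_shift_axis, hQ a ha, ← rep_shift_axis]

theorem IntertwinesFixed.axisConj_add_order {Q : Spinor ε →L[ℂ] Spinor ε'}
    (hQ : IntertwinesFixed θ b Q) (j : ℤ) :
    FlatBieberbach.axisConj θ Q (j + b.order) = FlatBieberbach.axisConj θ Q j := by
  ext1 ψ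
  have hN := hQ _ (monomial_axis_order_mem b θ)
  simp only [rep_monomial] at hN
  rw [axisConj_apply, axisConj_apply, ← shift_axis_axis, ← hN, shift_axis_axis]
  ring_nf

theorem IntertwinesFixed.axisConj_dirac {Q : Spinor ε →L[ℂ] Spinor ε'}
    (hQ : IntertwinesFixed θ b Q) (hD : IntertwinesDirac R τ Q) (hR : 0 < R) (j : ℤ) :
    IntertwinesDirac R τ (FlatBieberbach.axisConj θ Q j) := by
  intro ψ φ h
  have h1 := shift_axis_mem_graph (θ := θ) j (hD _ _ (shift_axis_mem_graph (θ := θ) (-j) h))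
  refine (congrArg (fun χ => (FlatBieberbach.axisConj θ Q j ψ, χ) ∈ (torusDirac R τ ε').graph) ?_).mp h1
  rw [map_add, map_add, map_smul, map_smul, hQ.grading hD hR, gradingOp_shift_axis, add_assoc,
    ← add_smul]
  simp [axisConj_apply]

/-- The sum of the operators `U^j Q U^{-j}` with coefficients `z^j`. -/
def axisSum (θ : ℝ) (b : Bieb) (z : ℂ) (Q : Spinor ε →L[ℂ] Spinor ε') : Spinor ε →L[ℂ] Spinor ε' :=
  ∑ j ∈ Finset.range b.order, z ^ j • axisConj θ Q j

theorem axisSum_apply (z : ℂ) (Q : Spinor ε →L[ℂ] Spinor ε') (ψ : Spinor ε) :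
    axisSum θ b z Q ψ = ∑ j ∈ Finset.range b.order, z ^ j • axisConj θ Q j ψ := by
  simp [axisSum]

theorem IntertwinesFixed.sum_succ {Q : Spinor ε →L[ℂ] Spinor ε'} (hQ : IntertwinesFixed θ b Q)
    {z : ℂ} (hz : z ^ b.order = 1) :
    ∑ j ∈ Finset.range b.order, z ^ (j + 1) • FlatBieberbach.axisConj θ Q ((j + 1 : ℕ) : ℤ) =
      axisSum θ b z Q := by
  have e1 := Finset.sum_range_succ (fun j : ℕ => z ^ j • FlatBieberbach.axisConj θ Q j) b.order
  have e2 := Finset.sum_range_succ' (fun j : ℕ => z ^ j • FlatBieberbach.axisConj θ Q j) b.order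
  have e3 := hQ.axisConj_add_order 0
  rw [zero_add] at e3
  simp only [hz, e3, pow_zero, Nat.cast_zero] at e1 e2
  exact (add_right_cancel (e1.symm.trans e2)).symm

theorem IntertwinesFixed.axisSum_shift_axis {Q : Spinor ε →L[ℂ] Spinor ε'}
    (hQ : IntertwinesFixed θ b Q) {z : ℂ} (hz : z ^ b.order = 1) (ψ : Spinor ε) :
    axisSum θ b z Q (FlatBieberbach.shift θ ε (axis 1) ψ) =
      z • FlatBieberbach.shift θ ε' (axis 1) (axisSum θ b z Q ψ) := by
  conv_lhs => rw [← hQ.sum_succ hz, sum_apply]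
  conv_rhs => rw [axisSum_apply, map_sum, Finset.smul_sum]
  refine Finset.sum_congr rfl fun j _ => ?_
  rw [smul_apply, Nat.cast_succ, axisConj_shift_axis, map_smul, smul_smul, pow_succ']

theorem IntertwinesFixed.axisSum {Q : Spinor ε →L[ℂ] Spinor ε'} (hQ : IntertwinesFixed θ b Q)
    (z : ℂ) : IntertwinesFixed θ b (axisSum θ b z Q) := by
  intro a ha ψ
  rw [axisSum_apply, axisSum_apply, map_sum]
  refine Finset.sum_congr rfl fun j _ => ?_
  rw [hQ.axisConj j a ha, map_smul]

theorem IntertwinesDirac.sum {ι : Type*} (s : Finset ι) (f : ι → ℂ)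
    (T : ι → (Spinor ε →L[ℂ] Spinor ε')) (h : ∀ i ∈ s, IntertwinesDirac R τ (T i)) :
    IntertwinesDirac R τ (∑ i ∈ s, f i • T i) := by
  intro ψ φ hψ
  have := Submodule.sum_mem (torusDirac R τ ε').graph
    fun i hi => Submodule.smul_mem _ (f i) (h i hi ψ φ hψ)
  convert this using 1
  simp [Prod.ext_iff, Prod.fst_sum, Prod.snd_sum]

theorem IntertwinesFixed.axisSum_dirac {Q : Spinor ε →L[ℂ] Spinor ε'}
    (hQ : IntertwinesFixed θ b Q) (hD : IntertwinesDirac R τ Q) (hR : 0 < R) (z : ℂ) :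
    IntertwinesDirac R τ (FlatBieberbach.axisSum θ b z Q) :=
  IntertwinesDirac.sum _ _ _ fun j _ => hQ.axisConj_dirac hD hR j

/-- The sum over `j` of `U^j Q U^{-j}` commutes with the whole algebra of the torus. -/
theorem IntertwinesFixed.intertwines_axisSum {Q : Spinor ε →L[ℂ] Spinor ε'}
    (hQ : IntertwinesFixed θ b Q) (hD : IntertwinesDirac R τ Q) (hR : 0 < R) :
    Intertwines θ R τ (FlatBieberbach.axisSum θ b 1 Q) where
  shift := (hQ.axisSum 1).shift_eq fun ψ => by
    rw [hQ.axisSum_shift_axis (one_pow _), one_smul]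
  dirac := hQ.axisSum_dirac hD hR 1

/-- The subspaces `K` with `U^j K ⊥ K` for `0 < j < N`. -/
def AxisOrthogonal (θ : ℝ) (b : Bieb) (K : Submodule ℂ (Spinor ε)) : Prop :=
  ∀ j : ℕ, 0 < j → j < b.order → ∀ ψ ∈ K, ∀ φ ∈ K, inner ℂ (shift θ ε (axis j) ψ) φ = 0

theorem AxisOrthogonal.inner_axisSum {K : Submodule ℂ (Spinor ε')} (hK : AxisOrthogonal θ b K)
    {Q : Spinor ε →L[ℂ] Spinor ε'} (hQ : ∀ ψ, Q ψ ∈ K) (z : ℂ) {χ : Spinor ε'} (hχ : χ ∈ K)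
    (ψ : Spinor ε) : inner ℂ (axisSum θ b z Q ψ) χ = inner ℂ (Q ψ) χ := by
  rw [axisSum_apply, sum_inner, Finset.sum_eq_single 0]
  · rw [Nat.cast_zero, axisConj_zero, pow_zero, one_smul]
  · intro j hj hj0
    rw [inner_smul_left, axisConj_apply,
      hK j (Nat.pos_of_ne_zero hj0) (Finset.mem_range.1 hj) _ (hQ _) _ hχ, mul_zero]
  · intro h; exact absurd (Finset.mem_range.2 b.order_pos) h

end Axis

section RestrictTriple
variable {𝒜 : Type*} [Ring 𝒜] [StarRing 𝒜] [Algebra ℂ 𝒜] [StarModule ℂ 𝒜]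
  {H : Type*} [NormedAddCommGroup H] [InnerProductSpace ℂ H] [CompleteSpace H]
  {T : RealTriple 𝒜 H} {B : StarSubalgebra ℂ 𝒜} {K : Submodule ℂ H} [CompleteSpace K]

theorem mem_graph_restrict (h : T.Reduces B K) {ψ φ : K} :
    (ψ, φ) ∈ (T.restrict B K h).dirac.graph ↔ ((ψ : H), (φ : H)) ∈ T.dirac.graph := by
  constructor
  · intro hg
    obtain ⟨x, hx, hx'⟩ := (LinearPMap.mem_graph_iff _).1 hg
    simp only at hx hx'
    subst hx hx'
    exact T.dirac.mem_graph ⟨x.1, x.2⟩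
  · intro hg
    obtain ⟨x, hx, hx'⟩ := (LinearPMap.mem_graph_iff _).1 hg
    simp only at hx hx'
    refine (LinearPMap.mem_graph_iff _).2 ⟨⟨ψ, ?_⟩, rfl, Subtype.ext ?_⟩
    · change (ψ : H) ∈ T.dirac.domain
      rw [← hx]; exact x.2
    · refine Eq.trans ?_ hx'
      exact congrArg T.dirac (Subtype.ext hx.symm)

/-- The restriction of a real spectral triple is a real spectral triple. -/
theorem RealTriple.IsRealSpectralTriple.restrict (hT : T.IsRealSpectralTriple)
    (h : T.Reduces B K) : (T.restrict B K h).IsRealSpectralTriple := by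
  obtain ⟨r, hr, hr1, hr2⟩ := hT.compactResolvent
  have hclosed : IsClosed (K : Set H) := (completeSpace_coe_iff_isComplete.1 ‹_›).isClosed
  have hrK : ∀ ψ ∈ K, r ψ ∈ K := by
    intro ψ hψ
    have h1 := h.dirac_mem.starProjection (hr1 ψ)
    have h2 := Submodule.sub_mem _ (hr1 ψ) h1
    rw [map_add, map_smul, (Submodule.starProjection_eq_self_iff).2 hψ, Prod.mk_sub_mk] at h2
    have h3 := hr2 _ _ h2
    rw [show ψ + I • r ψ - (ψ + I • K.starProjection (r ψ)) - I • (r ψ - K.starProjection (r ψ)) = 0 by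
      rw [smul_sub]; abel, map_zero] at h3
    rw [sub_eq_zero.1 h3.symm]
    exact Submodule.starProjection_apply_mem K _
  refine ⟨?_, ⟨(r.comp K.subtypeL).codRestrict K fun ψ => hrK ψ ψ.2, ?_, ?_, ?_⟩, ?_, ?_, ?_, ?_⟩
  · refine isSelfAdjoint_of_resolvents _ (fun ψ φ ψ' φ' h1 h2 => ?_) (fun χ => ?_) fun χ => ?_
    · exact IsSelfAdjoint.inner_graph hT.selfAdjoint ((mem_graph_restrict h).1 h1) ((mem_graph_restrict h).1 h2)
    · exact ⟨⟨r χ, hrK χ χ.2⟩, (mem_graph_restrict h).2 (hr1 χ)⟩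
    · have hJ : T.conj.symm (χ : H) ∈ K := (h.conj_mem _).1 (by simp)
      refine ⟨⟨T.conj (r (T.conj.symm χ)), (h.conj_mem _).2 (hrK _ hJ)⟩, (mem_graph_restrict h).2 ?_⟩
      have h1 := hT.conj_dirac _ _ (hr1 (T.conj.symm (χ : H)))
      rw [map_add, T.conj.apply_symm_apply, LinearIsometryEquiv.map_smulₛₗ] at h1
      refine (congrArg (fun x => (T.conj (r (T.conj.symm (χ : H))), x) ∈ T.dirac.graph) ?_).mp h1
      simp [sub_eq_add_neg]
  · exact (hr.comp_clm K.subtypeL).codRestrict _ hclosed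
  · exact fun ψ => (mem_graph_restrict h).2 (hr1 ψ)
  · exact fun ψ φ hψ => Subtype.ext (hr2 _ _ ((mem_graph_restrict h).1 hψ))
  · exact fun ψ => Subtype.ext (hT.conj_conj ψ)
  · exact fun ψ φ hψ => (mem_graph_restrict h).2 (hT.conj_dirac _ _ ((mem_graph_restrict h).1 hψ))
  · exact fun a b ψ => Subtype.ext (hT.order_zero a b ψ)
  · intro a
    obtain ⟨C, hC, hC'⟩ := hT.order_one a
    have hdom : ∀ ψ ∈ K, ψ ∈ T.dirac.domain → C ψ ∈ K := by
      intro ψ hψ hd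
      have h1 := h.dirac_apply_mem ⟨ψ, hd⟩ hψ
      obtain ⟨x, hx, hx'⟩ := (LinearPMap.mem_graph_iff _).1 (hC _ _ (T.dirac.mem_graph ⟨ψ, hd⟩))
      simp only at hx hx'
      have h2 := h.dirac_apply_mem x (by rw [hx]; exact h.rep_mem a a.2 ψ hψ)
      rw [hx'] at h2
      exact (Submodule.add_mem_iff_right K (h.rep_mem a a.2 _ h1)).1 h2
    have hCK : ∀ ψ ∈ K, C ψ ∈ K := by
      have h1 : (fun ψ => C (K.starProjection ψ)) =
          fun ψ => K.starProjection (C (K.starProjection ψ)) := by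
        refine Continuous.ext_on hT.selfAdjoint.dense_domain (by fun_prop) (by fun_prop) fun ψ hψ => ?_
        refine ((Submodule.starProjection_eq_self_iff).2 (hdom _ ?_ ?_)).symm
        · exact Submodule.starProjection_apply_mem K _
        · exact LinearPMap.mem_domain_of_mem_graph
            (h.dirac_mem.starProjection (T.dirac.mem_graph ⟨ψ, hψ⟩))
      intro ψ hψ
      have h2 := congrFun h1 ψ
      simp only [(Submodule.starProjection_eq_self_iff).2 hψ] at h2
      rw [h2]
      exact Submodule.starProjection_apply_mem K _
    refine ⟨(C.comp K.subtypeL).codRestrict K fun ψ => hCK ψ ψ.2, fun ψ φ hψ => ?_, fun b ψ => ?_⟩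
    · exact (mem_graph_restrict h).2 (hC _ _ ((mem_graph_restrict h).1 hψ))
    · exact Subtype.ext (hC' b ψ)

end RestrictTriple

section Fixed
variable {θ R : ℝ} {b : Bieb} {τ : ℂ} {ε : Fin 3 → Bool} {c : ℂ}

/-- The invariant subspace of an action. -/
def Holonomy.fixed (h : Holonomy b τ ε c) : Submodule ℂ (Spinor ε) where
  carrier := {ψ | h.op ψ = ψ}
  zero_mem' := map_zero _
  add_mem' := fun {ψ φ} hψ hφ => by
    simp only [Set.mem_ofPred_eq] at hψ hφ ⊢
    rw [map_add, hψ, hφ]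
  smul_mem' := fun z ψ hψ => by
    simp only [Set.mem_ofPred_eq] at hψ ⊢
    rw [map_smul, hψ]

theorem Holonomy.mem_fixed (h : Holonomy b τ ε c) {ψ : Spinor ε} : ψ ∈ h.fixed ↔ h.op ψ = ψ := Iff.rfl

theorem Holonomy.isClosed_fixed (h : Holonomy b τ ε c) : IsClosed (h.fixed : Set (Spinor ε)) :=
  isClosed_eq h.op.continuous continuous_id

instance Holonomy.completeSpace_fixed (h : Holonomy b τ ε c) : CompleteSpace h.fixed :=
  h.isClosed_fixed.completeSpace_coe

/-- The projection to the invariant subspace. -/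
def Holonomy.proj (h : Holonomy b τ ε c) : Spinor ε →L[ℂ] Spinor ε :=
  (b.order : ℂ)⁻¹ • ∑ p ∈ Finset.range b.order, h.op ^ p

theorem Holonomy.proj_apply (h : Holonomy b τ ε c) (ψ : Spinor ε) :
    h.proj ψ = (b.order : ℂ)⁻¹ • ∑ p ∈ Finset.range b.order, (h.op ^ p) ψ := by
  rw [proj, smul_apply, sum_apply]

theorem Holonomy.op_pow_of_mem (h : Holonomy b τ ε c) {ψ : Spinor ε} (hψ : ψ ∈ h.fixed) (p : ℕ) :
    (h.op ^ p) ψ = ψ := by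
  induction p with
  | zero => rfl
  | succ p ih => rw [pow_succ, clm_mul_apply, h.mem_fixed.1 hψ, ih]

theorem Holonomy.proj_mem (h : Holonomy b τ ε c) (ψ : Spinor ε) : h.proj ψ ∈ h.fixed := by
  rw [h.mem_fixed, h.proj_apply, map_smul, map_sum]
  congr 1
  have e1 := Finset.sum_range_succ (fun p => (h.op ^ p) ψ) b.order
  have e2 := Finset.sum_range_succ' (fun p => (h.op ^ p) ψ) b.order
  rw [h.op_pow] at e1
  rw [pow_zero] at e2
  rw [← add_right_cancel (e2.symm.trans e1)]
  exact Finset.sum_congr rfl fun p _ => by rw [pow_succ', clm_mul_apply]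

theorem Holonomy.op_pow_inner (h : Holonomy b τ ε c) (p : ℕ) (ψ φ : Spinor ε) :
    inner ℂ ((h.op ^ p) ψ) ((h.op ^ p) φ) = inner ℂ ψ φ := by
  induction p with
  | zero => rfl
  | succ p ih => rw [pow_succ', clm_mul_apply, clm_mul_apply, h.op_inner, ih]

theorem Holonomy.starProjection_fixed (h : Holonomy b τ ε c) : h.fixed.starProjection = h.proj := by
  ext1 ψ
  refine Submodule.eq_starProjection_of_mem_of_inner_eq_zero (h.proj_mem ψ) fun χ hχ => ?_
  have h1 : ∀ p : ℕ, inner ℂ ((h.op ^ p) ψ) χ = inner ℂ ψ χ := fun p => by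
    conv_lhs => rw [← h.op_pow_of_mem hχ p]
    exact h.op_pow_inner p ψ χ
  rw [inner_sub_left, h.proj_apply, inner_smul_left, sum_inner]
  simp only [h1, Finset.sum_const, Finset.card_range, nsmul_eq_mul, map_inv₀, map_natCast]
  rw [← mul_assoc, inv_mul_cancel₀ b.order_cast_ne, one_mul, sub_self]

theorem Holonomy.op_pow_dirac (h : Holonomy b τ ε c) (p : ℕ) : IntertwinesDirac R τ (h.op ^ p) := by
  induction p with
  | zero => exact fun _ _ h => h
  | succ p ih =>
    intro ψ φ hψ
    rw [pow_succ', clm_mul_apply, clm_mul_apply]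
    exact h.op_dirac _ _ (ih _ _ hψ)

theorem Holonomy.proj_dirac (h : Holonomy b τ ε c) : IntertwinesDirac R τ h.proj := by
  have h1 := IntertwinesDirac.sum (R := R) (τ := τ) (Finset.range b.order)
    (fun _ => (b.order : ℂ)⁻¹) (fun p => h.op ^ p) fun p _ => h.op_pow_dirac p
  rwa [← Finset.smul_sum] at h1

theorem Holonomy.rep_mem_fixed (h : Holonomy b τ ε c) {a : SmoothTorus θ} (ha : a ∈ b.algebra θ)
    {ψ : Spinor ε} (hψ : ψ ∈ h.fixed) : SmoothTorus.rep θ ε a ψ ∈ h.fixed := by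
  have h1 := congrArg (fun T : Spinor ε →L[ℂ] Spinor ε => T ψ)
    ((h.isEquivariantAction θ 1).rep a)
  rw [Bieb.mem_algebra.1 ha] at h1
  change h.op (SmoothTorus.rep θ ε a ψ) = SmoothTorus.rep θ ε a (h.op ψ) at h1
  rw [h.mem_fixed, h1, h.mem_fixed.1 hψ]

theorem Holonomy.reduces_fixed (h : Holonomy b τ ε c) (θ R : ℝ) :
    (flatTorus θ R τ ε).Reduces (b.algebra θ) h.fixed where
  rep_mem a ha ψ hψ := h.rep_mem_fixed ha hψ
  conj_mem ψ := by
    change torusConj ε ψ ∈ h.fixed ↔ _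
    rw [h.mem_fixed, h.op_conj, h.mem_fixed, (torusConj ε).injective.eq_iff]
  dirac_mem := reducesOperator_of_starProjection fun ψ φ hψ => by
    rw [h.starProjection_fixed]; exact h.proj_dirac ψ φ hψ

theorem Holonomy.axisOrthogonal_fixed (h : Holonomy b τ ε c) (θ : ℝ) :
    AxisOrthogonal θ b h.fixed := by
  intro j hj0 hjN ψ hψ φ hφ
  have h1 := h.op_inner (shift θ ε (axis j) ψ) φ
  rw [h.op_shift, lin_axis, h.mem_fixed.1 hψ, h.mem_fixed.1 hφ, b.twist_axis, inner_smul_left] at h1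
  by_contra h2
  have h3 := mul_right_cancel₀ h2 (h1.trans (one_mul _).symm)
  have h4 : b.root ^ j = 1 := by
    have := congrArg (starRingEnd ℂ) h3
    rwa [Complex.conj_conj, map_one, zpow_natCast] at this
  exact absurd (Nat.le_of_dvd hj0 ((b.isPrimitiveRoot_root.pow_eq_one_iff_dvd j).1 h4)) (by omega)

theorem Holonomy.slope_iterate (h : Holonomy b τ ε c) (p : ℕ) (x : Fin 3 → ℝ) :
    slope τ (b.lin^[p] x) = (c ^ 2) ^ p * slope τ x := by
  induction p with
  | zero => simp
  | succ p ih => rw [Function.iterate_succ_apply', h.slope_eq, ih, pow_succ]; ring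

theorem Holonomy.lin_iterate_ne (h : Holonomy b τ ε c) {μ : Weight ε} (hμ : slope τ μ.1 ≠ 0) {p : ℕ}
    (hp : 0 < p) (hpN : p < b.order) : (Weight.lin b h.maps)^[p] μ ≠ μ := by
  intro h1
  have h2 := h.slope_iterate p μ.1
  rw [← Weight.lin_iterate_coe h.maps, h1] at h2
  have h3 := mul_right_cancel₀ hμ (h2.symm.trans (one_mul _).symm)
  exact absurd (Nat.le_of_dvd hp ((h.isPrimitiveRoot.pow_eq_one_iff_dvd p).1 h3)) (by omega)

theorem Holonomy.proj_ket (h : Holonomy b τ ε c) (μ : Weight ε) (s : Fin 2) :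
    h.proj (ket (μ, s)) = (b.order : ℂ)⁻¹ • ∑ p ∈ Finset.range b.order,
      holPhase b c (μ.1 0) s ^ p • ket ((Weight.lin b h.maps)^[p] μ, s) := by
  rw [h.proj_apply]
  simp only [h.op_pow_ket]

theorem Holonomy.proj_ket_apply_self (h : Holonomy b τ ε c) {μ : Weight ε} (hμ : slope τ μ.1 ≠ 0)
    (s : Fin 2) : h.proj (ket (μ, s)) (μ, s) = (b.order : ℂ)⁻¹ := by
  rw [h.proj_ket, lp.coeFn_smul, Pi.smul_apply, lp.coeFn_sum, Finset.sum_apply,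
    Finset.sum_eq_single 0]
  · simp [ket_apply_self]
  · intro p hp hp0
    have := h.lin_iterate_ne hμ (Nat.pos_of_ne_zero hp0) (Finset.mem_range.1 hp)
    rw [lp.coeFn_smul, Pi.smul_apply, ket_apply_ne, smul_zero]
    exact fun e => this (congrArg Prod.fst e).symm
  · intro h; exact absurd (Finset.mem_range.2 b.order_pos) h

theorem exists_slope_ne (hτ : τ.im ≠ 0) (ε : Fin 3 → Bool) : ∃ μ : Weight ε, slope τ μ.1 ≠ 0 := by
  refine ⟨Weight.ofInt ε ![0, 1, 0], fun h => ?_⟩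
  have := ((slope_eq_zero hτ).1 h).1
  rw [Weight.ofInt_apply] at this
  have h1 := half_mem (ε 1)
  cases h2 : ε 1 <;> simp [half, h2] at this; norm_num at this

theorem Holonomy.fixed_ne_bot (h : Holonomy b τ ε c) (hτ : τ.im ≠ 0) : h.fixed ≠ ⊥ := by
  obtain ⟨μ, hμ⟩ := exists_slope_ne hτ ε
  intro h1
  have h2 := h.proj_mem (ket (μ, 0))
  rw [h1, Submodule.mem_bot] at h2
  have h3 := h.proj_ket_apply_self hμ 0
  rw [h2] at h3
  exact inv_ne_zero b.order_cast_ne h3.symm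

/-- The invariant subspace determines the action. -/
theorem Holonomy.eq_of_fixed_eq {c' : ℂ} (h : Holonomy b τ ε c) (h' : Holonomy b τ ε c')
    (hτ : τ.im ≠ 0) (hf : h.fixed = h'.fixed) : c = c' := by
  obtain ⟨μ, hμ⟩ := exists_slope_ne hτ ε
  have h1 := h.proj_mem (ket (μ, 0))
  have h2 := h1
  rw [hf] at h2
  have h3 := (h.op_lin (h.proj (ket (μ, 0))) μ 0).symm.trans
    (congrArg (fun ψ : Spinor ε => ψ (Weight.lin b h.maps μ, 0)) ((h.mem_fixed.1 h1).trans (h'.mem_fixed.1 h2).symm))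
  simp only at h3
  rw [show Weight.lin b h.maps μ = Weight.lin b h'.maps μ from rfl, h'.op_lin] at h3
  have h4 := mul_right_cancel₀
    (by rw [h.proj_ket_apply_self hμ]; exact inv_ne_zero b.order_cast_ne) h3
  exact mul_left_cancel₀ (charN_ne_zero _ _) h4

end Fixed

section InvariantSubspaces
variable {θ R : ℝ} {b : Bieb} {τ : ℂ} {ε ε' : Fin 3 → Bool} {c : ℂ}

theorem RealTriple.Reduces.starProjection_rep {K : Submodule ℂ (Spinor ε)} [CompleteSpace K]
    (h : (flatTorus θ R τ ε).Reduces (b.algebra θ) K) :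
    IntertwinesFixed θ b K.starProjection := by
  intro a ha ψ
  refine starProjection_commute K _ (h.rep_mem a ha) (fun ψ hψ => ?_) ψ
  rw [← map_star]
  exact h.rep_mem _ (star_mem ha) ψ hψ

theorem inner_antiunitary {H : Type*} [NormedAddCommGroup H] [InnerProductSpace ℂ H]
    (J : H ≃ₗᵢ⋆[ℂ] H) (ψ φ : H) : inner ℂ (J ψ) (J φ) = inner ℂ φ ψ := by
  rw [← inner_conj_symm φ ψ, inner_eq_sum_norm_sq_div_four (𝕜 := ℂ) (J ψ) (J φ),
    inner_eq_sum_norm_sq_div_four (𝕜 := ℂ) ψ φ]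
  have h1 : J ψ - (RCLike.I : ℂ) • J φ = J (ψ + (RCLike.I : ℂ) • φ) := by
    rw [map_add, LinearIsometryEquiv.map_smulₛₗ]; simp [sub_eq_add_neg]
  have h2 : J ψ + (RCLike.I : ℂ) • J φ = J (ψ - (RCLike.I : ℂ) • φ) := by
    rw [map_sub, LinearIsometryEquiv.map_smulₛₗ]; simp
  rw [h1, h2, ← map_add, ← map_sub]
  simp only [LinearIsometryEquiv.norm_map]
  simp [map_ofNat]
  ring

theorem starProjection_torusConj {K : Submodule ℂ (Spinor ε)} [CompleteSpace K]
    (h : (flatTorus θ R τ ε).Reduces (b.algebra θ) K) (ψ : Spinor ε) :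
    K.starProjection (torusConj ε ψ) = torusConj ε (K.starProjection ψ) := by
  refine Submodule.eq_starProjection_of_mem_of_inner_eq_zero
    ((h.conj_mem _).2 (Submodule.starProjection_apply_mem K ψ)) fun χ hχ => ?_
  have hJ : (torusConj ε).symm χ ∈ K := (h.conj_mem _).1 (by
    change torusConj ε _ ∈ K
    simpa using hχ)
  have h1 := Submodule.starProjection_inner_eq_zero (K := K) ψ _ hJ
  have h2 := inner_antiunitary (torusConj ε) (ψ - K.starProjection ψ) ((torusConj ε).symm χ)
  rw [(torusConj ε).apply_symm_apply, ← inner_conj_symm ((torusConj ε).symm χ), h1, map_zero, map_sub] at h2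
  exact h2

theorem torusConj_shift_axis (j : ℤ) (ψ : Spinor ε) :
    torusConj ε (shift θ ε (axis j) ψ) = shift θ ε (axis (-j)) (torusConj ε ψ) := by
  have h1 := fun (μ : Weight ε) (s : Fin 2) =>
    conj_shift_apply (θ := θ) (axis j) (torusConj ε ψ) μ s
  simp only [(torusConj ε).symm_apply_apply] at h1
  ext ⟨μ, s⟩
  rw [h1, phase_axis, one_mul, shift_axis_apply, axis_neg, neg_neg]

theorem axisSum_torusConj {K : Submodule ℂ (Spinor ε)} [CompleteSpace K]
    (h : (flatTorus θ R τ ε).Reduces (b.algebra θ) K) {z : ℂ} (hz : z ^ b.order = 1)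
    (hz' : z * starRingEnd ℂ z = 1) (ψ : Spinor ε) :
    axisSum θ b z K.starProjection (torusConj ε ψ) =
      torusConj ε (axisSum θ b z K.starProjection ψ) := by
  have hQ := h.starProjection_rep
  have hzN : ∀ j < b.order, starRingEnd ℂ (z ^ (b.order - 1 - j)) = z ^ (j + 1) := by
    intro j hj
    have h1 : z ^ (b.order - 1 - j) * z ^ (j + 1) = 1 := by
      rw [← pow_add, ← hz]; congr 1; omega
    have h2 : z ^ (b.order - 1 - j) * starRingEnd ℂ (z ^ (b.order - 1 - j)) = 1 := by
      rw [map_pow, ← mul_pow, hz', one_pow]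
    exact mul_left_cancel₀ (left_ne_zero_of_mul_eq_one h1) (h2.trans h1.symm)
  conv_lhs => rw [← hQ.sum_succ hz, sum_apply]
  rw [axisSum_apply, map_sum, ← Finset.sum_range_reflect
    (fun j => torusConj ε (z ^ j • axisConj θ K.starProjection j ψ))]
  refine Finset.sum_congr rfl fun j hj => ?_
  rw [LinearIsometryEquiv.map_smulₛₗ, hzN j (Finset.mem_range.1 hj), smul_apply]
  congr 1
  have e : ((b.order - 1 - j : ℕ) : ℤ) + ((j + 1 : ℕ) : ℤ) = b.order := by
    have := Finset.mem_range.1 hj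
    omega
  rw [axisConj_apply _ ((b.order - 1 - j : ℕ) : ℤ), torusConj_shift_axis, ← starProjection_torusConj h,
    torusConj_shift_axis, neg_neg]
  have e2 := hQ.axisConj_add_order (-((b.order - 1 - j : ℕ) : ℤ))
  have e3 : -((b.order - 1 - j : ℕ) : ℤ) + (b.order : ℤ) = ((j + 1 : ℕ) : ℤ) := by omega
  rw [e3] at e2
  rw [e2, axisConj_apply, neg_neg]

theorem orthogonal_shift_axis {K : Submodule ℂ (Spinor ε)} [CompleteSpace K]
    (hK : AxisOrthogonal θ b K) {j : ℕ} (hj0 : 0 < j) (hj : j < b.order) {ψ : Spinor ε}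
    (hψ : ψ ∈ K) : K.starProjection (shift θ ε (axis (-j)) ψ) = 0 := by
  rw [Submodule.starProjection_apply_eq_zero_iff]
  intro χ hχ
  rw [← inner_shift_axis]
  exact hK j hj0 hj χ hχ ψ hψ

theorem orthogonal_shift_axis' {K : Submodule ℂ (Spinor ε)} [CompleteSpace K]
    (hK : AxisOrthogonal θ b K) {j : ℕ} (hj0 : 0 < j) (hj : j < b.order) {ψ : Spinor ε}
    (hψ : ψ ∈ K) : K.starProjection (shift θ ε (axis j) ψ) = 0 := by
  rw [Submodule.starProjection_apply_eq_zero_iff]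
  intro χ hχ
  rw [← inner_conj_symm, hK j hj0 hj ψ hψ χ hχ, map_zero]

/-- The projection onto an invariant subspace and its translates form a partition of unity. -/
theorem axisSum_starProjection {K : Submodule ℂ (Spinor ε)} [CompleteSpace K] (hR : 0 < R)
    (hτ : τ.im ≠ 0) (h : (flatTorus θ R τ ε).Reduces (b.algebra θ) K)
    (hK : AxisOrthogonal θ b K) (hne : K ≠ ⊥) : axisSum θ b 1 K.starProjection = 1 := by
  have hD : IntertwinesDirac R τ K.starProjection := fun ψ φ => h.dirac_mem.starProjection
  obtain ⟨z, hz⟩ := (h.starProjection_rep.intertwines_axisSum hD hR).eq_smul hR hτ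
  obtain ⟨ψ, hψ, hψ0⟩ := (Submodule.ne_bot_iff K).1 hne
  have h1 := hK.inner_axisSum (fun ψ => Submodule.starProjection_apply_mem K ψ) 1 hψ ψ
  rw [hz, (Submodule.starProjection_eq_self_iff).2 hψ, smul_apply, one_apply_eq_self,
    inner_smul_left] at h1
  have h2 : starRingEnd ℂ z = 1 :=
    mul_right_cancel₀ (inner_self_ne_zero.2 hψ0) (h1.trans (one_mul _).symm)
  have h3 : z = 1 := by rw [← Complex.conj_conj z, h2, map_one]
  rw [hz, h3, one_smul]

theorem axisConj_mul {K : Submodule ℂ (Spinor ε)} [CompleteSpace K]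
    (hK : AxisOrthogonal θ b K) {i j : ℕ} (hi : i < b.order) (hj : j < b.order) (hij : i ≠ j)
    (ψ : Spinor ε) : axisConj θ K.starProjection i (axisConj θ K.starProjection j ψ) = 0 := by
  rw [axisConj_apply, axisConj_apply, shift_axis_axis]
  have hmem := Submodule.starProjection_apply_mem K (shift θ ε (axis (-j)) ψ)
  rcases lt_or_gt_of_ne hij with h | h
  · have e : (-(i : ℤ) + j) = ((j - i : ℕ) : ℤ) := by omega
    rw [e, orthogonal_shift_axis' hK (by omega) (by omega) hmem, map_zero]
  · have e : (-(i : ℤ) + j) = -((i - j : ℕ) : ℤ) := by omega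
    rw [e, orthogonal_shift_axis hK (by omega) (by omega) hmem, map_zero]

theorem axisConj_axisSum {K : Submodule ℂ (Spinor ε)} [CompleteSpace K]
    (hK : AxisOrthogonal θ b K) {i : ℕ} (hi : i < b.order) (z : ℂ) (ψ : Spinor ε) :
    axisConj θ K.starProjection i (axisSum θ b z K.starProjection ψ) =
      z ^ i • axisConj θ K.starProjection i ψ := by
  rw [axisSum_apply, map_sum, Finset.sum_eq_single i]
  · rw [map_smul, axisConj_apply _ _ (axisConj θ K.starProjection i ψ), axisConj_apply,
      shift_axis_axis, neg_add_cancel, shift_axis_zero,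
      (Submodule.starProjection_eq_self_iff).2 (Submodule.starProjection_apply_mem K _)]
  · intro j hj hji
    rw [map_smul, axisConj_mul hK hi (Finset.mem_range.1 hj) (Ne.symm hji), smul_zero]
  · intro h; exact absurd (Finset.mem_range.2 hi) h

/-- The intrinsic description of the invariant subspaces of equivariant actions. -/
theorem exists_equivariant_iff (hR : 0 < R) (hτ : τ.im ≠ 0) (K : Submodule ℂ (Spinor ε)) :
    (∃ S : Spinor ε →L[ℂ] Spinor ε,
      (flatTorus θ R τ ε).IsEquivariantAction (b.act θ) b.order S ∧ ∀ ψ, ψ ∈ K ↔ S ψ = ψ) ↔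
    (IsClosed (K : Set (Spinor ε)) ∧ K ≠ ⊥ ∧ (flatTorus θ R τ ε).Reduces (b.algebra θ) K ∧
      AxisOrthogonal θ b K) := by
  constructor
  · rintro ⟨S, hS, hK⟩
    obtain ⟨c, h, rfl⟩ := exists_holonomy hR hτ hS
    obtain rfl : K = h.fixed := Submodule.ext hK
    exact ⟨h.isClosed_fixed, h.fixed_ne_bot hτ, h.reduces_fixed θ R, h.axisOrthogonal_fixed θ⟩
  · rintro ⟨hc, hne, hred, hK⟩
    have : CompleteSpace K := hc.completeSpace_coe
    have hD : IntertwinesDirac R τ K.starProjection := fun ψ φ => hred.dirac_mem.starProjection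
    have hQ := hred.starProjection_rep
    have hone := axisSum_starProjection hR hτ hred hK hne
    have hroot := b.isPrimitiveRoot_root
    have hsum : ∀ ψ : Spinor ε,
        ∑ j ∈ Finset.range b.order, axisConj θ K.starProjection j ψ = ψ := by
      intro ψ
      have := congrArg (fun T : Spinor ε →L[ℂ] Spinor ε => T ψ) hone
      simpa [axisSum_apply] using this
    set S := axisSum θ b b.root K.starProjection with hS
    have hSi : ∀ i < b.order, ∀ ψ, axisConj θ K.starProjection (i : ℕ) (S ψ) =
        b.root ^ i • axisConj θ K.starProjection i ψ := fun i hi ψ => axisConj_axisSum hK hi _ ψ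
    refine ⟨S, ⟨?_, rep_act_of_shift _ ((hQ.axisSum _).shift_twist
      (hQ.axisSum_shift_axis hroot.pow_eq_one)), hQ.axisSum_dirac hD hR _,
      axisSum_torusConj hred hroot.pow_eq_one ?_⟩, fun ψ => ⟨fun hψ => ?_, fun hψ => ?_⟩⟩
    · have hp : ∀ (p i : ℕ), i < b.order → ∀ ψ, axisConj θ K.starProjection i ((S ^ p) ψ) =
          (b.root ^ i) ^ p • axisConj θ K.starProjection i ψ := by
        intro p i hi
        induction p with
        | zero => intro ψ; simp
        | succ p ih => intro ψ; rw [pow_succ, clm_mul_apply, ih, hSi i hi, smul_smul, ← pow_succ]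
      ext1 ψ
      rw [one_apply_eq_self, ← hsum ((S ^ b.order) ψ)]
      conv_rhs => rw [← hsum ψ]
      refine Finset.sum_congr rfl fun i hi => ?_
      rw [hp _ i (Finset.mem_range.1 hi), ← pow_mul, mul_comm, pow_mul, hroot.pow_eq_one, one_pow,
        one_smul]
    · rw [Complex.mul_conj, Complex.normSq_eq_norm_sq, hroot.norm'_eq_one b.order_pos.ne']; simp
    · rw [hS, axisSum_apply, Finset.sum_eq_single 0]
      · rw [Nat.cast_zero, axisConj_zero, pow_zero, one_smul,
          (Submodule.starProjection_eq_self_iff).2 hψ]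
      · intro j hj hj0
        rw [axisConj_apply, orthogonal_shift_axis hK (Nat.pos_of_ne_zero hj0)
          (Finset.mem_range.1 hj) hψ, map_zero, smul_zero]
      · intro h; exact absurd (Finset.mem_range.2 b.order_pos) h
    · have h1 := hsum ψ
      rw [Finset.sum_eq_single 0] at h1
      · rw [Nat.cast_zero, axisConj_zero] at h1
        rw [← h1]
        exact Submodule.starProjection_apply_mem K _
      · intro j hj hj0
        have h2 := hSi j (Finset.mem_range.1 hj) ψ
        rw [hψ] at h2
        by_contra h3
        have h4 := smul_left_injective ℂ h3 ((one_smul ℂ _).trans h2)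
        exact absurd (Nat.le_of_dvd (Nat.pos_of_ne_zero hj0)
          ((hroot.pow_eq_one_iff_dvd j).1 h4.symm)) (by have := Finset.mem_range.1 hj; omega)
      · intro h; exact absurd (Finset.mem_range.2 b.order_pos) h

end InvariantSubspaces

section Restrictions
variable {θ R : ℝ} {b : Bieb} {τ : ℂ} {ε ε' : Fin 3 → Bool} {c : ℂ}

/-- The flat triple given by an action. -/
def FlatRestriction.ofHolonomy (θ R : ℝ) (h : Holonomy b τ ε c) : FlatRestriction θ b R τ where
  spin := ε
  space := h.fixed
  complete := h.completeSpace_fixed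
  reduces := h.reduces_fixed θ R
  fixed := ⟨h.op, h.isEquivariantAction θ R, fun _ => Iff.rfl⟩

/-- The triple given by an action. -/
abbrev Holonomy.triple (θ R : ℝ) (h : Holonomy b τ ε c) : RealTriple (b.algebra θ) h.fixed :=
  (flatTorus θ R τ ε).restrict (b.algebra θ) h.fixed (h.reduces_fixed θ R)

theorem FlatRestriction.ext' {X Y : FlatRestriction θ b R τ} (h : X.spin = Y.spin)
    (h' : HEq X.space Y.space) : X = Y := by
  cases X; cases Y
  simp only at h h'
  subst h
  cases h'
  rfl

theorem FlatRestriction.exists_holonomy (hR : 0 < R) (hτ : τ.im ≠ 0) (X : FlatRestriction θ b R τ) :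
    ∃ (c : ℂ) (h : Holonomy b τ X.spin c), X.space = h.fixed := by
  obtain ⟨S, hS, hK⟩ := X.fixed
  obtain ⟨c, h, rfl⟩ := FlatBieberbach.exists_holonomy hR hτ hS
  exact ⟨c, h, Submodule.ext hK⟩

theorem FlatRestriction.eq_ofHolonomy (hR : 0 < R) (hτ : τ.im ≠ 0) (X : FlatRestriction θ b R τ) :
    ∃ (ε : Fin 3 → Bool) (c : ℂ) (h : Holonomy b τ ε c), X = .ofHolonomy θ R h := by
  obtain ⟨c, h, hX⟩ := X.exists_holonomy hR hτ
  exact ⟨X.spin, c, h, FlatRestriction.ext' rfl (heq_of_eq hX)⟩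

/-- An intertwiner from one invariant subspace to another one. -/
theorem eq_of_intertwiner {K' : Submodule ℂ (Spinor ε')} (hR : 0 < R) (hτ : τ.im ≠ 0) (hK' : AxisOrthogonal θ b K')
    {Q : Spinor ε →L[ℂ] Spinor ε'} (hQK : ∀ ψ, Q ψ ∈ K')
    (hQ : IntertwinesFixed θ b Q) (hD : IntertwinesDirac R τ Q) (hne : Q ≠ 0) :
    ε = ε' := by
  by_contra hε
  have h1 := (hQ.intertwines_axisSum hD hR).eq_zero hR hτ hε
  refine hne (ContinuousLinearMap.ext fun ψ => ?_)
  have h2 := hK'.inner_axisSum hQK 1 (hQK ψ) ψ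
  rw [h1] at h2
  simpa using h2.symm

theorem exists_smul_of_intertwiner {K' : Submodule ℂ (Spinor ε)}
    [CompleteSpace K'] (hR : 0 < R) (hτ : τ.im ≠ 0) (hK' : AxisOrthogonal θ b K')
    {Q : Spinor ε →L[ℂ] Spinor ε} (hQK : ∀ ψ, Q ψ ∈ K')
    (hQ : IntertwinesFixed θ b Q) (hD : IntertwinesDirac R τ Q) :
    ∃ z : ℂ, Q = z • K'.starProjection := by
  obtain ⟨z, hz⟩ := (hQ.intertwines_axisSum hD hR).eq_smul hR hτ
  refine ⟨z, ContinuousLinearMap.ext fun ψ => ?_⟩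
  rw [smul_apply, ← map_smul]
  refine (Submodule.eq_starProjection_of_mem_of_inner_eq_zero (hQK ψ) fun χ hχ => ?_).symm
  rw [inner_sub_left, ← hK'.inner_axisSum hQK 1 hχ ψ, hz, smul_apply, one_apply_eq_self, sub_self]

/-- The flat triples are irreducible. -/
theorem Holonomy.isDiracIrreducible (hR : 0 < R) (h : Holonomy b τ ε c)
    (hτ : τ.im ≠ 0) : (h.triple θ R).IsDiracIrreducible := by
  have hred := h.reduces_fixed θ R
  refine ⟨Submodule.nontrivial_iff_ne_bot.2 (h.fixed_ne_bot hτ), fun L hL hrep hD => ?_⟩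
  set L' : Submodule ℂ (Spinor ε) := L.map h.fixed.subtype with hL'
  have hmem : ∀ ψ, ψ ∈ L' ↔ ∃ χ : h.fixed, χ ∈ L ∧ (χ : Spinor ε) = ψ := fun ψ => Submodule.mem_map
  have hLK : ∀ ψ ∈ L', ψ ∈ h.fixed := by
    intro ψ hψ
    obtain ⟨χ, -, rfl⟩ := (hmem ψ).1 hψ
    exact χ.2
  have hclosed : IsClosed (L' : Set (Spinor ε)) :=
    (h.isClosed_fixed.isClosedEmbedding_subtypeVal.isClosedMap _ hL)
  have : CompleteSpace L' := hclosed.completeSpace_coe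
  have : CompleteSpace L := hL.completeSpace_coe
  have hL'rep : ∀ a ∈ b.algebra θ, ∀ ψ ∈ L', SmoothTorus.rep θ ε a ψ ∈ L' := by
    intro a ha ψ hψ
    obtain ⟨χ, hχ, rfl⟩ := (hmem ψ).1 hψ
    exact (hmem _).2 ⟨_, hrep ⟨a, ha⟩ χ hχ, rfl⟩
  have hQ : IntertwinesFixed θ b L'.starProjection := by
    intro a ha ψ
    refine starProjection_commute L' _ (hL'rep a ha) (fun ψ hψ => ?_) ψ
    rw [← map_star]
    exact hL'rep _ (star_mem ha) ψ hψ
  have hP : ∀ ψ : Spinor ε, L'.starProjection ψ =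
      L.starProjection (⟨h.proj ψ, h.proj_mem ψ⟩ : h.fixed) := by
    intro ψ
    refine Submodule.eq_starProjection_of_mem_of_inner_eq_zero
      ((hmem _).2 ⟨_, Submodule.starProjection_apply_mem L _, rfl⟩) fun χ hχ => ?_
    obtain ⟨χ, hχL, rfl⟩ := (hmem χ).1 hχ
    have h1 := Submodule.starProjection_inner_eq_zero (K := L)
      (⟨h.proj ψ, h.proj_mem ψ⟩ : h.fixed) χ hχL
    have h2 := Submodule.starProjection_inner_eq_zero (K := h.fixed) ψ χ χ.2
    rw [h.starProjection_fixed] at h2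
    have h3 : inner ℂ (h.proj ψ - ((L.starProjection (⟨h.proj ψ, h.proj_mem ψ⟩ : h.fixed) :
      h.fixed) : Spinor ε)) (χ : Spinor ε) = 0 := h1
    rw [← sub_add_sub_cancel ψ (h.proj ψ), inner_add_left, h2, h3, add_zero]
  have hDL : IntertwinesDirac R τ L'.starProjection := by
    intro ψ φ hψ
    have h1 := (mem_graph_restrict hred (ψ := ⟨h.proj ψ, h.proj_mem ψ⟩)
      (φ := ⟨h.proj φ, h.proj_mem φ⟩)).2 (h.proj_dirac _ _ hψ)
    have h2 := (mem_graph_restrict hred).1 (ReducesOperator.starProjection hD h1)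
    rw [hP, hP]
    exact h2
  obtain ⟨z, hz⟩ := exists_smul_of_intertwiner hR hτ (h.axisOrthogonal_fixed θ)
    (fun ψ => hLK _ (Submodule.starProjection_apply_mem L' ψ)) hQ hDL
  by_cases hz0 : z = 0
  · left
    rw [Submodule.eq_bot_iff]
    intro ψ hψ
    have h1 := (Submodule.starProjection_eq_self_iff (K := L')).2 ((hmem ψ).2 ⟨ψ, hψ, rfl⟩)
    rw [hz, hz0, zero_smul] at h1
    exact Subtype.ext h1.symm
  · right
    rw [eq_top_iff]
    intro ψ _
    have h1 := Submodule.starProjection_apply_mem L' (ψ : Spinor ε)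
    rw [hz, smul_apply, (Submodule.starProjection_eq_self_iff).2 ψ.2,
      Submodule.smul_mem_iff _ hz0] at h1
    obtain ⟨χ, hχ, h2⟩ := (hmem _).1 h1
    exact (Subtype.ext h2 : χ = ψ) ▸ hχ

/-- Unitarily equivalent flat triples have the same holonomy. -/
theorem Holonomy.eq_of_equivalent (hR : 0 < R) (hτ : τ.im ≠ 0) {c' : ℂ}
    (h : Holonomy b τ ε c) (h' : Holonomy b τ ε' c')
    (hW : (h.triple θ R).UnitarilyEquivalent (h'.triple θ R)) : ε = ε' ∧ c = c' := by
  obtain ⟨W, hW1, -, hW3⟩ := hW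
  have hred := h.reduces_fixed θ R
  have hred' := h'.reduces_fixed θ R
  let P : Spinor ε →L[ℂ] h.fixed := h.proj.codRestrict _ h.proj_mem
  let Q : Spinor ε →L[ℂ] Spinor ε' :=
    h'.fixed.subtypeL.comp (W.toContinuousLinearEquiv.toContinuousLinearMap.comp P)
  have hQ_apply : ∀ ψ, Q ψ = W (P ψ) := fun _ => rfl
  have hQK : ∀ ψ, Q ψ ∈ h'.fixed := fun ψ => (W (P ψ)).2
  have hQ : IntertwinesFixed θ b Q := by
    intro a ha ψ
    have h1 : P (SmoothTorus.rep θ ε a ψ) =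
        (h.triple θ R).rep ⟨a, ha⟩ (P ψ) := by
      refine Subtype.ext ?_
      have := hred.starProjection_rep a ha ψ
      rw [h.starProjection_fixed] at this
      exact this
    rw [hQ_apply, h1, hW1]
    rfl
  have hD : IntertwinesDirac R τ Q := by
    intro ψ φ hψ
    have h1 := (mem_graph_restrict hred (ψ := P ψ) (φ := P φ)).2 (h.proj_dirac _ _ hψ)
    exact (mem_graph_restrict hred').1 ((hW3 _ _).1 h1)
  have hker : ∀ ψ, Q ψ = 0 → h.proj ψ = 0 := by
    intro ψ hψ
    have h1 : W (P ψ) = 0 := Subtype.ext hψ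
    have h2 : P ψ = 0 := W.injective (h1.trans (map_zero W).symm)
    exact congrArg Subtype.val h2
  have hproj : h.proj ≠ 0 := by
    intro h0
    obtain ⟨ψ, hψ, hψ0⟩ := (Submodule.ne_bot_iff _).1 (h.fixed_ne_bot hτ)
    have := (Submodule.starProjection_eq_self_iff).2 hψ
    rw [h.starProjection_fixed, h0] at this
    exact hψ0 this.symm
  have hne : Q ≠ 0 := fun h0 => hproj (ContinuousLinearMap.ext fun ψ => hker ψ (by rw [h0]; rfl))
  obtain rfl := eq_of_intertwiner hR hτ (h'.axisOrthogonal_fixed θ) hQK hQ hD hne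
  obtain ⟨z, hz⟩ := exists_smul_of_intertwiner hR hτ (h'.axisOrthogonal_fixed θ) hQK hQ hD
  have hz0 : z ≠ 0 := fun h0 => hne (by rw [hz, h0, zero_smul])
  have h1 : ∀ ψ, h'.proj ψ = 0 ↔ h.proj ψ = 0 := by
    intro ψ
    rw [← h'.starProjection_fixed]
    constructor
    · intro h2
      exact hker ψ (by rw [hz, smul_apply, h2, smul_zero])
    · intro h2
      have h3 : Q ψ = 0 := by
        have : P ψ = 0 := Subtype.ext h2
        rw [hQ_apply, this, map_zero]; rfl
      rw [hz, smul_apply] at h3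
      exact (smul_eq_zero.1 h3).resolve_left hz0
  have h2 : h.fixedᗮ = h'.fixedᗮ := by
    ext ψ
    rw [← Submodule.starProjection_apply_eq_zero_iff, ← Submodule.starProjection_apply_eq_zero_iff,
      h.starProjection_fixed, h'.starProjection_fixed, h1]
  have h3 : h.fixed = h'.fixed := by
    rw [← Submodule.orthogonal_orthogonal h.fixed, h2, Submodule.orthogonal_orthogonal]
  exact ⟨rfl, h.eq_of_fixed_eq h' hτ h3⟩

theorem FlatRestriction.eq_of_equivalent (hR : 0 < R) (hτ : τ.im ≠ 0)
    {X Y : FlatRestriction θ b R τ} (hXY : X.triple.UnitarilyEquivalent Y.triple) : X = Y := by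
  obtain ⟨ε, c, h, rfl⟩ := X.eq_ofHolonomy hR hτ
  obtain ⟨ε', c', h', rfl⟩ := Y.eq_ofHolonomy hR hτ
  obtain ⟨rfl, rfl⟩ := h.eq_of_equivalent hR hτ h' hXY
  rfl

theorem ofHolonomy_inj (hτ : τ.im ≠ 0) {c' : ℂ} {h : Holonomy b τ ε c} {h' : Holonomy b τ ε' c'}
    (he : FlatRestriction.ofHolonomy θ R h = .ofHolonomy θ R h') : ε = ε' ∧ c = c' := by
  obtain rfl : ε = ε' := congrArg FlatRestriction.spin he
  refine ⟨rfl, h.eq_of_fixed_eq h' hτ ?_⟩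
  have := (FlatRestriction.mk.injEq .. ).mp he
  exact eq_of_heq this.2

/-- The flat triple with given label. -/
def Bieb.Label.restriction (θ R : ℝ) {σ : ℤˣ} (hσ : b.Admissible σ τ) (l : b.Label) :
    FlatRestriction θ b R τ := .ofHolonomy θ R (holonomy_label hσ l)

theorem bijective_restriction (hR : 0 < R) (hτ : τ.im ≠ 0) {σ : ℤˣ} (hσ : b.Admissible σ τ) :
    Function.Bijective (fun l : b.Label => l.restriction θ R hσ) := by
  constructor
  · intro l l' hl
    obtain ⟨h1, h2⟩ := ofHolonomy_inj hτ hl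
    exact label_injective σ h1 h2
  · intro X
    obtain ⟨ε, c, h, rfl⟩ := X.eq_ofHolonomy hR hτ
    obtain ⟨l, rfl, rfl⟩ := h.exists_label hσ
    exact ⟨l, rfl⟩

theorem Bieb.card_label (b : Bieb) : Nat.card b.Label = b.numSpin := by
  cases b
  · let e : Bool × Bool × ℤˣ ≃ Bieb.B2.Label :=
      { toFun := fun x => .b2 x.1 x.2.1 x.2.2
        invFun := fun | .b2 e₂ e₃ κ => (e₂, e₃, κ)
        left_inv := fun _ => rfl
        right_inv := fun | .b2 _ _ _ => rfl }
    rw [← Nat.card_congr e, Nat.card_eq_fintype_card]; rfl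
  · let e : Bool ≃ Bieb.B3.Label :=
      { toFun := fun x => .b3 x
        invFun := fun | .b3 e => e
        left_inv := fun _ => rfl
        right_inv := fun | .b3 _ => rfl }
    rw [← Nat.card_congr e, Nat.card_eq_fintype_card]; rfl
  · let e : Bool × ℤˣ ≃ Bieb.B4.Label :=
      { toFun := fun x => .b4 x.1 x.2
        invFun := fun | .b4 e κ => (e, κ)
        left_inv := fun _ => rfl
        right_inv := fun | .b4 _ _ => rfl }
    rw [← Nat.card_congr e, Nat.card_eq_fintype_card]; rfl
  · let e : ℤˣ ≃ Bieb.B6.Label :=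
      { toFun := fun x => .b6 x
        invFun := fun | .b6 κ => κ
        left_inv := fun _ => rfl
        right_inv := fun | .b6 _ => rfl }
    rw [← Nat.card_congr e, Nat.card_eq_fintype_card]; rfl

theorem card_quotient (hR : 0 < R) (hτ : τ.im ≠ 0) {σ : ℤˣ} (hσ : b.Admissible σ τ) :
    Nat.card (Quotient (FlatRestriction.setoid θ b R τ)) = b.numSpin := by
  rw [← b.card_label, Nat.card_congr (Equiv.ofBijective _ (bijective_restriction (θ := θ) hR hτ hσ))]
  refine (Nat.card_congr (Equiv.ofBijective (Quotient.mk (FlatRestriction.setoid θ b R τ)) ⟨?_, ?_⟩)).symm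
  · intro X Y h
    exact FlatRestriction.eq_of_equivalent hR hτ (Quotient.exact h)
  · exact Quotient.mk_surjective

end Restrictions

section InvariantSpace
variable {θ R : ℝ} {b : Bieb} {τ : ℂ} {ε : Fin 3 → Bool} {c : ℂ}

theorem exp_sub_sgn (A : ℂ) (s : Fin 2) : exp (A - sgn s * (Real.pi * I)) = -exp A := by
  fin_cases s
  · simp [sgn, exp_sub, div_neg]
  · simp [sgn, exp_add]

theorem Bieb.Label.phase_eq_exp (σ : ℤˣ) (l : b.Label) (x : ℝ) (s : Fin 2) :
    l.phase σ x s = exp (2 * Real.pi * I * (x / b.order - sgn s * l.offset σ)) := by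
  cases l with
  | b2 e₂ e₃ κ =>
    rcases Int.units_eq_one_or κ with rfl | rfl
    · simp only [phase, offset, Bieb.order, Units.val_one, Int.cast_one, one_mul]
      congr 1; push_cast; ring
    · simp only [phase, offset, Bieb.order, Units.val_neg, Units.val_one, Int.cast_neg, Int.cast_one,
        neg_mul, one_mul]
      rw [← exp_sub_sgn _ s]
      congr 1; push_cast; ring
  | b3 e =>
    cases e
    · simp only [phase, offset, Bieb.order, half, Bool.false_eq_true, if_false, one_mul]
      congr 1; push_cast; ring
    · simp only [phase, offset, Bieb.order, half, if_true, neg_mul, one_mul]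
      rw [← exp_sub_sgn _ s]
      congr 1; push_cast; ring
  | b4 e κ =>
    rcases Int.units_eq_one_or κ with rfl | rfl
    · simp only [phase, offset, Bieb.order, Units.val_one, Int.cast_one, one_mul]
      congr 1; push_cast; ring
    · simp only [phase, offset, Bieb.order, Units.val_neg, Units.val_one, Int.cast_neg, Int.cast_one,
        neg_mul, one_mul]
      rw [← exp_sub_sgn _ s]
      congr 1; push_cast; ring
  | b6 κ =>
    rcases Int.units_eq_one_or κ with rfl | rfl
    · simp only [phase, offset, Bieb.order, Units.val_one, Int.cast_one, one_mul]
      congr 1; push_cast; ring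
    · simp only [phase, offset, Bieb.order, Units.val_neg, Units.val_one, Int.cast_neg, Int.cast_one,
        neg_mul, one_mul]
      rw [← exp_sub_sgn _ s]
      congr 1; push_cast; ring

theorem sgn_mul_self (s : Fin 2) : sgn s * sgn s = 1 := by fin_cases s <;> simp [sgn]

theorem exists_int_sgn (s : Fin 2) : ∃ m : ℤ, sgn s = m ∧ m * m = 1 := by
  fin_cases s
  · exact ⟨1, by simp [sgn]⟩
  · exact ⟨-1, by simp [sgn]⟩

theorem Bieb.Label.phase_eq_one_iff (σ : ℤˣ) (l : b.Label) (x : ℝ) (s : Fin 2) :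
    l.phase σ x s = 1 ↔ ∃ k : ℤ, x = sgn s * (b.order * (k + l.offset σ)) := by
  have hN : (b.order : ℝ) ≠ 0 := by exact_mod_cast b.order_pos.ne'
  obtain ⟨m, hm, hmm⟩ := exists_int_sgn s
  have hmm' : (m : ℝ) * m = 1 := by exact_mod_cast hmm
  rw [l.phase_eq_exp, exp_eq_one_iff]
  have key : ∀ n : ℤ, (2 * Real.pi * I * (x / b.order - sgn s * l.offset σ) : ℂ) =
      n * (2 * Real.pi * I) ↔ x / b.order - sgn s * l.offset σ = n := by
    intro n
    constructor
    · intro h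
      have h1 : ((x / b.order - sgn s * l.offset σ : ℝ) : ℂ) = ((n : ℝ) : ℂ) := by
        push_cast
        refine mul_left_cancel₀ two_pi_I_ne_zero ?_
        linear_combination h
      exact_mod_cast h1
    · intro h
      have h1 : ((x / b.order - sgn s * l.offset σ : ℝ) : ℂ) = ((n : ℝ) : ℂ) := by rw [h]
      push_cast at h1
      linear_combination (2 * Real.pi * I) * h1
  simp only [key]
  simp only [hm]
  constructor
  · rintro ⟨n, hn⟩
    refine ⟨m * n, ?_⟩
    have : x = b.order * (n + m * l.offset σ) := by
      rw [← hn]; field_simp; ring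
    rw [this]
    push_cast
    linear_combination (-(b.order : ℝ) * n) * hmm'
  · rintro ⟨k, rfl⟩
    refine ⟨m * k, ?_⟩
    push_cast
    field_simp
    ring

/-- The invariant subspace in terms of the basis. -/
theorem invariantSpace_eq {σ : ℤˣ} (hσ : b.Admissible σ τ) (l : b.Label) :
    l.invariantSpace σ l.spin = (holonomy_label hσ l).fixed := by
  set h := holonomy_label hσ l
  have hN : ((Real.sqrt b.order : ℝ) : ℂ) ≠ 0 := by
    exact_mod_cast (Real.sqrt_pos.2 (by exact_mod_cast b.order_pos)).ne'
  have hgen : ∀ (μ : Weight l.spin) (s : Fin 2), ∑ p ∈ Finset.range b.order,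
      l.phase σ (μ.1 0) s ^ p • basisVec l.spin (b.lin^[p] μ.1) s =
      (b.order : ℂ) • h.proj (ket (μ, s)) := by
    intro μ s
    rw [h.proj_ket, smul_smul, mul_inv_cancel₀ b.order_cast_ne, one_smul]
    refine Finset.sum_congr rfl fun p _ => ?_
    rw [l.phase_eq, ← Weight.lin_iterate_coe h.maps, basisVec_coe]
  have hfix : ∀ μ : Weight l.spin, μ.1 1 = 0 ∧ μ.1 2 = 0 → Weight.lin b h.maps μ = μ := by
    rintro μ ⟨h1, h2⟩
    refine Weight.ext' fun i => ?_
    rw [Weight.lin_coe]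
    fin_cases i <;> simp [Bieb.lin, h1, h2]
  apply le_antisymm
  · refine Submodule.topologicalClosure_minimal _ (Submodule.span_le.2 ?_) h.isClosed_fixed
    rintro v (⟨μ, s, hμ, rfl⟩ | ⟨k, s, rfl⟩)
    · rw [hgen]
      exact Submodule.smul_mem _ _ (Submodule.smul_mem _ _ (h.proj_mem _))
    · by_cases hw : ∀ i, ∃ n : ℤ,
        (![sgn s * (b.order * (k + l.offset σ)), 0, 0] : Fin 3 → ℝ) i = n + half (l.spin i)
      · set μ : Weight l.spin := ⟨_, hw⟩ with hμ
        change basisVec l.spin μ.1 s ∈ h.fixed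
        have h1 : l.phase σ (μ.1 0) s = 1 := (l.phase_eq_one_iff σ _ s).2 ⟨k, rfl⟩
        rw [basisVec_coe, h.mem_fixed, h.op_ket, hfix μ ⟨rfl, rfl⟩, ← l.phase_eq, h1, one_smul]
      · rw [basisVec_of_not hw]; exact Submodule.zero_mem _
  · have hket : ∀ i, h.proj (ket i) ∈ l.invariantSpace σ l.spin := by
      rintro ⟨μ, s⟩
      by_cases hμ : μ.1 1 = 0 ∧ μ.1 2 = 0
      · have hit : ∀ p, (Weight.lin b h.maps)^[p] μ = μ := fun p =>
          Function.iterate_fixed (hfix μ hμ) p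
        rw [h.proj_ket]
        simp only [hit, ← l.phase_eq]
        rw [← Finset.sum_smul]
        by_cases h1 : l.phase σ (μ.1 0) s = 1
        · obtain ⟨k, hk⟩ := (l.phase_eq_one_iff σ _ s).1 h1
          refine Submodule.smul_mem _ _ (Submodule.smul_mem _ _ ?_)
          refine Submodule.le_topologicalClosure _ (Submodule.subset_span (Or.inr ⟨k, s, ?_⟩))
          rw [← basisVec_coe]
          congr 1
          ext i
          fin_cases i
          · exact hk
          · exact hμ.1
          · exact hμ.2
        · have h2 := geom_sum_mul (l.phase σ (μ.1 0) s) b.order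
          rw [show l.phase σ (μ.1 0) s ^ b.order = 1 by rw [l.phase_eq]; exact h.holPhase_pow μ s,
            sub_self] at h2
          rw [(mul_eq_zero.1 h2).resolve_right (sub_ne_zero.2 h1), zero_smul, smul_zero]
          exact Submodule.zero_mem _
      · have h1 : (((1 / Real.sqrt b.order : ℝ) : ℂ) • ∑ p ∈ Finset.range b.order,
            l.phase σ (μ.1 0) s ^ p • basisVec l.spin (b.lin^[p] μ.1) s) ∈
            l.invariantSpace σ l.spin :=
          Submodule.le_topologicalClosure _ (Submodule.subset_span (Or.inl ⟨μ, s, hμ, rfl⟩))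
        rw [hgen, smul_smul] at h1
        refine (Submodule.smul_mem_iff _ (mul_ne_zero ?_ b.order_cast_ne)).1 h1
        push_cast
        exact div_ne_zero one_ne_zero hN
    intro ψ hψ
    have h1 : h.proj ψ = ψ := by
      rw [← h.starProjection_fixed]; exact (Submodule.starProjection_eq_self_iff).2 hψ
    rw [← h1]
    have h2 : (⊤ : Submodule ℂ (Spinor l.spin)) ≤
        (l.invariantSpace σ l.spin).comap (h.proj : Spinor l.spin →ₗ[ℂ] Spinor l.spin) := by
      rw [← dense_span_ket]
      refine Submodule.topologicalClosure_minimal _ (Submodule.span_le.2 ?_) ?_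
      · rintro _ ⟨i, rfl⟩; exact hket i
      · exact (Submodule.isClosed_topologicalClosure _).preimage h.proj.continuous
    exact h2 trivial

end InvariantSpace

section Spectrum
variable {θ R : ℝ} {b : Bieb} {τ : ℂ} {ε : Fin 3 → Bool} {c : ℂ}

theorem ReducesOperator_eigen (h : Holonomy b τ ε c) (x : ℝ) :
    (diracEigenspace (h.triple θ R).dirac x).map h.fixed.subtype =
      diracEigenspace (torusDirac R τ ε) x ⊓ h.fixed := by
  have : diracEigenspace (h.triple θ R).dirac x =
      (diracEigenspace (torusDirac R τ ε) x).comap h.fixed.subtype := by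
    ext ψ
    exact mem_graph_restrict (h.reduces_fixed θ R)
  rw [this, Submodule.map_comap_subtype, inf_comm]

theorem symbolEigen_op (h : Holonomy b τ ε c) {x : ℝ} {ψ : Spinor ε}
    (hψ : ψ ∈ diracEigenspace (torusDirac R τ ε) x) :
    h.op ψ ∈ diracEigenspace (torusDirac R τ ε) x := by
  have : (h.op ψ, h.op ((x : ℂ) • ψ)) ∈ (torusDirac R τ ε).graph := h.op_dirac (R := R) _ _ hψ
  rw [map_smul] at this
  exact this

theorem Holonomy.slope_lin_ne (h : Holonomy b τ ε c) (μ : Weight ε) :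
    slope τ (Weight.lin b h.maps μ).1 ≠ 0 ↔ slope τ μ.1 ≠ 0 := by
  rw [Weight.lin_coe, h.slope_eq, ne_eq, mul_eq_zero, not_or]
  exact ⟨fun h => h.2, fun h' => ⟨pow_ne_zero 2 h.ne_zero, h'⟩⟩

theorem Holonomy.op_mem_eigenPart (h : Holonomy b τ ε c) {x : ℝ} {ψ : Spinor ε}
    (hψ : ψ ∈ eigenPart R τ ε (fun μ => slope τ μ.1 ≠ 0) x) :
    h.op ψ ∈ eigenPart R τ ε (fun μ => slope τ μ.1 ≠ 0) x := by
  refine ⟨symbolEigen_op h hψ.1, fun μ s hμ => ?_⟩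
  obtain ⟨μ, rfl⟩ := (Weight.lin b h.maps).surjective μ
  rw [h.op_lin, hψ.2 μ s (fun h' => hμ ((h.slope_lin_ne μ).2 h')), mul_zero]

/-- The phase of the slope. -/
def slopePhase (τ : ℂ) (x : Fin 3 → ℝ) : ℂ := slope τ x / ‖slope τ x‖

theorem norm_slopePhase_le (x : Fin 3 → ℝ) : ‖slopePhase τ x‖ ≤ 1 := by
  rw [slopePhase, norm_div, norm_real, norm_norm]
  exact div_self_le_one _

/-- The number of invariant eigenvectors with nonzero slope. -/
theorem mul_finrank_slope_ne (h : Holonomy b τ ε c) (hR : 0 < R) (hτ : τ.im ≠ 0) (x : ℝ) :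
    ((b.order * Module.finrank ℂ
      (eigenPart R τ ε (fun μ => slope τ μ.1 ≠ 0) x ⊓ h.fixed : Submodule ℂ (Spinor ε)) : ℕ) : ℕ∞) =
      Set.encard {i : Weight ε × Fin 2 |
        slope τ i.1.1 ≠ 0 ∧ torusEigenvalue R τ i.1.1 i.2 = x} := by
  set E := eigenPart R τ ε (fun μ => slope τ μ.1 ≠ 0) x with hE
  have := finiteDimensional_eigenPart (ε := ε) hR hτ (fun μ => slope τ μ.1 ≠ 0) x
  refine Eq.trans ?_ (finrank_eigenPart hR hτ (fun μ => slope τ μ.1 ≠ 0) x)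
  let S : E →ₗ[ℂ] E := (h.op : Spinor ε →ₗ[ℂ] Spinor ε).restrict fun ψ hψ => h.op_mem_eigenPart hψ
  let M₀ : Spinor ε →L[ℂ] Spinor ε :=
    diagOp (fun i => slopePhase τ i.1.1) 1 (fun i => norm_slopePhase_le _)
  have hM₀ : ∀ ψ μ s, M₀ ψ (μ, s) = slopePhase τ μ.1 * ψ (μ, s) := fun _ _ _ => rfl
  have hM₀E : ∀ ψ ∈ E, M₀ ψ ∈ E := by
    rintro ψ ⟨h1, h2⟩
    refine ⟨mem_diracEigenspace_torus.2 fun μ => ?_, fun μ s hμ => ?_⟩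
    · exact Submodule.smul_mem _ (slopePhase τ μ.1) (mem_diracEigenspace_torus.1 h1 μ)
    · rw [hM₀, h2 μ s hμ, mul_zero]
  let M : E →ₗ[ℂ] E := (M₀ : Spinor ε →ₗ[ℂ] Spinor ε).restrict hM₀E
  have hS : ∀ ψ, ((S ψ : E) : Spinor ε) = h.op ψ := fun _ => rfl
  have hM : ∀ ψ, ((M ψ : E) : Spinor ε) = M₀ ψ := fun _ => rfl
  have hζ : IsPrimitiveRoot (starRingEnd ℂ (c ^ 2)) b.order :=
    h.isPrimitiveRoot.map_of_injective (starRingEnd ℂ).injective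
  have hcc : starRingEnd ℂ (c ^ 2) * c ^ 2 = 1 := by
    rw [map_pow, ← mul_pow, mul_comm, h.mul_conj, one_pow]
  have hmain := mul_finrank_fixed S M b.order_pos hζ ?_ ?_ ?_
  · rw [← hmain]
    congr 2
    have hEq : (E ⊓ h.fixed : Submodule ℂ (Spinor ε)) = Submodule.map E.subtype (S - 1).ker := ?_
    · rw [hEq, Submodule.finrank_map_subtype_eq]
    ext ψ
    rw [Submodule.mem_map, Submodule.mem_inf]
    constructor
    · rintro ⟨hψ, hψ'⟩
      refine ⟨⟨ψ, hψ⟩, ?_, rfl⟩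
      rw [LinearMap.mem_ker, LinearMap.sub_apply, sub_eq_zero]
      exact Subtype.ext hψ'
    · rintro ⟨φ, hφ, rfl⟩
      rw [LinearMap.mem_ker, LinearMap.sub_apply, sub_eq_zero] at hφ
      exact ⟨φ.2, congrArg Subtype.val hφ⟩
  · have hp : ∀ (p : ℕ) (ψ : E), (((S ^ p) ψ : E) : Spinor ε) = (h.op ^ p) ψ := by
      intro p
      induction p with
      | zero => intro ψ; rfl
      | succ p ih => intro ψ; rw [pow_succ', pow_succ', Module.End.mul_apply, hS, ih]; rfl
    refine LinearMap.ext fun ψ => Subtype.ext ?_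
    rw [hp, h.op_pow]; rfl
  · intro ψ φ hψφ
    ext ⟨μ, s⟩
    have h1 := congrArg (fun χ : E => (χ : Spinor ε) (μ, s)) hψφ
    simp only [hM, hM₀] at h1
    by_cases hμ : slope τ μ.1 ≠ 0
    · refine mul_left_cancel₀ (div_ne_zero hμ ?_) h1
      exact_mod_cast norm_ne_zero_iff.2 hμ
    · rw [ψ.2.2 μ s hμ, φ.2.2 μ s hμ]
  · intro ψ
    ext ⟨μ, s⟩
    obtain ⟨μ, rfl⟩ := (Weight.lin b h.maps).surjective μ
    change h.op (M₀ ψ) (Weight.lin b h.maps μ, s) =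
      starRingEnd ℂ (c ^ 2) * (M₀ (h.op ψ) (Weight.lin b h.maps μ, s))
    rw [h.op_lin, hM₀, hM₀, h.op_lin, slopePhase, slopePhase, Weight.lin_coe, h.slope_eq, norm_mul,
      norm_pow, h.norm_eq, one_pow, one_mul]
    linear_combination (-(slope τ μ.1 / ‖slope τ μ.1‖) * (holPhase b c (μ.1 0) s) *
      ((ψ : Spinor ε) (μ, s))) * hcc

theorem finrank_supported (T : Set (Weight ε × Fin 2)) (hT : T.Finite) (B : Submodule ℂ (Spinor ε))
    (hB : ∀ ψ, ψ ∈ B ↔ ∀ i ∉ T, ψ i = 0) :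
    FiniteDimensional ℂ B ∧ ((Module.finrank ℂ B : ℕ) : ℕ∞) = T.encard := by
  classical
  have := hT.fintype
  let e : B ≃ₗ[ℂ] (T → ℂ) := LinearEquiv.ofBijective
    { toFun := fun ψ i => ψ.1 i.1
      map_add' := fun _ _ => rfl
      map_smul' := fun _ _ => rfl }
    ⟨by
      rw [← LinearMap.ker_eq_bot, LinearMap.ker_eq_bot']
      intro ψ h
      ext i
      by_cases hi : i ∈ T
      · exact congrFun h ⟨i, hi⟩
      · exact (hB _).1 ψ.2 i hi, by
      intro f
      let g : Weight ε × Fin 2 → ℂ := fun i => if h : i ∈ T then f ⟨i, h⟩ else 0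
      have hg : Memℓp g 2 := memℓp_of_finite (hT.subset fun i hi => by
        by_contra h
        exact hi (dif_neg h))
      exact ⟨⟨⟨g, hg⟩, (hB _).2 fun i hi => dif_neg hi⟩, funext fun i => dif_pos i.2⟩⟩
  refine ⟨e.symm.finiteDimensional, ?_⟩
  rw [e.finrank_eq, Module.finrank_fintype_fun_eq_card, Set.encard_eq_coe_toFinset_card,
    Set.toFinset_card]

/-- The weights on the axis with invariant basis vectors. -/
theorem offset_mem (σ : ℤˣ) (l : b.Label) (k : ℤ) (s : Fin 2) :
    ∃ n : ℤ, sgn s * (b.order * (k + l.offset σ)) = n + half (l.spin 0) := by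
  have key : ∃ n : ℤ, b.order * l.offset σ = n + half (l.spin 0) := by
    cases l with
    | b2 e₂ e₃ κ =>
      rcases Int.units_eq_one_or κ with rfl | rfl
      · exact ⟨-1, by simp [Bieb.order, Bieb.Label.offset, Bieb.Label.spin, half]; norm_num⟩
      · exact ⟨0, by simp [Bieb.order, Bieb.Label.offset, Bieb.Label.spin, half]; norm_num⟩
    | b3 e =>
      rcases Int.units_eq_one_or σ with rfl | rfl <;> cases e
      · exact ⟨-1, by simp [Bieb.order, Bieb.Label.offset, Bieb.Label.spin, half]⟩
      · exact ⟨0, by simp [Bieb.order, Bieb.Label.offset, Bieb.Label.spin, half]; norm_num⟩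
      · exact ⟨1, by simp [Bieb.order, Bieb.Label.offset, Bieb.Label.spin, half]; norm_num⟩
      · exact ⟨2, by simp [Bieb.order, Bieb.Label.offset, Bieb.Label.spin, half]; norm_num⟩
    | b4 e κ =>
      rcases Int.units_eq_one_or σ with rfl | rfl <;> rcases Int.units_eq_one_or κ with rfl | rfl
      · exact ⟨-1, by simp [Bieb.order, Bieb.Label.offset, Bieb.Label.spin, half]; norm_num⟩
      · exact ⟨1, by simp [Bieb.order, Bieb.Label.offset, Bieb.Label.spin, half]; norm_num⟩
      · exact ⟨0, by simp [Bieb.order, Bieb.Label.offset, Bieb.Label.spin, half]; norm_num⟩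
      · exact ⟨2, by simp [Bieb.order, Bieb.Label.offset, Bieb.Label.spin, half]; norm_num⟩
    | b6 κ =>
      rcases Int.units_eq_one_or σ with rfl | rfl <;> rcases Int.units_eq_one_or κ with rfl | rfl
      · exact ⟨-1, by simp [Bieb.order, Bieb.Label.offset, Bieb.Label.spin, half]; norm_num⟩
      · exact ⟨2, by simp [Bieb.order, Bieb.Label.offset, Bieb.Label.spin, half]; norm_num⟩
      · exact ⟨0, by simp [Bieb.order, Bieb.Label.offset, Bieb.Label.spin, half]; norm_num⟩
      · exact ⟨3, by simp [Bieb.order, Bieb.Label.offset, Bieb.Label.spin, half]; norm_num⟩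
  obtain ⟨n, hn⟩ := key
  have hp : sgn s * (b.order * (k + l.offset σ)) =
      sgn s * ((b.order * k + n : ℤ) + half (l.spin 0)) := by
    push_cast; rw [mul_add, hn]; ring
  rw [hp]
  fin_cases s
  · exact ⟨b.order * k + n, by simp [sgn]⟩
  · cases l.spin 0
    · exact ⟨-(b.order * k + n), by simp [sgn, half]⟩
    · exact ⟨-(b.order * k + n) - 1, by simp [sgn, half]; ring⟩

/-- The number of invariant eigenvectors with zero slope. -/
theorem finrank_slope_eq {σ : ℤˣ} (hσ : b.Admissible σ τ) (hR : 0 < R) (hτ : τ.im ≠ 0) (l : b.Label)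
    (x : ℝ) : ((Module.finrank ℂ (eigenPart R τ l.spin (fun μ => slope τ μ.1 = 0) x ⊓
      (holonomy_label hσ l).fixed : Submodule ℂ (Spinor l.spin)) : ℕ) : ℕ∞) =
      if l.spin 1 = false ∧ l.spin 2 = false then
        2 * Set.encard {k : ℤ | b.order * R * (k + l.offset σ) = x} else 0 := by
  set h := holonomy_label hσ l
  set T : Set (Weight l.spin × Fin 2) := {i | slope τ i.1.1 = 0 ∧ l.phase σ (i.1.1 0) i.2 = 1 ∧
    sgn i.2 * (R * i.1.1 0) = x} with hT
  have hTfin : T.Finite := by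
    refine ((finite_energy_le hR hτ l.spin |x|).prod (Set.finite_univ (α := Fin 2))).subset ?_
    rintro ⟨μ, s⟩ ⟨h1, -, h2⟩
    refine ⟨?_, trivial⟩
    have : energy R τ μ.1 = x ^ 2 := by
      rw [energy, h1, ← h2, norm_zero]
      linear_combination (-(R * μ.1 0) ^ 2) * sgn_mul_self s
    rw [Set.mem_ofPred_eq, this, Real.sqrt_sq_eq_abs]
  have hmem : ∀ ψ, ψ ∈ (eigenPart R τ l.spin (fun μ => slope τ μ.1 = 0) x ⊓ h.fixed :
      Submodule ℂ (Spinor l.spin)) ↔ ∀ i ∉ T, ψ i = 0 := by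
    have hlin : ∀ μ : Weight l.spin, slope τ μ.1 = 0 → Weight.lin b h.maps μ = μ := by
      intro μ hμ
      obtain ⟨h1, h2⟩ := (slope_eq_zero hτ).1 hμ
      refine Weight.ext' fun i => ?_
      rw [Weight.lin_coe]
      fin_cases i <;> simp [Bieb.lin, h1, h2]
    have heig : ∀ (μ : Weight l.spin), slope τ μ.1 = 0 → ∀ v : Fin 2 → ℂ,
        v ∈ symbolEigen R τ μ.1 x ↔ ∀ s, ((sgn s * (R * μ.1 0) : ℝ) : ℂ) * v s = x * v s := by
      intro μ hμ v
      obtain ⟨h1, h2⟩ := (slope_eq_zero hτ).1 hμ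
      rw [mem_symbolEigen]
      refine forall_congr' fun s => ?_
      fin_cases s <;> simp [symbol, h1, h2, sgn]
    intro ψ
    rw [Submodule.mem_inf, mem_eigenPart, mem_diracEigenspace_torus]
    constructor
    · rintro ⟨⟨h1, h2⟩, h3⟩ ⟨μ, s⟩ hi
      by_contra h0
      have hμ : slope τ μ.1 = 0 := by
        by_contra h4
        exact h0 (h2 μ s h4)
      refine hi ⟨hμ, ?_, ?_⟩
      · have h4 := h.op_lin ψ μ s
        rw [h.mem_fixed.1 h3, hlin μ hμ, ← l.phase_eq] at h4
        exact mul_right_cancel₀ h0 (h4.symm.trans (one_mul _).symm)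
      · have h4 := (heig μ hμ _).1 (h1 μ) s
        have h5 : sgn s * (R * μ.1 0) = x := Complex.ofReal_injective (mul_right_cancel₀ h0 h4)
        exact h5
    · intro h1
      have h2 : ∀ μ s, slope τ μ.1 ≠ 0 → ψ (μ, s) = 0 := fun μ s hμ =>
        h1 (μ, s) fun h => hμ h.1
      refine ⟨⟨fun μ => ?_, h2⟩, ?_⟩
      · by_cases hμ : slope τ μ.1 = 0
        · refine (heig μ hμ _).2 fun s => ?_
          by_cases hi : (μ, s) ∈ T
          · rw [hi.2.2]
          · rw [h1 _ hi, mul_zero, mul_zero]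
        · have : (fun s => ψ (μ, s)) = 0 := funext fun s => h2 μ s hμ
          rw [this]; exact Submodule.zero_mem _
      · rw [h.mem_fixed]
        ext ⟨μ, s⟩
        obtain ⟨μ, rfl⟩ := (Weight.lin b h.maps).surjective μ
        rw [h.op_lin]
        by_cases hμ : slope τ μ.1 = 0
        · rw [hlin μ hμ, ← l.phase_eq]
          by_cases hi : (μ, s) ∈ T
          · rw [hi.2.1, one_mul]
          · rw [h1 _ hi, mul_zero]
        · rw [h2 μ s hμ, h2 _ s ((h.slope_lin_ne μ).2 hμ), mul_zero]
  rw [(finrank_supported T hTfin _ hmem).2]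
  split_ifs with hl
  · have hw : ∀ (k : ℤ) (s : Fin 2) (i : Fin 3), ∃ n : ℤ,
        (![sgn s * (b.order * (k + l.offset σ)), 0, 0] : Fin 3 → ℝ) i = n + half (l.spin i) := by
      intro k s i
      fin_cases i
      · exact offset_mem σ l k s
      · exact ⟨0, by simp [hl.1, half]⟩
      · exact ⟨0, by simp [hl.2, half]⟩
    let f : ℤ × Fin 2 → Weight l.spin × Fin 2 := fun q => (⟨_, hw q.1 q.2⟩, q.2)
    have hN : (b.order : ℝ) ≠ 0 := by exact_mod_cast b.order_pos.ne'
    have hf : Function.Injective f := by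
      rintro ⟨k, s⟩ ⟨k', s'⟩ hkk
      obtain rfl : s = s' := congrArg Prod.snd hkk
      have h1 : sgn s * (b.order * (k + l.offset σ)) = sgn s * (b.order * (k' + l.offset σ)) :=
        congrArg (fun q : Weight l.spin × Fin 2 => q.1.1 0) hkk
      have h2 : sgn s ≠ 0 := by fin_cases s <;> simp [sgn]
      have h3 := add_right_cancel (mul_left_cancel₀ hN (mul_left_cancel₀ h2 h1))
      rw [show k = k' by exact_mod_cast h3]
    have hTeq : T = f '' ({k : ℤ | b.order * R * (k + l.offset σ) = x} ×ˢ Set.univ) := by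
      ext ⟨μ, s⟩
      constructor
      · rintro ⟨h1, h2, h3⟩
        obtain ⟨h4, h5⟩ := (slope_eq_zero hτ).1 h1
        obtain ⟨k, hk⟩ := (l.phase_eq_one_iff σ _ s).1 h2
        refine ⟨(k, s), ⟨?_, trivial⟩, Prod.ext (Weight.ext' fun i => ?_) rfl⟩
        · rw [hk] at h3
          rw [Set.mem_ofPred_eq, ← h3]
          linear_combination (-(b.order * R * (k + l.offset σ))) * sgn_mul_self s
        · fin_cases i
          · exact hk.symm
          · exact h4.symm
          · exact h5.symm
      · rintro ⟨⟨k, s'⟩, ⟨hk, -⟩, he⟩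
        obtain rfl : s' = s := congrArg Prod.snd he
        obtain rfl : (⟨_, hw k s'⟩ : Weight l.spin) = μ := congrArg Prod.fst he
        refine ⟨(slope_eq_zero hτ).2 ⟨rfl, rfl⟩, (l.phase_eq_one_iff σ _ s').2 ⟨k, rfl⟩, ?_⟩
        rw [Set.mem_ofPred_eq] at hk
        change sgn s' * (R * (sgn s' * (b.order * (k + l.offset σ)))) = x
        rw [← hk]
        linear_combination (b.order * R * (k + l.offset σ)) * sgn_mul_self s'
    rw [hTeq, hf.encard_image, Set.encard_prod, Set.encard_univ, mul_comm]
    simp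
  · have : T = ∅ := by
      rw [Set.eq_empty_iff_forall_notMem]
      rintro ⟨μ, s⟩ ⟨h1, -⟩
      obtain ⟨h4, h5⟩ := (slope_eq_zero hτ).1 h1
      refine hl ⟨?_, ?_⟩
      · obtain ⟨n, hn⟩ := μ.2 1
        rw [h4] at hn
        by_contra h6
        rw [Bool.not_eq_false] at h6
        simp only [h6, half, if_true] at hn
        have : ((2 * n + 1 : ℤ) : ℝ) = ((0 : ℤ) : ℝ) := by push_cast; linarith
        have := Int.cast_injective this
        omega
      · obtain ⟨n, hn⟩ := μ.2 2
        rw [h5] at hn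
        by_contra h6
        rw [Bool.not_eq_false] at h6
        simp only [h6, half, if_true] at hn
        have : ((2 * n + 1 : ℤ) : ℝ) = ((0 : ℤ) : ℝ) := by push_cast; linarith
        have := Int.cast_injective this
        omega
    rw [this, Set.encard_empty]

/-- The spectrum of the Dirac operator with multiplicities. -/
theorem finrank_eigenspace_label {σ : ℤˣ} (hσ : b.Admissible σ τ) (hR : 0 < R) (hτ : τ.im ≠ 0)
    (l : b.Label) (x : ℝ) :
    FiniteDimensional ℂ (diracEigenspace ((holonomy_label hσ l).triple θ R).dirac x) ∧
    Module.finrank ℂ (diracEigenspace ((holonomy_label hσ l).triple θ R).dirac x) =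
      Module.finrank ℂ (eigenPart R τ l.spin (fun μ => slope τ μ.1 ≠ 0) x ⊓
        (holonomy_label hσ l).fixed : Submodule ℂ (Spinor l.spin)) +
      Module.finrank ℂ (eigenPart R τ l.spin (fun μ => slope τ μ.1 = 0) x ⊓
        (holonomy_label hσ l).fixed : Submodule ℂ (Spinor l.spin)) := by
  set h := holonomy_label hσ l
  set A := (eigenPart R τ l.spin (fun μ => slope τ μ.1 ≠ 0) x ⊓ h.fixed : Submodule ℂ (Spinor l.spin))
  set B := (eigenPart R τ l.spin (fun μ => slope τ μ.1 = 0) x ⊓ h.fixed : Submodule ℂ (Spinor l.spin))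
  have hmap := ReducesOperator_eigen (θ := θ) (R := R) h x
  have : FiniteDimensional ℂ (diracEigenspace (torusDirac R τ l.spin) x) :=
    (finrank_eigenspace_flatTorus hR hτ x).1
  have hAle : A ≤ diracEigenspace (torusDirac R τ l.spin) x := fun ψ hψ => hψ.1.1
  have hBle : B ≤ diracEigenspace (torusDirac R τ l.spin) x := fun ψ hψ => hψ.1.1
  have := Submodule.finiteDimensional_of_le hAle
  have := Submodule.finiteDimensional_of_le hBle
  have hfd : FiniteDimensional ℂ
      (diracEigenspace (torusDirac R τ l.spin) x ⊓ h.fixed : Submodule ℂ (Spinor l.spin)) :=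
    Submodule.finiteDimensional_of_le inf_le_left
  constructor
  · rw [← hmap] at hfd
    exact (Submodule.equivMapOfInjective h.fixed.subtype h.fixed.subtype_injective _).symm.finiteDimensional
  · rw [← Submodule.finrank_map_subtype_eq, hmap, ← Submodule.finrank_sup_add_finrank_inf_eq]
    have h1 : A ⊓ B = ⊥ := by
      rw [Submodule.eq_bot_iff]
      rintro ψ ⟨h1, h2⟩
      ext ⟨μ, s⟩
      by_cases hμ : slope τ μ.1 = 0
      · exact h1.1.2 μ s (not_not.2 hμ)
      · exact h2.1.2 μ s hμ
    have h2 : diracEigenspace (torusDirac R τ l.spin) x ⊓ h.fixed = A ⊔ B := by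
      apply le_antisymm
      · rintro ψ ⟨h1, h2⟩
        classical
        let χ : Spinor l.spin →L[ℂ] Spinor l.spin := diagOp
          (fun i => if slope τ i.1.1 = 0 then 0 else 1) 1 (fun i => by split_ifs <;> simp)
        have hχ : ∀ ψ μ s, χ ψ (μ, s) = (if slope τ μ.1 = 0 then 0 else 1) * ψ (μ, s) :=
          fun _ _ _ => rfl
        have hχE : χ ψ ∈ diracEigenspace (torusDirac R τ l.spin) x :=
          mem_diracEigenspace_torus.2 fun μ =>
            Submodule.smul_mem _ (if slope τ μ.1 = 0 then 0 else 1) (mem_diracEigenspace_torus.1 h1 μ)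
        have hχf : χ ψ ∈ h.fixed := by
          rw [h.mem_fixed]
          ext ⟨μ, s⟩
          obtain ⟨μ, rfl⟩ := (Weight.lin b h.maps).surjective μ
          have h3 := h.op_lin ψ μ s
          rw [h.mem_fixed.1 h2] at h3
          have h4 := h.slope_lin_ne μ
          rw [h.op_lin, hχ, hχ, h3]
          by_cases hμ : slope τ μ.1 = 0
          · rw [if_pos hμ, if_pos (not_not.1 fun h5 => h4.1 h5 hμ), zero_mul, mul_zero, zero_mul]
          · rw [if_neg hμ, if_neg (h4.2 hμ), one_mul, one_mul]
        rw [← add_sub_cancel (χ ψ) ψ]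
        refine Submodule.add_mem_sup ⟨⟨hχE, fun μ s hμ => ?_⟩, hχf⟩
          ⟨⟨Submodule.sub_mem _ h1 hχE, fun μ s hμ => ?_⟩, Submodule.sub_mem _ h2 hχf⟩
        · rw [hχ, if_pos (not_not.1 hμ), zero_mul]
        · rw [lp.coeFn_sub, Pi.sub_apply, hχ, if_neg hμ, one_mul, sub_self]
      · exact sup_le (le_inf hAle inf_le_right) (le_inf hBle inf_le_right)
    rw [h1, finrank_bot, add_zero, h2]

theorem mul_finrank_eigenspace_label {σ : ℤˣ} (hσ : b.Admissible σ τ) (hR : 0 < R) (hτ : τ.im ≠ 0)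
    (l : b.Label) (x : ℝ) :
    ((b.order * Module.finrank ℂ (diracEigenspace ((holonomy_label hσ l).triple θ R).dirac x) : ℕ) : ℕ∞) =
      Set.encard {i : Weight l.spin × Fin 2 |
        ¬(i.1.1 1 = 0 ∧ i.1.1 2 = 0) ∧ torusEigenvalue R τ i.1.1 i.2 = x} +
      if l.spin 1 = false ∧ l.spin 2 = false then
        b.order * (2 * Set.encard {k : ℤ | b.order * R * (k + l.offset σ) = x}) else 0 := by
  rw [(finrank_eigenspace_label hσ hR hτ l x).2, mul_add, Nat.cast_add,
    mul_finrank_slope_ne _ hR hτ, Nat.cast_mul, finrank_slope_eq hσ hR hτ]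
  congr 1
  · congr 1
    ext i
    simp only [Set.mem_ofPred_eq, ne_eq, slope_eq_zero hτ]
  · split_ifs <;> simp

end Spectrum

section HurwitzValue

theorem hasDerivAt_real_cpow (r : ℂ) {x : ℝ} (hx : 0 < x) :
    HasDerivAt (fun y : ℝ => (y : ℂ) ^ r) (r * (x : ℂ) ^ (r - 1)) x := by
  have := (hasDerivAt_id (x : ℂ)).cpow_const (c := r) (Or.inl (by simpa using hx))
  simpa using this.comp_ofReal

/-- First-order Taylor estimate for powers. -/
theorem norm_cpow_sub_le {s : ℂ} (hs : -2 ≤ s.re) {x t : ℝ} (hx : 0 < x) (ht : 0 ≤ t) (ht1 : t ≤ 1) :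
    ‖((x + t : ℝ) : ℂ) ^ (-s) - (x : ℂ) ^ (-s) - t * (-s * (x : ℂ) ^ (-s - 1))‖ ≤
      ‖s‖ * ‖s + 1‖ * x ^ (-s.re - 2) := by
  set M := ‖s‖ * ‖s + 1‖ * x ^ (-s.re - 2) with hM
  have hM0 : 0 ≤ M := by positivity
  have hpow : ∀ u : ℝ, 0 ≤ u → (x + u) ^ (-s.re - 2) ≤ x ^ (-s.re - 2) := fun u hu =>
    Real.rpow_le_rpow_of_nonpos hx (by linarith) (by linarith)
  have h1 : ∀ u ∈ Set.Icc (0 : ℝ) 1,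
      ‖-s * ((x + u : ℝ) : ℂ) ^ (-s - 1) - -s * ((x + 0 : ℝ) : ℂ) ^ (-s - 1)‖ ≤ M * (u - 0) := by
    refine norm_image_sub_le_of_norm_deriv_le_segment'
      (f := fun u : ℝ => -s * ((x + u : ℝ) : ℂ) ^ (-s - 1))
      (f' := fun u => -s * ((-s - 1) * ((x + u : ℝ) : ℂ) ^ (-s - 1 - 1))) (fun u hu => ?_) fun u hu => ?_
    · have := (hasDerivAt_real_cpow (-s - 1) (x := x + u) (by linarith [hu.1])).scomp u
        ((hasDerivAt_id u).const_add x)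
      simpa [Function.comp_def] using (this.const_mul (-s)).hasDerivWithinAt
    · have hxu : 0 < x + u := by linarith [hu.1]
      rw [norm_mul, norm_mul, norm_neg, norm_cpow_eq_rpow_re_of_pos hxu,
        show -s - 1 = -(s + 1) by ring, norm_neg, ← mul_assoc]
      refine mul_le_mul_of_nonneg_left ?_ (by positivity)
      have he : (-(s + 1) - 1).re = -s.re - 2 := by
        simp only [sub_re, neg_re, add_re, one_re]; ring
      rw [he]
      exact hpow u hu.1
  have h2 : ∀ u ∈ Set.Icc (0 : ℝ) 1,
      ‖(((x + u : ℝ) : ℂ) ^ (-s) - u * (-s * (x : ℂ) ^ (-s - 1))) -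
        (((x + 0 : ℝ) : ℂ) ^ (-s) - (0 : ℝ) * (-s * (x : ℂ) ^ (-s - 1)))‖ ≤ M * (u - 0) := by
    refine norm_image_sub_le_of_norm_deriv_le_segment'
      (f := fun u : ℝ => ((x + u : ℝ) : ℂ) ^ (-s) - u * (-s * (x : ℂ) ^ (-s - 1)))
      (f' := fun u => -s * ((x + u : ℝ) : ℂ) ^ (-s - 1) - -s * (x : ℂ) ^ (-s - 1))
      (fun u hu => ?_) fun u hu => ?_
    · have h3 := (hasDerivAt_real_cpow (-s) (x := x + u) (by linarith [hu.1])).scomp u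
        ((hasDerivAt_id u).const_add x)
      have h4 := ((hasDerivAt_id (u : ℂ)).comp_ofReal).mul_const (-s * (x : ℂ) ^ (-s - 1))
      simpa [Function.comp_def] using (h3.fun_sub h4).hasDerivWithinAt
    · have h5 := h1 u ⟨hu.1, hu.2.le⟩
      rw [add_zero, sub_zero] at h5
      refine h5.trans ?_
      nlinarith [hu.1, hu.2]
  have h6 := h2 t ⟨ht, ht1⟩
  have h7 : ∀ A B C : ℂ, A - B - C = A - C - (B - ((0 : ℝ) : ℂ) * (-s * (x : ℂ) ^ (-s - 1))) := by
    intro A B C; rw [ofReal_zero, zero_mul]; ring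
  rw [h7]
  rw [add_zero] at h6
  refine h6.trans ?_
  nlinarith

/-- The terms of a telescoped form of the odd Hurwitz series. -/
def oddTerm (a : ℝ) (n : ℕ) (s : ℂ) : ℂ :=
  (((n + a : ℝ) : ℂ) ^ (-s) - ((n + a + (1 - 2 * a) : ℝ) : ℂ) ^ (-s)) -
    (1 - 2 * a) * (((n + a : ℝ) : ℂ) ^ (-s) - ((n + a + 1 : ℝ) : ℂ) ^ (-s))

theorem norm_oddTerm_le {a : ℝ} (ha : 0 < a) (ha1 : a ≤ 1 / 2) {s : ℂ} (hs : -(1 / 2) < s.re)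
    (hs3 : ‖s‖ < 3) (n : ℕ) :
    ‖oddTerm a n s‖ ≤ 24 * a ^ (-5 : ℝ) * ((n + 1 : ℕ) : ℝ) ^ (-(3 / 2) : ℝ) := by
  have hx : 0 < n + a := by positivity
  have h1 := norm_cpow_sub_le (by linarith) hx (t := 1 - 2 * a) (by linarith) (by linarith) (s := s)
  have h2 := norm_cpow_sub_le (by linarith) hx (t := 1) (by linarith) (by linarith) (s := s)
  set M := ‖s‖ * ‖s + 1‖ * (n + a) ^ (-s.re - 2)
  have hre : s.re ≤ 3 := (re_le_norm s).trans hs3.le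
  have hM : M ≤ 12 * (a ^ (-5 : ℝ) * ((n + 1 : ℕ) : ℝ) ^ (-(3 / 2) : ℝ)) := by
    have h3 : ‖s + 1‖ ≤ 4 := (norm_add_le _ _).trans (by rw [norm_one]; linarith)
    have h4 : ‖s‖ * ‖s + 1‖ ≤ 12 := by nlinarith [norm_nonneg s, norm_nonneg (s + 1)]
    have hn1 : (1 : ℝ) ≤ ((n + 1 : ℕ) : ℝ) := by push_cast; linarith [n.cast_nonneg (α := ℝ)]
    have h5 : a * ((n + 1 : ℕ) : ℝ) ≤ n + a := by
      push_cast; nlinarith [n.cast_nonneg (α := ℝ)]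
    refine mul_le_mul h4 ?_ (by positivity) (by norm_num)
    calc (n + a) ^ (-s.re - 2) ≤ (a * ((n + 1 : ℕ) : ℝ)) ^ (-s.re - 2) :=
          Real.rpow_le_rpow_of_nonpos (by positivity) h5 (by linarith)
      _ = a ^ (-s.re - 2) * ((n + 1 : ℕ) : ℝ) ^ (-s.re - 2) := Real.mul_rpow ha.le (by positivity)
      _ ≤ _ := by
        refine mul_le_mul ?_ ?_ (by positivity) (by positivity)
        · exact Real.rpow_le_rpow_of_exponent_ge ha (by linarith) (by linarith)
        · exact Real.rpow_le_rpow_of_exponent_le hn1 (by linarith)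
  have h6 : oddTerm a n s =
      -(((n + a + (1 - 2 * a) : ℝ) : ℂ) ^ (-s) - ((n + a : ℝ) : ℂ) ^ (-s) -
        (1 - 2 * a : ℝ) * (-s * ((n + a : ℝ) : ℂ) ^ (-s - 1))) +
      (1 - 2 * a : ℝ) * (((n + a + 1 : ℝ) : ℂ) ^ (-s) - ((n + a : ℝ) : ℂ) ^ (-s) -
        (1 : ℝ) * (-s * ((n + a : ℝ) : ℂ) ^ (-s - 1))) := by
    rw [oddTerm]; push_cast; ring
  rw [h6]
  refine (norm_add_le _ _).trans ?_
  rw [norm_neg, norm_mul, norm_real, Real.norm_of_nonneg (by linarith : (0 : ℝ) ≤ 1 - 2 * a)]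
  have h7 : (1 - 2 * a) * ‖((n + a + 1 : ℝ) : ℂ) ^ (-s) - ((n + a : ℝ) : ℂ) ^ (-s) -
        (1 : ℝ) * (-s * ((n + a : ℝ) : ℂ) ^ (-s - 1))‖ ≤ M := by
    refine (mul_le_of_le_one_left (norm_nonneg _) (by linarith)).trans h2
  linarith

theorem hurwitzZetaOdd_zero_of_le_half {a : ℝ} (ha : 0 < a) (ha1 : a ≤ 1 / 2) :
    HurwitzZeta.hurwitzZetaOdd a 0 = 1 / 2 - a := by
  set U : Set ℂ := Metric.ball 0 3 ∩ {s | -(1 / 2) < s.re} with hU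
  have hUo : IsOpen U := Metric.isOpen_ball.inter (isOpen_lt continuous_const continuous_re)
  have hUc : IsPreconnected U :=
    Convex.isPreconnected ((convex_ball (0 : ℂ) 3).inter (convex_halfSpace_re_gt (-(1 / 2))))
  have hx : ∀ n : ℕ, ∀ t : ℝ, 0 ≤ t → ((n + a + t : ℝ) : ℂ) ≠ 0 := fun n t ht => by
    have : 0 < (n : ℝ) + a + t := by positivity
    exact_mod_cast this.ne'
  have hdiff : ∀ n : ℕ, ∀ t : ℝ, 0 ≤ t → Differentiable ℂ fun s : ℂ => ((n + a + t : ℝ) : ℂ) ^ (-s) :=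
    fun n t ht => (differentiable_id.neg : Differentiable ℂ fun s : ℂ => -s).const_cpow (Or.inl (hx n t ht))
  have hdiff0 : ∀ n : ℕ, Differentiable ℂ fun s : ℂ => ((n + a : ℝ) : ℂ) ^ (-s) := fun n => by
    simpa using hdiff n 0 le_rfl
  have hsum : Summable fun n : ℕ => 24 * a ^ (-5 : ℝ) * ((n + 1 : ℕ) : ℝ) ^ (-(3 / 2) : ℝ) :=
    ((summable_nat_add_iff 1).2 (Real.summable_nat_rpow.2 (by norm_num))).mul_left _
  have hG : DifferentiableOn ℂ (fun s => ∑' n, oddTerm a n s) U :=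
    differentiableOn_tsum_of_summable_norm hsum (fun n => by
      refine Differentiable.differentiableOn ?_
      exact ((hdiff0 n).sub (hdiff n _ (by linarith))).sub
        (((hdiff0 n).sub (hdiff n _ zero_le_one)).const_mul _)) hUo
      fun n s hs => norm_oddTerm_le ha ha1 hs.2 (by simpa using hs.1) n
  have hkey : Set.EqOn (fun s => 2 * HurwitzZeta.hurwitzZetaOdd a s)
      (fun s => ∑' n, oddTerm a n s + (1 - 2 * a) * (a : ℂ) ^ (-s)) U := by
    have h2U : (2 : ℂ) ∈ U := ⟨by simp; norm_num, by simp; norm_num⟩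
    refine AnalyticOnNhd.eqOn_of_preconnected_of_eventuallyEq (𝕜 := ℂ) (z₀ := 2) ?_ ?_ hUc h2U ?_
    · exact ((HurwitzZeta.differentiable_hurwitzZetaOdd _).const_mul 2).differentiableOn.analyticOnNhd hUo
    · refine (hG.add (Differentiable.differentiableOn ?_)).analyticOnNhd hUo
      have := (hdiff0 0).const_mul (1 - 2 * (a : ℂ))
      simpa using this
    · filter_upwards [(isOpen_lt continuous_const continuous_re).mem_nhds
        (show (1 : ℝ) < (2 : ℂ).re by simp)] with s hs
      have ha' : a ∈ Set.Icc (0 : ℝ) 1 := ⟨ha.le, by linarith⟩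
      have h1 := (HurwitzZeta.hasSum_nat_hurwitzZetaOdd_of_mem_Icc ha' hs).mul_left 2
      have h2 := HurwitzZeta.hasSum_hurwitzZeta_of_one_lt_re ha' hs
      have h3 := (hasSum_nat_add_iff' 1).2 h2
      have h4 := (h2.sub h3).mul_left (1 - 2 * (a : ℂ))
      have h5 := (h1.sub h4).congr_fun (g := fun n => oddTerm a n s) fun n => by
        rw [oddTerm]
        push_cast
        simp only [cpow_neg, one_div]
        rw [show (n : ℂ) + 1 - a = n + a + (1 - 2 * a) by ring,
          show (n : ℂ) + 1 + a = n + a + 1 by ring]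
        ring
      change 2 * HurwitzZeta.hurwitzZetaOdd a s = ∑' n, oddTerm a n s + (1 - 2 * a) * (a : ℂ) ^ (-s)
      rw [h5.tsum_eq]
      simp only [Finset.sum_range_one, Nat.cast_zero, zero_add, cpow_neg, one_div]
      ring
  have h0 := hkey (show (0 : ℂ) ∈ U from ⟨by simp, by simp⟩)
  have hz : ∀ n, oddTerm a n 0 = 0 := fun n => by simp [oddTerm]
  simp only [hz, tsum_zero, neg_zero, cpow_zero, zero_add, mul_one] at h0
  linear_combination h0 / 2

/-- The odd Hurwitz zeta function at `s = 0`. -/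
theorem hurwitzZetaOdd_zero {a : ℝ} (ha : 0 < a) (ha1 : a < 1) :
    HurwitzZeta.hurwitzZetaOdd a 0 = 1 / 2 - a := by
  rcases le_or_gt a (1 / 2) with h | h
  · exact hurwitzZetaOdd_zero_of_le_half ha h
  · have h1 := hurwitzZetaOdd_zero_of_le_half (a := 1 - a) (by linarith) (by linarith)
    have h2 : ((1 - a : ℝ) : UnitAddCircle) = -((a : ℝ) : UnitAddCircle) := by
      rw [AddCircle.coe_sub, AddCircle.coe_period, zero_sub]
    rw [h2, HurwitzZeta.hurwitzZetaOdd_neg] at h1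
    push_cast at h1
    linear_combination -h1

theorem hurwitzZetaOdd_zero_of_eq_add {x a : ℝ} (m : ℤ) (hx : x = a + m) (ha : 0 < a) (ha1 : a < 1) :
    HurwitzZeta.hurwitzZetaOdd x 0 = 1 / 2 - a := by
  have : ((m : ℝ) : UnitAddCircle) = 0 := by
    rw [show (m : ℝ) = m • (1 : ℝ) by simp, AddCircle.coe_zsmul, AddCircle.coe_period, smul_zero]
  rw [hx, AddCircle.coe_add, this, add_zero, hurwitzZetaOdd_zero ha ha1]

theorem Bieb.Label.four_mul_hurwitz {b : Bieb} (σ : ℤˣ) (l : b.Label)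
    (hl : l.spin 1 = false ∧ l.spin 2 = false) :
    4 * HurwitzZeta.hurwitzZetaOdd (l.offset σ : ℝ) 0 = (l.eta σ : ℂ) := by
  have key : ∀ (x a e : ℝ) (m : ℤ), x = a + m → 0 < a → a < 1 → e = 2 - 4 * a →
      4 * HurwitzZeta.hurwitzZetaOdd x 0 = (e : ℂ) := by
    intro x a e m hx ha ha1 he
    rw [hurwitzZetaOdd_zero_of_eq_add m hx ha ha1, he]
    push_cast; ring
  cases l with
  | b2 e₂ e₃ κ =>
    obtain ⟨h1, h2⟩ := hl
    simp only [spin, Matrix.cons_val] at h1 h2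
    subst h1 h2
    rcases Int.units_eq_one_or κ with rfl | rfl
    · exact key _ (3 / 4) _ (-1) (by simp [offset]; norm_num) (by norm_num) (by norm_num)
        (by simp [eta]; norm_num)
    · exact key _ (1 / 4) _ 0 (by simp [offset]) (by norm_num) (by norm_num)
        (by simp [eta]; norm_num)
  | b3 e =>
    rcases Int.units_eq_one_or σ with rfl | rfl <;> cases e
    · exact key _ (2 / 3) _ (-1) (by simp [offset, half]; norm_num) (by norm_num) (by norm_num)
        (by simp [eta]; norm_num)
    · exact key _ (1 / 6) _ 0 (by simp [offset, half]; norm_num) (by norm_num) (by norm_num)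
        (by simp [eta]; norm_num)
    · exact key _ (1 / 3) _ 0 (by simp [offset, half]; norm_num) (by norm_num) (by norm_num)
        (by simp [eta]; norm_num)
    · exact key _ (5 / 6) _ 0 (by simp [offset, half]; norm_num) (by norm_num) (by norm_num)
        (by simp [eta]; norm_num)
  | b4 e κ =>
    obtain ⟨h1, -⟩ := hl
    simp only [spin, Matrix.cons_val] at h1
    subst h1
    rcases Int.units_eq_one_or σ with rfl | rfl <;> rcases Int.units_eq_one_or κ with rfl | rfl
    · exact key _ (7 / 8) _ (-1) (by simp [offset]; norm_num) (by norm_num) (by norm_num)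
        (by simp [eta]; norm_num)
    · exact key _ (3 / 8) _ 0 (by simp [offset]; norm_num) (by norm_num) (by norm_num)
        (by simp [eta]; norm_num)
    · exact key _ (1 / 8) _ 0 (by simp [offset]; norm_num) (by norm_num) (by norm_num)
        (by simp [eta]; norm_num)
    · exact key _ (5 / 8) _ 0 (by simp [offset]; norm_num) (by norm_num) (by norm_num)
        (by simp [eta]; norm_num)
  | b6 κ =>
    rcases Int.units_eq_one_or σ with rfl | rfl <;> rcases Int.units_eq_one_or κ with rfl | rfl
    · exact key _ (11 / 12) _ (-1) (by simp [offset]; norm_num) (by norm_num) (by norm_num)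
        (by simp [eta]; norm_num)
    · exact key _ (5 / 12) _ 0 (by simp [offset]; norm_num) (by norm_num) (by norm_num)
        (by simp [eta]; norm_num)
    · exact key _ (1 / 12) _ 0 (by simp [offset]; norm_num) (by norm_num) (by norm_num)
        (by simp [eta]; norm_num)
    · exact key _ (7 / 12) _ 0 (by simp [offset]; norm_num) (by norm_num) (by norm_num)
        (by simp [eta]; norm_num)

theorem Bieb.Label.eta_eq_zero {b : Bieb} (σ : ℤˣ) (l : b.Label)
    (hl : ¬(l.spin 1 = false ∧ l.spin 2 = false)) : l.eta σ = 0 := by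
  cases l with
  | b2 e₂ e₃ κ => cases e₂ <;> cases e₃ <;> simp_all [spin, eta]
  | b3 e => simp [spin] at hl
  | b4 e κ => cases e <;> simp_all [spin, eta]
  | b6 κ => simp [spin] at hl

end HurwitzValue

section Eta

theorem hasSum_fiber {ι : Type*} (v : ι → ℝ) (hv : ∀ l, (v ⁻¹' {l}).Finite) {g : ℝ → ℂ} {S : ℂ}
    (h : HasSum (fun i => g (v i)) S) : HasSum (fun l => ((v ⁻¹' {l}).ncard : ℂ) * g l) S := by
  have h1 := ((Equiv.sigmaFiberEquiv v).hasSum_iff).2 h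
  refine h1.sigma fun l => ?_
  have : Finite {i // v i = l} := hv l
  have := Fintype.ofFinite {i // v i = l}
  have h2 := hasSum_fintype fun i : {i // v i = l} => g (v i)
  have h3 : ∑ i : {i // v i = l}, g (v i) = ((v ⁻¹' {l}).ncard : ℂ) * g l := by
    rw [Finset.sum_congr rfl (fun i _ => by rw [i.2]), Finset.sum_const, nsmul_eq_mul]
    congr 2
    rw [Finset.card_univ, ← Nat.card_eq_fintype_card]
    rfl
  rw [h3] at h2
  exact h2

theorem summable_norm_weight (ε : Fin 3 → Bool) {r : ℝ} (hr : r < -3) :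
    Summable fun μ : Weight ε => ‖μ.1‖ ^ r := by
  rw [← (Weight.ofInt ε).summable_iff]
  let L := Submodule.span ℤ (Set.range (Pi.basisFun ℝ (Fin 3)))
  have hL : Module.finrank ℤ L = 3 := by
    rw [Module.finrank_eq_card_basis ((Pi.basisFun ℝ (Fin 3)).restrictScalars ℤ), Fintype.card_fin]
  have h1 := ZLattice.summable_norm_sub_rpow L r (by rw [hL]; exact_mod_cast hr)
    (fun i => -half (ε i))
  let f : (Fin 3 → ℤ) → L := fun n => ⟨fun i => n i, by
    have : (fun i => (n i : ℝ)) = ∑ i, n i • Pi.basisFun ℝ (Fin 3) i := by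
      ext j
      simp [Finset.sum_apply, Pi.single_apply]
    rw [this]
    exact Submodule.sum_mem _ fun i _ => Submodule.smul_mem _ _ (Submodule.subset_span ⟨i, rfl⟩)⟩
  have hf : Function.Injective f := fun m n h => by
    ext i
    have : (m i : ℝ) = n i := congrFun (congrArg Subtype.val h) i
    exact_mod_cast this
  refine (h1.comp_injective hf).congr fun n => ?_
  simp only [Function.comp]
  congr 2
  ext i
  simp [f, Weight.ofInt_apply]

variable {θ R : ℝ} {b : Bieb} {τ : ℂ} {ε : Fin 3 → Bool} {c : ℂ}

/-- The summand of the eta function. -/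
def etaTerm (s : ℂ) (l : ℝ) : ℂ := ((SignType.sign l : ℝ) : ℂ) * ((|l| : ℝ) : ℂ) ^ (-s)

theorem etaTerm_neg (s : ℂ) (l : ℝ) : etaTerm s (-l) = -etaTerm s l := by
  simp [etaTerm, Left.sign_neg]

theorem etaTerm_mul (s : ℂ) {r : ℝ} (hr : 0 < r) (l : ℝ) :
    etaTerm s (r * l) = (r : ℂ) ^ (-s) * etaTerm s l := by
  rw [etaTerm, etaTerm, sign_mul, sign_pos hr, one_mul, abs_mul, abs_of_pos hr, ofReal_mul,
    mul_cpow_ofReal_nonneg hr.le (abs_nonneg _)]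
  ring

theorem norm_etaTerm_le (s : ℂ) {l : ℝ} (hl : l ≠ 0) : ‖etaTerm s l‖ ≤ |l| ^ (-s.re) := by
  rw [etaTerm, norm_mul, norm_cpow_eq_rpow_re_of_pos (abs_pos.2 hl), neg_re]
  refine mul_le_of_le_one_left (by positivity) ?_
  rcases lt_or_gt_of_ne hl with h | h
  · simp [sign_neg h]
  · simp [sign_pos h]

theorem hasSum_etaTerm_slope (hR : 0 < R) (hτ : τ.im ≠ 0) (ε : Fin 3 → Bool) {s : ℂ} (hs : 3 < s.re) :
    HasSum (fun i : {i : Weight ε × Fin 2 // ¬(i.1.1 1 = 0 ∧ i.1.1 2 = 0)} =>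
      etaTerm s (torusEigenvalue R τ i.1.1.1 i.1.2)) 0 := by
  obtain ⟨c, hc, hle⟩ := exists_energy_ge hR hτ
  have habs : ∀ (x : Fin 3 → ℝ) t, |torusEigenvalue R τ x t| = Real.sqrt (energy R τ x) := by
    intro x t
    rw [torusEigenvalue_eq, abs_mul, abs_of_nonneg (Real.sqrt_nonneg _)]
    fin_cases t <;> simp [sgn]
  have hsum : Summable fun i : {i : Weight ε × Fin 2 // ¬(i.1.1 1 = 0 ∧ i.1.1 2 = 0)} =>
      etaTerm s (torusEigenvalue R τ i.1.1.1 i.1.2) := by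
    have h1 : Summable fun i : Weight ε × Fin 2 => c ^ (-s.re) * ‖i.1.1‖ ^ (-s.re) := by
      rw [← (Equiv.prodComm (Fin 2) (Weight ε)).summable_iff]
      refine (summable_prod_of_nonneg fun _ => by simp only [Function.comp, Pi.zero_apply]; positivity).2 ⟨fun t => ?_, .of_finite⟩
      exact (summable_norm_weight ε (by linarith)).mul_left _
    refine Summable.of_norm_bounded (h1.comp_injective Subtype.val_injective) fun i => ?_
    have h0 : 0 < ‖i.1.1.1‖ := by
      rw [norm_pos_iff]
      intro h
      exact i.2 (by simp [h])
    have h2 := hle i.1.1.1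
    have h3 : 0 < Real.sqrt (energy R τ i.1.1.1) := lt_of_lt_of_le (by positivity) h2
    have h4 : torusEigenvalue R τ i.1.1.1 i.1.2 ≠ 0 := abs_pos.1 (by rw [habs]; exact h3)
    refine (norm_etaTerm_le s h4).trans ?_
    rw [habs, Function.comp, ← Real.mul_rpow hc.le (norm_nonneg _)]
    exact Real.rpow_le_rpow_of_nonpos (by positivity) h2 (by linarith)
  have h1 := hsum.hasSum
  let e : {i : Weight ε × Fin 2 // ¬(i.1.1 1 = 0 ∧ i.1.1 2 = 0)} ≃
      {i : Weight ε × Fin 2 // ¬(i.1.1 1 = 0 ∧ i.1.1 2 = 0)} :=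
    ((Equiv.refl (Weight ε)).prodCongr (Equiv.swap (0 : Fin 2) 1)).subtypeEquiv fun i => Iff.rfl
  have h2 := (e.hasSum_iff).2 h1
  have h3 := h2.congr_fun (g := fun i : {i : Weight ε × Fin 2 // ¬(i.1.1 1 = 0 ∧ i.1.1 2 = 0)} =>
      -etaTerm s (torusEigenvalue R τ i.1.1.1 i.1.2)) fun i => by
    change _ = etaTerm s (torusEigenvalue R τ i.1.1.1 (Equiv.swap (0 : Fin 2) 1 i.1.2))
    rw [← etaTerm_neg, torusEigenvalue_eq, torusEigenvalue_eq]
    congr 1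
    generalize i.1.2 = t
    fin_cases t <;> simp [sgn]
  have h4 := h3.unique h1.neg
  have h5 : (∑' i : {i : Weight ε × Fin 2 // ¬(i.1.1 1 = 0 ∧ i.1.1 2 = 0)},
      etaTerm s (torusEigenvalue R τ i.1.1.1 i.1.2)) = 0 := by
    linear_combination h4 / 2
  rwa [h5] at h1

theorem hasSum_etaTerm_axis {r : ℝ} (hr : 0 < r) (a : ℝ) {s : ℂ} (hs : 1 < s.re) :
    HasSum (fun k : ℤ => etaTerm s (r * (k + a)))
      (2 * (r : ℂ) ^ (-s) * HurwitzZeta.hurwitzZetaOdd a s) := by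
  refine ((HurwitzZeta.hasSum_int_hurwitzZetaOdd a hs).mul_left (2 * (r : ℂ) ^ (-s))).congr_fun
    fun k => ?_
  rw [etaTerm_mul s hr, etaTerm]
  simp only [cpow_neg _ s, div_eq_mul_inv]
  generalize SignType.sign ((k : ℝ) + a) = t
  cases t <;> simp <;> ring

theorem hasEtaInvariant_label {σ : ℤˣ} (hσ : b.Admissible σ τ) (hR : 0 < R) (hτ : τ.im ≠ 0)
    (l : b.Label) :
    HasEtaInvariant ((holonomy_label hσ l).triple θ R).dirac (l.eta σ) := by
  have hr : 0 < b.order * R := mul_pos (by exact_mod_cast b.order_pos) hR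
  have hr' : ((b.order * R : ℝ) : ℂ) ≠ 0 := by exact_mod_cast hr.ne'
  have hF : Differentiable ℂ fun s : ℂ => if l.spin 1 = false ∧ l.spin 2 = false then
      2 * (2 * ((b.order * R : ℝ) : ℂ) ^ (-s) * HurwitzZeta.hurwitzZetaOdd (l.offset σ : ℝ) s) else 0 := by
    split_ifs
    · exact (((differentiable_neg.const_cpow (Or.inl hr')).const_mul 2).mul
        (HurwitzZeta.differentiable_hurwitzZetaOdd _)).const_mul 2
    · exact differentiable_const 0
  refine ⟨_, fun s _ => (hF.analyticAt s).meromorphicAt, hF.analyticAt 0, ?_, 3, fun s hs => ?_⟩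
  · split_ifs with hl
    · rw [← l.four_mul_hurwitz σ hl, neg_zero, cpow_zero]; ring
    · rw [l.eta_eq_zero σ hl, ofReal_zero]
  set v : {i : Weight l.spin × Fin 2 // ¬(i.1.1 1 = 0 ∧ i.1.1 2 = 0)} → ℝ :=
    fun i => torusEigenvalue R τ i.1.1.1 i.1.2
  set w : ℤ → ℝ := fun k => b.order * R * (k + l.offset σ)
  have hv : ∀ x, Subtype.val '' (v ⁻¹' {x}) = {i : Weight l.spin × Fin 2 |
        ¬(i.1.1 1 = 0 ∧ i.1.1 2 = 0) ∧ torusEigenvalue R τ i.1.1 i.2 = x} := by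
    intro x
    ext i
    constructor
    · rintro ⟨i, hi, rfl⟩; exact ⟨i.2, hi⟩
    · rintro ⟨h1, h2⟩; exact ⟨⟨i, h1⟩, h2, rfl⟩
  have hvfin : ∀ x, (v ⁻¹' {x}).Finite := by
    intro x
    refine Set.Finite.of_finite_image (f := Subtype.val) ?_ Subtype.val_injective.injOn
    rw [hv]
    refine ((finite_energy_le hR hτ l.spin |x|).prod (Set.finite_univ (α := Fin 2))).subset ?_
    rintro ⟨μ, t⟩ ⟨-, h2⟩
    refine ⟨?_, trivial⟩
    rw [Set.mem_ofPred_eq, ← h2, torusEigenvalue_eq, abs_mul, abs_of_nonneg (Real.sqrt_nonneg _)]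
    fin_cases t <;> simp [sgn]
  have hwfin : ∀ x, (w ⁻¹' {x}).Finite := by
    intro x
    refine Set.Subsingleton.finite fun k hk k' hk' => ?_
    have h1 : b.order * R * (k + l.offset σ) = b.order * R * (k' + l.offset σ) := hk.trans hk'.symm
    exact_mod_cast add_right_cancel (mul_left_cancel₀ hr.ne' h1)
  have hcard : ∀ x, (b.order : ℂ) *
      (Module.finrank ℂ (diracEigenspace ((holonomy_label hσ l).triple θ R).dirac x) : ℂ) =
      ((v ⁻¹' {x}).ncard : ℂ) + if l.spin 1 = false ∧ l.spin 2 = false then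
        b.order * (2 * ((w ⁻¹' {x}).ncard : ℂ)) else 0 := by
    intro x
    have h1 := mul_finrank_eigenspace_label (θ := θ) hσ hR hτ l x
    rw [← hv, Subtype.val_injective.encard_image, ← (hvfin x).cast_ncard_eq,
      show {k : ℤ | b.order * R * (k + l.offset σ) = x} = w ⁻¹' {x} from rfl,
      ← (hwfin x).cast_ncard_eq] at h1
    split_ifs at h1 ⊢
    · have h2 : b.order * Module.finrank ℂ (diracEigenspace ((holonomy_label hσ l).triple θ R).dirac x) =
          (v ⁻¹' {x}).ncard + b.order * (2 * (w ⁻¹' {x}).ncard) := by exact_mod_cast h1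
      exact_mod_cast h2
    · have h2 : b.order * Module.finrank ℂ (diracEigenspace ((holonomy_label hσ l).triple θ R).dirac x) =
          (v ⁻¹' {x}).ncard := by rw [add_zero] at h1; exact_mod_cast h1
      rw [add_zero]
      exact_mod_cast h2
  have h1 := hasSum_fiber v hvfin (hasSum_etaTerm_slope hR hτ l.spin hs)
  have h2 := hasSum_fiber w hwfin (hasSum_etaTerm_axis hr (l.offset σ) (s := s) (by linarith))
  have h3 := (h1.mul_left (b.order : ℂ)⁻¹).add (h2.mul_left
    (if l.spin 1 = false ∧ l.spin 2 = false then (2 : ℂ) else 0))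
  have hN := b.order_cast_ne
  have hval : (if l.spin 1 = false ∧ l.spin 2 = false then
      2 * (2 * ((b.order * R : ℝ) : ℂ) ^ (-s) * HurwitzZeta.hurwitzZetaOdd (l.offset σ : ℝ) s) else 0) =
      (b.order : ℂ)⁻¹ * 0 + (if l.spin 1 = false ∧ l.spin 2 = false then (2 : ℂ) else 0) *
        (2 * ((b.order * R : ℝ) : ℂ) ^ (-s) * HurwitzZeta.hurwitzZetaOdd (l.offset σ : ℝ) s) := by
    split_ifs <;> ring
  rw [hval]
  refine h3.congr_fun fun x => ?_
  have h4 := hcard x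
  rw [mul_assoc]
  change _ * etaTerm s x = _
  have h5 : (Module.finrank ℂ (diracEigenspace ((holonomy_label hσ l).triple θ R).dirac x) : ℂ) =
      (b.order : ℂ)⁻¹ * ((v ⁻¹' {x}).ncard) +
        (if l.spin 1 = false ∧ l.spin 2 = false then (2 : ℂ) else 0) * (w ⁻¹' {x}).ncard := by
    rw [← mul_right_inj' hN, h4, mul_add, mul_inv_cancel_left₀ hN]
    split_ifs <;> ring
  rw [h5]; ring

end Eta

section Reversal
variable {θ R : ℝ} {b : Bieb} {τ : ℂ} {ε : Fin 3 → Bool} {c : ℂ}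

theorem Holonomy.conj (h : Holonomy b τ ε c) :
    Holonomy b (starRingEnd ℂ τ) ε (starRingEnd ℂ c) where
  norm_eq := by rw [RCLike.norm_conj, h.norm_eq]
  pow_eq := by
    rw [← map_pow, h.pow_eq]
    split_ifs <;> simp
  slope_eq x := by
    have hc : ∀ y : Fin 3 → ℝ, slope (starRingEnd ℂ τ) y = starRingEnd ℂ (slope τ y) :=
      fun y => by simp [slope]
    rw [hc, hc, h.slope_eq, map_mul, map_pow]
  maps := h.maps

/-- The unitary `(ψ₊, ψ₋) ↦ (ψ₋, -ψ₊)`. -/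
def flip (ε : Fin 3 → Bool) : Spinor ε ≃ₗᵢ[ℂ] Spinor ε :=
  weightedPerm ((Equiv.refl (Weight ε)).prodCongr (Equiv.swap (0 : Fin 2) 1))
    (fun i => (sgn i.2 : ℂ)) (fun i => by
      obtain ⟨μ, s⟩ := i
      fin_cases s <;> simp [sgn])

theorem flip_zero (ψ : Spinor ε) (μ : Weight ε) : flip ε ψ (μ, 0) = ψ (μ, 1) := by
  change (sgn 0 : ℂ) * ψ (μ, Equiv.swap (0 : Fin 2) 1 0) = _
  simp [sgn]

theorem flip_one (ψ : Spinor ε) (μ : Weight ε) : flip ε ψ (μ, 1) = -ψ (μ, 0) := by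
  change (sgn 1 : ℂ) * ψ (μ, Equiv.swap (0 : Fin 2) 1 1) = _
  simp [sgn]

theorem flip_shift (k : Fin 3 → ℤ) (ψ : Spinor ε) :
    flip ε (shift θ ε k ψ) = shift θ ε k (flip ε ψ) := by
  ext ⟨μ, s⟩
  fin_cases s
  · change flip ε _ (μ, 0) = shift θ ε k _ (μ, 0)
    rw [flip_zero, shift_apply, shift_apply, flip_zero]
  · change flip ε _ (μ, 1) = shift θ ε k _ (μ, 1)
    rw [flip_one, shift_apply, shift_apply, flip_one, mul_neg]

theorem flip_rep (a : SmoothTorus θ) (ψ : Spinor ε) :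
    flip ε (SmoothTorus.rep θ ε a ψ) = SmoothTorus.rep θ ε a (flip ε ψ) := by
  have h1 := (hasSum_rep a ψ).mapL (flip ε).toContinuousLinearEquiv.toContinuousLinearMap
  refine h1.unique ((hasSum_rep a (flip ε ψ)).congr_fun fun k => ?_)
  rw [map_smul]
  exact congrArg _ (flip_shift k ψ)

theorem flip_conj (ψ : Spinor ε) : flip ε (torusConj ε ψ) = torusConj ε (flip ε ψ) := by
  ext ⟨μ, s⟩
  fin_cases s
  · change flip ε _ (μ, 0) = torusConj ε _ (μ, 0)
    rw [flip_zero, torusConj_one, torusConj_zero, flip_one, map_neg, neg_neg]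
  · change flip ε _ (μ, 1) = torusConj ε _ (μ, 1)
    rw [flip_one, torusConj_zero, torusConj_one, flip_zero, neg_neg]

theorem flip_dirac (ψ φ : Spinor ε) :
    (ψ, φ) ∈ (torusDirac R τ ε).graph ↔
      (flip ε ψ, -flip ε φ) ∈ (torusDirac R (starRingEnd ℂ τ) ε).graph := by
  rw [mem_graph_torusDirac, mem_graph_torusDirac]
  have h0 : ∀ μ : Weight ε, (-flip ε φ : Spinor ε) (μ, 0) = -φ (μ, 1) := fun μ => by
    rw [lp.coeFn_neg, Pi.neg_apply, flip_zero]
  have h1 : ∀ μ : Weight ε, (-flip ε φ : Spinor ε) (μ, 1) = φ (μ, 0) := fun μ => by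
    rw [lp.coeFn_neg, Pi.neg_apply, flip_one, neg_neg]
  constructor
  · intro h
    rintro ⟨μ, s⟩
    have e0 := h (μ, 0)
    have e1 := h (μ, 1)
    fin_cases s
    · change (-flip ε φ : Spinor ε) (μ, 0) = diracFun R _ _ (μ, 0)
      rw [h0, e1]
      simp [diracFun, symbol, flip_zero, flip_one]
    · change (-flip ε φ : Spinor ε) (μ, 1) = diracFun R _ _ (μ, 1)
      rw [h1, e0]
      simp [diracFun, symbol, flip_zero, flip_one]
      ring
  · intro h
    rintro ⟨μ, s⟩
    have e0 := h (μ, 0)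
    have e1 := h (μ, 1)
    rw [h0] at e0
    rw [h1] at e1
    simp [diracFun, symbol, flip_zero, flip_one] at e0 e1
    fin_cases s
    · change φ (μ, 0) = diracFun R _ _ (μ, 0)
      rw [e1]
      simp [diracFun, symbol]
      ring
    · change φ (μ, 1) = diracFun R _ _ (μ, 1)
      simp [diracFun, symbol]
      linear_combination -e0

theorem holPhase_conj_swap (c : ℂ) (x : ℝ) (s : Fin 2) :
    holPhase b (starRingEnd ℂ c) x s = holPhase b c x (Equiv.swap (0 : Fin 2) 1 s) := by
  fin_cases s <;> simp [holPhase, conjIf]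

theorem flip_op (h : Holonomy b τ ε c) (ψ : Spinor ε) : flip ε (h.op ψ) = h.conj.op (flip ε ψ) := by
  ext ⟨μ, s⟩
  obtain ⟨μ, rfl⟩ := (Weight.lin b h.maps).surjective μ
  have h1 := h.conj.op_lin (flip ε ψ) μ s
  change h.conj.op (flip ε ψ) (Weight.lin b h.maps μ, s) = _ at h1
  rw [h1, holPhase_conj_swap]
  fin_cases s
  · change flip ε _ (_, 0) = _ * flip ε _ (_, 0)
    rw [flip_zero, flip_zero, h.op_lin]
    rfl
  · change flip ε _ (_, 1) = _ * flip ε _ (_, 1)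
    rw [flip_one, flip_one, h.op_lin, mul_neg]
    rfl

theorem map_flip_fixed (h : Holonomy b τ ε c) :
    h.fixed.map (flip ε).toLinearEquiv.toLinearMap = h.conj.fixed := by
  ext ψ
  rw [Submodule.mem_map]
  constructor
  · rintro ⟨φ, hφ, rfl⟩
    rw [h.mem_fixed] at hφ
    rw [h.conj.mem_fixed]
    exact (flip_op h φ).symm.trans (congrArg (flip ε) hφ)
  · intro hψ
    refine ⟨(flip ε).symm ψ, ?_, (flip ε).apply_symm_apply ψ⟩
    rw [h.mem_fixed]
    apply (flip ε).injective
    rw [flip_op, (flip ε).apply_symm_apply]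
    exact h.conj.mem_fixed.1 hψ

theorem mem_graph_neg {H : Type*} [NormedAddCommGroup H] [InnerProductSpace ℂ H]
    (D : H →ₗ.[ℂ] H) (ψ φ : H) : (ψ, φ) ∈ (-D).graph ↔ (ψ, -φ) ∈ D.graph := by
  rw [LinearPMap.mem_graph_iff, LinearPMap.mem_graph_iff]
  constructor
  · rintro ⟨y, h1, h2⟩
    refine ⟨y, h1, ?_⟩
    change -(D y) = φ at h2
    change D y = -φ
    rw [← h2, neg_neg]
  · rintro ⟨y, h1, h2⟩
    refine ⟨y, h1, ?_⟩
    change -(D y) = φ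
    rw [show D y = -φ from h2, neg_neg]

theorem Holonomy.neg_equivalent (h : Holonomy b τ ε c) :
    (h.triple θ R).neg.UnitarilyEquivalent (h.conj.triple θ R) := by
  refine ⟨⟨(flip ε).toLinearEquiv.ofSubmodules _ _ (map_flip_fixed h),
    fun ψ => (flip ε).norm_map ψ⟩, fun a ψ => ?_, fun ψ => ?_, fun ψ φ => ?_⟩
  · exact Subtype.ext (flip_rep _ _)
  · exact Subtype.ext (flip_conj _)
  · refine (mem_graph_neg _ ψ φ).trans ?_
    rw [mem_graph_restrict (h.reduces_fixed θ R), mem_graph_restrict (h.conj.reduces_fixed θ R)]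
    refine (flip_dirac _ _).trans ?_
    change (flip ε ψ, -flip ε ((-φ : h.fixed) : Spinor ε)) ∈ _ ↔ (flip ε ψ, flip ε φ) ∈ _
    rw [Submodule.coe_neg, map_neg, neg_neg]
    rfl

theorem exists_neg_equivalent (hR : 0 < R) (hτ : τ.im ≠ 0) (X : FlatRestriction θ b R τ) :
    ∃ Y : FlatRestriction θ b R (starRingEnd ℂ τ), X.triple.neg.UnitarilyEquivalent Y.triple := by
  obtain ⟨ε, c, h, rfl⟩ := X.eq_ofHolonomy hR hτ
  exact ⟨.ofHolonomy θ R h.conj, h.neg_equivalent⟩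

end Reversal

section SpinStructures
variable {R : ℝ} {b : Bieb} {τ : ℂ} {ε : Fin 3 → Bool} {c : ℂ}

/-- The screw motion as an element of the group. -/
def Bieb.screwElt (b : Bieb) : b.group :=
  ⟨b.screw, Subgroup.subset_closure (Or.inl rfl)⟩

/-- The unit translations as elements of the group. -/
def Bieb.transElt (b : Bieb) (i : Fin 3) : b.group :=
  ⟨Equiv.addRight (Pi.single i (1 : ℝ)), Subgroup.subset_closure (Or.inr ⟨i, rfl⟩)⟩

/-- The sign `e^{2 π i ε}`. -/
def spinSign (e : Bool) : ℂ := if e then -1 else 1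

theorem spinSign_mul_self (e : Bool) : spinSign e * spinSign e = 1 := by cases e <;> simp [spinSign]

theorem spinSign_ne_zero (e : Bool) : spinSign e ≠ 0 := by cases e <;> simp [spinSign]

theorem conj_spinSign (e : Bool) : starRingEnd ℂ (spinSign e) = spinSign e := by
  cases e <;> simp [spinSign]

theorem spinSign_zpow_neg (e : Bool) (m : ℤ) : spinSign e ^ (-m) = spinSign e ^ m := by
  rw [zpow_neg, ← inv_zpow]
  congr 1
  exact (eq_inv_of_mul_eq_one_left (spinSign_mul_self e)).symm

theorem Bieb.group_induction {p : ∀ g : Equiv.Perm (Fin 3 → ℝ), g ∈ b.group → Prop}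
    (hs : p b.screw b.screwElt.2) (ht : ∀ i, p (Equiv.addRight (Pi.single i 1)) (b.transElt i).2)
    (h1 : p 1 (one_mem _)) (hm : ∀ g g' hg hg', p g hg → p g' hg' → p (g * g') (mul_mem hg hg'))
    (hi : ∀ g hg, p g hg → p g⁻¹ (inv_mem hg)) (g : b.group) : p g g.2 := by
  refine Subgroup.closure_induction (p := p) ?_ h1 (fun g g' hg hg' => hm g g' hg hg') hi g.2
  rintro g (rfl | ⟨i, rfl⟩)
  · exact hs
  · exact ht i

/-- The values of the lift on the generators. -/
structure SpinStructure.Compatible (s : SpinStructure b R τ) (h : Holonomy b τ ε c) : Prop where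
  trans : ∀ i, (s.lift (b.transElt i) : Matrix (Fin 2) (Fin 2) ℂ) = spinSign (ε i) • 1
  screw : (s.lift b.screwElt : Matrix (Fin 2) (Fin 2) ℂ) = Matrix.diagonal ![starRingEnd ℂ c, c]

theorem SpinStructure.ext' {s s' : SpinStructure b R τ} (h : s.lift = s'.lift) : s = s' := by
  cases s; cases s'; simp only at h; subst h; rfl

theorem SpinStructure.Compatible.eq {s s' : SpinStructure b R τ} {h : Holonomy b τ ε c}
    (hs : s.Compatible h) (hs' : s'.Compatible h) : s = s' := by
  refine SpinStructure.ext' (MonoidHom.ext fun g => ?_)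
  refine Bieb.group_induction (p := fun g hg => s.lift ⟨g, hg⟩ = s'.lift ⟨g, hg⟩) ?_ (fun i => ?_) ?_ ?_ ?_ g
  · exact Subtype.ext (hs.screw.trans hs'.screw.symm)
  · exact Subtype.ext ((hs.trans i).trans (hs'.trans i).symm)
  · exact s.lift.map_one.trans s'.lift.map_one.symm
  · intro g g' hg hg' h1 h2
    have e1 := s.lift.map_mul ⟨g, hg⟩ ⟨g', hg'⟩
    have e2 := s'.lift.map_mul ⟨g, hg⟩ ⟨g', hg'⟩
    rw [h1, h2, ← e2] at e1
    exact e1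
  · intro g hg h1
    have e1 := s.lift.map_inv ⟨g, hg⟩
    have e2 := s'.lift.map_inv ⟨g, hg⟩
    rw [h1, ← e2] at e1
    exact e1

theorem perm_apply_inv_self {α : Type*} (g : Equiv.Perm α) (x : α) : g (g⁻¹ x) = x :=
  g.apply_symm_apply x

/-- The linear part of the screw motion. -/
def Bieb.screwLin (b : Bieb) : (Fin 3 → ℝ) ≃ₗ[ℝ] (Fin 3 → ℝ) where
  toFun x := ![x 0, b.matrix 0 0 * x 1 + b.matrix 1 0 * x 2, b.matrix 0 1 * x 1 + b.matrix 1 1 * x 2]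
  invFun x := ![x 0, b.matrix 1 1 * x 1 - b.matrix 1 0 * x 2, -b.matrix 0 1 * x 1 + b.matrix 0 0 * x 2]
  map_add' x y := by ext i; fin_cases i <;> simp <;> ring
  map_smul' r x := by ext i; fin_cases i <;> simp <;> ring
  left_inv x := by ext i; fin_cases i <;> cases b <;> simp [matrix]
  right_inv x := by ext i; fin_cases i <;> cases b <;> simp [matrix]

theorem Bieb.screw_eq (b : Bieb) (x : Fin 3 → ℝ) : b.screw x = b.screw 0 + b.screwLin x := by
  ext i
  fin_cases i <;> simp [screw, screwLin, add_comm]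

theorem dotProduct_screwLin (ξ x : Fin 3 → ℝ) : ξ ⬝ᵥ b.screwLin x = b.lin ξ ⬝ᵥ x := by
  simp [dotProduct, Fin.sum_univ_three, Bieb.screwLin, Bieb.lin]
  ring

theorem lin_eq_screwLin (ξ : Fin 3 → ℝ) :
    (fun j => ξ ⬝ᵥ b.screwLin (Pi.single j 1)) = b.lin ξ := by
  ext j
  rw [dotProduct_screwLin, dotProduct_single, mul_one]

theorem Bieb.screw_pow_order (b : Bieb) : b.screw ^ b.order = Equiv.addRight (Pi.single 0 1) := by
  ext x i
  cases b <;> fin_cases i <;> simp [order, pow_succ, screw, matrix] <;> ring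

theorem screw_mul_trans_b3 : Bieb.B3.transElt 2 * Bieb.B3.transElt 1 * Bieb.B3.screwElt *
    Bieb.B3.transElt 1 = Bieb.B3.screwElt ∧
    Bieb.B3.screwElt * Bieb.B3.transElt 2 = Bieb.B3.transElt 1 * Bieb.B3.screwElt := by
  constructor <;> ext x i <;> fin_cases i <;>
    simp [Bieb.transElt, Bieb.screwElt, Bieb.screw, Bieb.matrix] <;> ring

theorem screw_mul_trans_b4 :
    Bieb.B4.screwElt * Bieb.B4.transElt 2 = Bieb.B4.transElt 1 * Bieb.B4.screwElt := by
  ext x i; fin_cases i <;> simp [Bieb.transElt, Bieb.screwElt, Bieb.screw, Bieb.matrix]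

theorem screw_mul_trans_b6 : Bieb.B6.transElt 2 * Bieb.B6.screwElt * Bieb.B6.transElt 1 =
    Bieb.B6.screwElt ∧ Bieb.B6.screwElt * Bieb.B6.transElt 2 =
    Bieb.B6.transElt 2 * Bieb.B6.transElt 1 * Bieb.B6.screwElt := by
  constructor <;> ext x i <;> fin_cases i <;>
    simp [Bieb.transElt, Bieb.screwElt, Bieb.screw, Bieb.matrix] <;> ring

theorem special_diagonal {U : Matrix (Fin 2) (Fin 2) ℂ} (hU : U ∈ Matrix.specialUnitaryGroup (Fin 2) ℂ)
    (h01 : U 0 1 = 0) (h10 : U 1 0 = 0) :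
    ∃ z : ℂ, ‖z‖ = 1 ∧ U = Matrix.diagonal ![z, starRingEnd ℂ z] := by
  rw [Matrix.mem_specialUnitaryGroup_iff, Matrix.mem_unitaryGroup_iff] at hU
  have h1 := congrFun (congrFun hU.1 0) 0
  have h2 := hU.2
  simp [Matrix.mul_apply, h01, Matrix.star_apply] at h1
  rw [Matrix.det_fin_two, h01, zero_mul, sub_zero] at h2
  have hn : ‖U 0 0‖ = 1 := by
    rw [mul_conj, normSq_eq_norm_sq] at h1
    have h3 : ‖U 0 0‖ ^ 2 = 1 := by exact_mod_cast h1
    exact (pow_eq_one_iff_of_nonneg (norm_nonneg _) two_ne_zero).1 h3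
  refine ⟨U 0 0, hn, ?_⟩
  have h0 : U 0 0 ≠ 0 := by rw [← norm_pos_iff, hn]; exact one_pos
  have h3 : U 1 1 = starRingEnd ℂ (U 0 0) := mul_left_cancel₀ h0 (h2.trans h1.symm)
  ext i j
  fin_cases i <;> fin_cases j <;> simp [h01, h10, h3]

theorem diagonal_mem_special {z : ℂ} (hz : ‖z‖ = 1) :
    Matrix.diagonal ![z, starRingEnd ℂ z] ∈ Matrix.specialUnitaryGroup (Fin 2) ℂ := by
  have h : z * starRingEnd ℂ z = 1 := by rw [mul_conj, normSq_eq_norm_sq, hz]; simp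
  have h' : starRingEnd ℂ z * z = 1 := by rw [mul_comm]; exact h
  rw [Matrix.mem_specialUnitaryGroup_iff, Matrix.mem_unitaryGroup_iff]
  constructor
  · ext i j
    fin_cases i <;> fin_cases j <;> simp [Matrix.mul_apply, h, h']
  · simp [h]

/-- A spin structure determines a holonomy. -/
theorem SpinStructure.exists_compatible (hR : 0 < R) (s : SpinStructure b R τ) :
    ∃ (ε : Fin 3 → Bool) (c : ℂ) (h : Holonomy b τ ε c), s.Compatible h := by
  classical
  have hR' : (R : ℂ) ≠ 0 := by exact_mod_cast hR.ne'
  have htrans : ∀ i, ∃ e : Bool,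
      (s.lift (b.transElt i) : Matrix (Fin 2) (Fin 2) ℂ) = spinSign e • 1 := by
    intro i
    set U : Matrix (Fin 2) (Fin 2) ℂ := (s.lift (b.transElt i)).1 with hU
    have h1 : ∀ ξ, U * symbol R τ ξ = symbol R τ ξ * U := by
      intro ξ
      have := s.covers (b.transElt i) ξ
      convert this using 3
      ext j
      simp [Bieb.transElt, dotProduct_single]
    have h2 := scalar_of_commute_symbol hR h1
    have h3 := (Matrix.mem_specialUnitaryGroup_iff.1 (s.lift (b.transElt i)).2).2
    change U.det = 1 at h3
    rw [h2, Matrix.det_smul, Matrix.det_one, mul_one, Fintype.card_fin, sq_eq_one_iff] at h3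
    rcases h3 with h3 | h3
    · exact ⟨false, by rw [h2, h3]; simp [spinSign]⟩
    · exact ⟨true, by rw [h2, h3]; simp [spinSign]⟩
  choose ε hε using htrans
  set M : Matrix (Fin 2) (Fin 2) ℂ := (s.lift b.screwElt).1 with hM
  have hcov : ∀ ξ, M * symbol R τ (b.lin ξ) = symbol R τ ξ * M := by
    intro ξ
    have := s.covers b.screwElt ξ
    rw [← lin_eq_screwLin]
    have hj : ∀ j, b.screwLin (Pi.single j 1) = b.screw (Pi.single j 1) - b.screw 0 := fun j => by
      rw [b.screw_eq (Pi.single j 1), add_sub_cancel_left]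
    simp only [hj]
    exact this
  have h0 := hcov ![1, 0, 0]
  have h01 : M 0 1 = 0 := by
    have := congrFun (congrFun h0 0) 1
    simp [Matrix.mul_apply, symbol, Bieb.lin] at this
    have h2 : (R : ℂ) * M 0 1 = 0 := by linear_combination -this / 2
    exact (mul_eq_zero.1 h2).resolve_left hR'
  have h10 : M 1 0 = 0 := by
    have := congrFun (congrFun h0 1) 0
    simp [Matrix.mul_apply, symbol, Bieb.lin] at this
    have h2 : (R : ℂ) * M 1 0 = 0 := by linear_combination this / 2
    exact (mul_eq_zero.1 h2).resolve_left hR'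
  obtain ⟨z, hz, hMz⟩ := special_diagonal (s.lift b.screwElt).2 h01 h10
  change M = _ at hMz
  have hzz : z * starRingEnd ℂ z = 1 := by rw [mul_conj, normSq_eq_norm_sq, hz]; simp
  have hz0 : z ≠ 0 := left_ne_zero_of_mul_eq_one hzz
  have hcoe : ∀ g g' : b.group, (s.lift (g * g') : Matrix (Fin 2) (Fin 2) ℂ) =
      (s.lift g : Matrix (Fin 2) (Fin 2) ℂ) * (s.lift g' : Matrix (Fin 2) (Fin 2) ℂ) := by
    intro g g'; rw [map_mul]; rfl
  have hM00 : M 0 0 = z := by rw [hMz]; rfl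
  refine ⟨ε, starRingEnd ℂ z, ⟨?_, ?_, ?_, ?_⟩, hε, ?_⟩
  · rw [RCLike.norm_conj, hz]
  · have h1 : b.screwElt ^ b.order = b.transElt 0 := Subtype.ext b.screw_pow_order
    have h2 : (s.lift (b.screwElt ^ b.order) : Matrix (Fin 2) (Fin 2) ℂ) = M ^ b.order := by
      rw [map_pow]; rfl
    rw [h1, hε, hMz, Matrix.diagonal_pow] at h2
    have h3 := congrFun (congrFun h2 0) 0
    simp at h3
    rw [← map_pow, ← h3, conj_spinSign]
    rfl
  · intro ξ
    have h2 := congrFun (congrFun (hcov ξ) 0) 1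
    rw [hMz] at h2
    simp only [symbol, Matrix.mul_apply, Fin.sum_univ_two, Matrix.diagonal_apply_eq,
      Matrix.diagonal_apply_ne _ zero_ne_one] at h2
    simp at h2
    have h3 : z * slope τ (b.lin ξ) = slope τ ξ * starRingEnd ℂ z := h2
    refine mul_left_cancel₀ hz0 ?_
    rw [h3]
    linear_combination (-(slope τ ξ) * starRingEnd ℂ z) * hzz
  · rw [maps_iff]
    have hz1 : ∀ e : Bool, spinSign e = 1 → e = false := by
      intro e; cases e <;> simp [spinSign]; norm_num
    have hinj : ∀ e e' : Bool, spinSign e = spinSign e' → e = e' := by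
      intro e e'; cases e <;> cases e' <;> simp [spinSign] <;> norm_num
    cases b with
    | B2 => exact ⟨-halfInt (ε 1), -halfInt (ε 2), by simp [Bieb.matrix]; ring, by simp [Bieb.matrix]; ring⟩
    | B3 =>
      have e1 := congrArg (fun g => (s.lift g : Matrix (Fin 2) (Fin 2) ℂ) 0 0) screw_mul_trans_b3.1
      have e2 := congrArg (fun g => (s.lift g : Matrix (Fin 2) (Fin 2) ℂ) 0 0) screw_mul_trans_b3.2
      simp only [hcoe, hε] at e1 e2
      simp [← hM, hM00] at e1 e2
      have e3 : spinSign (ε 2) = spinSign (ε 1) := e2.resolve_right hz0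
      have e4 : spinSign (ε 2) = 1 := mul_left_cancel₀ hz0 (by
        linear_combination e1 - spinSign (ε 2) * z * spinSign_mul_self (ε 1))
      have e5 := hz1 _ e4
      have e6 := hz1 _ (e3.symm.trans e4)
      exact ⟨0, 0, by simp [Bieb.matrix, halfInt, e5, e6], by simp [Bieb.matrix, halfInt, e5, e6]⟩
    | B4 =>
      have e2 := congrArg (fun g => (s.lift g : Matrix (Fin 2) (Fin 2) ℂ) 0 0) screw_mul_trans_b4
      simp only [hcoe, hε] at e2
      simp [← hM, hM00] at e2
      have e3 : spinSign (ε 2) = spinSign (ε 1) := e2.resolve_right hz0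
      have e4 := hinj _ _ e3
      exact ⟨-halfInt (ε 1), 0, by simp [Bieb.matrix, e4]; ring, by simp [Bieb.matrix, e4]⟩
    | B6 =>
      have e1 := congrArg (fun g => (s.lift g : Matrix (Fin 2) (Fin 2) ℂ) 0 0) screw_mul_trans_b6.1
      have e2 := congrArg (fun g => (s.lift g : Matrix (Fin 2) (Fin 2) ℂ) 0 0) screw_mul_trans_b6.2
      simp only [hcoe, hε] at e1 e2
      simp [← hM, hM00] at e1 e2
      have e4 : spinSign (ε 1) = 1 := by
        refine mul_left_cancel₀ (mul_ne_zero hz0 (spinSign_ne_zero (ε 2))) ?_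
        linear_combination -e2
      have e3 : spinSign (ε 2) = 1 := by
        rw [e4] at e1
        exact mul_left_cancel₀ hz0 (by linear_combination e1)
      have e5 := hz1 _ e3
      have e6 := hz1 _ e4
      exact ⟨0, 0, by simp [Bieb.matrix, halfInt, e5, e6], by simp [Bieb.matrix, halfInt, e5, e6]⟩
  · rw [← hM, hMz, conj_conj]

/-- The orbit of the origin is contained in this lattice. -/
def Bieb.latticePt (b : Bieb) (n m₁ m₂ : ℤ) : Fin 3 → ℝ := ![n / b.order, m₁, m₂]

theorem Bieb.exists_latticePt_screw (b : Bieb) (x : Fin 3 → ℝ) :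
    (∃ n m₁ m₂, b.screw x = b.latticePt n m₁ m₂) ↔ ∃ n m₁ m₂, x = b.latticePt n m₁ m₂ := by
  constructor
  · rintro ⟨n, m₁, m₂, h⟩
    refine ⟨n - 1, b.matrix 1 1 * m₁ - b.matrix 1 0 * m₂, -b.matrix 0 1 * m₁ + b.matrix 0 0 * m₂, ?_⟩
    rw [← b.screw.symm_apply_apply x, h]
    ext i
    fin_cases i
    · simp [screw, latticePt]; ring
    · simp [screw, latticePt]
    · simp [screw, latticePt]
  · rintro ⟨n, m₁, m₂, rfl⟩
    refine ⟨n + 1, b.matrix 0 0 * m₁ + b.matrix 1 0 * m₂, b.matrix 0 1 * m₁ + b.matrix 1 1 * m₂, ?_⟩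
    ext i
    fin_cases i
    · simp [screw, latticePt]; ring
    · simp [screw, latticePt]
    · simp [screw, latticePt]

theorem Holonomy.spinSign_screw (h : Holonomy b τ ε c) (m₁ m₂ : ℤ) :
    spinSign (ε 1) ^ (b.matrix 0 0 * m₁ + b.matrix 1 0 * m₂) *
      spinSign (ε 2) ^ (b.matrix 0 1 * m₁ + b.matrix 1 1 * m₂) =
    spinSign (ε 1) ^ m₁ * spinSign (ε 2) ^ m₂ := by
  obtain ⟨m, n, h1, h2⟩ := maps_iff.1 h.maps
  cases b with
  | B2 =>
    have e : ∀ e (m : ℤ), (spinSign e ^ m)⁻¹ = spinSign e ^ m := fun e m => by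
      rw [← zpow_neg, spinSign_zpow_neg]
    simp [Bieb.matrix, e]
  | B3 =>
    have h3 : ε 1 = false ∧ ε 2 = false := by
      cases e1 : ε 1 <;> cases e2 : ε 2 <;> simp [Bieb.matrix, halfInt, e1, e2] at h1 h2 ⊢ <;> omega
    simp [h3.1, h3.2, spinSign]
  | B4 =>
    have h3 : ε 1 = ε 2 := by
      cases e1 : ε 1 <;> cases e2 : ε 2 <;> simp [Bieb.matrix, halfInt, e1, e2] at h1 h2 ⊢ <;> omega
    have e : ∀ e (m : ℤ), (spinSign e ^ m)⁻¹ = spinSign e ^ m := fun e m => by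
      rw [← zpow_neg, spinSign_zpow_neg]
    simp [Bieb.matrix, e, h3, mul_comm]
  | B6 =>
    have h3 : ε 1 = false ∧ ε 2 = false := by
      cases e1 : ε 1 <;> cases e2 : ε 2 <;> simp [Bieb.matrix, halfInt, e1, e2] at h1 h2 ⊢ <;> omega
    simp [h3.1, h3.2, spinSign]

/-- A character of the group, evaluated along the orbit of the origin. -/
def Bieb.latticeChar (b : Bieb) (ε : Fin 3 → Bool) (c : ℂ) (y : Fin 3 → ℝ) : ℂ :=
  starRingEnd ℂ c ^ ⌊b.order * y 0⌋ * (spinSign (ε 1) ^ ⌊y 1⌋ * spinSign (ε 2) ^ ⌊y 2⌋)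

theorem Bieb.latticeChar_latticePt (b : Bieb) (ε : Fin 3 → Bool) (c : ℂ) (n m₁ m₂ : ℤ) :
    b.latticeChar ε c (b.latticePt n m₁ m₂) =
      starRingEnd ℂ c ^ n * (spinSign (ε 1) ^ m₁ * spinSign (ε 2) ^ m₂) := by
  have hN : (b.order : ℝ) ≠ 0 := by exact_mod_cast b.order_pos.ne'
  simp [latticeChar, latticePt, mul_div_cancel₀, hN]

/-- `u` is the value of the lift at `g`. -/
structure IsLiftValue (b : Bieb) (τ : ℂ) (ε : Fin 3 → Bool) (c : ℂ) (g : Equiv.Perm (Fin 3 → ℝ)) (u : ℂ) :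
    Prop where
  norm_eq : ‖u‖ = 1
  exists_lin : ∃ L : (Fin 3 → ℝ) ≃ₗ[ℝ] (Fin 3 → ℝ), (∀ x, g x = g 0 + L x) ∧
    ∀ ξ : Fin 3 → ℝ, ξ ⬝ᵥ L (Pi.single 0 1) = ξ 0 ∧
      slope τ ξ = u ^ 2 * slope τ fun j => ξ ⬝ᵥ L (Pi.single j 1)
  mem_iff : ∀ x, (∃ n m₁ m₂, g x = b.latticePt n m₁ m₂) ↔ ∃ n m₁ m₂, x = b.latticePt n m₁ m₂
  char_eq : ∀ n m₁ m₂, b.latticeChar ε c (g (b.latticePt n m₁ m₂)) =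
    u * b.latticeChar ε c (b.latticePt n m₁ m₂)

theorem dotProduct_lin (L : (Fin 3 → ℝ) ≃ₗ[ℝ] (Fin 3 → ℝ)) (ξ x : Fin 3 → ℝ) :
    (fun j => ξ ⬝ᵥ L (Pi.single j 1)) ⬝ᵥ x = ξ ⬝ᵥ L x := by
  conv_rhs => rw [← Finset.univ_sum_single x, map_sum, dotProduct_sum]
  rw [dotProduct]
  refine Finset.sum_congr rfl fun j _ => ?_
  have : (Pi.single j (x j) : Fin 3 → ℝ) = x j • Pi.single j 1 := by
    rw [← Pi.single_smul, smul_eq_mul, mul_one]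
  rw [this, map_smul, dotProduct_smul, smul_eq_mul, mul_comm]

theorem IsLiftValue.screw (h : Holonomy b τ ε c) : IsLiftValue b τ ε c b.screw (starRingEnd ℂ c) where
  norm_eq := by rw [RCLike.norm_conj, h.norm_eq]
  exists_lin := by
    refine ⟨b.screwLin, b.screw_eq, fun ξ => ⟨?_, ?_⟩⟩
    · exact congrFun (lin_eq_screwLin ξ) 0
    · rw [lin_eq_screwLin, h.slope_eq]
      linear_combination (-(1 + c * starRingEnd ℂ c) * slope τ ξ) * h.mul_conj
  mem_iff := b.exists_latticePt_screw
  char_eq n m₁ m₂ := by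
    have h1 : b.screw (b.latticePt n m₁ m₂) = b.latticePt (n + 1)
        (b.matrix 0 0 * m₁ + b.matrix 1 0 * m₂) (b.matrix 0 1 * m₁ + b.matrix 1 1 * m₂) := by
      ext i
      fin_cases i
      · simp [Bieb.screw, Bieb.latticePt]; ring
      · simp [Bieb.screw, Bieb.latticePt]
      · simp [Bieb.screw, Bieb.latticePt]
    have hc : starRingEnd ℂ c ≠ 0 := (map_ne_zero _).2 h.ne_zero
    rw [h1, b.latticeChar_latticePt, b.latticeChar_latticePt, h.spinSign_screw, zpow_add_one₀ hc]
    ring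

theorem IsLiftValue.trans (h : Holonomy b τ ε c) (i : Fin 3) :
    IsLiftValue b τ ε c (Equiv.addRight (Pi.single i 1)) (spinSign (ε i)) where
  norm_eq := by cases ε i <;> simp [spinSign]
  exists_lin := by
    refine ⟨LinearEquiv.refl ℝ _, fun x => by simp [add_comm], fun ξ => ⟨by simp, ?_⟩⟩
    rw [sq, spinSign_mul_self, one_mul]
    simp
  mem_iff x := by
    have hN : (b.order : ℝ) ≠ 0 := by exact_mod_cast b.order_pos.ne'
    constructor
    · rintro ⟨n, m₁, m₂, hx⟩
      rw [Equiv.coe_addRight, ← eq_sub_iff_add_eq] at hx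
      rw [hx]
      fin_cases i
      · refine ⟨n - b.order, m₁, m₂, ?_⟩
        ext j; fin_cases j <;> simp [Bieb.latticePt]; field_simp
      · refine ⟨n, m₁ - 1, m₂, ?_⟩
        ext j; fin_cases j <;> simp [Bieb.latticePt]
      · refine ⟨n, m₁, m₂ - 1, ?_⟩
        ext j; fin_cases j <;> simp [Bieb.latticePt]
    · rintro ⟨n, m₁, m₂, rfl⟩
      fin_cases i
      · refine ⟨n + b.order, m₁, m₂, ?_⟩
        ext j; fin_cases j <;> simp [Bieb.latticePt]; field_simp
      · refine ⟨n, m₁ + 1, m₂, ?_⟩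
        ext j; fin_cases j <;> simp [Bieb.latticePt]
      · refine ⟨n, m₁, m₂ + 1, ?_⟩
        ext j; fin_cases j <;> simp [Bieb.latticePt]
  char_eq n m₁ m₂ := by
    have hN : (b.order : ℝ) ≠ 0 := by exact_mod_cast b.order_pos.ne'
    have hc : starRingEnd ℂ c ≠ 0 := (map_ne_zero _).2 h.ne_zero
    fin_cases i
    · have h1 : Equiv.addRight (Pi.single 0 1) (b.latticePt n m₁ m₂) =
          b.latticePt (n + b.order) m₁ m₂ := by
        ext j; fin_cases j <;> simp [Bieb.latticePt]; field_simp
      have h2 : starRingEnd ℂ c ^ b.order = spinSign (ε 0) := by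
        rw [← map_pow, h.pow_eq]; exact conj_spinSign (ε 0)
      change b.latticeChar ε c (Equiv.addRight (Pi.single 0 1) (b.latticePt n m₁ m₂)) = spinSign (ε 0) * _
      rw [h1, b.latticeChar_latticePt, b.latticeChar_latticePt, zpow_add₀ hc, zpow_natCast, h2]
      ring
    · have h1 : Equiv.addRight (Pi.single 1 1) (b.latticePt n m₁ m₂) =
          b.latticePt n (m₁ + 1) m₂ := by
        ext j; fin_cases j <;> simp [Bieb.latticePt]
      change b.latticeChar ε c (Equiv.addRight (Pi.single 1 1) (b.latticePt n m₁ m₂)) = spinSign (ε 1) * _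
      rw [h1, b.latticeChar_latticePt, b.latticeChar_latticePt, zpow_add_one₀ (spinSign_ne_zero _)]
      ring
    · have h1 : Equiv.addRight (Pi.single 2 1) (b.latticePt n m₁ m₂) =
          b.latticePt n m₁ (m₂ + 1) := by
        ext j; fin_cases j <;> simp [Bieb.latticePt]
      change b.latticeChar ε c (Equiv.addRight (Pi.single 2 1) (b.latticePt n m₁ m₂)) = spinSign (ε 2) * _
      rw [h1, b.latticeChar_latticePt, b.latticeChar_latticePt, zpow_add_one₀ (spinSign_ne_zero _)]
      ring

theorem IsLiftValue.one : IsLiftValue b τ ε c 1 1 where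
  norm_eq := norm_one
  exists_lin := ⟨LinearEquiv.refl ℝ _, fun x => by simp, fun ξ => ⟨by simp, by simp⟩⟩
  mem_iff _ := Iff.rfl
  char_eq _ _ _ := by simp

theorem IsLiftValue.mul {g g' : Equiv.Perm (Fin 3 → ℝ)} {u u' : ℂ} (hg : IsLiftValue b τ ε c g u)
    (hg' : IsLiftValue b τ ε c g' u') : IsLiftValue b τ ε c (g * g') (u * u') where
  norm_eq := by rw [norm_mul, hg.norm_eq, hg'.norm_eq, one_mul]
  exists_lin := by
    obtain ⟨L, h1, h2⟩ := hg.exists_lin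
    obtain ⟨L', h1', h2'⟩ := hg'.exists_lin
    have h3 : ∀ ξ : Fin 3 → ℝ, (fun j => (fun k => ξ ⬝ᵥ L (Pi.single k 1)) ⬝ᵥ L' (Pi.single j 1)) =
        fun j => ξ ⬝ᵥ (L'.trans L) (Pi.single j 1) := fun ξ => funext fun j => dotProduct_lin L ξ _
    refine ⟨L'.trans L, fun x => ?_, fun ξ => ⟨?_, ?_⟩⟩
    · rw [Equiv.Perm.mul_apply, Equiv.Perm.mul_apply, h1 (g' x), h1' x, map_add, ← add_assoc,
        ← h1 (g' 0)]
      rfl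
    · have := (h2' fun k => ξ ⬝ᵥ L (Pi.single k 1)).1
      rw [(h2 ξ).1] at this
      rw [← this]
      exact (congrFun (h3 ξ) 0).symm
    · rw [(h2 ξ).2, (h2' fun k => ξ ⬝ᵥ L (Pi.single k 1)).2, h3]
      ring
  mem_iff x := (hg.mem_iff _).trans (hg'.mem_iff x)
  char_eq n m₁ m₂ := by
    obtain ⟨n', m₁', m₂', h1⟩ := (hg'.mem_iff _).2 ⟨n, m₁, m₂, rfl⟩
    rw [Equiv.Perm.mul_apply, h1, hg.char_eq, ← h1, hg'.char_eq, mul_assoc]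

theorem IsLiftValue.inv {g : Equiv.Perm (Fin 3 → ℝ)} {u : ℂ} (hg : IsLiftValue b τ ε c g u) :
    IsLiftValue b τ ε c g⁻¹ u⁻¹ where
  norm_eq := by rw [norm_inv, hg.norm_eq, inv_one]
  exists_lin := by
    have hu : u ≠ 0 := by rw [← norm_pos_iff, hg.norm_eq]; exact one_pos
    obtain ⟨L, h1, h2⟩ := hg.exists_lin
    have h3 : ∀ ξ : Fin 3 → ℝ, (fun j => (fun k => ξ ⬝ᵥ L.symm (Pi.single k 1)) ⬝ᵥ L (Pi.single j 1)) =
        ξ := fun ξ => funext fun j => by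
      rw [dotProduct_lin L.symm, L.symm_apply_apply, dotProduct_single, mul_one]
    refine ⟨L.symm, fun x => ?_, fun ξ => ⟨?_, ?_⟩⟩
    · apply g.injective
      rw [perm_apply_inv_self, h1, map_add, L.apply_symm_apply, ← add_assoc, ← h1,
        perm_apply_inv_self, zero_add]
    · have := (h2 fun k => ξ ⬝ᵥ L.symm (Pi.single k 1)).1
      rw [← this]
      exact congrFun (h3 ξ) 0
    · rw [(h2 fun k => ξ ⬝ᵥ L.symm (Pi.single k 1)).2, h3, ← mul_assoc, ← mul_pow,
        inv_mul_cancel₀ hu, one_pow, one_mul]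
  mem_iff x := by rw [← hg.mem_iff, perm_apply_inv_self]
  char_eq n m₁ m₂ := by
    have hu : u ≠ 0 := by rw [← norm_pos_iff, hg.norm_eq]; exact one_pos
    obtain ⟨n', m₁', m₂', h1⟩ := (hg.mem_iff (g⁻¹ (b.latticePt n m₁ m₂))).1
      ⟨n, m₁, m₂, perm_apply_inv_self _ _⟩
    have h2 := hg.char_eq n' m₁' m₂'
    rw [← h1, perm_apply_inv_self] at h2
    rw [h2, inv_mul_cancel_left₀ hu]

theorem latticeChar_zero : b.latticeChar ε c 0 = 1 := by simp [Bieb.latticeChar]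

theorem latticePt_zero : b.latticePt 0 0 0 = 0 := by
  ext i; fin_cases i <;> simp [Bieb.latticePt]

theorem IsLiftValue.eq_char {g : Equiv.Perm (Fin 3 → ℝ)} {u : ℂ} (hg : IsLiftValue b τ ε c g u) :
    u = b.latticeChar ε c (g 0) := by
  have := hg.char_eq 0 0 0
  rw [latticePt_zero, latticeChar_zero, mul_one] at this
  exact this.symm

theorem IsLiftValue.exists (h : Holonomy b τ ε c) (g : b.group) : ∃ u, IsLiftValue b τ ε c g u :=
  Bieb.group_induction (p := fun g _ => ∃ u, IsLiftValue b τ ε c g u) ⟨_, .screw h⟩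
    (fun i => ⟨_, .trans h i⟩) ⟨_, .one⟩ (fun _ _ _ _ ⟨_, h1⟩ ⟨_, h2⟩ => ⟨_, h1.mul h2⟩)
    (fun _ _ ⟨_, h1⟩ => ⟨_, h1.inv⟩) g

/-- A holonomy determines a spin structure. -/
theorem Holonomy.exists_spinStructure (h : Holonomy b τ ε c) (R : ℝ) :
    ∃ s : SpinStructure b R τ, s.Compatible h := by
  choose u hu using IsLiftValue.exists h
  have hmul : ∀ g g', u (g * g') = u g * u g' := fun g g' => by
    rw [(hu (g * g')).eq_char]
    exact ((hu g).mul (hu g')).eq_char.symm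
  refine ⟨⟨MonoidHom.mk' (fun g => ⟨_, diagonal_mem_special (hu g).norm_eq⟩) fun g g' => ?_, ?_⟩, ?_, ?_⟩
  · refine Subtype.ext ?_
    change Matrix.diagonal _ = Matrix.diagonal _ * Matrix.diagonal _
    rw [Matrix.diagonal_mul_diagonal]
    congr 1
    ext i
    fin_cases i <;> simp [hmul]
  · intro g ξ
    obtain ⟨L, h1, h2⟩ := (hu g).exists_lin
    have huu : u g * starRingEnd ℂ (u g) = 1 := by
      rw [Complex.mul_conj, normSq_eq_norm_sq, (hu g).norm_eq]; simp
    have h3 : (fun j => ξ ⬝ᵥ ((g : Equiv.Perm (Fin 3 → ℝ)) (Pi.single j 1) -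
        (g : Equiv.Perm (Fin 3 → ℝ)) 0)) = fun j => ξ ⬝ᵥ L (Pi.single j 1) :=
      funext fun j => by rw [h1 (Pi.single j 1), add_sub_cancel_left]
    rw [h3]
    obtain ⟨h4, h5⟩ := h2 ξ
    set η : Fin 3 → ℝ := fun j => ξ ⬝ᵥ L (Pi.single j 1)
    have h6 : η 0 = ξ 0 := h4
    have h7 : u g * slope τ η = slope τ ξ * starRingEnd ℂ (u g) := by
      rw [h5]; linear_combination (-(u g) * slope τ η) * huu
    have h8 := congrArg (starRingEnd ℂ) h7
    rw [map_mul, map_mul, conj_conj, conj_slope, conj_slope] at h8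
    change Matrix.diagonal _ * _ = _ * Matrix.diagonal _
    ext i j
    rw [Matrix.diagonal_mul, Matrix.mul_diagonal]
    fin_cases i <;> fin_cases j
    · simp [symbol, h6, mul_comm]
    · exact h7
    · exact h8
    · simp [symbol, h6, mul_comm]
  · intro i
    change Matrix.diagonal ![u (b.transElt i), starRingEnd ℂ (u (b.transElt i))] = _
    have : u (b.transElt i) = spinSign (ε i) := by
      rw [(hu _).eq_char]; exact (IsLiftValue.trans h i).eq_char.symm
    rw [this, conj_spinSign]
    ext j k
    fin_cases j <;> fin_cases k <;> simp
  · change Matrix.diagonal ![u b.screwElt, starRingEnd ℂ (u b.screwElt)] = _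
    have : u b.screwElt = starRingEnd ℂ c := by
      rw [(hu _).eq_char]; exact (IsLiftValue.screw h).eq_char.symm
    rw [this, conj_conj]

end SpinStructures

section Waves
variable {R : ℝ} {b : Bieb} {τ : ℂ} {ε : Fin 3 → Bool} {c : ℂ}

/-- The plane wave `e^{2 π i μ·x}`. -/
def wave (μ x : Fin 3 → ℝ) : ℂ := exp (((2 * Real.pi * ∑ i, μ i * x i : ℝ) : ℂ) * I)

theorem norm_wave (μ x : Fin 3 → ℝ) : ‖wave μ x‖ = 1 := norm_exp_ofReal_mul_I _

theorem wave_add (μ ν x : Fin 3 → ℝ) : wave (μ + ν) x = wave μ x * wave ν x := by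
  rw [wave, wave, wave, ← Complex.exp_add]
  congr 1
  simp only [Fin.sum_univ_three, Pi.add_apply]
  push_cast
  ring

theorem conj_wave (μ x : Fin 3 → ℝ) : starRingEnd ℂ (wave μ x) = wave (-μ) x := by
  rw [wave, wave, ← Complex.exp_conj]
  congr 1
  simp only [Fin.sum_univ_three, Pi.neg_apply, map_mul, conj_ofReal, conj_I]
  push_cast
  ring

theorem wave_add_right (μ x y : Fin 3 → ℝ) : wave μ (x + y) = wave μ x * wave μ y := by
  rw [wave, wave, wave, ← Complex.exp_add]
  congr 1
  simp only [Fin.sum_univ_three, Pi.add_apply]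
  push_cast
  ring

theorem wave_add_single (μ : Weight ε) (x : Fin 3 → ℝ) (i : Fin 3) :
    wave μ.1 (x + Pi.single i 1) = spinSign (ε i) * wave μ.1 x := by
  rw [wave_add_right, mul_comm]
  congr 1
  refine Eq.trans ?_ (exp_weight μ i)
  rw [wave]
  congr 1
  fin_cases i <;> simp [Fin.sum_univ_three] <;> ring

theorem wave_screw (μ x : Fin 3 → ℝ) : wave μ (b.screw x) = charN b (μ 0) * wave (b.lin μ) x := by
  rw [wave, wave, charN, ← Complex.exp_add]
  congr 1
  simp only [Fin.sum_univ_three, Bieb.screw, Bieb.lin, Equiv.coe_fn_mk, Matrix.cons_val_zero,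
    Matrix.cons_val_one, Matrix.cons_val]
  push_cast
  ring

theorem contDiff_wave (μ : Fin 3 → ℝ) : ContDiff ℝ (⊤ : ℕ∞) (wave μ) := by
  unfold wave
  refine ContDiff.cexp (ContDiff.mul (ofRealCLM.contDiff.comp (contDiff_const.mul ?_)) contDiff_const)
  exact ContDiff.sum fun i _ => contDiff_const.mul (contDiff_apply ℝ ℝ i)

theorem continuous_wave (μ : Fin 3 → ℝ) : Continuous (wave μ) := (contDiff_wave μ).continuous

theorem differentiable_wave (μ : Fin 3 → ℝ) : Differentiable ℝ (wave μ) :=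
  (contDiff_wave μ).differentiable (by simp)

theorem fderiv_wave (μ x : Fin 3 → ℝ) (j : Fin 3) :
    fderiv ℝ (wave μ) x (Pi.single j 1) = 2 * Real.pi * I * μ j * wave μ x := by
  have h1 : HasDerivAt (fun t : ℝ => wave μ (x + t • Pi.single j 1))
      (2 * Real.pi * I * μ j * wave μ x) 0 := by
    have h2 : ∀ t : ℝ, wave μ (x + t • Pi.single j 1) =
        wave μ x * exp ((t : ℂ) * (2 * Real.pi * I * μ j)) := by
      intro t
      rw [wave_add_right]
      congr 1
      rw [wave]
      congr 1
      fin_cases j <;> simp [Fin.sum_univ_three] <;> ring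
    rw [funext h2]
    have h3 := (((hasDerivAt_id (0 : ℝ)).ofReal_comp.mul_const (2 * Real.pi * I * μ j)).cexp).const_mul
      (wave μ x)
    simp only [id, ofReal_zero, ofReal_one, zero_mul, exp_zero, one_mul] at h3
    rwa [mul_comm (wave μ x)] at h3
  have h4 : HasDerivAt (fun t : ℝ => x + t • (Pi.single j 1 : Fin 3 → ℝ)) (Pi.single j 1) 0 := by
    simpa using ((hasDerivAt_id (0 : ℝ)).smul_const (Pi.single j 1 : Fin 3 → ℝ)).const_add x
  have h5 : HasFDerivAt (wave μ) (fderiv ℝ (wave μ) x) (x + (0 : ℝ) • (Pi.single j 1 : Fin 3 → ℝ)) := by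
    simpa using (differentiable_wave μ x).hasFDerivAt
  exact (h5.comp_hasDerivAt (f := fun t : ℝ => x + t • (Pi.single j 1 : Fin 3 → ℝ)) (0 : ℝ) h4).unique h1

/-- `ℤ³`-periodic continuous functions come from the torus. -/
theorem exists_torus_function {p : (Fin 3 → ℝ) → ℂ} (hp : Continuous p)
    (hper : ∀ (n : Fin 3 → ℤ) x, p (x + fun i => (n i : ℝ)) = p x) :
    ∃ F : C(UnitAddTorus (Fin 3), ℂ), ∀ x : Fin 3 → ℝ, F (fun i => (x i : UnitAddCircle)) = p x := by
  have hq : IsOpenQuotientMap (Pi.map fun (_ : Fin 3) (t : ℝ) => (t : UnitAddCircle)) :=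
    IsOpenQuotientMap.piMap fun _ => QuotientAddGroup.isOpenQuotientMap_mk
  let π : C(Fin 3 → ℝ, UnitAddTorus (Fin 3)) := ⟨_, hq.continuous⟩
  have hπ : Topology.IsQuotientMap π := hq.isQuotientMap
  have hfac : Function.FactorsThrough (⟨p, hp⟩ : C(Fin 3 → ℝ, ℂ)) π := by
    intro x y hxy
    have h1 : ∀ i, ∃ n : ℤ, (n : ℝ) = x i - y i := by
      intro i
      have h2 := congrFun hxy i
      change ((x i : ℝ) : UnitAddCircle) = (y i : ℝ) at h2
      rw [← sub_eq_zero, ← AddCircle.coe_sub, AddCircle.coe_eq_zero_iff] at h2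
      obtain ⟨n, hn⟩ := h2
      exact ⟨n, by simpa using hn⟩
    choose n hn using h1
    have h3 := hper n y
    have h4 : (y + fun i => (n i : ℝ)) = x := by ext i; simp [hn]
    rw [h4] at h3
    exact h3
  exact ⟨hπ.lift ⟨p, hp⟩ hfac, fun x => congrFun (congrArg DFunLike.coe (hπ.lift_comp ⟨p, hp⟩ hfac)) x⟩

/-- The values of a function `ℝ³ → ℂ` on a spinor field with spin structure `ε`. -/
structure IsTwistedPeriodic (ε : Fin 3 → Bool) (f : (Fin 3 → ℝ) → ℂ) : Prop where
  continuous : Continuous f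
  add_single : ∀ x i, f (x + Pi.single i 1) = spinSign (ε i) * f x

theorem isTwistedPeriodic_wave (μ : Weight ε) : IsTwistedPeriodic ε (wave μ.1) :=
  ⟨continuous_wave _, fun x i => wave_add_single μ x i⟩

theorem IsTwistedPeriodic.conj_mul {f g : (Fin 3 → ℝ) → ℂ} (hf : IsTwistedPeriodic ε f)
    (hg : IsTwistedPeriodic ε g) :
    IsTwistedPeriodic (fun _ => false) fun x => starRingEnd ℂ (f x) * g x := by
  refine ⟨(continuous_conj.comp hf.continuous).mul hg.continuous, fun x i => ?_⟩
  simp only [hf.add_single, hg.add_single, map_mul, conj_spinSign]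
  rw [mul_mul_mul_comm, spinSign_mul_self]
  simp [spinSign]

theorem IsTwistedPeriodic.add_int {f : (Fin 3 → ℝ) → ℂ} (hf : IsTwistedPeriodic (fun _ => false) f)
    (n : Fin 3 → ℤ) (x : Fin 3 → ℝ) : f (x + fun i => (n i : ℝ)) = f x := by
  have h1 : ∀ x i, f (x + Pi.single i 1) = f x := fun x i => by simp [hf.add_single, spinSign]
  have h2 : ∀ (m : ℤ) i x, f (x + Pi.single i (m : ℝ)) = f x := by
    intro m i
    induction m using Int.induction_on with
    | zero => intro x; simp
    | succ k ih =>
      intro x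
      have h3 := h1 (x + Pi.single i ((k : ℤ) : ℝ)) i
      rw [add_assoc, ← Pi.single_add, ih] at h3
      push_cast at h3 ⊢
      exact h3
    | pred k ih =>
      intro x
      have h3 := h1 (x + Pi.single i ((-(k : ℤ) - 1 : ℤ) : ℝ)) i
      rw [add_assoc, ← Pi.single_add] at h3
      push_cast at h3 ⊢
      rw [← h3, sub_add_cancel]
      simpa using ih x
  have h3 : (x + fun i => (n i : ℝ)) =
      x + Pi.single 0 (n 0 : ℝ) + Pi.single 1 (n 1 : ℝ) + Pi.single 2 (n 2 : ℝ) := by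
    ext i; fin_cases i <;> simp
  rw [h3, h2, h2, h2]

open MeasureTheory in
/-- The mean over the unit cube. -/
def cubeMean (f : (Fin 3 → ℝ) → ℂ) : ℂ := ∫ x in Set.Icc (0 : Fin 3 → ℝ) 1, f x

/-- The Fourier coefficient. -/
def waveCoeff (μ : Fin 3 → ℝ) (f : (Fin 3 → ℝ) → ℂ) : ℂ := cubeMean fun x => wave (-μ) x * f x

theorem cube_ae_eq : {x : Fin 3 → ℝ | ∀ i, x i ∈ Set.Ioc (0 : ℝ) (0 + 1)} =ᵐ[MeasureTheory.volume]
    Set.Icc (0 : Fin 3 → ℝ) 1 := by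
  have h := MeasureTheory.Measure.univ_pi_Ioc_ae_eq_Icc (μ := fun _ : Fin 3 => MeasureTheory.volume)
    (f := (0 : Fin 3 → ℝ)) (g := 1)
  refine Filter.EventuallyEq.trans (Filter.EventuallyEq.of_eq ?_) h
  ext x
  change (∀ i, 0 < x i ∧ x i ≤ 0 + 1) ↔ ∀ i, i ∈ Set.univ → 0 < x i ∧ x i ≤ 1
  simp

local instance : MeasureTheory.MeasureSpace UnitAddCircle := ⟨AddCircle.haarAddCircle⟩

local instance : MeasureTheory.IsProbabilityMeasure
    (MeasureTheory.volume : MeasureTheory.Measure UnitAddCircle) :=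
  inferInstanceAs (MeasureTheory.IsProbabilityMeasure AddCircle.haarAddCircle)

theorem mFourier_coe (n : Fin 3 → ℤ) (x : Fin 3 → ℝ) :
    UnitAddTorus.mFourier n (fun i => (x i : UnitAddCircle)) = wave (fun i => n i) x := by
  simp only [UnitAddTorus.mFourier, ContinuousMap.coe_mk, fourier_coe_apply, wave,
    Fin.prod_univ_three, Fin.sum_univ_three, ← Complex.exp_add]
  congr 1
  push_cast
  ring

/-- Integrals over the torus are integrals over the cube. -/
theorem integral_torus {E : Type*} [NormedAddCommGroup E] [NormedSpace ℝ E]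
    (F : UnitAddTorus (Fin 3) → E) :
    ∫ t, F t = ∫ x in Set.Icc (0 : Fin 3 → ℝ) 1, F (fun i => (x i : UnitAddCircle)) := by
  rw [UnitAddTorus.integral_preimage F 0]
  exact MeasureTheory.setIntegral_congr_set cube_ae_eq

/-- Parseval's identity. -/
theorem hasSum_sq_waveCoeff {f : (Fin 3 → ℝ) → ℂ} (hf : IsTwistedPeriodic ε f) :
    HasSum (fun μ : Weight ε => ‖waveCoeff μ.1 f‖ ^ 2)
      (∫ x in Set.Icc (0 : Fin 3 → ℝ) 1, ‖f x‖ ^ 2) := by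
  have hp := (isTwistedPeriodic_wave (Weight.ofInt ε 0)).conj_mul hf
  obtain ⟨F, hF⟩ := exists_torus_function hp.continuous hp.add_int
  have h1 := UnitAddTorus.hasSum_sq_mFourierCoeff
    (ContinuousMap.toLp 2 MeasureTheory.volume ℂ F)
  rw [← (Weight.ofInt ε).hasSum_iff]
  have h2 : ∫ t, ‖(ContinuousMap.toLp 2 MeasureTheory.volume ℂ F) t‖ ^ 2 =
      ∫ x in Set.Icc (0 : Fin 3 → ℝ) 1, ‖f x‖ ^ 2 := by
    refine (MeasureTheory.integral_congr_ae ((ContinuousMap.coeFn_toLp MeasureTheory.volume F).fun_comp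
      fun z : ℂ => ‖z‖ ^ 2)).trans ?_
    rw [integral_torus]
    simp only [Function.comp_apply, hF, norm_mul, RCLike.norm_conj, norm_wave, one_mul]
  rw [h2] at h1
  refine h1.congr_fun fun n => ?_
  rw [UnitAddTorus.mFourierCoeff_toLp, UnitAddTorus.mFourierCoeff, integral_torus]
  have h3 : (fun i => ((-n) i : ℝ)) + -(Weight.ofInt ε 0).1 = -(Weight.ofInt ε n).1 := by
    ext i
    simp only [Pi.add_apply, Pi.neg_apply, Weight.ofInt_apply, Pi.zero_apply]
    push_cast
    ring
  simp only [Function.comp, waveCoeff, cubeMean, hF, mFourier_coe, conj_wave, smul_eq_mul, ← mul_assoc,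
    ← wave_add, h3]

/-- The plane waves span a dense subspace of the continuous periodic functions. -/
theorem cubeMean_eq_of_wave {T : (Fin 3 → ℝ) → Fin 3 → ℝ} (hT : Continuous T)
    (h : ∀ n : Fin 3 → ℤ, cubeMean (wave (fun i => n i) ∘ T) = cubeMean (wave fun i => n i))
    {p : (Fin 3 → ℝ) → ℂ} (hp : IsTwistedPeriodic (fun _ => false) p) :
    cubeMean (p ∘ T) = cubeMean p := by
  obtain ⟨F, hF⟩ := exists_torus_function hp.continuous hp.add_int
  have hc : ∀ S : (Fin 3 → ℝ) → Fin 3 → ℝ, Continuous S → ∃ L : C(UnitAddTorus (Fin 3), ℂ) →L[ℂ] ℂ,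
      ∀ G, L G = cubeMean fun x => G (fun i => (S x i : UnitAddCircle)) := by
    intro S hS
    have hcont : ∀ G : C(UnitAddTorus (Fin 3), ℂ),
        Continuous fun x => G (fun i => (S x i : UnitAddCircle)) := fun G =>
      G.continuous.comp (continuous_pi fun i =>
        (AddCircle.continuous_mk' 1).comp ((continuous_apply i).comp hS))
    have hint := fun G => ((hcont G).continuousOn (s := Set.Icc 0 1)).integrableOn_compact
      (μ := MeasureTheory.volume) isCompact_Icc
    refine ⟨LinearMap.mkContinuous
      { toFun := fun G => cubeMean fun x => G (fun i => (S x i : UnitAddCircle))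
        map_add' := fun G G' => MeasureTheory.integral_add (hint G) (hint G')
        map_smul' := fun z G => MeasureTheory.integral_const_mul z _ } 1 fun G => ?_, fun G => rfl⟩
    refine (MeasureTheory.norm_setIntegral_le_of_norm_le_const (C := ‖G‖) ?_ ?_).trans ?_
    · exact isCompact_Icc.measure_lt_top
    · exact fun x _ => G.norm_coe_le_norm _
    · simp [MeasureTheory.Measure.real, Real.volume_Icc_pi]
  obtain ⟨L, hL⟩ := hc T hT
  obtain ⟨L', hL'⟩ := hc id continuous_id
  have hLL : L = L' := by
    refine ContinuousLinearMap.ext_on (s := Set.range UnitAddTorus.mFourier) ?_ ?_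
    · exact (Submodule.dense_iff_topologicalClosure_eq_top).2 UnitAddTorus.span_mFourier_closure_eq_top
    · rintro _ ⟨n, rfl⟩
      rw [hL, hL']
      simp only [mFourier_coe, id]
      exact h n
  have := congrFun (congrArg DFunLike.coe hLL) F
  rw [hL, hL'] at this
  simp only [hF, id] at this
  exact this

/-- The integral of a derivative of a periodic function vanishes. -/
theorem cubeMean_fderiv {p : (Fin 3 → ℝ) → ℂ} (hp : IsTwistedPeriodic (fun _ => false) p)
    (hd : ContDiff ℝ 1 p) (j : Fin 3) :
    cubeMean (fun x => fderiv ℝ p x (Pi.single j 1)) = 0 := by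
  have h := MeasureTheory.integral_divergence_of_hasFDerivAt_off_countable' (0 : Fin 3 → ℝ) 1 zero_le_one
    (fun i => if i = j then p else 0) (fun i x => if i = j then fderiv ℝ p x else 0) ∅
    Set.countable_empty (fun i => ?_) (fun x _ i => ?_) ?_
  · have h1 : ∀ x : Fin 3 → ℝ, ∑ i, (if i = j then fderiv ℝ p x else 0) (Pi.single i 1) =
        fderiv ℝ p x (Pi.single j 1) := by
      intro x
      rw [Finset.sum_eq_single j (fun i _ hi => by simp [hi]) (by simp), if_pos rfl]
    simp only [h1] at h
    refine h.trans ?_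
    rw [Finset.sum_eq_single j (fun i _ hi => by simp [hi]) (by simp), sub_eq_zero]
    simp only [if_true]
    refine MeasureTheory.setIntegral_congr_fun measurableSet_Icc fun x _ => ?_
    have h2 : (j.insertNth (1 : ℝ) x : Fin 3 → ℝ) = j.insertNth 0 x + Pi.single j 1 := by
      rw [← j.insertNth_zero_right, ← Fin.insertNth_add]
      simp
    change p (j.insertNth 1 x) = p (j.insertNth 0 x)
    rw [h2, hp.add_single]
    simp [spinSign]
  · split_ifs
    · exact hp.continuous.continuousOn
    · exact continuousOn_const
  · split_ifs
    · exact (hd.differentiable (by simp) x).hasFDerivAt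
    · exact hasFDerivAt_const 0 x
  · refine (Continuous.continuousOn ?_).integrableOn_compact isCompact_Icc
    refine continuous_finsetSum _ fun i _ => ?_
    split_ifs
    · exact (hd.continuous_fderiv (by simp)).clm_apply continuous_const
    · exact continuous_const

theorem cubeMean_wave (n : Fin 3 → ℤ) : cubeMean (wave fun i => n i) = if n = 0 then 1 else 0 := by
  split_ifs with hn
  · subst hn
    have : (wave fun i => ((0 : Fin 3 → ℤ) i : ℝ)) = fun _ => 1 := by ext x; simp [wave]
    rw [this]
    simp [cubeMean, MeasureTheory.Measure.real, Real.volume_Icc_pi]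
  · obtain ⟨j, hj⟩ := Function.ne_iff.1 hn
    have h1 := cubeMean_fderiv (p := wave fun i => n i) ⟨continuous_wave _, fun x i => ?_⟩
      ((contDiff_wave _).of_le (by simp)) j
    · simp only [fderiv_wave] at h1
      rw [cubeMean, MeasureTheory.integral_const_mul, mul_eq_zero] at h1
      refine h1.resolve_left ?_
      simpa [Real.pi_ne_zero] using hj
    · have h2 := wave_add_single (Weight.ofInt (fun _ => false) n) x i
      have h3 : (Weight.ofInt (fun _ => false) n).1 = fun i => (n i : ℝ) := by
        ext i; simp [Weight.ofInt_apply, half]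
      rwa [h3] at h2

theorem cubeMean_screw {p : (Fin 3 → ℝ) → ℂ} (hp : IsTwistedPeriodic (fun _ => false) p) :
    cubeMean (fun x => p (b.screw x)) = cubeMean p := by
  refine cubeMean_eq_of_wave ?_ (fun n => ?_) hp
  · have h1 : (b.screw : (Fin 3 → ℝ) → Fin 3 → ℝ) = fun x => b.screw 0 + b.screwLin x :=
      funext b.screw_eq
    rw [h1]
    exact continuous_const.add b.screwLin.toLinearMap.continuous_of_finiteDimensional
  · have h1 : (wave (fun i => n i) ∘ b.screw) = fun x => b.twist n * wave (fun i => (b.lin n i : ℤ)) x := by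
      ext x
      rw [Function.comp, wave_screw, charN_intCast]
      congr 2
      ext i
      exact (b.lin_intCast n i).symm
    rw [h1, cubeMean, MeasureTheory.integral_const_mul]
    change _ * cubeMean (wave fun i => (b.lin n i : ℤ)) = _
    have h0 : b.lin n = 0 ↔ n = 0 := by
      refine ⟨fun h => ?_, fun h => by ext i; fin_cases i <;> simp [h, Bieb.lin]⟩
      have := b.linEquiv.symm_apply_apply n
      rw [← this]
      change b.linEquiv.symm (b.lin n) = 0
      rw [h]
      ext i
      fin_cases i <;> simp [Bieb.linEquiv, Bieb.linInv]
    rw [cubeMean_wave, cubeMean_wave]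
    simp only [h0]
    split_ifs with hn
    · subst hn; simp [Bieb.twist]
    · simp

theorem waveCoeff_wave (μ ν : Weight ε) [Decidable (ν = μ)] :
    waveCoeff μ.1 (wave ν.1) = if ν = μ then 1 else 0 := by
  obtain ⟨n, rfl⟩ := (Weight.ofInt ε).surjective μ
  obtain ⟨m, rfl⟩ := (Weight.ofInt ε).surjective ν
  have h1 : -(Weight.ofInt ε n).1 + (Weight.ofInt ε m).1 = fun i => ((m - n) i : ℝ) := by
    ext i
    simp only [Pi.add_apply, Pi.neg_apply, Weight.ofInt_apply, Pi.sub_apply]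
    push_cast
    ring
  simp only [waveCoeff, ← wave_add, h1]
  rw [cubeMean_wave]
  simp only [sub_eq_zero, EmbeddingLike.apply_eq_iff_eq]

theorem integrableOn_cube {f : (Fin 3 → ℝ) → ℂ} (hf : Continuous f) :
    MeasureTheory.IntegrableOn f (Set.Icc 0 1) :=
  hf.continuousOn.integrableOn_compact isCompact_Icc

theorem waveCoeff_add (μ : Fin 3 → ℝ) {f g : (Fin 3 → ℝ) → ℂ} (hf : Continuous f) (hg : Continuous g) :
    waveCoeff μ (fun x => f x + g x) = waveCoeff μ f + waveCoeff μ g := by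
  simp only [waveCoeff, cubeMean, mul_add]
  exact MeasureTheory.integral_add (integrableOn_cube ((continuous_wave _).mul hf))
    (integrableOn_cube ((continuous_wave _).mul hg))

theorem waveCoeff_const_mul (μ : Fin 3 → ℝ) (z : ℂ) (f : (Fin 3 → ℝ) → ℂ) :
    waveCoeff μ (fun x => z * f x) = z * waveCoeff μ f := by
  simp only [waveCoeff, cubeMean, mul_left_comm _ z]
  exact MeasureTheory.integral_const_mul z _

theorem waveCoeff_conj (μ : Fin 3 → ℝ) (f : (Fin 3 → ℝ) → ℂ) :
    waveCoeff μ (fun x => starRingEnd ℂ (f x)) = starRingEnd ℂ (waveCoeff (-μ) f) := by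
  simp only [waveCoeff, cubeMean]
  rw [← integral_conj]
  simp [conj_wave]

theorem waveCoeff_lin (μ : Weight ε) {f : (Fin 3 → ℝ) → ℂ} (hf : IsTwistedPeriodic ε f) {z : ℂ}
    (hz : ‖z‖ = 1) (hs : ∀ x, f (b.screw x) = starRingEnd ℂ z * f x) :
    waveCoeff (b.lin μ.1) f = charN b (μ.1 0) * z * waveCoeff μ.1 f := by
  have h1 := cubeMean_screw (b := b) ((isTwistedPeriodic_wave μ).conj_mul hf)
  have h2 : ∀ x, starRingEnd ℂ (wave μ.1 (b.screw x)) * f (b.screw x) =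
      starRingEnd ℂ (charN b (μ.1 0) * z) * (wave (-b.lin μ.1) x * f x) := by
    intro x
    rw [wave_screw, hs, map_mul, map_mul, conj_wave]
    ring
  simp only [h2] at h1
  simp only [conj_wave] at h1
  rw [cubeMean, MeasureTheory.integral_const_mul] at h1
  change _ * waveCoeff (b.lin μ.1) f = waveCoeff μ.1 f at h1
  rw [← h1, ← mul_assoc, Complex.mul_conj, normSq_eq_norm_sq, norm_mul, norm_charN, hz]
  simp

theorem waveCoeff_fderiv (μ : Weight ε) {f : (Fin 3 → ℝ) → ℂ} (hf : IsTwistedPeriodic ε f)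
    (hd : ContDiff ℝ 1 f) (j : Fin 3) :
    waveCoeff μ.1 (fun x => fderiv ℝ f x (Pi.single j 1)) = 2 * Real.pi * I * μ.1 j * waveCoeff μ.1 f := by
  have hp := (isTwistedPeriodic_wave μ).conj_mul hf
  simp only [conj_wave] at hp
  have h1 := cubeMean_fderiv hp (((contDiff_wave _).of_le (by simp)).mul hd) j
  have h2 : ∀ x, fderiv ℝ (fun x => wave (-μ.1) x * f x) x (Pi.single j 1) =
      wave (-μ.1) x * fderiv ℝ f x (Pi.single j 1) +
      -(2 * Real.pi * I * μ.1 j) * (wave (-μ.1) x * f x) := by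
    intro x
    rw [fderiv_fun_mul (differentiable_wave _ x) (hd.differentiable (by simp) x)]
    simp only [add_apply, smul_apply, smul_eq_mul, fderiv_wave,
      Pi.neg_apply]
    push_cast
    ring
  simp only [h2] at h1
  rw [cubeMean, MeasureTheory.integral_add, MeasureTheory.integral_const_mul] at h1
  · change waveCoeff μ.1 (fun x => fderiv ℝ f x (Pi.single j 1)) + _ * waveCoeff μ.1 f = 0 at h1
    linear_combination h1
  · exact integrableOn_cube ((continuous_wave _).mul
      ((hd.continuous_fderiv (by simp)).clm_apply continuous_const))
  · exact (integrableOn_cube ((continuous_wave _).mul hf.continuous)).const_mul _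

theorem classicalFunction_eq (a : SmoothTorus 0) (x : Fin 3 → ℝ) :
    classicalFunction a x = ∑' k, a.coeff k * wave (fun i => k i) x := rfl

theorem waveCoeff_classicalFunction_mul (μ : Fin 3 → ℝ) (a : SmoothTorus 0) {f : (Fin 3 → ℝ) → ℂ}
    (hf : Continuous f) :
    waveCoeff μ (fun x => classicalFunction a x * f x) =
      ∑' k, a.coeff k * waveCoeff (fun i => μ i + ((-k) i : ℤ)) f := by
  have hF : ∀ k : Fin 3 → ℤ, Continuous fun x => a.coeff k * (wave (fun i => -(μ i + ((-k) i : ℤ))) x * f x) :=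
    fun k => continuous_const.mul ((continuous_wave _).mul hf)
  obtain ⟨C, hC⟩ := isCompact_Icc.exists_bound_of_continuousOn (s := Set.Icc (0 : Fin 3 → ℝ) 1)
    hf.continuousOn
  have h1 := MeasureTheory.hasSum_integral_of_summable_integral_norm
    (μ := MeasureTheory.volume.restrict (Set.Icc (0 : Fin 3 → ℝ) 1))
    (F := fun (k : Fin 3 → ℤ) x => a.coeff k * (wave (fun i => -(μ i + ((-k) i : ℤ))) x * f x))
    (fun k => integrableOn_cube (hF k)) ?_
  · simp only [MeasureTheory.integral_const_mul] at h1
    refine Eq.trans ?_ h1.tsum_eq.symm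
    rw [waveCoeff, cubeMean]
    refine MeasureTheory.integral_congr_ae (Filter.Eventually.of_forall fun x => ?_)
    simp only [classicalFunction_eq, ← tsum_mul_right, ← tsum_mul_left]
    refine tsum_congr fun k => ?_
    have h2 : (fun i => -(μ i + ((-k) i : ℤ))) = -μ + fun i => (k i : ℝ) := by
      ext i
      simp [add_comm]
    rw [h2, wave_add]
    ring
  · refine Summable.of_nonneg_of_le (fun k => MeasureTheory.integral_nonneg fun x => norm_nonneg _)
      (fun k => ?_) (a.summable_norm.mul_right C)
    refine (Real.le_norm_self _).trans ((MeasureTheory.norm_setIntegral_le_of_norm_le_const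
      (C := ‖a.coeff k‖ * C) isCompact_Icc.measure_lt_top fun x hx => ?_).trans ?_)
    · rw [norm_norm, norm_mul, norm_mul, norm_wave, one_mul]
      gcongr
      exact hC x hx
    · simp [MeasureTheory.Measure.real, Real.volume_Icc_pi]

end Waves

section SmoothFunctions
variable {b : Bieb}

theorem iteratedDeriv_expI (k : ℕ) :
    iteratedDeriv k (fun t : ℝ => exp ((t : ℂ) * I)) = fun t : ℝ => I ^ k * exp ((t : ℂ) * I) := by
  induction k with
  | zero => simp
  | succ k ih =>
    rw [iteratedDeriv_succ, ih]
    ext t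
    have h1 := (((hasDerivAt_id t).ofReal_comp.mul_const I).cexp).const_mul (I ^ k)
    simp only [id, ofReal_one, one_mul] at h1
    rw [h1.deriv, pow_succ]
    ring

theorem norm_iteratedFDeriv_wave_le (k : ℕ) (μ x : Fin 3 → ℝ) :
    ‖iteratedFDeriv ℝ k (wave μ) x‖ ≤ (6 * Real.pi * ‖μ‖) ^ k := by
  let L : (Fin 3 → ℝ) →L[ℝ] ℝ := (2 * Real.pi) • ∑ i, μ i • ContinuousLinearMap.proj i
  have hL : ‖L‖ ≤ 6 * Real.pi * ‖μ‖ := by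
    refine ContinuousLinearMap.opNorm_le_bound _ (by positivity) fun y => ?_
    have h1 : ∀ i, |μ i * y i| ≤ ‖μ‖ * ‖y‖ := fun i => by
      rw [abs_mul]
      exact mul_le_mul (norm_le_pi_norm μ i) (norm_le_pi_norm y i) (abs_nonneg _) (norm_nonneg _)
    have h2 : L y = 2 * Real.pi * (μ 0 * y 0 + μ 1 * y 1 + μ 2 * y 2) := by
      simp [L, Fin.sum_univ_three]
      ring
    rw [h2, Real.norm_eq_abs, abs_mul, abs_of_pos Real.two_pi_pos]
    have h3 := (abs_add_three _ _ _).trans (add_le_add (add_le_add (h1 0) (h1 1)) (h1 2))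
    nlinarith [Real.pi_pos]
  have h1 : wave μ = (fun t : ℝ => exp ((t : ℂ) * I)) ∘ L := by
    ext y
    simp [wave, L]
  have hc : ContDiff ℝ k fun t : ℝ => exp ((t : ℂ) * I) :=
    ContDiff.cexp (ofRealCLM.contDiff.mul contDiff_const)
  rw [h1, L.iteratedFDeriv_comp_right hc x le_rfl]
  refine (ContinuousMultilinearMap.norm_compContinuousLinearMap_le _ _).trans ?_
  rw [norm_iteratedFDeriv_eq_norm_iteratedDeriv, iteratedDeriv_expI, norm_mul, norm_pow, norm_I,
    one_pow, norm_exp_ofReal_mul_I, one_mul, one_mul, Finset.prod_const, Finset.card_univ, Fintype.card_fin]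
  exact pow_le_pow_left₀ (norm_nonneg _) hL k

theorem contDiff_classicalFunction (a : SmoothTorus 0) : ContDiff ℝ (⊤ : ℕ∞) (classicalFunction a) := by
  refine contDiff_tsum (f := fun k x => a.coeff k * wave (fun i => k i) x)
    (v := fun p k => (6 * Real.pi) ^ p * ((1 + ‖k‖) ^ p * ‖a.coeff k‖))
    (fun k => contDiff_const.mul (contDiff_wave _)) (fun p _ => (a.rapid p).mul_left _) fun p k x _ => ?_
  have h1 : (fun x => a.coeff k * wave (fun i => k i) x) = a.coeff k • wave fun i => k i := rfl
  rw [h1, iteratedFDeriv_const_smul_apply ((contDiff_wave _).of_le (by exact_mod_cast le_top)).contDiffAt, norm_smul]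
  have h2 : ‖fun i => (k i : ℝ)‖ ≤ 1 + ‖k‖ := by
    refine (pi_norm_le_iff_of_nonneg (by positivity)).2 fun i => ?_
    rw [Int.norm_cast_real]
    linarith [norm_le_pi_norm k i]
  have h3 := norm_iteratedFDeriv_wave_le p (fun i => (k i : ℝ)) x
  rw [mul_pow] at h3
  rw [mul_comm, ← mul_assoc]
  gcongr
  refine h3.trans ?_
  gcongr

theorem classicalFunction_add_single (a : SmoothTorus 0) (x : Fin 3 → ℝ) (i : Fin 3) :
    classicalFunction a (x + Pi.single i 1) = classicalFunction a x := by
  simp only [classicalFunction_eq]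
  refine tsum_congr fun k => ?_
  have h2 := wave_add_single (Weight.ofInt (fun _ => false) k) x i
  have h3 : (Weight.ofInt (fun _ => false) k).1 = fun i => (k i : ℝ) := by
    ext i; simp [Weight.ofInt_apply, half]
  rw [h3] at h2
  simp [h2, spinSign]

theorem classicalFunction_screw {a : SmoothTorus 0} (ha : a ∈ b.algebra 0) (x : Fin 3 → ℝ) :
    classicalFunction a (b.screw x) = classicalFunction a x := by
  have ha' : ∀ k, a.coeff (b.lin k) = b.twist k * a.coeff k := by
    intro k
    have h1 : b.act 0 a = a := ha
    conv_lhs => rw [← h1]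
    change b.twist (b.lin k) * a.coeff (b.linEquiv.symm (b.linEquiv k)) = _
    rw [Equiv.symm_apply_apply]
    rfl
  simp only [classicalFunction_eq]
  refine Eq.trans (tsum_congr fun k => ?_) (b.linEquiv.tsum_eq _)
  have h2 : (fun i => ((b.linEquiv k) i : ℝ)) = b.lin fun i => (k i : ℝ) := by
    ext i
    exact (b.lin_intCast k i)
  change _ = a.coeff (b.lin k) * wave (fun i => ((b.linEquiv k) i : ℝ)) x
  rw [h2, ha', wave_screw, charN_intCast]
  ring

end SmoothFunctions

section SmoothSpinors
variable {R : ℝ} {b : Bieb} {τ : ℂ} {ε : Fin 3 → Bool} {c : ℂ} {h : Holonomy b τ ε c}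
  {s : SpinStructure b R τ}

/-- The components of smooth spinor fields. -/
structure IsSmoothSpinor (b : Bieb) (ε : Fin 3 → Bool) (c : ℂ) (ψ : (Fin 3 → ℝ) → Fin 2 → ℂ) : Prop where
  contDiff : ∀ t, ContDiff ℝ (⊤ : ℕ∞) fun x => ψ x t
  screw : ∀ x t, ψ (b.screw x) t = starRingEnd ℂ (conjIf c t) * ψ x t
  add_single : ∀ x i t, ψ (x + Pi.single i 1) t = spinSign (ε i) * ψ x t

theorem IsSmoothSpinor.isTwistedPeriodic {ψ : (Fin 3 → ℝ) → Fin 2 → ℂ} (hψ : IsSmoothSpinor b ε c ψ)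
    (t : Fin 2) : IsTwistedPeriodic ε fun x => ψ x t :=
  ⟨(hψ.contDiff t).continuous, fun x i => hψ.add_single x i t⟩

theorem SpinStructure.Compatible.mem_smoothSpinors (hs : s.Compatible h) {ψ : (Fin 3 → ℝ) → Fin 2 → ℂ} :
    ψ ∈ s.smoothSpinors ↔ IsSmoothSpinor b ε c ψ := by
  have hscrew : ∀ x, (ψ (b.screw x) =
      (s.lift b.screwElt : Matrix (Fin 2) (Fin 2) ℂ).mulVec (ψ x)) ↔
      ∀ t, ψ (b.screw x) t = starRingEnd ℂ (conjIf c t) * ψ x t := by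
    intro x
    rw [hs.screw, funext_iff]
    refine forall_congr' fun t => ?_
    rw [Matrix.mulVec_diagonal]
    fin_cases t <;> simp
  have htrans : ∀ i x, (ψ (x + Pi.single i 1) =
      (s.lift (b.transElt i) : Matrix (Fin 2) (Fin 2) ℂ).mulVec (ψ x)) ↔
      ∀ t, ψ (x + Pi.single i 1) t = spinSign (ε i) * ψ x t := by
    intro i x
    rw [hs.trans, Matrix.smul_mulVec, Matrix.one_mulVec, funext_iff]
    rfl
  constructor
  · rintro ⟨h1, h2⟩
    exact ⟨contDiff_pi.1 h1, fun x => (hscrew x).1 (h2 b.screwElt x),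
      fun x i => (htrans i x).1 (h2 (b.transElt i) x)⟩
  · rintro ⟨h1, h2, h3⟩
    refine ⟨contDiff_pi.2 h1, fun g => ?_⟩
    refine Bieb.group_induction (p := fun g hg => ∀ x, ψ (g x) =
      (s.lift ⟨g, hg⟩ : Matrix (Fin 2) (Fin 2) ℂ).mulVec (ψ x)) ?_ ?_ ?_ ?_ ?_ g
    · exact fun x => (hscrew x).2 (h2 x)
    · exact fun i x => (htrans i x).2 (h3 x i)
    · intro x
      have : s.lift ⟨1, one_mem _⟩ = 1 := s.lift.map_one
      rw [this]
      simp
    · intro g g' hg hg' h1 h2 x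
      have : s.lift ⟨g * g', mul_mem hg hg'⟩ = s.lift ⟨g, hg⟩ * s.lift ⟨g', hg'⟩ :=
        s.lift.map_mul ⟨g, hg⟩ ⟨g', hg'⟩
      rw [this, Equiv.Perm.mul_apply, h1, h2, Matrix.mulVec_mulVec]
      rfl
    · intro g hg h1 x
      have h4 : s.lift ⟨g⁻¹, inv_mem hg⟩ * s.lift ⟨g, hg⟩ = 1 := by
        rw [← map_mul]
        exact (congrArg s.lift (inv_mul_cancel (⟨g, hg⟩ : b.group))).trans s.lift.map_one
      have h5 := h1 (g⁻¹ x)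
      rw [perm_apply_inv_self] at h5
      have h6 := congrArg Subtype.val h4
      rw [h5, Matrix.mulVec_mulVec]
      change _ = ((s.lift ⟨g⁻¹, inv_mem hg⟩ * s.lift ⟨g, hg⟩ : Matrix.specialUnitaryGroup (Fin 2) ℂ) :
        Matrix (Fin 2) (Fin 2) ℂ).mulVec _
      rw [h4]
      simp

theorem hasSum_prod_fin_two {ι : Type*} {f : ι × Fin 2 → ℝ} {x y : ℝ} (hx : HasSum (fun i => f (i, 0)) x)
    (hy : HasSum (fun i => f (i, 1)) y) : HasSum f (x + y) := by
  have h1 : ∀ (t : Fin 2) (z : ℝ), HasSum (fun i => f (i, t)) z →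
      HasSum (fun i : ι × Fin 2 => if i.2 = t then f i else 0) z := by
    intro t z hz
    refine ((Prod.mk_left_injective t).hasSum_iff fun i hi => ?_).1 (hz.congr_fun fun i => by simp)
    rw [if_neg]
    rintro rfl
    exact hi ⟨i.1, rfl⟩
  refine ((h1 0 x hx).add (h1 1 y hy)).congr_fun ?_
  rintro ⟨i, t⟩
  fin_cases t <;> simp

theorem IsSmoothSpinor.hasSum_norm_sq {ψ : (Fin 3 → ℝ) → Fin 2 → ℂ} (hψ : IsSmoothSpinor b ε c ψ) :
    HasSum (fun i : Weight ε × Fin 2 => ‖waveCoeff i.1.1 fun x => ψ x i.2‖ ^ 2)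
      (∫ x in Set.Icc (0 : Fin 3 → ℝ) 1, (‖ψ x 0‖ ^ 2 + ‖ψ x 1‖ ^ 2)) := by
  have hi : ∀ t, MeasureTheory.IntegrableOn (fun x => ‖ψ x t‖ ^ 2) (Set.Icc (0 : Fin 3 → ℝ) 1) :=
    fun t => Continuous.integrableOn_Icc (((hψ.contDiff t).continuous).norm.pow 2)
  have h0 : HasSum (fun μ : Weight ε => ‖waveCoeff μ.1 fun x => ψ x 0‖ ^ 2)
      (∫ x in Set.Icc (0 : Fin 3 → ℝ) 1, ‖ψ x 0‖ ^ 2) := hasSum_sq_waveCoeff (hψ.isTwistedPeriodic 0)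
  have h1 : HasSum (fun μ : Weight ε => ‖waveCoeff μ.1 fun x => ψ x 1‖ ^ 2)
      (∫ x in Set.Icc (0 : Fin 3 → ℝ) 1, ‖ψ x 1‖ ^ 2) := hasSum_sq_waveCoeff (hψ.isTwistedPeriodic 1)
  have h2 : (∫ x in Set.Icc (0 : Fin 3 → ℝ) 1, (‖ψ x 0‖ ^ 2 + ‖ψ x 1‖ ^ 2)) =
      (∫ x in Set.Icc (0 : Fin 3 → ℝ) 1, ‖ψ x 0‖ ^ 2) + ∫ x in Set.Icc (0 : Fin 3 → ℝ) 1, ‖ψ x 1‖ ^ 2 :=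
    MeasureTheory.integral_add (hi 0) (hi 1)
  rw [h2]
  exact hasSum_prod_fin_two h0 h1

theorem IsSmoothSpinor.memℓp {ψ : (Fin 3 → ℝ) → Fin 2 → ℂ} (hψ : IsSmoothSpinor b ε c ψ) :
    Memℓp (fun i : Weight ε × Fin 2 => waveCoeff i.1.1 fun x => ψ x i.2) 2 := by
  refine memℓp_gen ?_
  simpa using hψ.hasSum_norm_sq.summable

/-- The Fourier transform of smooth spinor fields. -/
def SpinStructure.Compatible.fourier (hs : s.Compatible h) : s.smoothSpinors →ₗ[ℂ] h.fixed where
  toFun ψ := ⟨⟨fun i => waveCoeff i.1.1 fun x => ψ.1 x i.2, (hs.mem_smoothSpinors.1 ψ.2).memℓp⟩, by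
    have hψ := hs.mem_smoothSpinors.1 ψ.2
    rw [h.mem_fixed]
    ext ⟨ν, t⟩
    obtain ⟨μ, rfl⟩ := (Weight.lin b h.maps).surjective ν
    rw [h.op_lin]
    exact (waveCoeff_lin μ (hψ.isTwistedPeriodic t) ((norm_conjIf c t).trans h.norm_eq)
      fun x => hψ.screw x t).symm⟩
  map_add' ψ φ := by
    ext i
    exact waveCoeff_add _ ((hs.mem_smoothSpinors.1 ψ.2).contDiff i.2).continuous
      ((hs.mem_smoothSpinors.1 φ.2).contDiff i.2).continuous
  map_smul' z ψ := by
    ext i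
    exact waveCoeff_const_mul _ z _

theorem SpinStructure.Compatible.fourier_apply (hs : s.Compatible h) (ψ : s.smoothSpinors)
    (i : Weight ε × Fin 2) : (hs.fourier ψ : Spinor ε) i = waveCoeff i.1.1 fun x => ψ.1 x i.2 := rfl

theorem SpinStructure.Compatible.norm_fourier (hs : s.Compatible h) (ψ : s.smoothSpinors) :
    ‖hs.fourier ψ‖ ^ 2 = ∫ x in Set.Icc (0 : Fin 3 → ℝ) 1, (‖ψ.1 x 0‖ ^ 2 + ‖ψ.1 x 1‖ ^ 2) := by
  have h1 := lp.norm_rpow_eq_tsum (p := 2) (by norm_num) (hs.fourier ψ : Spinor ε)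
  have h2 := (hs.mem_smoothSpinors.1 ψ.2).hasSum_norm_sq.tsum_eq
  simp only [ENNReal.toReal_ofNat, Real.rpow_ofNat] at h1
  exact h1.trans h2

theorem SpinStructure.Compatible.exists_rep (hs : s.Compatible h) (a : b.algebra 0) (ψ : s.smoothSpinors) :
    ∃ φ : s.smoothSpinors, (∀ x, φ.1 x = classicalFunction a x • ψ.1 x) ∧
      (h.triple 0 R).rep a (hs.fourier ψ) = hs.fourier φ := by
  have hψ := hs.mem_smoothSpinors.1 ψ.2
  refine ⟨⟨fun x => classicalFunction a x • ψ.1 x, hs.mem_smoothSpinors.2 ⟨fun t => ?_, fun x t => ?_,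
    fun x i t => ?_⟩⟩, fun x => rfl, ?_⟩
  · exact (contDiff_classicalFunction a).mul (hψ.contDiff t)
  · rw [Pi.smul_apply, Pi.smul_apply, hψ.screw, classicalFunction_screw a.2, smul_eq_mul, smul_eq_mul]
    ring
  · rw [Pi.smul_apply, Pi.smul_apply, hψ.add_single, classicalFunction_add_single, smul_eq_mul, smul_eq_mul]
    ring
  · ext ⟨μ, t⟩
    change SmoothTorus.op (shift 0 ε) a.1 (hs.fourier ψ : Spinor ε) (μ, t) =
      waveCoeff μ.1 fun x => classicalFunction a x * ψ.1 x t
    rw [waveCoeff_classicalFunction_mul _ _ (hψ.contDiff t).continuous, SmoothTorus.op_apply]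
    refine tsum_congr fun k => ?_
    rw [shift_apply, hs.fourier_apply]
    simp only [phase, ofReal_zero, mul_zero, zero_mul, exp_zero, one_mul]
    rfl

theorem SpinStructure.Compatible.exists_conj (hs : s.Compatible h) (ψ : s.smoothSpinors) :
    ∃ φ : s.smoothSpinors, (∀ x, φ.1 x = classicalConj ψ.1 x) ∧
      (h.triple 0 R).conj (hs.fourier ψ) = hs.fourier φ := by
  have hψ := hs.mem_smoothSpinors.1 ψ.2
  have hc : ∀ t, ContDiff ℝ (⊤ : ℕ∞) fun x => starRingEnd ℂ (ψ.1 x t) := fun t =>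
    conjCLE.contDiff.comp (hψ.contDiff t)
  refine ⟨⟨classicalConj ψ.1, hs.mem_smoothSpinors.2 ⟨fun t => ?_, fun x t => ?_,
    fun x i t => ?_⟩⟩, fun x => rfl, ?_⟩
  · fin_cases t
    · exact (hc 1).neg
    · exact hc 0
  · fin_cases t <;> simp [classicalConj, hψ.screw]
  · fin_cases t <;> simp [classicalConj, hψ.add_single, conj_spinSign]
  · ext ⟨μ, t⟩
    fin_cases t
    · refine (torusConj_zero ε (hs.fourier ψ : Spinor ε) μ).trans ?_
      change _ = waveCoeff μ.1 fun x => -starRingEnd ℂ (ψ.1 x 1)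
      have h1 := waveCoeff_const_mul μ.1 (-1) fun x => starRingEnd ℂ (ψ.1 x 1)
      simp only [neg_one_mul] at h1
      rw [h1, waveCoeff_conj]
      rfl
    · refine (torusConj_one ε (hs.fourier ψ : Spinor ε) μ).trans ?_
      change _ = waveCoeff μ.1 fun x => starRingEnd ℂ (ψ.1 x 0)
      rw [waveCoeff_conj]
      rfl

end SmoothSpinors

section ClassicalDirac
variable {R : ℝ} {b : Bieb} {τ : ℂ} {ε : Fin 3 → Bool} {c : ℂ} {h : Holonomy b τ ε c}
  {s : SpinStructure b R τ} {ψ : (Fin 3 → ℝ) → Fin 2 → ℂ}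

/-- The partial derivatives of the components. -/
def partialDeriv (ψ : (Fin 3 → ℝ) → Fin 2 → ℂ) (j : Fin 3) (t : Fin 2) (x : Fin 3 → ℝ) : ℂ :=
  fderiv ℝ (fun y => ψ y t) x (Pi.single j 1)

theorem classicalDirac_eq (hψ : IsSmoothSpinor b ε c ψ) (x : Fin 3 → ℝ) :
    classicalDirac R τ ψ x =
      ![1 / (2 * Real.pi * I) * (R * partialDeriv ψ 0 0 x +
          (partialDeriv ψ 1 1 x + τ * partialDeriv ψ 2 1 x)),
        1 / (2 * Real.pi * I) * (-R * partialDeriv ψ 0 1 x +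
          (partialDeriv ψ 1 0 x + starRingEnd ℂ τ * partialDeriv ψ 2 0 x))] := by
  have h1 : ∀ j t, fderiv ℝ ψ x (Pi.single j 1) t = partialDeriv ψ j t x := by
    intro j t
    have hd : ∀ t, DifferentiableAt ℝ (fun y => ψ y t) x := fun t =>
      (hψ.contDiff t).differentiable (by simp) x
    have := congrFun (congrArg DFunLike.coe (fderiv_pi (φ := fun t y => ψ y t) hd)) (Pi.single j 1)
    exact congrFun this t
  ext t
  rw [classicalDirac, Pi.smul_apply, Finset.sum_apply, Fin.sum_univ_three]
  simp only [symbol, Matrix.mulVec, dotProduct, Fin.sum_univ_two, h1, smul_eq_mul]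
  fin_cases t <;> simp [add_assoc]

theorem IsSmoothSpinor.contDiff_partialDeriv (hψ : IsSmoothSpinor b ε c ψ) (j : Fin 3) (t : Fin 2) :
    ContDiff ℝ (⊤ : ℕ∞) (partialDeriv ψ j t) :=
  ((hψ.contDiff t).fderiv_right (m := (⊤ : ℕ∞)) (by simp)).clm_apply contDiff_const

theorem IsSmoothSpinor.partialDeriv_add_single (hψ : IsSmoothSpinor b ε c ψ) (j : Fin 3) (t : Fin 2)
    (x : Fin 3 → ℝ) (i : Fin 3) :
    partialDeriv ψ j t (x + Pi.single i 1) = spinSign (ε i) * partialDeriv ψ j t x := by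
  have h1 : (fun y => ψ (y + Pi.single i 1) t) = fun y => spinSign (ε i) * ψ y t :=
    funext fun y => hψ.add_single y i t
  have h2 := fderiv_comp_add_right (𝕜 := ℝ) (f := fun y => ψ y t) (x := x) (Pi.single i 1)
  rw [partialDeriv, ← h2, h1, fderiv_const_mul ((hψ.contDiff t).differentiable (by simp) x)]
  rfl

theorem IsSmoothSpinor.fderiv_screw (hψ : IsSmoothSpinor b ε c ψ) (t : Fin 2) (x v : Fin 3 → ℝ) :
    fderiv ℝ (fun y => ψ y t) (b.screw x) (b.screwLin v) =
      starRingEnd ℂ (conjIf c t) * fderiv ℝ (fun y => ψ y t) x v := by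
  have h1 : (fun y => ψ (b.screw y) t) = fun y => starRingEnd ℂ (conjIf c t) * ψ y t :=
    funext fun y => hψ.screw y t
  have hd : ∀ y, DifferentiableAt ℝ (fun y => ψ y t) y := (hψ.contDiff t).differentiable (by simp)
  have h2 : HasFDerivAt (b.screw : (Fin 3 → ℝ) → Fin 3 → ℝ)
      (LinearMap.toContinuousLinearMap b.screwLin.toLinearMap) x := by
    have h3 : (b.screw : (Fin 3 → ℝ) → Fin 3 → ℝ) = fun x => b.screw 0 + b.screwLin x :=
      funext b.screw_eq
    rw [h3]
    exact (LinearMap.toContinuousLinearMap b.screwLin.toLinearMap).hasFDerivAt.const_add _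
  have h4 := ((hd (b.screw x)).hasFDerivAt.comp x h2).fderiv
  have h5 : ((fun y => ψ y t) ∘ b.screw) = fun y => starRingEnd ℂ (conjIf c t) * ψ y t := h1
  rw [h5, fderiv_const_mul (hd x)] at h4
  exact (congrFun (congrArg DFunLike.coe h4) v).symm

theorem IsSmoothSpinor.partialDeriv_screw (hψ : IsSmoothSpinor b ε c ψ) (t : Fin 2) (x : Fin 3 → ℝ) :
    partialDeriv ψ 0 t (b.screw x) = starRingEnd ℂ (conjIf c t) * partialDeriv ψ 0 t x ∧
    b.matrix 0 0 * partialDeriv ψ 1 t (b.screw x) + b.matrix 0 1 * partialDeriv ψ 2 t (b.screw x) =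
      starRingEnd ℂ (conjIf c t) * partialDeriv ψ 1 t x ∧
    b.matrix 1 0 * partialDeriv ψ 1 t (b.screw x) + b.matrix 1 1 * partialDeriv ψ 2 t (b.screw x) =
      starRingEnd ℂ (conjIf c t) * partialDeriv ψ 2 t x := by
  have h0 : b.screwLin (Pi.single 0 1) = Pi.single 0 1 := by
    ext i; fin_cases i <;> simp [Bieb.screwLin]
  have h1 : b.screwLin (Pi.single 1 1) =
      (b.matrix 0 0 : ℝ) • Pi.single 1 1 + (b.matrix 0 1 : ℝ) • Pi.single 2 1 := by
    ext i; fin_cases i <;> simp [Bieb.screwLin]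
  have h2 : b.screwLin (Pi.single 2 1) =
      (b.matrix 1 0 : ℝ) • Pi.single 1 1 + (b.matrix 1 1 : ℝ) • Pi.single 2 1 := by
    ext i; fin_cases i <;> simp [Bieb.screwLin]
  refine ⟨?_, ?_, ?_⟩
  · have := hψ.fderiv_screw t x (Pi.single 0 1)
    rwa [h0] at this
  · have := hψ.fderiv_screw t x (Pi.single 1 1)
    rw [h1, map_add, map_smul, map_smul] at this
    simpa [partialDeriv] using this
  · have := hψ.fderiv_screw t x (Pi.single 2 1)
    rw [h2, map_add, map_smul, map_smul] at this
    simpa [partialDeriv] using this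

theorem Holonomy.matrix_slope (h : Holonomy b τ ε c) :
    (b.matrix 0 0 + τ * b.matrix 1 0 : ℂ) = c ^ 2 ∧ (b.matrix 0 1 + τ * b.matrix 1 1 : ℂ) = c ^ 2 * τ := by
  have h1 := h.slope_eq (Pi.single 1 1)
  have h2 := h.slope_eq (Pi.single 2 1)
  simp [slope, Bieb.lin] at h1 h2
  exact ⟨h1, h2⟩

theorem IsSmoothSpinor.classicalDirac (h : Holonomy b τ ε c) (hψ : IsSmoothSpinor b ε c ψ) :
    IsSmoothSpinor b ε c (classicalDirac R τ ψ) := by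
  have hc := hψ.contDiff_partialDeriv
  have he : ∀ x, _ := classicalDirac_eq (R := R) (τ := τ) hψ
  have hcc : c * starRingEnd ℂ c = 1 := h.mul_conj
  obtain ⟨m1, m2⟩ := h.matrix_slope
  refine ⟨fun t => ?_, fun x t => ?_, fun x i t => ?_⟩
  · simp only [he]
    fin_cases t
    · exact contDiff_const.mul ((contDiff_const.mul (hc 0 0)).add ((hc 1 1).add (contDiff_const.mul (hc 2 1))))
    · exact contDiff_const.mul ((contDiff_const.mul (hc 0 1)).add ((hc 1 0).add (contDiff_const.mul (hc 2 0))))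
  · rw [he, he]
    obtain ⟨a0, a1, a2⟩ := hψ.partialDeriv_screw 0 x
    obtain ⟨b0, b1, b2⟩ := hψ.partialDeriv_screw 1 x
    simp only [conjIf_zero, conjIf_one, Complex.conj_conj] at a0 a1 a2 b0 b1 b2
    have m1' := congrArg (starRingEnd ℂ) m1
    have m2' := congrArg (starRingEnd ℂ) m2
    simp only [map_add, map_mul, map_pow, map_intCast] at m1' m2'
    fin_cases t
    · simp only [Fin.zero_eta, Matrix.cons_val_zero, conjIf_zero, a0]
      have h1 : partialDeriv ψ 1 1 (b.screw x) + τ * partialDeriv ψ 2 1 (b.screw x) =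
          starRingEnd ℂ c * (partialDeriv ψ 1 1 x + τ * partialDeriv ψ 2 1 x) := by
        linear_combination starRingEnd ℂ c ^ 2 * (b1 + τ * b2) - starRingEnd ℂ c ^ 2 * partialDeriv ψ 1 1 (b.screw x) * m1 -
          starRingEnd ℂ c ^ 2 * partialDeriv ψ 2 1 (b.screw x) * m2 +
          (starRingEnd ℂ c * (partialDeriv ψ 1 1 x + τ * partialDeriv ψ 2 1 x) - (c * starRingEnd ℂ c + 1) *
            (partialDeriv ψ 1 1 (b.screw x) + τ * partialDeriv ψ 2 1 (b.screw x))) * hcc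
      rw [h1]; ring
    · simp only [Fin.mk_one, Matrix.cons_val_one, conjIf_one, Complex.conj_conj, b0]
      have h1 : partialDeriv ψ 1 0 (b.screw x) + starRingEnd ℂ τ * partialDeriv ψ 2 0 (b.screw x) =
          c * (partialDeriv ψ 1 0 x + starRingEnd ℂ τ * partialDeriv ψ 2 0 x) := by
        linear_combination c ^ 2 * (a1 + starRingEnd ℂ τ * a2) - c ^ 2 * partialDeriv ψ 1 0 (b.screw x) * m1' -
          c ^ 2 * partialDeriv ψ 2 0 (b.screw x) * m2' +
          (c * (partialDeriv ψ 1 0 x + starRingEnd ℂ τ * partialDeriv ψ 2 0 x) - (c * starRingEnd ℂ c + 1) *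
            (partialDeriv ψ 1 0 (b.screw x) + starRingEnd ℂ τ * partialDeriv ψ 2 0 (b.screw x))) * hcc
      simp only [Matrix.cons_val_fin_one]
      rw [h1]; ring
  · rw [he, he]
    fin_cases t <;> simp [hψ.partialDeriv_add_single] <;> ring

theorem waveCoeff_partialDeriv (hψ : IsSmoothSpinor b ε c ψ) (μ : Weight ε) (j : Fin 3) (t : Fin 2) :
    waveCoeff μ.1 (partialDeriv ψ j t) = 2 * Real.pi * I * μ.1 j * waveCoeff μ.1 fun x => ψ x t :=
  waveCoeff_fderiv μ (hψ.isTwistedPeriodic t) ((hψ.contDiff t).of_le (by simp)) j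

theorem waveCoeff_classicalDirac (hψ : IsSmoothSpinor b ε c ψ) (i : Weight ε × Fin 2) :
    waveCoeff i.1.1 (fun x => classicalDirac R τ ψ x i.2) =
      diracFun R τ (fun i => waveCoeff i.1.1 fun x => ψ x i.2) i := by
  obtain ⟨μ, t⟩ := i
  have hc : ∀ j t, Continuous (partialDeriv ψ j t) := fun j t => (hψ.contDiff_partialDeriv j t).continuous
  have key : ∀ (z₁ z₂ : ℂ) (t₁ t₂ : Fin 2),
      waveCoeff μ.1 (fun x => 1 / (2 * Real.pi * I) * (z₁ * partialDeriv ψ 0 t₁ x +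
        (partialDeriv ψ 1 t₂ x + z₂ * partialDeriv ψ 2 t₂ x))) =
      z₁ * μ.1 0 * waveCoeff μ.1 (fun x => ψ x t₁) +
        (μ.1 1 + z₂ * μ.1 2) * waveCoeff μ.1 fun x => ψ x t₂ := by
    intro z₁ z₂ t₁ t₂
    rw [waveCoeff_const_mul, waveCoeff_add, waveCoeff_add, waveCoeff_const_mul, waveCoeff_const_mul,
      waveCoeff_partialDeriv hψ, waveCoeff_partialDeriv hψ, waveCoeff_partialDeriv hψ]
    · have := Real.pi_ne_zero
      field_simp
    · exact hc _ _
    · exact continuous_const.mul (hc _ _)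
    · exact continuous_const.mul (hc _ _)
    · exact (hc _ _).add (continuous_const.mul (hc _ _))
  simp only [classicalDirac_eq hψ]
  fin_cases t
  · exact (key _ _ 0 1).trans (diracFun_zero' R τ (fun i => waveCoeff i.1.1 fun x => ψ x i.2) μ).symm
  · refine (key _ _ 1 0).trans ((diracFun_one' R τ (fun i => waveCoeff i.1.1 fun x => ψ x i.2) μ).trans ?_).symm
    ring

theorem SpinStructure.Compatible.exists_dirac (hs : s.Compatible h) (ψ : s.smoothSpinors) :
    ∃ φ : s.smoothSpinors, (∀ x, φ.1 x = classicalDirac R τ ψ.1 x) ∧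
      (hs.fourier ψ, hs.fourier φ) ∈ (h.triple 0 R).dirac.graph := by
  have hψ := hs.mem_smoothSpinors.1 ψ.2
  refine ⟨⟨classicalDirac R τ ψ.1, hs.mem_smoothSpinors.2 (hψ.classicalDirac h)⟩, fun x => rfl, ?_⟩
  rw [mem_graph_restrict]
  exact mem_graph_torusDirac.2 fun i => waveCoeff_classicalDirac hψ i

theorem waveCoeff_sum {ι : Type*} (μ : Fin 3 → ℝ) (F : Finset ι) {f : ι → (Fin 3 → ℝ) → ℂ}
    (hf : ∀ i, Continuous (f i)) : waveCoeff μ (fun x => ∑ i ∈ F, f i x) = ∑ i ∈ F, waveCoeff μ (f i) := by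
  simp only [waveCoeff, cubeMean, Finset.mul_sum]
  exact MeasureTheory.integral_finsetSum _ fun i _ => integrableOn_cube ((continuous_wave _).mul (hf i))

/-- The orbit sums of plane waves. -/
def Holonomy.orbitWave (h : Holonomy b τ ε c) (μ : Weight ε) (s : Fin 2) (x : Fin 3 → ℝ) : ℂ :=
  (b.order : ℂ)⁻¹ * ∑ p ∈ Finset.range b.order,
    holPhase b c (μ.1 0) s ^ p * wave ((Weight.lin b h.maps)^[p] μ).1 x

theorem Holonomy.orbitWave_screw (h : Holonomy b τ ε c) (μ : Weight ε) (s : Fin 2) (x : Fin 3 → ℝ) :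
    h.orbitWave μ s (b.screw x) = starRingEnd ℂ (conjIf c s) * h.orbitWave μ s x := by
  let g : ℕ → ℂ := fun p => holPhase b c (μ.1 0) s ^ p * wave ((Weight.lin b h.maps)^[p] μ).1 x
  have hz : starRingEnd ℂ (conjIf c s) * conjIf c s = 1 := by
    rw [mul_comm, Complex.mul_conj, normSq_eq_norm_sq, norm_conjIf, h.norm_eq]
    simp
  have h0 : ∀ p, ((Weight.lin b h.maps)^[p] μ).1 0 = μ.1 0 := by
    intro p
    induction p with
    | zero => rfl
    | succ p ih => rw [Function.iterate_succ_apply', ← ih]; rfl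
  have h1 : ∀ p, holPhase b c (μ.1 0) s ^ p * wave ((Weight.lin b h.maps)^[p] μ).1 (b.screw x) =
      starRingEnd ℂ (conjIf c s) * g (p + 1) := by
    intro p
    simp only [g, Function.iterate_succ_apply', pow_succ, wave_screw, h0, Weight.lin_coe]
    rw [show holPhase b c (μ.1 0) s ^ p * holPhase b c (μ.1 0) s =
      holPhase b c (μ.1 0) s ^ p * charN b (μ.1 0) * conjIf c s by rw [holPhase]; ring]
    linear_combination (-(holPhase b c (μ.1 0) s ^ p * charN b (μ.1 0) *
      wave (b.lin ((Weight.lin b h.maps)^[p] μ).1) x)) * hz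
  have h2 : g b.order = g 0 := by
    simp only [g, h.holPhase_pow, Weight.lin_iterate_order]
    simp
  have h3 := (Finset.sum_range_succ g b.order).symm.trans (Finset.sum_range_succ' g b.order)
  rw [h2] at h3
  have h4 := add_right_cancel h3
  simp only [orbitWave, h1, ← Finset.mul_sum, ← h4]
  ring

/-- The smooth spinor fields with one nonzero component, an orbit sum of plane waves. -/
def Holonomy.orbitSpinor (h : Holonomy b τ ε c) (μ : Weight ε) (s : Fin 2) (x : Fin 3 → ℝ) (t : Fin 2) : ℂ :=
  if t = s then h.orbitWave μ s x else 0

theorem Holonomy.isSmoothSpinor_orbitSpinor (h : Holonomy b τ ε c) (μ : Weight ε) (s : Fin 2) :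
    IsSmoothSpinor b ε c (h.orbitSpinor μ s) := by
  refine ⟨fun t => ?_, fun x t => ?_, fun x i t => ?_⟩
  · by_cases hts : t = s
    · simp only [orbitSpinor, hts, if_true]
      exact contDiff_const.mul (ContDiff.sum fun p _ => contDiff_const.mul (contDiff_wave _))
    · simp only [orbitSpinor, hts, if_false]
      exact contDiff_const
  · by_cases hts : t = s
    · simp only [orbitSpinor, hts, if_true]
      exact h.orbitWave_screw μ s x
    · simp [orbitSpinor, hts]
  · by_cases hts : t = s
    · simp only [orbitSpinor, hts, if_true, orbitWave, wave_add_single, Finset.mul_sum]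
      exact Finset.sum_congr rfl fun p _ => by ring
    · simp [orbitSpinor, hts]

theorem Holonomy.proj_ket_eq (h : Holonomy b τ ε c) (μ : Weight ε) (s : Fin 2) (i : Weight ε × Fin 2) :
    h.proj (ket (μ, s)) i = waveCoeff i.1.1 fun x => h.orbitSpinor μ s x i.2 := by
  classical
  obtain ⟨ν, t⟩ := i
  rw [h.proj_ket, lp.coeFn_smul, Pi.smul_apply, lp.coeFn_sum, Finset.sum_apply, smul_eq_mul]
  simp only [lp.coeFn_smul, Pi.smul_apply, ket_apply, smul_eq_mul, Prod.mk.injEq]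
  by_cases hts : t = s
  · simp only [orbitSpinor, hts, if_true, and_true, orbitWave]
    rw [waveCoeff_const_mul, waveCoeff_sum (f := fun p x => holPhase b c (μ.1 0) s ^ p *
      wave ((Weight.lin b h.maps)^[p] μ).1 x) _ _ fun p => continuous_const.mul (continuous_wave _)]
    simp only [waveCoeff_const_mul, waveCoeff_wave, eq_comm]
  · have h0 := waveCoeff_const_mul ν.1 0 fun _ => 0
    simp only [zero_mul] at h0
    simp [orbitSpinor, hts, h0]

theorem SpinStructure.Compatible.exists_fourier (hs : s.Compatible h) (i : Weight ε × Fin 2) :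
    ∃ ψ : s.smoothSpinors, (hs.fourier ψ : Spinor ε) = h.proj (ket i) := by
  refine ⟨⟨h.orbitSpinor i.1 i.2, hs.mem_smoothSpinors.2 (h.isSmoothSpinor_orbitSpinor i.1 i.2)⟩, ?_⟩
  ext j
  exact (h.proj_ket_eq i.1 i.2 j).symm

theorem Holonomy.proj_of_mem (h : Holonomy b τ ε c) {ψ : Spinor ε} (hψ : ψ ∈ h.fixed) : h.proj ψ = ψ := by
  rw [← h.starProjection_fixed]
  exact Submodule.starProjection_eq_self_iff.2 hψ

/-- The projection, with values in the invariant subspace. -/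
def Holonomy.projFixed (h : Holonomy b τ ε c) : Spinor ε →L[ℂ] h.fixed := h.proj.codRestrict h.fixed h.proj_mem

theorem Holonomy.projFixed_coe (h : Holonomy b τ ε c) (ψ : h.fixed) : h.projFixed ψ = ψ :=
  Subtype.ext (h.proj_of_mem ψ.2)

theorem sum_ket_apply (F : Finset (Weight ε)) (u : Spinor ε) (ν : Weight ε) (s : Fin 2) [Decidable (ν ∈ F)] :
    (∑ μ ∈ F, ∑ t, u (μ, t) • ket (μ, t) : Spinor ε) (ν, s) = if ν ∈ F then u (ν, s) else 0 := by
  classical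
  simp only [lp.coeFn_sum, Finset.sum_apply, lp.coeFn_smul, Pi.smul_apply, ket_apply, smul_eq_mul,
    Prod.mk.injEq, mul_ite, mul_one, mul_zero, ite_and, Finset.sum_ite_eq, Finset.sum_ite_irrel,
    Finset.sum_const_zero, Finset.mem_univ, if_true]
  split_ifs <;> rfl

theorem sum_ket_mem_graph (F : Finset (Weight ε)) {u v : Spinor ε} (huv : (u, v) ∈ (torusDirac R τ ε).graph) :
    (∑ μ ∈ F, ∑ t, u (μ, t) • ket (μ, t), ∑ μ ∈ F, ∑ t, v (μ, t) • ket (μ, t)) ∈ (torusDirac R τ ε).graph := by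
  classical
  rw [mem_graph_torusDirac] at huv ⊢
  rintro ⟨ν, s⟩
  have h1 := huv (ν, s)
  simp only [diracFun, sum_ket_apply] at h1 ⊢
  split_ifs
  · exact h1
  · simp

theorem Holonomy.hasSum_projFixed (h : Holonomy b τ ε c) (u : h.fixed) :
    HasSum (fun μ : Weight ε => ∑ t, (u : Spinor ε) (μ, t) • h.projFixed (ket (μ, t))) u := by
  have h1 := (hasSum_ket (u : Spinor ε)).mapL h.projFixed
  simp only [map_smul, h.projFixed_coe] at h1
  exact h1.prod_fiberwise fun μ => hasSum_fintype _

theorem SpinStructure.Compatible.exists_fourier_sum (hs : s.Compatible h) (u : h.fixed)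
    (F : Finset (Weight ε)) : ∃ ψ : s.smoothSpinors,
      hs.fourier ψ = ∑ μ ∈ F, ∑ t, (u : Spinor ε) (μ, t) • h.projFixed (ket (μ, t)) := by
  choose f hf using hs.exists_fourier
  have hf' : ∀ i, hs.fourier (f i) = h.projFixed (ket i) := fun i => Subtype.ext (hf i)
  refine ⟨∑ μ ∈ F, ∑ t, (u : Spinor ε) (μ, t) • f (μ, t), ?_⟩
  simp only [map_sum, map_smul, hf']

theorem Holonomy.sum_projFixed_mem_graph (h : Holonomy b τ ε c) (R : ℝ) {u v : h.fixed}
    (huv : (u, v) ∈ (h.triple 0 R).dirac.graph) (F : Finset (Weight ε)) :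
    (∑ μ ∈ F, ∑ t, (u : Spinor ε) (μ, t) • h.projFixed (ket (μ, t)),
      ∑ μ ∈ F, ∑ t, (v : Spinor ε) (μ, t) • h.projFixed (ket (μ, t))) ∈ (h.triple 0 R).dirac.graph := by
  have huv' : ((u : Spinor ε), (v : Spinor ε)) ∈ (torusDirac R τ ε).graph :=
    (mem_graph_restrict (h.reduces_fixed 0 R)).1 huv
  have h3 := h.proj_dirac (R := R) _ _ (sum_ket_mem_graph F huv')
  have h4 : ∀ w : h.fixed, ∑ μ ∈ F, ∑ t, (w : Spinor ε) (μ, t) • h.projFixed (ket (μ, t)) =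
      h.projFixed (∑ μ ∈ F, ∑ t, (w : Spinor ε) (μ, t) • ket (μ, t)) := fun w => by
    simp only [map_sum, map_smul]
  rw [h4, h4, mem_graph_restrict]
  exact h3

theorem SpinStructure.Compatible.isClassicalDiracTriple (hs : s.Compatible h) :
    IsClassicalDiracTriple s (h.triple 0 R) := by
  refine ⟨hs.fourier, fun u => ?_, hs.norm_fourier, hs.exists_rep, hs.exists_conj, hs.exists_dirac, fun q hq => ?_⟩
  · refine mem_closure_of_tendsto (h.hasSum_projFixed u) (Filter.Eventually.of_forall fun F => ?_)
    exact hs.exists_fourier_sum u F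
  · have h1 : Filter.Tendsto (fun F : Finset (Weight ε) =>
        (∑ μ ∈ F, ∑ t, (q.1 : Spinor ε) (μ, t) • h.projFixed (ket (μ, t)),
          ∑ μ ∈ F, ∑ t, (q.2 : Spinor ε) (μ, t) • h.projFixed (ket (μ, t)))) Filter.atTop (nhds (q.1, q.2)) :=
      Filter.Tendsto.prodMk_nhds (h.hasSum_projFixed q.1) (h.hasSum_projFixed q.2)
    refine mem_closure_of_tendsto h1 (Filter.Eventually.of_forall fun F => ?_)
    obtain ⟨ψ, hψ⟩ := hs.exists_fourier_sum q.1 F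
    obtain ⟨φ, hφ, hφ'⟩ := hs.exists_dirac ψ
    refine ⟨ψ, φ, hφ, ?_⟩
    have h2 := h.sum_projFixed_mem_graph R hq F
    rw [← hψ] at h2 ⊢
    rw [(h.triple 0 R).dirac.mem_graph_snd_inj hφ' h2 rfl]

end ClassicalDirac

section ClassicalTriples
variable {R : ℝ} {b : Bieb} {τ : ℂ} {s : SpinStructure b R τ}
  {H : Type*} [NormedAddCommGroup H] [InnerProductSpace ℂ H] [CompleteSpace H]
  {H' : Type*} [NormedAddCommGroup H'] [InnerProductSpace ℂ H'] [CompleteSpace H']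
  {T : RealTriple (b.algebra 0) H} {T' : RealTriple (b.algebra 0) H'}

theorem IsClassicalDiracTriple.of_equivalent (h : IsClassicalDiracTriple s T)
    (hT : T.UnitarilyEquivalent T') : IsClassicalDiracTriple s T' := by
  obtain ⟨Φ, h1, h2, h3, h4, h5, h6⟩ := h
  obtain ⟨W, w1, w2, w3⟩ := hT
  refine ⟨W.toLinearEquiv.toLinearMap ∘ₗ Φ, ?_, fun ψ => ?_, fun a ψ => ?_, fun ψ => ?_, fun ψ => ?_, ?_⟩
  · exact W.surjective.denseRange.comp h1 W.continuous
  · rw [← h2]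
    exact congrArg (· ^ 2) (W.norm_map _)
  · obtain ⟨φ, hφ, hφ'⟩ := h3 a ψ
    exact ⟨φ, hφ, (w1 a (Φ ψ)).symm.trans (congrArg W hφ')⟩
  · obtain ⟨φ, hφ, hφ'⟩ := h4 ψ
    exact ⟨φ, hφ, (w2 (Φ ψ)).symm.trans (congrArg W hφ')⟩
  · obtain ⟨φ, hφ, hφ'⟩ := h5 ψ
    exact ⟨φ, hφ, (w3 _ _).1 hφ'⟩
  · rintro ⟨u, v⟩ huv
    have h7 := h6 ((w3 (W.symm u) (W.symm v)).2 (by simpa using huv))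
    have hc : Continuous (Prod.map W W) := W.continuous.prodMap W.continuous
    have h8 := map_mem_closure hc h7 (t := {q | ∃ ψ φ : s.smoothSpinors,
      (∀ x, φ.1 x = classicalDirac R τ ψ.1 x) ∧ q = (W (Φ ψ), W (Φ φ))}) ?_
    · simpa using h8
    · rintro _ ⟨ψ, φ, hφ, rfl⟩
      exact ⟨ψ, φ, hφ, rfl⟩

theorem IsClassicalDiracTriple.equivalent (h : IsClassicalDiracTriple s T) (h' : IsClassicalDiracTriple s T')
    (hT : IsClosed (T.dirac.graph : Set (H × H))) (hT' : IsClosed (T'.dirac.graph : Set (H' × H'))) :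
    T.UnitarilyEquivalent T' := by
  obtain ⟨Φ, h1, h2, h3, h4, h5, h6⟩ := h
  obtain ⟨Φ', h1', h2', h3', h4', h5', h6'⟩ := h'
  have hn : ∀ ψ, ‖Φ' ψ‖ = ‖Φ ψ‖ := fun ψ =>
    (pow_left_inj₀ (norm_nonneg _) (norm_nonneg _) two_ne_zero).1 ((h2' ψ).trans (h2 ψ).symm)
  let W : H ≃ₗᵢ[ℂ] H' := (LinearEquiv.refl ℂ s.smoothSpinors).extendOfIsometry Φ Φ' h1 h1' hn
  have hW : ∀ ψ, W (Φ ψ) = Φ' ψ := fun ψ =>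
    LinearEquiv.extendOfIsometry_eq (LinearEquiv.refl ℂ s.smoothSpinors) Φ Φ' h1 h1' hn ψ
  have hWs : ∀ ψ, W.symm (Φ' ψ) = Φ ψ := fun ψ => by rw [← hW, W.symm_apply_apply]
  have huniq : ∀ {f : (Fin 3 → ℝ) → Fin 2 → ℂ} {φ φ' : s.smoothSpinors}, (∀ x, φ.1 x = f x) →
      (∀ x, φ'.1 x = f x) → φ = φ' := fun hφ hφ' =>
    Subtype.ext (funext fun x => (hφ x).trans (hφ' x).symm)
  refine ⟨W, fun a ψ => ?_, fun ψ => ?_, fun u v => ⟨fun huv => ?_, fun huv => ?_⟩⟩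
  · refine h1.induction_on (p := fun ψ => W (T.rep a ψ) = T'.rep a (W ψ)) ψ
      (isClosed_eq (W.continuous.comp (T.rep a).continuous) ((T'.rep a).continuous.comp W.continuous)) fun ψ => ?_
    obtain ⟨φ, hφ, e⟩ := h3 a ψ
    obtain ⟨φ', hφ', e'⟩ := h3' a ψ
    rw [e, hW, hW, e', huniq hφ hφ']
  · refine h1.induction_on (p := fun ψ => W (T.conj ψ) = T'.conj (W ψ)) ψ
      (isClosed_eq (W.continuous.comp T.conj.continuous) (T'.conj.continuous.comp W.continuous)) fun ψ => ?_
    obtain ⟨φ, hφ, e⟩ := h4 ψ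
    obtain ⟨φ', hφ', e'⟩ := h4' ψ
    rw [e, hW, hW, e', huniq hφ hφ']
  · have hc : Continuous (Prod.map W W) := W.continuous.prodMap W.continuous
    have h7 := map_mem_closure hc (h6 huv) (t := (T'.dirac.graph : Set (H' × H'))) ?_
    · rwa [hT'.closure_eq] at h7
    · rintro _ ⟨ψ, φ, hφ, rfl⟩
      obtain ⟨φ', hφ', e'⟩ := h5' ψ
      rw [Prod.map_apply, hW, hW, huniq hφ hφ']
      exact e'
  · have hc : Continuous (Prod.map W.symm W.symm) := W.symm.continuous.prodMap W.symm.continuous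
    have h7 := map_mem_closure hc (h6' huv) (t := (T.dirac.graph : Set (H × H))) ?_
    · rw [hT.closure_eq] at h7
      simpa using h7
    · rintro _ ⟨ψ, φ, hφ, rfl⟩
      obtain ⟨φ', hφ', e'⟩ := h5 ψ
      rw [Prod.map_apply, hWs, hWs, huniq hφ hφ']
      exact e'

theorem FlatRestriction.isClosed_graph {θ : ℝ} (X : FlatRestriction θ b R τ) :
    IsClosed (X.triple.dirac.graph : Set (X.space × X.space)) := by
  have h1 : (X.triple.dirac.graph : Set (X.space × X.space)) =
      {q | ∀ i, coordCLM i (q.2 : Spinor X.spin) =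
        ∑ t, symbol R τ i.1.1 i.2 t * coordCLM (i.1, t) (q.1 : Spinor X.spin)} := by
    ext q
    exact (mem_graph_restrict X.reduces).trans mem_graph_torusDirac
  rw [h1, Set.ofPred_forall]
  refine isClosed_iInter fun i => isClosed_eq ?_ ?_
  · exact (coordCLM i).continuous.comp (continuous_subtype_val.comp continuous_snd)
  · exact continuous_finsetSum _ fun t _ => continuous_const.mul
      ((coordCLM _).continuous.comp (continuous_subtype_val.comp continuous_fst))

theorem SpinStructure.exists_restriction (hR : 0 < R) (s : SpinStructure b R τ) :
    ∃ X : FlatRestriction 0 b R τ, ∀ Y : FlatRestriction 0 b R τ,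
      IsClassicalDiracTriple s Y.triple ↔ X.triple.UnitarilyEquivalent Y.triple := by
  obtain ⟨ε, c, h, hs⟩ := s.exists_compatible hR
  have h1 : IsClassicalDiracTriple s (FlatRestriction.ofHolonomy 0 R h).triple := hs.isClassicalDiracTriple
  exact ⟨.ofHolonomy 0 R h, fun Y => ⟨fun hY => h1.equivalent hY (FlatRestriction.isClosed_graph _) Y.isClosed_graph,
    h1.of_equivalent⟩⟩

theorem FlatRestriction.existsUnique_spinStructure (hR : 0 < R) (hτ : τ.im ≠ 0) (X : FlatRestriction 0 b R τ) :
    ∃! s : SpinStructure b R τ, IsClassicalDiracTriple s X.triple := by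
  obtain ⟨ε, c, h, rfl⟩ := X.eq_ofHolonomy hR hτ
  obtain ⟨s, hs⟩ := h.exists_spinStructure R
  refine ⟨s, hs.isClassicalDiracTriple, fun s' hs' => ?_⟩
  obtain ⟨ε', c', h', hc'⟩ := s'.exists_compatible hR
  have h1 : IsClassicalDiracTriple s' (FlatRestriction.ofHolonomy 0 R h').triple := hc'.isClassicalDiracTriple
  have h2 := h1.equivalent hs' (FlatRestriction.isClosed_graph _) (FlatRestriction.isClosed_graph _)
  obtain ⟨rfl, rfl⟩ := h'.eq_of_equivalent hR hτ h h2
  exact hc'.eq hs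

end ClassicalTriples

end FlatBieberbach

end

theorem mainTheorem1 (θ R : ℝ) (hR : 0 < R) (τ : ℂ) (hτ : τ.im ≠ 0) :
    -- the flat triples of the torus
    (∀ ε : Fin 3 → Bool,
      (flatTorus θ R τ ε).IsRealSpectralTriple ∧
      (flatTorus θ R τ ε).IsDiracIrreducible ∧
      IsTorusEquivariant (flatTorus θ R τ ε) ∧
      ∀ l : ℝ, FiniteDimensional ℂ (diracEigenspace (flatTorus θ R τ ε).dirac l) ∧
        ((Module.finrank ℂ (diracEigenspace (flatTorus θ R τ ε).dirac l) : ℕ) : ℕ∞) =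
          Set.encard {i : Weight ε × Fin 2 | torusEigenvalue R τ i.1.1 i.2 = l}) ∧
    ∀ b : Bieb,
      -- classification of the equivariant actions of the cyclic group
      (∀ (ε : Fin 3 → Bool) (S : Spinor ε →L[ℂ] Spinor ε),
        (flatTorus θ R τ ε).IsEquivariantAction (b.act θ) b.order S ↔
          ∃ (σ : ℤˣ) (l : b.Label), b.Admissible σ τ ∧ l.spin = ε ∧
            ∀ (μ : Weight ε) (s : Fin 2),
              S (basisVec ε μ.1 s) = l.phase σ (μ.1 0) s • basisVec ε (b.lin μ.1) s) ∧
      -- the invariant subspaces of such actions, intrinsically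
      (∀ (ε : Fin 3 → Bool) (K : Submodule ℂ (Spinor ε)),
        (∃ S : Spinor ε →L[ℂ] Spinor ε,
          (flatTorus θ R τ ε).IsEquivariantAction (b.act θ) b.order S ∧ ∀ ψ, ψ ∈ K ↔ S ψ = ψ) ↔
        (IsClosed (K : Set (Spinor ε)) ∧ K ≠ ⊥ ∧ (flatTorus θ R τ ε).Reduces (b.algebra θ) K ∧
          ∀ j : ℕ, 0 < j → j < b.order → ∀ ψ ∈ K, ∀ φ ∈ K,
            inner ℂ (SmoothTorus.rep θ ε (SmoothTorus.monomial θ ![(j : ℤ), 0, 0]) ψ) φ = 0)) ∧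
      -- there is nothing unless `τ` is admissible
      ((∀ σ : ℤˣ, ¬ b.Admissible σ τ) → IsEmpty (FlatRestriction θ b R τ)) ∧
      -- the classification
      (∀ σ : ℤˣ, b.Admissible σ τ →
        Nat.card (Quotient (FlatRestriction.setoid θ b R τ)) = b.numSpin ∧
        ∃ X : b.Label → FlatRestriction θ b R τ, Function.Bijective X ∧
          (∀ l l' : b.Label, (X l).triple.UnitarilyEquivalent (X l').triple → l = l') ∧
          ∀ l : b.Label,
            (X l).spin = l.spin ∧
            (X l).space = l.invariantSpace σ (X l).spin ∧
            (X l).triple.IsRealSpectralTriple ∧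
            (X l).triple.IsDiracIrreducible ∧
            (∀ x : ℝ, FiniteDimensional ℂ (diracEigenspace (X l).triple.dirac x) ∧
              ((b.order * Module.finrank ℂ (diracEigenspace (X l).triple.dirac x) : ℕ) : ℕ∞) =
                Set.encard {i : Weight l.spin × Fin 2 |
                  ¬(i.1.1 1 = 0 ∧ i.1.1 2 = 0) ∧ torusEigenvalue R τ i.1.1 i.2 = x} +
                if l.spin 1 = false ∧ l.spin 2 = false then
                  b.order * (2 * Set.encard {k : ℤ | b.order * R * (k + l.offset σ) = x})
                else 0) ∧
            HasEtaInvariant (X l).triple.dirac (l.eta σ)) ∧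
      -- exchanging `τ` and its conjugate amounts to changing the sign of `D`
      (∀ X : FlatRestriction θ b R τ, ∃ Y : FlatRestriction θ b R (starRingEnd ℂ τ),
        X.triple.neg.UnitarilyEquivalent Y.triple) ∧
      -- the classical case
      (∀ s : SpinStructure b R τ, ∃ X : FlatRestriction 0 b R τ, ∀ Y : FlatRestriction 0 b R τ,
        IsClassicalDiracTriple s Y.triple ↔ X.triple.UnitarilyEquivalent Y.triple) ∧
      (∀ X : FlatRestriction 0 b R τ, ∃! s : SpinStructure b R τ,
        IsClassicalDiracTriple s X.triple) := by
  refine ⟨fun ε => ⟨isRealSpectralTriple_flatTorus θ hR hτ ε, isDiracIrreducible_flatTorus θ hR hτ ε,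
    isTorusEquivariant_flatTorus θ R τ ε, finrank_eigenspace_flatTorus hR hτ⟩, fun b =>
    ⟨fun ε S => isEquivariantAction_iff hR hτ b S, fun ε K => ?_, fun hσ => ?_, fun σ hσ => ?_,
      exists_neg_equivalent hR hτ, fun s => s.exists_restriction hR,
      fun X => X.existsUnique_spinStructure hR hτ⟩⟩
  · rw [exists_equivariant_iff hR hτ K]
    simp only [AxisOrthogonal, rep_monomial, axis]
  · refine ⟨fun X => ?_⟩
    obtain ⟨c, h, -⟩ := X.exists_holonomy hR hτ
    obtain ⟨σ, hσ'⟩ := h.exists_admissible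
    exact hσ σ hσ'
  · refine ⟨card_quotient hR hτ hσ, fun l => l.restriction θ R hσ, bijective_restriction hR hτ hσ,
      fun l l' hl => (bijective_restriction hR hτ hσ).injective (FlatRestriction.eq_of_equivalent hR hτ hl),
      fun l => ⟨rfl, (invariantSpace_eq hσ l).symm,
        (isRealSpectralTriple_flatTorus θ hR hτ l.spin).restrict
          ((holonomy_label hσ l).reduces_fixed θ R),
        (holonomy_label hσ l).isDiracIrreducible hR hτ,
        fun x => ⟨(finrank_eigenspace_label hσ hR hτ l x).1, mul_finrank_eigenspace_label hσ hR hτ l x⟩,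
        hasEtaInvariant_label hσ hR hτ l⟩⟩
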